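/- **Conventions.** All forms and functions are real and smooth, manifolds are Hausdorff and second countable, $n\ge 0$. For a family of neighbourhoods of some ends (or of infinity) the complex of forms vanishing on some such neighbourhood has a first cohomology group, (closed 1-forms in the complex)/(differentials of functions in the complex): with no vanishing condition it is $H^1$, for compactly supported forms it is $H^1_c$. A *conifold* of dimension $m=n+1$ is a Riemannian manifold $(L,g)$ which is the union of a compact set and of finitely many pairwise disjoint open ends $S_1,\dots,S_e$ with compact complement, together with compact connected Riemannian $n$-manifolds $(\Sigma_i,g_i')$ (the links) and diffeomorphisms $\phi_i$ onto $\overline{S_i}$, where each end is either * *conically singular* (CS): $\phi_i:\Sigma_i\times(0,\epsilon_i]\to\overline{S_i}$ and, for some $\nu_i>0$ and all $k\ge0$, $|\tilde\nabla^k(\phi_i^*g-\tilde g_i)|_{\tilde g_i}=O(r^{\nu_i-k})$ as $r\to0$, or * *asymptotically conical* (AC): $\phi_i:\Sigma_i\times[R_i,\infty)\to\overline{S_i}$ with $R_i>0$ and, for some $\nu_i<0$ and all $k\ge0$, $|\tilde\nabla^k(\phi_i^*g-\tilde g_i)|_{\tilde g_i}=O(r^{\nu_i-k})$ as $r\to\infty$;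 here $\tilde g_i=dr^2+r^2g_i'$ and $\tilde\nabla$ is its Levi-Civita connection. $L$ is an AC (CS) manifold if all its ends are AC (CS), and a CS/AC manifold in general. For $\beta\in\mathbb R^e$, $C^\infty_\beta(L)$ (respectively $C^\infty_\beta(\Lambda^1)$) is the space of smooth functions (1-forms) $\sigma$ with $|\nabla^j\sigma|_g=O(r^{\beta_i-j})$ along each end $S_i$, for all $j\ge0$. Inequalities on weights are meant componentwise, $\beta-1=(\beta_1-1,\dots,\beta_e-1)$, and on a CS/AC manifold $\beta=(\mu,\lambda)$, with $\mu$ the weights on the CS ends and $\lambda$ those on the AC ends. $H^1_{\bullet,c}(L)$ is the first cohomology of the forms that vanish near infinity on the AC ends (no condition on the CS ends), $\Sigma_0$ is the disjoint union of the links of the CS ends, and $\rho$ is induced by restricting forms to $\Sigma_0\subset L$. For each CS end $S_i$ let $f_i$ be a smooth function equal to $1$ near the singularity on $S_i$ and to $0$ near the singularity, respectively near infinity, on every other end; $E_0$ is the span of these $f_i$. **Corollary.** In each of the following cases there is an isomorphism of real vector spaces as displayed. It can be chosen to be the inclusion (the sum of the inclusions) on the summands consisting of exact forms, and to send each class in the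 cohomological summand to a closed 1-form, in the complex that defines the cohomology group, representing that class. 1. If $M$ is a smooth compact manifold without boundary (of any dimension), then $$\{\text{closed 1-forms on }M\}\simeq H^1(M;\mathbb R)\oplus d(C^\infty(M)).$$ 2. Let $(L,g)$ be an AC manifold. If $\beta<0$, then $$\{\text{closed 1-forms on }L\text{ in }C^\infty_{\beta-1}(\Lambda^1)\}\simeq H^1_c(L;\mathbb R)\oplus d(C^\infty_\beta(L)),$$ and if $\beta>0$, then $$\{\text{closed 1-forms on }L\text{ in }C^\infty_{\beta-1}(\Lambda^1)\}\simeq H^1(L;\mathbb R)\oplus d(C^\infty_\beta(L)).$$ 3. Let $(L,g)$ be a connected CS manifold and suppose that the $f_i$ are chosen with $\sum_i f_i\equiv1$. If $\beta>0$, then $$\{\text{closed 1-forms on }L\text{ in }C^\infty_{\beta-1}(\Lambda^1)\}\simeq \operatorname{Ker}\bigl(H^1(L)\xrightarrow{\rho}H^1(\Sigma_0)\bigr)\oplus d(E_0)\oplus d(C^\infty_\beta(L)).$$ 4. Let $(L,g)$ be a CS/AC manifold. If $L$ is connected and has at least one AC end, and $\mu>0$, $\lambda<0$, then $$\{\text{closed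 1-forms on }L\text{ in }C^\infty_{(\mu-1,\lambda-1)}(\Lambda^1)\}\simeq \operatorname{Ker}\bigl(H^1_{\bullet,c}(L)\xrightarrow{\rho}H^1(\Sigma_0)\bigr)\oplus d(E_0)\oplus d(C^\infty_{(\mu,\lambda)}(L)).$$ If $\mu>0$, $\lambda>0$, then $E_0\cap C^\infty_{(\mu,\lambda)}(L)=0$ and $$\{\text{closed 1-forms on }L\text{ in }C^\infty_{(\mu-1,\lambda-1)}(\Lambda^1)\}\simeq \operatorname{Ker}\bigl(H^1(L)\xrightarrow{\rho}H^1(\Sigma_0)\bigr)\oplus d\bigl(E_0\oplus C^\infty_{(\mu,\lambda)}(L)\bigr).$$ -/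

import Mathlib

open Bundle Filter Set
open scoped Manifold ContDiff Topology

noncomputable section

namespace Conifolds

section Forms
variable {E : Type*} [NormedAddCommGroup E] [NormedSpace ℝ E]
  {H : Type*} [TopologicalSpace H] (I : ModelWithCorners ℝ E H)
  {M : Type*} [TopologicalSpace M] [ChartedSpace H M]

/-- The differential at `y` of the inverse of the preferred chart at `x₀`: it sends the coordinate
frame of the model space to the coordinate frame of the manifold. -/
def chartFrame (x₀ : M) (y : E) : E →L[ℝ] TangentSpace I ((extChartAt I x₀).symm y) :=
  mfderiv 𝓘(ℝ, E) I (extChartAt I x₀).symm y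

/-- The expression of a 1-form in the chart at `x₀`. -/
def formInChart (α : ∀ x : M, TangentSpace I x →L[ℝ] ℝ) (x₀ : M) (y : E) : E →L[ℝ] ℝ :=
  (α ((extChartAt I x₀).symm y)).comp (chartFrame I x₀ y)

/-- The pullback of a bilinear form by a linear map. -/
def pullBilin {V W : Type*} [AddCommGroup V] [Module ℝ V] [TopologicalSpace V]
    [AddCommGroup W] [Module ℝ W] [TopologicalSpace W]
    (B : V →L[ℝ] V →L[ℝ] ℝ) (A : W →L[ℝ] V) : W →L[ℝ] W →L[ℝ] ℝ :=
  (ContinuousLinearMap.precomp ℝ A).comp (B.comp A)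

/-- The matrix of a field of bilinear forms (for instance a metric) in the chart at `x₀`. -/
def bilinInChart (g : ∀ x : M, TangentSpace I x →L[ℝ] TangentSpace I x →L[ℝ] ℝ) (x₀ : M) (y : E) :
    E →L[ℝ] E →L[ℝ] ℝ :=
  pullBilin (g ((extChartAt I x₀).symm y)) (chartFrame I x₀ y)

/-- Smooth 1-forms: smooth sections of the cotangent bundle. -/
abbrev OneForm (E : Type*) [NormedAddCommGroup E] [NormedSpace ℝ E]
  (M : Type*) [TopologicalSpace M] [ChartedSpace E M] [IsManifold 𝓘(ℝ, E) ∞ M] : Type _ :=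
  Cₛ^∞⟮𝓘(ℝ, E); E →L[ℝ] ℝ, fun x : M => TangentSpace 𝓘(ℝ, E) x →L[ℝ] ℝ⟯

variable {I} [I.Boundaryless] [IsManifold I ∞ M]

theorem chartFrame_eq (x₀ : M) {y : E} (hy : y ∈ (extChartAt I x₀).target) :
    chartFrame I x₀ y =
      (trivializationAt E (TangentSpace I) x₀).symmL ℝ ((extChartAt I x₀).symm y) := by
  have hx : (extChartAt I x₀).symm y ∈ (chartAt H x₀).source := by
    simpa using (extChartAt I x₀).map_target hy
  have : IsManifold I 1 M := .of_le (n := ∞) (by simp)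
  rw [TangentBundle.symmL_trivializationAt hx, chartFrame, I.range_eq_univ, mfderivWithin_univ,
    (extChartAt I x₀).right_inv hy]

theorem contMDiffOn_chart_iff {F : Type*} [NormedAddCommGroup F] [NormedSpace ℝ F]
    (f : M → F) (x₀ : M) :
    ContMDiffOn I 𝓘(ℝ, F) ∞ f (chartAt H x₀).source ↔
      ContDiffOn ℝ ∞ (f ∘ (extChartAt I x₀).symm) (extChartAt I x₀).target := by
  constructor
  · intro h
    rw [← contMDiffOn_iff_contDiffOn]
    refine h.comp (contMDiffOn_extChartAt_symm x₀) fun y hy => ?_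
    simpa using (extChartAt I x₀).map_target hy
  · intro h
    rw [← contMDiffOn_iff_contDiffOn] at h
    have h2 : ContMDiffOn I 𝓘(ℝ, F) ∞ ((f ∘ (extChartAt I x₀).symm) ∘ extChartAt I x₀)
        (chartAt H x₀).source :=
      h.comp contMDiffOn_extChartAt fun x hx =>
        (extChartAt I x₀).map_source (by simpa using hx)
    refine h2.congr fun x hx => ?_
    exact congrArg f ((extChartAt I x₀).left_inv (by simpa using hx)).symm

theorem contMDiff_iff_formInChart (α : ∀ x : M, TangentSpace I x →L[ℝ] ℝ) :
    ContMDiff I (I.prod 𝓘(ℝ, E →L[ℝ] ℝ)) ∞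
      (fun x ↦ TotalSpace.mk' (E →L[ℝ] ℝ) (E := fun x : M => TangentSpace I x →L[ℝ] ℝ) x (α x)) ↔
    ∀ x₀ : M, ContDiffOn ℝ ∞ (formInChart I α x₀) (extChartAt I x₀).target := by
  have key : ∀ x₀ : M, ContMDiffOn I (I.prod 𝓘(ℝ, E →L[ℝ] ℝ)) ∞
      (fun x ↦ TotalSpace.mk' (E →L[ℝ] ℝ) (E := fun x : M => TangentSpace I x →L[ℝ] ℝ) x (α x))
      (chartAt H x₀).source ↔
      ContDiffOn ℝ ∞ (formInChart I α x₀) (extChartAt I x₀).target := by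
    intro x₀
    have hb : (chartAt H x₀).source = (trivializationAt (E →L[ℝ] ℝ)
        (fun x : M => TangentSpace I x →L[ℝ] ℝ) x₀).baseSet := by
      simp [hom_trivializationAt_baseSet]
    have h1 := (trivializationAt (E →L[ℝ] ℝ)
        (fun x : M => TangentSpace I x →L[ℝ] ℝ) x₀).contMDiffOn_section_baseSet_iff
        (IB := I) (n := ∞) (s := α)
    rw [← hb] at h1
    refine h1.trans ((contMDiffOn_chart_iff _ x₀).trans (contDiffOn_congr fun y hy => ?_))
    simp only [Function.comp, formInChart, chartFrame_eq x₀ hy]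
    ext v
    simp [hom_trivializationAt_apply, ContinuousLinearMap.inCoordinates]
    rfl
  constructor
  · exact fun h x₀ => (key x₀).1 h.contMDiffOn
  · exact fun h x => ((key x).2 (h x)).contMDiffAt
      ((chartAt H x).open_source.mem_nhds (mem_chart_source H x))

theorem contMDiffOn_chartFrame (x₀ : M) (u : E) :
    ContMDiffOn 𝓘(ℝ, E) I.tangent ∞
      (fun y : E => (TotalSpace.mk' E ((extChartAt I x₀).symm y) (chartFrame I x₀ y u) :
        TangentBundle I M)) (extChartAt I x₀).target := by
  have h1 : ContMDiffOn I I.tangent ∞ (fun x : M => (TotalSpace.mk' E x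
      ((trivializationAt E (TangentSpace I) x₀).symmL ℝ x u) : TangentBundle I M))
      (chartAt H x₀).source := by
    have h2 := (trivializationAt E (TangentSpace I) x₀).contMDiffOn_symmL (IB := I) (n := ∞)
    have := h2.clm_bundle_apply (v := fun _ => u) (E₁ := Bundle.Trivial M E)
      (F₁ := E) (fun x _ => (contMDiffWithinAt_totalSpace (n := ∞)).2
        ⟨contMDiffWithinAt_id, contMDiffWithinAt_const (c := u)⟩)
    simpa using this
  refine (h1.comp (contMDiffOn_extChartAt_symm x₀) fun y hy => ?_).congr fun y hy => ?_
  · simpa using (extChartAt I x₀).map_target hy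
  · simp only [Function.comp, chartFrame_eq x₀ hy]

theorem contDiffOn_bilinInChart [FiniteDimensional ℝ E]
    {g : ∀ x : M, TangentSpace I x →L[ℝ] TangentSpace I x →L[ℝ] ℝ}
    (hg : ContMDiff I (I.prod 𝓘(ℝ, E →L[ℝ] E →L[ℝ] ℝ)) ∞
      (fun x ↦ TotalSpace.mk' (E →L[ℝ] E →L[ℝ] ℝ)
        (E := fun x : M => TangentSpace I x →L[ℝ] TangentSpace I x →L[ℝ] ℝ) x (g x))) (x₀ : M) :
    ContDiffOn ℝ ∞ (bilinInChart I g x₀) (extChartAt I x₀).target := by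
  refine contDiffOn_clm_apply.2 fun u => contDiffOn_clm_apply.2 fun v => ?_
  rw [← contMDiffOn_iff_contDiffOn]
  have h0 := hg.comp_contMDiffOn (contMDiffOn_extChartAt_symm (n := ∞) (I := I) x₀)
  have h1 := ContMDiffOn.clm_bundle_apply₂ (F₃ := ℝ) (E₃ := fun _ : M => ℝ) h0
    (contMDiffOn_chartFrame x₀ u) (contMDiffOn_chartFrame x₀ v)
  intro y hy
  exact (contMDiffWithinAt_totalSpace.1 (h1 y hy)).2

end Forms

section Flat
variable {E : Type*} [NormedAddCommGroup E] [NormedSpace ℝ E]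

/-- The Christoffel symbols of a metric `G` on (an open subset of) a vector space, as the bilinear
map `(u, v) ↦ Γ(u, v)` determined by the Koszul formula
`G(Γ(u, v), w) = (∂_u G(v, w) + ∂_v G(u, w) - ∂_w G(u, v)) / 2`. -/
def christoffel (G : E → E →L[ℝ] E →L[ℝ] ℝ) (y u v : E) : E :=
  (G y).inverse ((1 / 2 : ℝ) •
    (fderiv ℝ G y u v + fderiv ℝ G y v u - ((fderiv ℝ G y).flip u).flip v))

/-- The Levi-Civita covariant derivative of a covariant `k`-tensor field `T`, in coordinates:
`(∇T)(u₀, u₁, …, u_k) = ∂_{u₀} (T(u₁, …, u_k)) - ∑ i, T(u₁, …, Γ(u₀, u_i), …, u_k)`.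
The new argument is put in the first slot. -/
def covDeriv (G : E → E →L[ℝ] E →L[ℝ] ℝ) {k : ℕ} (T : E → (Fin k → E) → ℝ)
    (y : E) (u : Fin (k + 1) → E) : ℝ :=
  fderiv ℝ (fun z => T z (Fin.tail u)) y (u 0) -
    ∑ i : Fin k, T y (Function.update (Fin.tail u) i (christoffel G y (u 0) (Fin.tail u i)))

/-- The iterated covariant derivative `∇^j T`, in coordinates. -/
def iterCovDeriv (G : E → E →L[ℝ] E →L[ℝ] ℝ) {k : ℕ} (T : E → (Fin k → E) → ℝ) :
    ∀ j : ℕ, E → (Fin (k + j) → E) → ℝ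
  | 0 => T
  | j + 1 => covDeriv G (iterCovDeriv G T j)

/-- `T` is smooth on `U`, jointly in the point and in the vectors. -/
def JointlySmoothOn (U : Set E) {k : ℕ} (T : E → (Fin k → E) → ℝ) : Prop :=
  ContDiffOn ℝ ∞ (fun p : E × (Fin k → E) => T p.1 p.2) (U ×ˢ univ)

variable {G : E → E →L[ℝ] E →L[ℝ] ℝ} {U : Set E} {k : ℕ} {T S : E → (Fin k → E) → ℝ}

set_option synthInstance.maxHeartbeats 200000 in
theorem contDiffOn_christoffel [FiniteDimensional ℝ E] (hU : IsOpen U) (hG : ContDiffOn ℝ ∞ G U)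
    (hinv : ∀ y ∈ U, (G y).IsInvertible) :
    ContDiffOn ℝ ∞ (fun p : E × E × E => christoffel G p.1 p.2.1 p.2.2) (U ×ˢ univ) := by
  have : CompleteSpace E := FiniteDimensional.complete ℝ E
  have hU' : IsOpen (U ×ˢ (univ : Set (E × E))) := hU.prod isOpen_univ
  have h2 : ContDiffOn ℝ ∞ (fun p : E × E × E => (G p.1).inverse) (U ×ˢ univ) := by
    intro p hp
    have h1 : ContDiffAt ℝ ∞ G p.1 := hG.contDiffAt (hU.mem_nhds hp.1)
    exact (((hinv p.1 hp.1).contDiffAt_map_inverse (n := ∞)).comp p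
      (h1.comp p contDiffAt_fst)).contDiffWithinAt
  have h3 := (hG.fderiv_of_isOpen (m := ∞) hU (by simp)).comp
    (contDiffOn_fst (s := U ×ˢ (univ : Set (E × E)))) fun p hp => hp.1
  have hu : ContDiffOn ℝ ∞ (fun p : E × E × E => p.2.1) (U ×ˢ univ) := by fun_prop
  have hv : ContDiffOn ℝ ∞ (fun p : E × E × E => p.2.2) (U ×ˢ univ) := by fun_prop
  refine h2.clm_apply (contDiffOn_clm_apply.2 fun w => ?_)
  have hw : ContDiffOn ℝ ∞ (fun _ : E × E × E => w) (U ×ˢ univ) := contDiffOn_const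
  refine contDiffOn_const.mul (ContDiffOn.sub (ContDiffOn.add ?_ ?_) ?_)
  · exact ((h3.clm_apply hu).clm_apply hv).clm_apply hw
  · exact ((h3.clm_apply hv).clm_apply hu).clm_apply hw
  · exact ((h3.clm_apply hw).clm_apply hu).clm_apply hv

theorem JointlySmoothOn.covDeriv [FiniteDimensional ℝ E] (hU : IsOpen U)
    (hG : ContDiffOn ℝ ∞ G U) (hinv : ∀ y ∈ U, (G y).IsInvertible) (hT : JointlySmoothOn U T) :
    JointlySmoothOn U (covDeriv G T) := by
  rintro ⟨y, u⟩ ⟨hy, -⟩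
  refine ContDiffAt.contDiffWithinAt ?_
  have hT' : ∀ w, ContDiffAt ℝ ∞ (fun p : E × (Fin k → E) => T p.1 p.2) (y, w) := fun w =>
    ContDiffOn.contDiffAt hT ((hU.prod isOpen_univ).mem_nhds ⟨hy, mem_univ _⟩)
  have hu : ∀ i, ContDiffAt ℝ ∞ (fun p : E × (Fin (k + 1) → E) => p.2 i) (y, u) := by
    intro i; fun_prop
  have htail : ContDiffAt ℝ ∞ (fun p : E × (Fin (k + 1) → E) => Fin.tail p.2) (y, u) :=
    contDiffAt_pi.2 fun i => hu i.succ
  unfold Conifolds.covDeriv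
  refine ContDiffAt.sub ?_ (ContDiffAt.sum fun i _ => ?_)
  · refine ContDiffAt.clm_apply (ContDiffAt.fderiv (n := ∞)
      (f := fun (p : E × (Fin (k + 1) → E)) z => T z (Fin.tail p.2)) (g := fun p => p.1) ?_
      contDiffAt_fst (by simp)) (hu 0)
    exact (hT' (Fin.tail u)).comp (((y, u), y) : (E × (Fin (k + 1) → E)) × E)
      (contDiffAt_snd.prodMk (htail.comp ((y, u), y) contDiffAt_fst))
  · have hc : ContDiffAt ℝ ∞ (fun p : E × (Fin (k + 1) → E) =>
        christoffel G p.1 (p.2 0) (Fin.tail p.2 i)) (y, u) := by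
      have := (contDiffOn_christoffel hU hG hinv).contDiffAt
        ((hU.prod isOpen_univ).mem_nhds (show (y, u 0, Fin.tail u i) ∈ U ×ˢ univ from ⟨hy, mem_univ _⟩))
      exact this.comp (y, u) (contDiffAt_fst.prodMk ((hu 0).prodMk (hu i.succ)))
    refine (hT' _).comp (y, u) (contDiffAt_fst.prodMk (contDiffAt_pi.2 fun j => ?_))
    by_cases hj : j = i
    · subst hj
      exact hc.congr_of_eventuallyEq (.of_forall fun p => Function.update_self ..)
    · exact (hu j.succ).congr_of_eventuallyEq (.of_forall fun p => Function.update_of_ne hj ..)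

theorem JointlySmoothOn.iterCovDeriv [FiniteDimensional ℝ E] (hU : IsOpen U)
    (hG : ContDiffOn ℝ ∞ G U) (hinv : ∀ y ∈ U, (G y).IsInvertible) (hT : JointlySmoothOn U T) :
    ∀ j, JointlySmoothOn U (iterCovDeriv G T j)
  | 0 => hT
  | j + 1 => (JointlySmoothOn.iterCovDeriv hU hG hinv hT j).covDeriv hU hG hinv

theorem JointlySmoothOn.differentiableAt (hU : IsOpen U) (hT : JointlySmoothOn U T) {y : E}
    (hy : y ∈ U) (v : Fin k → E) : DifferentiableAt ℝ (fun z => T z v) y := by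
  have h : ContDiffAt ℝ ∞ (fun p : E × (Fin k → E) => T p.1 p.2) (y, v) :=
    ContDiffOn.contDiffAt hT ((hU.prod isOpen_univ).mem_nhds ⟨hy, mem_univ _⟩)
  have h2 : ContDiffAt ℝ ∞ (fun z => T z v) y :=
    h.comp y (contDiffAt_id.prodMk contDiffAt_const)
  exact h2.differentiableAt (by simp)

theorem iterCovDeriv_linear [FiniteDimensional ℝ E] (hU : IsOpen U)
    (hG : ContDiffOn ℝ ∞ G U) (hinv : ∀ y ∈ U, (G y).IsInvertible) (hT : JointlySmoothOn U T)
    (hS : JointlySmoothOn U S) (a b : ℝ) (j : ℕ) :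
    ∀ y ∈ U, ∀ v, iterCovDeriv G (fun y v => a * T y v + b * S y v) j y v =
      a * iterCovDeriv G T j y v + b * iterCovDeriv G S j y v := by
  induction j with
  | zero => intro y _ v; rfl
  | succ j ih =>
    intro y hy v
    have h1 := (hT.iterCovDeriv hU hG hinv j).differentiableAt hU hy (Fin.tail v)
    have h2 := (hS.iterCovDeriv hU hG hinv j).differentiableAt hU hy (Fin.tail v)
    have h3 : fderiv ℝ (fun z => iterCovDeriv G (fun y v => a * T y v + b * S y v) j z
        (Fin.tail v)) y = a • fderiv ℝ (fun z => iterCovDeriv G T j z (Fin.tail v)) y +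
          b • fderiv ℝ (fun z => iterCovDeriv G S j z (Fin.tail v)) y := by
      have : (fun z => iterCovDeriv G (fun y v => a * T y v + b * S y v) j z (Fin.tail v))
          =ᶠ[𝓝 y] fun z => a * iterCovDeriv G T j z (Fin.tail v) +
            b * iterCovDeriv G S j z (Fin.tail v) := by
        filter_upwards [hU.mem_nhds hy] with z hz using ih z hz _
      rw [this.fderiv_eq]
      exact ((h1.hasFDerivAt.const_mul a).add (h2.hasFDerivAt.const_mul b)).fderiv
    simp only [iterCovDeriv, Conifolds.covDeriv]
    erw [h3]
    simp only [ih y hy, Finset.sum_add_distrib, ← Finset.mul_sum, add_apply,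
      smul_apply, smul_eq_mul]
    ring

end Flat

section Tensors
variable {E : Type*} [NormedAddCommGroup E] [NormedSpace ℝ E]
  {H : Type*} [TopologicalSpace H] (I : ModelWithCorners ℝ E H)
  {M : Type*} [TopologicalSpace M] [ChartedSpace H M]

/-- Covariant `k`-tensor fields, as functions of a point and of `k` tangent vectors there. -/
abbrev TensorField (M : Type*) [TopologicalSpace M] [ChartedSpace H M] (k : ℕ) : Type _ :=
  ∀ x : M, (Fin k → TangentSpace I x) → ℝ

/-- Fields of bilinear forms on the tangent spaces. -/
abbrev BilinField (M : Type*) [TopologicalSpace M] [ChartedSpace H M] : Type _ :=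
  ∀ x : M, TangentSpace I x →L[ℝ] TangentSpace I x →L[ℝ] ℝ

variable {I}

/-- A function as a covariant `0`-tensor field. -/
def functionTensor (f : M → ℝ) : TensorField I M 0 := fun x _ => f x

/-- A 1-form as a covariant `1`-tensor field. -/
def formTensor (α : ∀ x : M, TangentSpace I x →L[ℝ] ℝ) : TensorField I M 1 := fun x v => α x (v 0)

/-- A field of bilinear forms as a covariant `2`-tensor field. -/
def bilinTensor (h : BilinField I M) : TensorField I M 2 := fun x v => h x (v 0) (v 1)

/-- The expression of a covariant tensor field in the chart at `x₀`. -/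
def tensorInChart {k : ℕ} (T : TensorField I M k) (x₀ : M) (y : E) (v : Fin k → E) : ℝ :=
  T ((extChartAt I x₀).symm y) fun i => chartFrame I x₀ y (v i)

/-- The iterated covariant derivative `∇^j T` with respect to the Levi-Civita connection of `g`,
computed at each point `x` in the preferred chart at `x`. -/
def iterNabla (g : BilinField I M) {k : ℕ} (T : TensorField I M k) (j : ℕ) :
    TensorField I M (k + j) := fun x v =>
  iterCovDeriv (bilinInChart I g x) (tensorInChart T x) j (extChartAt I x x)
    fun i => mfderiv I 𝓘(ℝ, E) (extChartAt I x) x (v i)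

/-- `|T|_g = O(w)` along the filter `l`. The pointwise norm is
`|T|_g(x) = sup |T(v₁, …, v_k)| / (|v₁|_g ⋯ |v_k|_g)`, which agrees with any other norm
built from `g` up to factors depending only on `k` and on the dimension. -/
def TensorIsBigO (l : Filter M) (g : BilinField I M) {k : ℕ} (T : TensorField I M k)
    (w : M → ℝ) : Prop :=
  ∃ K : ℝ, ∀ᶠ x in l, ∀ v : Fin k → TangentSpace I x,
    |T x v| ≤ K * w x * ∏ i, √(g x (v i) (v i))

theorem TensorIsBigO.add {l : Filter M} {g : BilinField I M} {k : ℕ} {T S : TensorField I M k}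
    {w : M → ℝ} (hT : TensorIsBigO l g T w) (hS : TensorIsBigO l g S w) (a b : ℝ) :
    TensorIsBigO l g (fun x v => a * T x v + b * S x v) w := by
  obtain ⟨K, hK⟩ := hT
  obtain ⟨K', hK'⟩ := hS
  refine ⟨|a| * K + |b| * K', ?_⟩
  filter_upwards [hK, hK'] with x h h' v
  calc |a * T x v + b * S x v| ≤ |a| * |T x v| + |b| * |S x v| := by
        rw [← abs_mul, ← abs_mul]; exact abs_add_le _ _
    _ ≤ |a| * (K * w x * ∏ i, √(g x (v i) (v i))) + |b| * (K' * w x * ∏ i, √(g x (v i) (v i))) := by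
        gcongr
        · exact h v
        · exact h' v
    _ = _ := by ring

/-- All chart expressions of `T` are smooth. -/
def ChartSmooth {k : ℕ} (T : TensorField I M k) : Prop :=
  ∀ x₀ : M, JointlySmoothOn (extChartAt I x₀).target (tensorInChart T x₀)

variable [I.Boundaryless] [IsManifold I ∞ M]

theorem isInvertible_bilinInChart [FiniteDimensional ℝ E] {g : BilinField I M}
    (hpos : ∀ (x : M) (v : TangentSpace I x), v ≠ 0 → 0 < g x v v) (x₀ : M) {y : E}
    (hy : y ∈ (extChartAt I x₀).target) : (bilinInChart I g x₀ y).IsInvertible := by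
  have hinj : ∀ u : E, u ≠ 0 → chartFrame I x₀ y u ≠ 0 := by
    intro u hu h0
    have hx : (extChartAt I x₀).symm y ∈ (chartAt H x₀).source := by
      simpa using (extChartAt I x₀).map_target hy
    rw [chartFrame_eq x₀ hy] at h0
    have h1 := (trivializationAt E (TangentSpace I) x₀).continuousLinearMapAt_symmL (R := ℝ)
      (b := (extChartAt I x₀).symm y) (by simpa using hx) u
    rw [h0, map_zero] at h1
    exact hu h1.symm
  have hker : Function.Injective (bilinInChart I g x₀ y : E →ₗ[ℝ] (E →L[ℝ] ℝ)) := by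
    rw [← LinearMap.ker_eq_bot, LinearMap.ker_eq_bot']
    intro u hu
    by_contra hne
    have h1 : bilinInChart I g x₀ y u u = 0 := by
      have := congrArg (fun f : E →L[ℝ] ℝ => f u) hu
      simpa using this
    exact (hpos _ _ (hinj u hne)).ne' h1
  have hfin : Module.finrank ℝ E = Module.finrank ℝ (E →L[ℝ] ℝ) := by
    rw [← (LinearMap.toContinuousLinearMap (𝕜 := ℝ) (E := E) (F' := ℝ)).finrank_eq]
    exact (Subspace.dual_finrank_eq (K := ℝ) (V := E)).symm
  refine ⟨(LinearEquiv.ofInjectiveOfFinrankEq _ hker hfin).toContinuousLinearEquiv, ?_⟩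
  ext u v
  rfl

theorem iterNabla_linear [FiniteDimensional ℝ E]
    (g : ContMDiffRiemannianMetric I ∞ E (fun x : M => TangentSpace I x)) {k : ℕ}
    {T S : TensorField I M k} (hT : ChartSmooth T) (hS : ChartSmooth S) (a b : ℝ) (j : ℕ) :
    iterNabla g.inner (fun x v => a * T x v + b * S x v) j =
      fun x v => a * iterNabla g.inner T j x v + b * iterNabla g.inner S j x v := by
  funext x v
  exact iterCovDeriv_linear (isOpen_extChartAt_target x) (contDiffOn_bilinInChart g.contMDiff x)
    (fun y hy => isInvertible_bilinInChart g.pos x hy) (hT x) (hS x) a b j _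
    (mem_extChartAt_target x) _

end Tensors

section DeRham
variable {E : Type*} [NormedAddCommGroup E] [NormedSpace ℝ E]
  {M : Type*} [TopologicalSpace M] [ChartedSpace E M]
  {E' : Type*} [NormedAddCommGroup E'] [NormedSpace ℝ E']
  {N : Type*} [TopologicalSpace N] [ChartedSpace E' N]

/-- The pullback of a 1-form by a map from a vector space to the manifold. -/
def localPullback (α : ∀ x : M, TangentSpace 𝓘(ℝ, E) x →L[ℝ] ℝ) (ψ : E' → M) (y : E') :
    E' →L[ℝ] ℝ :=
  (α (ψ y)).comp (mfderiv 𝓘(ℝ, E') 𝓘(ℝ, E) ψ y)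

theorem localPullback_congr (α : ∀ x : M, TangentSpace 𝓘(ℝ, E) x →L[ℝ] ℝ) {ψ ψ' : E' → M}
    {y : E'} (h : ψ =ᶠ[𝓝 y] ψ') : localPullback α ψ y = localPullback α ψ' y := by
  have key : ∀ (p q : M) (_ : p = q) (A B : E' →L[ℝ] E), A = B →
      ContinuousLinearMap.comp (α p : E →L[ℝ] ℝ) A = ContinuousLinearMap.comp (α q : E →L[ℝ] ℝ) B := by
    rintro p _ rfl A _ rfl; rfl
  exact key _ _ h.eq_of_nhds _ _ h.mfderiv_eq

theorem localPullback_comp (α : ∀ x : M, TangentSpace 𝓘(ℝ, E) x →L[ℝ] ℝ) {ψ : E → M} {Φ : E' → E}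
    {y : E'} (hψ : MDifferentiableAt 𝓘(ℝ, E) 𝓘(ℝ, E) ψ (Φ y)) (hΦ : DifferentiableAt ℝ Φ y) :
    localPullback α (ψ ∘ Φ) y = (localPullback α ψ (Φ y)).comp (fderiv ℝ Φ y) := by
  unfold localPullback
  rw [mfderiv_comp y hψ hΦ.mdifferentiableAt, mfderiv_eq_fderiv]
  rfl

variable [IsManifold 𝓘(ℝ, E) ∞ M] [IsManifold 𝓘(ℝ, E') ∞ N]

/-- Smooth real-valued functions. -/
abbrev SmoothFunction (E : Type*) [NormedAddCommGroup E] [NormedSpace ℝ E]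
    (M : Type*) [TopologicalSpace M] [ChartedSpace E M] : Type _ := C^∞⟮𝓘(ℝ, E), M; ℝ⟯

theorem mdifferentiableAt_chart_symm (x₀ : M) {y : E} (hy : y ∈ (extChartAt 𝓘(ℝ, E) x₀).target) :
    MDifferentiableAt 𝓘(ℝ, E) 𝓘(ℝ, E) (extChartAt 𝓘(ℝ, E) x₀).symm y :=
  ((contMDiffOn_extChartAt_symm (n := ∞) x₀).contMDiffAt
    ((isOpen_extChartAt_target x₀).mem_nhds hy)).mdifferentiableAt (by simp)

/-- The differential of functions. -/
def d : SmoothFunction E M →ₗ[ℝ] OneForm E M where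
  toFun f := ⟨fun x => mfderiv 𝓘(ℝ, E) 𝓘(ℝ, ℝ) f x, by
    refine (contMDiff_iff_formInChart _).2 fun x₀ => ?_
    have h1 : ContDiffOn ℝ ∞ (f ∘ (extChartAt 𝓘(ℝ, E) x₀).symm)
        (extChartAt 𝓘(ℝ, E) x₀).target :=
      (contMDiffOn_chart_iff _ x₀).1 f.contMDiff.contMDiffOn
    refine (h1.fderiv_of_isOpen (m := ∞) (isOpen_extChartAt_target x₀) (by simp)).congr
      fun y hy => ?_
    rw [← mfderiv_eq_fderiv, mfderiv_comp y (f.contMDiff.mdifferentiable (by simp) _)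
      (mdifferentiableAt_chart_symm x₀ hy)]
    rfl⟩
  map_add' f h := by
    ext x v
    exact DFunLike.congr_fun (mfderiv_add (f.contMDiff.mdifferentiable (by simp) x)
      (h.contMDiff.mdifferentiable (by simp) x)) v
  map_smul' c f := by
    ext x v
    exact DFunLike.congr_fun (const_smul_mfderiv (f.contMDiff.mdifferentiable (by simp) x) c) v

theorem contDiffOn_formInChart (α : OneForm E M) (x₀ : M) :
    ContDiffOn ℝ ∞ (formInChart 𝓘(ℝ, E) (fun x => α x) x₀) (extChartAt 𝓘(ℝ, E) x₀).target :=
  (contMDiff_iff_formInChart _).1 α.contMDiff x₀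

theorem formInChart_add (α β : OneForm E M) (x₀ : M) :
    formInChart 𝓘(ℝ, E) (fun x => (α + β) x) x₀ =
      formInChart 𝓘(ℝ, E) (fun x => α x) x₀ + formInChart 𝓘(ℝ, E) (fun x => β x) x₀ := rfl

theorem formInChart_smul (c : ℝ) (α : OneForm E M) (x₀ : M) :
    formInChart 𝓘(ℝ, E) (fun x => (c • α) x) x₀ =
      c • formInChart 𝓘(ℝ, E) (fun x => α x) x₀ := rfl

/-- The space of smooth closed 1-forms. In a chart, `dα(u, v) = ∂_u (α(v)) - ∂_v (α(u))`. -/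
def closedForms (E : Type*) [NormedAddCommGroup E] [NormedSpace ℝ E] (M : Type*)
    [TopologicalSpace M] [ChartedSpace E M] [IsManifold 𝓘(ℝ, E) ∞ M] :
    Submodule ℝ (OneForm E M) where
  carrier := {α | ∀ x₀ : M, ∀ y ∈ (extChartAt 𝓘(ℝ, E) x₀).target, ∀ u v : E,
    fderiv ℝ (formInChart 𝓘(ℝ, E) (fun x => α x) x₀) y u v =
      fderiv ℝ (formInChart 𝓘(ℝ, E) (fun x => α x) x₀) y v u}
  zero_mem' := by
    intro x₀ y _ u v
    have : formInChart 𝓘(ℝ, E) (fun x => (0 : OneForm E M) x) x₀ = fun _ => 0 := rfl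
    rw [this]; simp
  add_mem' := by
    intro α β hα hβ x₀ y hy u v
    have h : ∀ γ : OneForm E M,
        DifferentiableAt ℝ (formInChart 𝓘(ℝ, E) (fun x => γ x) x₀) y := fun γ =>
      ((contDiffOn_formInChart γ x₀).contDiffAt
        ((isOpen_extChartAt_target x₀).mem_nhds hy)).differentiableAt (by simp)
    rw [formInChart_add, fderiv_add (h α) (h β)]
    simp [hα x₀ y hy u v, hβ x₀ y hy u v]
  smul_mem' := by
    intro c α hα x₀ y hy u v
    have h : DifferentiableAt ℝ (formInChart 𝓘(ℝ, E) (fun x => α x) x₀) y :=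
      ((contDiffOn_formInChart α x₀).contDiffAt
        ((isOpen_extChartAt_target x₀).mem_nhds hy)).differentiableAt (by simp)
    rw [formInChart_smul, fderiv_const_smul h]
    simp [hα x₀ y hy u v]

/-- The smooth 1-forms which vanish eventually along the filter `l`. For `l = ⊥` these are all
smooth 1-forms, for `l = cocompact M` the compactly supported ones. -/
def formsVanishing (E : Type*) [NormedAddCommGroup E] [NormedSpace ℝ E] {M : Type*}
    [TopologicalSpace M] [ChartedSpace E M] [IsManifold 𝓘(ℝ, E) ∞ M] (l : Filter M) :
    Submodule ℝ (OneForm E M) where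
  carrier := {α | ∀ᶠ x in l, α x = 0}
  zero_mem' := .of_forall fun _ => rfl
  add_mem' := by
    intro α β hα hβ
    filter_upwards [hα, hβ] with x h h'
    simp [h, h']
  smul_mem' := by
    intro c α hα
    filter_upwards [hα] with x h
    simp [h]

/-- The smooth functions which vanish eventually along the filter `l`. -/
def functionsVanishing (E : Type*) [NormedAddCommGroup E] [NormedSpace ℝ E] {M : Type*}
    [TopologicalSpace M] [ChartedSpace E M] (l : Filter M) :
    Submodule ℝ (SmoothFunction E M) where
  carrier := {f | ∀ᶠ x in l, f x = 0}
  zero_mem' := .of_forall fun _ => rfl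
  add_mem' := by
    intro α β hα hβ
    filter_upwards [hα, hβ] with x h h'
    simp [h, h']
  smul_mem' := by
    intro c α hα
    filter_upwards [hα] with x h
    simp [h]

/-- The smooth closed 1-forms which vanish eventually along the filter `l`. -/
def closedFormsVanishing (E : Type*) [NormedAddCommGroup E] [NormedSpace ℝ E] {M : Type*}
    [TopologicalSpace M] [ChartedSpace E M] [IsManifold 𝓘(ℝ, E) ∞ M] (l : Filter M) :
    Submodule ℝ (OneForm E M) :=
  closedForms E M ⊓ formsVanishing E l

/-- The first de Rham cohomology of the complex of forms which vanish eventually along `l`.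
For `l = ⊥` this is `H¹(M)`, for `l = cocompact M` it is `H¹_c(M)`. -/
def H1Rel (E : Type*) [NormedAddCommGroup E] [NormedSpace ℝ E] {M : Type*}
    [TopologicalSpace M] [ChartedSpace E M] [IsManifold 𝓘(ℝ, E) ∞ M] (l : Filter M) : Type _ :=
  closedFormsVanishing E l ⧸
    ((functionsVanishing E l).map d).submoduleOf (closedFormsVanishing E l)

instance (l : Filter M) : AddCommGroup (H1Rel E l) :=
  inferInstanceAs (AddCommGroup (closedFormsVanishing E l ⧸
    ((functionsVanishing E l).map d).submoduleOf (closedFormsVanishing E l)))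

instance (l : Filter M) : Module ℝ (H1Rel E l) :=
  inferInstanceAs (Module ℝ (closedFormsVanishing E l ⧸
    ((functionsVanishing E l).map d).submoduleOf (closedFormsVanishing E l)))

/-- The cohomology class of a closed 1-form. -/
def H1Rel.mk {l : Filter M} (α : OneForm E M) (hα : α ∈ closedFormsVanishing E l) :
    H1Rel E l :=
  Submodule.Quotient.mk ⟨α, hα⟩

/-- The first de Rham cohomology `H¹(M; ℝ)`. -/
abbrev H1 (E : Type*) [NormedAddCommGroup E] [NormedSpace ℝ E] (M : Type*)
    [TopologicalSpace M] [ChartedSpace E M] [IsManifold 𝓘(ℝ, E) ∞ M] : Type _ :=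
  H1Rel E (⊥ : Filter M)

theorem formInChart_pullback {F : N → M} (hF : ContMDiff 𝓘(ℝ, E') 𝓘(ℝ, E) ∞ F)
    (α : ∀ x : M, TangentSpace 𝓘(ℝ, E) x →L[ℝ] ℝ) (x₀ : N) {y₀ : E'}
    (hy₀ : y₀ ∈ (extChartAt 𝓘(ℝ, E') x₀).target) :
    ∃ (q : M) (Φ : E' → E), ContDiffAt ℝ ∞ Φ y₀ ∧ Φ y₀ ∈ (extChartAt 𝓘(ℝ, E) q).target ∧
      formInChart 𝓘(ℝ, E') (fun x => (α (F x)).comp (mfderiv 𝓘(ℝ, E') 𝓘(ℝ, E) F x)) x₀ =ᶠ[𝓝 y₀]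
        fun y => (formInChart 𝓘(ℝ, E) α q (Φ y)).comp (fderiv ℝ Φ y) := by
  set φ := extChartAt 𝓘(ℝ, E') x₀ with hφ
  set q : M := F (φ.symm y₀) with hq
  set Φ : E' → E := extChartAt 𝓘(ℝ, E) q ∘ F ∘ φ.symm with hΦ
  have hs : ContMDiffAt 𝓘(ℝ, E') 𝓘(ℝ, E) ∞ (F ∘ φ.symm) y₀ :=
    hF.contMDiffAt.comp y₀ ((contMDiffOn_extChartAt_symm (n := ∞) x₀).contMDiffAt
      ((isOpen_extChartAt_target x₀).mem_nhds hy₀))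
  have hΦs : ContDiffAt ℝ ∞ Φ y₀ := by
    rw [← contMDiffAt_iff_contDiffAt]
    exact (contMDiffAt_extChartAt (x := q)).comp y₀ hs
  have hsrc : ∀ᶠ y in 𝓝 y₀, (F ∘ φ.symm) y ∈ (extChartAt 𝓘(ℝ, E) q).source :=
    hs.continuousAt.eventually_mem (extChartAt_source_mem_nhds q)
  refine ⟨q, Φ, hΦs, mem_extChartAt_target q, ?_⟩
  have hd : ∀ᶠ y in 𝓝 y₀, DifferentiableAt ℝ Φ y := by
    have : ∀ᶠ y in 𝓝 y₀, ContDiffAt ℝ 1 Φ y := (hΦs.of_le (m := 1) (by simp)).eventually (by simp)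
    exact this.mono fun y h => h.differentiableAt (by simp)
  filter_upwards [hsrc.eventually_nhds, hd, (isOpen_extChartAt_target x₀).mem_nhds hy₀]
    with y hy hdy hyt
  have e1 : formInChart 𝓘(ℝ, E') (fun x => (α (F x)).comp (mfderiv 𝓘(ℝ, E') 𝓘(ℝ, E) F x)) x₀ y =
      localPullback α (F ∘ φ.symm) y := by
    unfold localPullback
    rw [mfderiv_comp y (hF.mdifferentiable (by simp) _) (mdifferentiableAt_chart_symm x₀ hyt)]
    rfl
  have e2 : F ∘ φ.symm =ᶠ[𝓝 y] (extChartAt 𝓘(ℝ, E) q).symm ∘ Φ := by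
    filter_upwards [hy] with z hz
    exact ((extChartAt 𝓘(ℝ, E) q).left_inv hz).symm
  rw [e1, localPullback_congr α e2, localPullback_comp (Φ := Φ) α
    (mdifferentiableAt_chart_symm q ((extChartAt 𝓘(ℝ, E) q).map_source hy.self_of_nhds)) hdy]
  rfl

/-- The pullback of smooth 1-forms by a smooth map. -/
def pullback (F : N → M) (hF : ContMDiff 𝓘(ℝ, E') 𝓘(ℝ, E) ∞ F) :
    OneForm E M →ₗ[ℝ] OneForm E' N where
  toFun α := ⟨fun x => (α (F x)).comp (mfderiv 𝓘(ℝ, E') 𝓘(ℝ, E) F x), by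
    refine (contMDiff_iff_formInChart _).2 fun x₀ y₀ hy₀ => ContDiffAt.contDiffWithinAt ?_
    obtain ⟨q, Φ, hΦ, hq, he⟩ := formInChart_pullback hF (fun x => α x) x₀ hy₀
    refine ContDiffAt.congr_of_eventuallyEq ?_ he
    exact (((contDiffOn_formInChart α q).contDiffAt ((isOpen_extChartAt_target q).mem_nhds hq)).comp
      y₀ hΦ).clm_comp (hΦ.fderiv_right (by simp))⟩
  map_add' _ _ := rfl
  map_smul' _ _ := rfl

theorem pullback_mem_closedForms {F : N → M} (hF : ContMDiff 𝓘(ℝ, E') 𝓘(ℝ, E) ∞ F)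
    {α : OneForm E M} (hα : α ∈ closedForms E M) : pullback F hF α ∈ closedForms E' N := by
  intro x₀ y₀ hy₀ u v
  obtain ⟨q, Φ, hΦ, hq, he⟩ := formInChart_pullback hF (fun x => α x) x₀ hy₀
  have hA : DifferentiableAt ℝ (formInChart 𝓘(ℝ, E) (fun x => α x) q) (Φ y₀) :=
    ((contDiffOn_formInChart α q).contDiffAt
      ((isOpen_extChartAt_target q).mem_nhds hq)).differentiableAt (by simp)
  have hΦ1 : DifferentiableAt ℝ Φ y₀ := hΦ.differentiableAt (by simp)
  have h2 : (2 : WithTop ℕ∞) ≤ ∞ := by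
    change ((2 : ℕ∞) : WithTop ℕ∞) ≤ ((⊤ : ℕ∞) : WithTop ℕ∞)
    exact_mod_cast le_top
  have hΦ2 : DifferentiableAt ℝ (fderiv ℝ Φ) y₀ :=
    (hΦ.fderiv_right (m := 1) (by simpa [one_add_one_eq_two] using h2)).differentiableAt (by simp)
  have hsymm := (hΦ.isSymmSndFDerivAt (by simpa using h2)).eq u v
  have hd := (hA.hasFDerivAt.comp y₀ hΦ1.hasFDerivAt).clm_comp hΦ2.hasFDerivAt
  have hcl := hα q (Φ y₀) hq (fderiv ℝ Φ y₀ u) (fderiv ℝ Φ y₀ v)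
  have e : fderiv ℝ (formInChart 𝓘(ℝ, E') (fun x => pullback F hF α x) x₀) y₀ = _ :=
    he.fderiv_eq.trans hd.fderiv
  rw [e]
  simp [hsymm, hcl]

theorem pullback_d {F : N → M} (hF : ContMDiff 𝓘(ℝ, E') 𝓘(ℝ, E) ∞ F) (f : SmoothFunction E M) :
    pullback F hF (d f) = d (f.comp ⟨F, hF⟩) := by
  ext x v
  have := mfderiv_comp x (f.contMDiff.mdifferentiable (by simp) (F x))
    (hF.mdifferentiable (by simp) x)
  exact (DFunLike.congr_fun this v).symm

/-- The map induced in cohomology by the pullback of forms by a smooth map `F`. -/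
def restriction {l : Filter M} (F : N → M) (hF : ContMDiff 𝓘(ℝ, E') 𝓘(ℝ, E) ∞ F) :
    H1Rel E l →ₗ[ℝ] H1 E' N :=
  Submodule.mapQ _ _
    ((pullback F hF).restrict fun _ hα =>
      ⟨pullback_mem_closedForms hF hα.1, by simp [formsVanishing]⟩) (by
    rintro ⟨_, hα⟩ ⟨f, -, rfl⟩
    exact ⟨(f.comp ⟨F, hF⟩ : SmoothFunction E' N), by simp [functionsVanishing],
      (pullback_d hF f).symm⟩)

end DeRham

section Conifold

/-- The Euclidean space on which `n`-dimensional manifolds are modelled. -/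
abbrev Euc (n : ℕ) : Type := EuclideanSpace ℝ (Fin n)

/-- The conical metric `dr² + r² g'` at the points `(θ, r)` of `S × ℝ`; it is of interest only
on the cone `S × (0, ∞)`. -/
def coneMetric {E : Type*} [NormedAddCommGroup E] [NormedSpace ℝ E] {S : Type*}
    [TopologicalSpace S] [ChartedSpace E S] (g' : BilinField 𝓘(ℝ, E) S) :
    BilinField (𝓘(ℝ, E).prod 𝓘(ℝ, ℝ)) (S × ℝ) := fun p =>
  let dr : TangentSpace (𝓘(ℝ, E).prod 𝓘(ℝ, ℝ)) p →L[ℝ] ℝ :=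
    mfderiv (𝓘(ℝ, E).prod 𝓘(ℝ, ℝ)) 𝓘(ℝ, ℝ) (Prod.snd : S × ℝ → ℝ) p
  dr.smulRight dr + p.2 ^ 2 • pullBilin (g' p.1)
    (mfderiv (𝓘(ℝ, E).prod 𝓘(ℝ, ℝ)) 𝓘(ℝ, E) (Prod.fst : S × ℝ → S) p)

/-- The two kinds of ends: conically singular and asymptotically conical. -/
inductive EndKind : Type
  | cs
  | ac

/-- The direction in which the radial variable goes: `r → 0` on a conically singular end,
`r → ∞` on an asymptotically conical one. -/
def EndKind.radial : EndKind → Filter ℝ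
  | cs => 𝓝[>] 0
  | ac => atTop

/-- The range `(0, a]`, respectively `[a, ∞)`, of the radial variable on the closure of an end. -/
def EndKind.interval (a : ℝ) : EndKind → Set ℝ
  | cs => Ioc 0 a
  | ac => Ici a

/-- The range `(0, a)`, respectively `(a, ∞)`, of the radial variable on an end. -/
def EndKind.openInterval (a : ℝ) : EndKind → Set ℝ
  | cs => Ioo 0 a
  | ac => Ioi a

/-- The sign condition on the convergence rate of an end. -/
def EndKind.RateSign (ν : ℝ) : EndKind → Prop
  | cs => 0 < ν
  | ac => ν < 0

theorem EndKind.mem_interval {a : ℝ} (ha : 0 < a) : ∀ k : EndKind, a ∈ k.interval a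
  | cs => ⟨ha, le_rfl⟩
  | ac => self_mem_Ici

/-- A Riemannian conifold of dimension `n + 1`: a Riemannian manifold `L` which is the union of a
compact set and of finitely many disjoint ends, each of which is conically singular or
asymptotically conical with link `S i`. It is a CS manifold if all ends are of kind `cs`, an AC
manifold if all ends are of kind `ac`, and a CS/AC manifold in general. -/
structure Conifold (n : ℕ) (L : Type*) [TopologicalSpace L] [ChartedSpace (Euc (n + 1)) L]
    [IsManifold 𝓘(ℝ, Euc (n + 1)) ∞ L] {ι : Type*} (S : ι → Type*)
    [∀ i, TopologicalSpace (S i)] [∀ i, ChartedSpace (Euc n) (S i)]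
    [∀ i, IsManifold 𝓘(ℝ, Euc n) ∞ (S i)] where
  /-- The Riemannian metric `g` of the conifold. -/
  metric : ContMDiffRiemannianMetric 𝓘(ℝ, Euc (n + 1)) ∞ (Euc (n + 1))
    (fun x : L => TangentSpace 𝓘(ℝ, Euc (n + 1)) x)
  /-- The Riemannian metrics of the links. -/
  linkMetric : ∀ i, ContMDiffRiemannianMetric 𝓘(ℝ, Euc n) ∞ (Euc n)
    (fun θ : S i => TangentSpace 𝓘(ℝ, Euc n) θ)
  /-- The kinds of the ends. -/
  kind : ι → EndKind
  /-- The radius at which an end begins (`ε` on a CS end, `R` on an AC end). -/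
  bound : ι → ℝ
  bound_pos : ∀ i, 0 < bound i
  /-- The diffeomorphism from `S i × (0, ε]`, respectively `S i × [R, ∞)`, to the closure of
  the `i`-th end. -/
  param : ∀ i, PartialEquiv (S i × ℝ) L
  source_param : ∀ i, (param i).source = univ ×ˢ (kind i).interval (bound i)
  target_param : ∀ i, (param i).target =
    closure (param i '' (univ ×ˢ (kind i).openInterval (bound i)))
  contMDiffOn_param : ∀ i, ContMDiffOn (𝓘(ℝ, Euc n).prod 𝓘(ℝ, ℝ)) 𝓘(ℝ, Euc (n + 1)) ∞
    (param i) (param i).source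
  contMDiffOn_param_symm : ∀ i, ContMDiffOn 𝓘(ℝ, Euc (n + 1)) (𝓘(ℝ, Euc n).prod 𝓘(ℝ, ℝ)) ∞
    (param i).symm (param i).target
  isOpen_end : ∀ i, IsOpen (param i '' (univ ×ˢ (kind i).openInterval (bound i)))
  disjoint_end : ∀ i j, i ≠ j → Disjoint
    (param i '' (univ ×ˢ (kind i).openInterval (bound i)))
    (param j '' (univ ×ˢ (kind j).openInterval (bound j)))
  isCompact_compl_ends :
    IsCompact (⋃ i, param i '' (univ ×ˢ (kind i).openInterval (bound i)))ᶜ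
  /-- The convergence rates of the ends. -/
  rate : ι → ℝ
  rateSign : ∀ i, (kind i).RateSign (rate i)
  /-- The metric is asymptotic to the conical metric, with all derivatives. -/
  asymptotic : ∀ (i : ι) (j : ℕ),
    TensorIsBigO (comap (Prod.snd : S i × ℝ → ℝ) (kind i).radial)
      (coneMetric (linkMetric i).inner)
      (iterNabla (coneMetric (linkMetric i).inner)
        (bilinTensor fun p =>
          pullBilin (metric.inner (param i p))
            (mfderiv (𝓘(ℝ, Euc n).prod 𝓘(ℝ, ℝ)) 𝓘(ℝ, Euc (n + 1)) (param i) p) -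
          coneMetric (linkMetric i).inner p) j)
      (fun p => p.2 ^ (rate i - j))

namespace Conifold

variable {n : ℕ} {L : Type*} [TopologicalSpace L] [ChartedSpace (Euc (n + 1)) L]
  [IsManifold 𝓘(ℝ, Euc (n + 1)) ∞ L] {ι : Type*} {S : ι → Type*}
  [∀ i, TopologicalSpace (S i)] [∀ i, ChartedSpace (Euc n) (S i)]
  [∀ i, IsManifold 𝓘(ℝ, Euc n) ∞ (S i)] (C : Conifold n L S)

/-- The filter of neighbourhoods of the `i`-th singularity, respectively of infinity on the
`i`-th end. -/
def endFilter (i : ι) : Filter L :=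
  map (C.param i) (comap (Prod.snd : S i × ℝ → ℝ) (C.kind i).radial)

/-- The filter of neighbourhoods of infinity on the large (AC) ends. -/
def acFilter : Filter L := ⨆ i, ⨆ _ : C.kind i = .ac, C.endFilter i

/-- The radial variable `r` on the `i`-th end. -/
def radius (i : ι) (x : L) : ℝ := ((C.param i).symm x).2

/-- `|∇^j T| = O(r^(β i - j))` along the `i`-th end, for every `i` and every `j ≥ 0`. -/
def HasWeight (β : ι → ℝ) {k : ℕ} (T : TensorField 𝓘(ℝ, Euc (n + 1)) L k) : Prop :=
  ∀ (i : ι) (j : ℕ), TensorIsBigO (C.endFilter i) C.metric.inner (iterNabla C.metric.inner T j)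
    (fun x => C.radius i x ^ (β i - j))

theorem HasWeight.linear {β : ι → ℝ} {k : ℕ} {T T' : TensorField 𝓘(ℝ, Euc (n + 1)) L k}
    (hT : C.HasWeight β T) (hT' : C.HasWeight β T') (hs : ChartSmooth T) (hs' : ChartSmooth T')
    (a b : ℝ) : C.HasWeight β (fun x v => a * T x v + b * T' x v) := by
  intro i j
  rw [iterNabla_linear C.metric hs hs' a b j]
  exact (hT i j).add (hT' i j) a b

theorem HasWeight.zero {β : ι → ℝ} {k : ℕ} {T : TensorField 𝓘(ℝ, Euc (n + 1)) L k}
    (hs : ChartSmooth T) : C.HasWeight β (fun x v => 0 * T x v + 0 * T x v) := by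
  intro i j
  rw [iterNabla_linear C.metric hs hs 0 0 j]
  exact ⟨0, .of_forall fun x v => by simp⟩

theorem chartSmooth_function (f : SmoothFunction (Euc (n + 1)) L) :
    ChartSmooth (functionTensor (I := 𝓘(ℝ, Euc (n + 1))) f) := by
  intro x₀
  have h : ContDiffOn ℝ ∞ (f ∘ (extChartAt 𝓘(ℝ, Euc (n + 1)) x₀).symm) _ :=
    (contMDiffOn_chart_iff _ x₀).1 f.contMDiff.contMDiffOn
  exact h.comp contDiffOn_fst fun p hp => hp.1

theorem chartSmooth_form (α : OneForm (Euc (n + 1)) L) :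
    ChartSmooth (formTensor (I := 𝓘(ℝ, Euc (n + 1))) fun x => α x) := by
  intro x₀
  have h0 : ContDiffOn ℝ ∞ (fun p : Euc (n + 1) × (Fin 1 → Euc (n + 1)) => p.2 0)
      ((extChartAt 𝓘(ℝ, Euc (n + 1)) x₀).target ×ˢ univ) := by fun_prop
  exact ((contDiffOn_formInChart α x₀).comp (contDiffOn_fst
    (s := (extChartAt 𝓘(ℝ, Euc (n + 1)) x₀).target ×ˢ univ)) fun p hp => hp.1).clm_apply h0

/-- The weighted space of smooth functions `C_β^∞(L)`. -/
def weightedFunctions (β : ι → ℝ) : Submodule ℝ (SmoothFunction (Euc (n + 1)) L) where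
  carrier := {f | C.HasWeight β (functionTensor (I := 𝓘(ℝ, Euc (n + 1))) f)}
  zero_mem' := by
    have h := HasWeight.zero C (β := β) (chartSmooth_function (0 : SmoothFunction (Euc (n + 1)) L))
    refine (congrArg (C.HasWeight β) ?_).mp h
    funext x v
    simp [functionTensor]
  add_mem' := by
    intro f h hf hh
    have := HasWeight.linear C hf hh (chartSmooth_function f) (chartSmooth_function h) 1 1
    refine (congrArg (C.HasWeight β) ?_).mp this
    funext x v
    simp [functionTensor]
  smul_mem' := by
    intro c f hf
    have := HasWeight.linear C hf hf (chartSmooth_function f) (chartSmooth_function f) c 0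
    refine (congrArg (C.HasWeight β) ?_).mp this
    funext x v
    simp [functionTensor]

/-- The weighted space of smooth 1-forms `C_β^∞(Λ¹)`. -/
def weightedForms (β : ι → ℝ) : Submodule ℝ (OneForm (Euc (n + 1)) L) where
  carrier := {α | C.HasWeight β (formTensor (I := 𝓘(ℝ, Euc (n + 1))) fun x => α x)}
  zero_mem' := by
    have h := HasWeight.zero C (β := β) (chartSmooth_form (0 : OneForm (Euc (n + 1)) L))
    refine (congrArg (C.HasWeight β) ?_).mp h
    funext x v
    simp [formTensor]
  add_mem' := by
    intro f h hf hh
    have := HasWeight.linear C hf hh (chartSmooth_form f) (chartSmooth_form h) 1 1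
    refine (congrArg (C.HasWeight β) ?_).mp this
    funext x v
    simp [formTensor]
  smul_mem' := by
    intro c f hf
    have := HasWeight.linear C hf hf (chartSmooth_form f) (chartSmooth_form f) c 0
    refine (congrArg (C.HasWeight β) ?_).mp this
    funext x v
    simp [formTensor]

/-- The closed 1-forms in `C_{β-1}^∞(Λ¹)`. -/
def closedWeightedForms (β : ι → ℝ) : Submodule ℝ (OneForm (Euc (n + 1)) L) :=
  closedForms (Euc (n + 1)) L ⊓ C.weightedForms fun i => β i - 1

/-- The inclusion of the `i`-th link in `L`, as the boundary of the `i`-th end. -/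
def linkInclusion (i : ι) (θ : S i) : L := C.param i (θ, C.bound i)

theorem contMDiff_linkInclusion (i : ι) :
    ContMDiff 𝓘(ℝ, Euc n) 𝓘(ℝ, Euc (n + 1)) ∞ (C.linkInclusion i) := by
  rw [← contMDiffOn_univ]
  refine (C.contMDiffOn_param i).comp (contMDiffOn_id.prodMk contMDiffOn_const) fun θ _ => ?_
  rw [mem_preimage, C.source_param i]
  exact ⟨mem_univ _, (C.kind i).mem_interval (C.bound_pos i)⟩

/-- The restriction map `ρ` from the cohomology of `L` (of forms vanishing along `l`) to
`H¹(Σ₀)`, where `Σ₀` is the disjoint union of the links of the CS ends. -/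
def restrictCS (l : Filter L) :
    H1Rel (Euc (n + 1)) l →ₗ[ℝ] ∀ i : {i // C.kind i = .cs}, H1 (Euc n) (S i) :=
  LinearMap.pi fun i => restriction (C.linkInclusion i) (C.contMDiff_linkInclusion i)

/-- For each CS end `i`, the function `f i` is equal to `1` near the singularity of the `i`-th end
and to `0` near the singularity, respectively near infinity, of every other end. -/
def IsEndCutoff (f : ι → SmoothFunction (Euc (n + 1)) L) : Prop :=
  ∀ i, C.kind i = .cs → (∀ᶠ x in C.endFilter i, f i x = 1) ∧
    ∀ j, j ≠ i → ∀ᶠ x in C.endFilter j, f i x = 0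

/-- The space `E₀` spanned by the functions `f i`, where `i` runs through the CS ends. -/
def cutoffSpan (f : ι → SmoothFunction (Euc (n + 1)) L) :
    Submodule ℝ (SmoothFunction (Euc (n + 1)) L) :=
  Submodule.span ℝ (f '' {i | C.kind i = .cs})

end Conifold

end Conifold

end Conifolds

end

open Conifolds

noncomputable section

set_option synthInstance.maxHeartbeats 400000
set_option maxSynthPendingDepth 3

/-! All cases rest on one piece of linear algebra, `exists_splitting`. Let `W` be the space of
closed forms to be decomposed, `K` a space of classes in the relevant complex, and `D ⊆ W` a space
of exact forms. Suppose that every element of `W` becomes, modulo `D`, a form of the complex with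
class in `K`, that every class in `K` has a representative in `W`, and that exactness in the complex
agrees with membership in `D` where both make sense. A linear choice of representatives of `K` in
`W`, together with the inclusion of `D`, is then an isomorphism. For compact manifolds nothing else
is needed. For conifolds `D = d(E₀ + C_β)` and `K = Ker ρ`, and the hypotheses are verified by
analysis on one end at a time.

Decaying weight (positive at a singularity, negative at infinity). The radial component of the form
is `O(r^(b-1))`, so a local primitive converges along each ray; its derivative along the link is
`O(r^b)`, so the limit is locally constant. Normalised to limit zero, local primitives agree on
overlaps, and the form has a primitive `O(r^b)` on the end (`exists_primitive_of_decays`). Hence the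
form restricts to an exact form on each CS link, and on decaying AC ends it can be made to vanish
near infinity by subtracting `dw` with `w` in the weighted space. Likewise a function whose
differential decays is asymptotic to a constant; on CS ends these constants are the origin of `E₀`.

Representatives. A closed form whose restriction to a CS link is exact is exact on that end
(`exists_primitive_iff`), and subtracting a cut-off primitive makes it zero near the singularity. On
an AC end with positive weight, subtracting the radial integral from a fixed radius leaves a form
pulled back from the link (`exists_weightAt_neg_one_sub_d`). Such a form has weight `-1`, which is
at most `β - 1`.

The last claim concerns all covariant derivatives and is the technical core. With `r = exp t` the
conical metric is `exp(2t)(dt² + g')`; its Christoffel symbols are bounded with all derivatives, and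
the asymptotic condition transfers this to `g` (`exists_boundedToOrder_metricCoord`). Covariant and
partial derivatives then obey the same bounds, and each argument of a tensor contributes a factor
`r⁻¹`.

Independence of `d(E₀)` and `d(C_β)` uses connectedness: if `de = dw`, then `e - w` is a constant
`a`, so all coefficients of `e` equal `a`. An AC end with negative weight forces `a = 0`; if the
cutoffs add up to `1`, then `e` itself is constant. -/

namespace Conifolds

/-! ### Levi-Civita differentiation of fields of multilinear forms on a vector space -/

section FlatTensors
variable {E : Type*} [NormedAddCommGroup E] [NormedSpace ℝ E]

/-- The trilinear form `(u, v, w) ↦ (L u v w + L v u w - L w u v) / 2` of the Koszul formula. -/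
def koszul : (E →L[ℝ] E →L[ℝ] E →L[ℝ] ℝ) →L[ℝ] (E →L[ℝ] E →L[ℝ] E →L[ℝ] ℝ) :=
  let flip₃ : (E →L[ℝ] E →L[ℝ] E →L[ℝ] ℝ) →L[ℝ] (E →L[ℝ] E →L[ℝ] E →L[ℝ] ℝ) :=
    (ContinuousLinearMap.flipₗᵢ ℝ E E (E →L[ℝ] ℝ)).toContinuousLinearEquiv
  let flip₂ : (E →L[ℝ] E →L[ℝ] ℝ) →L[ℝ] (E →L[ℝ] E →L[ℝ] ℝ) :=
    (ContinuousLinearMap.flipₗᵢ ℝ E E ℝ).toContinuousLinearEquiv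
  (1 / 2 : ℝ) • (ContinuousLinearMap.id ℝ (E →L[ℝ] E →L[ℝ] E →L[ℝ] ℝ) + flip₃ - (ContinuousLinearMap.compL ℝ E _ _ flip₂).comp flip₃)

theorem koszul_apply (L : E →L[ℝ] E →L[ℝ] E →L[ℝ] ℝ) (u v w : E) :
    koszul L u v w = (1 / 2 : ℝ) * (L u v w + L v u w - L w u v) := rfl

/-- The bilinear operation which raises an index of a trilinear form. -/
def raiseIndex : ((E →L[ℝ] ℝ) →L[ℝ] E) →L[ℝ] (E →L[ℝ] E →L[ℝ] E →L[ℝ] ℝ) →L[ℝ]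
    (E →L[ℝ] E →L[ℝ] E) :=
  (ContinuousLinearMap.compL ℝ E (E →L[ℝ] E →L[ℝ] ℝ) (E →L[ℝ] E)).comp
    (ContinuousLinearMap.compL ℝ E (E →L[ℝ] ℝ) E)

/-- The Christoffel symbols as a field of bilinear maps. -/
def christoffelMap (G : E → E →L[ℝ] E →L[ℝ] ℝ) (y : E) : E →L[ℝ] E →L[ℝ] E :=
  raiseIndex (G y).inverse (koszul (fderiv ℝ G y))

theorem christoffelMap_apply (G : E → E →L[ℝ] E →L[ℝ] ℝ) (y u v : E) :
    christoffelMap G y u v = christoffel G y u v := by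
  rfl

/-- The action of an endomorphism on multilinear forms as a derivation. -/
def derivation (E : Type*) [NormedAddCommGroup E] [NormedSpace ℝ E] (k : ℕ) : (E →L[ℝ] E) →L[ℝ] (E [×k]→L[ℝ] ℝ) →L[ℝ] (E [×k]→L[ℝ] ℝ) :=
  ((ContinuousMultilinearMap.compContinuousLinearMapContinuousMultilinear ℝ
    (fun _ : Fin k => E) (fun _ => E) ℝ).linearDeriv fun _ => .id ℝ E).comp
      (ContinuousLinearMap.pi fun _ => .id ℝ _)

/-- Pulling `T` back by a family of endomorphisms, one per slot, is multilinear in the family; its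
derivative at the identity family acts on one slot at a time. -/
theorem derivation_apply {k : ℕ} (A : E →L[ℝ] E) (T : E [×k]→L[ℝ] ℝ) (v : Fin k → E) :
    derivation E k A T v = ∑ i, T (Function.update v i (A (v i))) := by
  simp only [derivation, ContinuousLinearMap.comp_apply,
    ContinuousMultilinearMap.linearDeriv_apply, sum_apply]
  refine Finset.sum_congr rfl fun i _ => ?_
  simp only [ContinuousMultilinearMap.compContinuousLinearMapContinuousMultilinear_apply_apply]
  refine congrArg T (funext fun j => ?_)
  by_cases h : j = i
  · subst h; simp
  · simp [h]

/-- The zeroth order part of the covariant derivative, as a bilinear operation. -/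
def christoffelAction (E : Type*) [NormedAddCommGroup E] [NormedSpace ℝ E] (k : ℕ) : (E [×k]→L[ℝ] ℝ) →L[ℝ] (E →L[ℝ] E →L[ℝ] E) →L[ℝ]
    (E →L[ℝ] E [×k]→L[ℝ] ℝ) :=
  (ContinuousLinearMap.compL ℝ E (E →L[ℝ] E) (E [×k]→L[ℝ] ℝ)).comp (derivation E k).flip

theorem christoffelAction_apply {k : ℕ} (T : E [×k]→L[ℝ] ℝ) (Γ : E →L[ℝ] E →L[ℝ] E) (u : E) :
    christoffelAction E k T Γ u = derivation E k (Γ u) T := rfl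

/-- The covariant derivative of a field of multilinear forms. -/
def covDerivMap (G : E → E →L[ℝ] E →L[ℝ] ℝ) {k : ℕ} (T : E → E [×k]→L[ℝ] ℝ) (y : E) :
    E [×(k + 1)]→L[ℝ] ℝ :=
  (continuousMultilinearCurryLeftEquiv ℝ (fun _ : Fin (k + 1) => E) ℝ).symm
    (fderiv ℝ T y - christoffelAction E k (T y) (christoffelMap G y))

/-- The iterated covariant derivative of a field of multilinear forms. -/
def iterCovDerivMap (G : E → E →L[ℝ] E →L[ℝ] ℝ) {k : ℕ} (T : E → E [×k]→L[ℝ] ℝ) :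
    ∀ j : ℕ, E → E [×(k + j)]→L[ℝ] ℝ
  | 0 => T
  | j + 1 => covDerivMap G (iterCovDerivMap G T j)

variable {G : E → E →L[ℝ] E →L[ℝ] ℝ} {U : Set E} {k : ℕ}

/-- `covDeriv` differentiates the number `T(v)` for each fixed `v`, whereas norm estimates need a
map into the normed space of multilinear forms. The two agree because evaluation at a fixed `v` is
continuous and linear, so it commutes with differentiation. -/
theorem covDeriv_eq_covDerivMap {T : E → (Fin k → E) → ℝ} {T' : E → E [×k]→L[ℝ] ℝ}
    (hU : IsOpen U) (hT : ∀ y ∈ U, ∀ v, T y v = T' y v) (hd : DifferentiableOn ℝ T' U) {y : E}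
    (hy : y ∈ U) (u : Fin (k + 1) → E) : covDeriv G T y u = covDerivMap G T' y u := by
  have h1 : fderiv ℝ (fun z => T z (Fin.tail u)) y (u 0) = fderiv ℝ T' y (u 0) (Fin.tail u) := by
    have h2 : (fun z => T z (Fin.tail u)) =ᶠ[𝓝 y] fun z => T' z (Fin.tail u) := by
      filter_upwards [hU.mem_nhds hy] with z hz using hT z hz _
    have h3 := (hd.differentiableAt (hU.mem_nhds hy)).hasFDerivAt.continuousMultilinear_apply_const
      (Fin.tail u)
    rw [h2.fderiv_eq, h3.fderiv]
    rfl
  simp only [covDeriv, h1, hT y hy]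
  rw [covDerivMap, continuousMultilinearCurryLeftEquiv_symm_apply, sub_apply, sub_apply,
    christoffelAction_apply, derivation_apply]
  rfl

theorem contDiffOn_bilinear {F F₁ F₂ : Type*} [NormedAddCommGroup F] [NormedSpace ℝ F]
    [NormedAddCommGroup F₁] [NormedSpace ℝ F₁] [NormedAddCommGroup F₂] [NormedSpace ℝ F₂]
    {Ω : Set E} {f : E → F₁} {g : E → F₂} (hf : ContDiffOn ℝ ∞ f Ω)
    (hg : ContDiffOn ℝ ∞ g Ω) (B : F₁ →L[ℝ] F₂ →L[ℝ] F) :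
    ContDiffOn ℝ ∞ (fun z => B (f z) (g z)) Ω :=
  B.isBoundedBilinearMap.contDiff.comp_contDiffOn (hf.prodMk hg)

theorem contDiffOn_inverse [FiniteDimensional ℝ E] (hU : IsOpen U)
    (hG : ContDiffOn ℝ ∞ G U) (hinv : ∀ y ∈ U, (G y).IsInvertible) :
    ContDiffOn ℝ ∞ (fun y => (G y).inverse) U := by
  have : CompleteSpace E := FiniteDimensional.complete ℝ E
  exact fun y hy => (((hinv y hy).contDiffAt_map_inverse (n := ∞)).comp y
    (hG.contDiffAt (hU.mem_nhds hy))).contDiffWithinAt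

set_option maxHeartbeats 2000000 in
theorem contDiffOn_christoffelMap [FiniteDimensional ℝ E] (hU : IsOpen U)
    (hG : ContDiffOn ℝ ∞ G U) (hinv : ∀ y ∈ U, (G y).IsInvertible) :
    ContDiffOn ℝ ∞ (christoffelMap G) U := by
  have h1 := contDiffOn_inverse hU hG hinv
  have h2 : ContDiffOn ℝ ∞ (fderiv ℝ G) U := hG.fderiv_of_isOpen (m := ∞) hU (by simp)
  have h4 : ContDiffOn ℝ ∞ (fun y => koszul (fderiv ℝ G y)) U := koszul.contDiff.comp_contDiffOn h2
  exact contDiffOn_bilinear h1 h4 raiseIndex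

theorem contDiffOn_covDerivMap [FiniteDimensional ℝ E] {T : E → E [×k]→L[ℝ] ℝ} (hU : IsOpen U)
    (hG : ContDiffOn ℝ ∞ G U) (hinv : ∀ y ∈ U, (G y).IsInvertible) (hT : ContDiffOn ℝ ∞ T U) :
    ContDiffOn ℝ ∞ (covDerivMap G T) U := by
  have h1 := contDiffOn_christoffelMap hU hG hinv
  have h2 := hT.fderiv_of_isOpen (m := ∞) hU (by simp)
  exact (continuousMultilinearCurryLeftEquiv ℝ (fun _ : Fin (k + 1) => E)
    ℝ).symm.contDiff.comp_contDiffOn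
      (h2.sub (((christoffelAction E k).contDiff.comp_contDiffOn hT).clm_apply h1))

theorem contDiffOn_iterCovDerivMap [FiniteDimensional ℝ E] {T : E → E [×k]→L[ℝ] ℝ}
    (hU : IsOpen U) (hG : ContDiffOn ℝ ∞ G U) (hinv : ∀ y ∈ U, (G y).IsInvertible)
    (hT : ContDiffOn ℝ ∞ T U) : ∀ j, ContDiffOn ℝ ∞ (iterCovDerivMap G T j) U
  | 0 => hT
  | j + 1 => contDiffOn_covDerivMap hU hG hinv (contDiffOn_iterCovDerivMap hU hG hinv hT j)

theorem iterCovDeriv_eq_iterCovDerivMap [FiniteDimensional ℝ E] {T : E → (Fin k → E) → ℝ}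
    {T' : E → E [×k]→L[ℝ] ℝ} (hU : IsOpen U) (hG : ContDiffOn ℝ ∞ G U)
    (hinv : ∀ y ∈ U, (G y).IsInvertible) (hT : ∀ y ∈ U, ∀ v, T y v = T' y v)
    (hT' : ContDiffOn ℝ ∞ T' U) (j : ℕ) :
    ∀ y ∈ U, ∀ v, iterCovDeriv G T j y v = iterCovDerivMap G T' j y v := by
  induction j with
  | zero => exact hT
  | succ j ih =>
    intro y hy v
    exact covDeriv_eq_covDerivMap hU ih
      ((contDiffOn_iterCovDerivMap hU hG hinv hT' j).differentiableOn (by simp)) hy v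

theorem christoffel_congr {G' : E → E →L[ℝ] E →L[ℝ] ℝ} {y : E} (h : G =ᶠ[𝓝 y] G') (u v : E) :
    christoffel G y u v = christoffel G' y u v := by
  simp only [christoffel, h.eq_of_nhds, h.fderiv_eq]

/-- The equality must be one of germs, since each further covariant derivative looks at a
neighbourhood of the point. -/
theorem iterCovDeriv_congr {G' : E → E →L[ℝ] E →L[ℝ] ℝ} {T T' : E → (Fin k → E) → ℝ} {y : E}
    (hG : G =ᶠ[𝓝 y] G') (hT : T =ᶠ[𝓝 y] T') (j : ℕ) :
    iterCovDeriv G T j =ᶠ[𝓝 y] iterCovDeriv G' T' j := by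
  induction j with
  | zero => exact hT
  | succ j ih =>
    filter_upwards [ih.eventually_nhds, hG.eventually_nhds] with z hz hGz
    funext u
    simp only [iterCovDeriv, covDeriv]
    have h1 : (fun z => iterCovDeriv G T j z (Fin.tail u)) =ᶠ[𝓝 z]
        fun z => iterCovDeriv G' T' j z (Fin.tail u) := by
      filter_upwards [hz] with w hw using congrFun hw _
    have h2 : iterCovDeriv G T j z = iterCovDeriv G' T' j z := hz.self_of_nhds
    rw [h1.fderiv_eq]
    erw [h2]
    simp only [christoffel_congr hGz]

/-- Covariant differentiation commutes with a renumbering of the arguments. -/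
theorem covDeriv_cast {k k' : ℕ} (h : k = k') (T : E → (Fin k → E) → ℝ) (y : E)
    (v : Fin (k' + 1) → E) :
    covDeriv G (fun y v => T y fun i => v (Fin.cast h i)) y v =
      covDeriv G T y fun i => v (Fin.cast (congrArg (· + 1) h) i) := by
  subst h
  rfl

/-- The iterated covariant derivatives of a function are those of its differential. -/
theorem iterCovDeriv_fderiv (f : E → ℝ) (j : ℕ) (y : E) (v : Fin (0 + (j + 1)) → E) :
    iterCovDeriv G (fun y (_ : Fin 0 → E) => f y) (j + 1) y v =
      iterCovDeriv G (fun y (v : Fin 1 → E) => fderiv ℝ f y (v 0)) j y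
        fun i => v (Fin.cast (Nat.add_comm _ _ |>.trans (Nat.zero_add _).symm) i) := by
  induction j generalizing y with
  | zero => simp [iterCovDeriv, covDeriv]
  | succ j ih =>
    have h : iterCovDeriv G (fun y (_ : Fin 0 → E) => f y) (j + 1) = fun y v =>
      iterCovDeriv G (fun y (v : Fin 1 → E) => fderiv ℝ f y (v 0)) j y
        fun i => v (Fin.cast (Nat.add_comm _ _ |>.trans (Nat.zero_add _).symm) i) := by
      funext y v; exact ih y v
    change covDeriv G (iterCovDeriv G (fun y (_ : Fin 0 → E) => f y) (j + 1)) y v = _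
    rw [h]
    -- The two sides have `1 + j` and `0 + (j + 1)` slots; the renumbering is moved outside the
    -- derivative.
    exact covDeriv_cast (show 1 + j = 0 + (j + 1) by omega) _ y v

end FlatTensors

/-! ### Invariance of covariant derivatives under local diffeomorphisms -/

section Invariance
variable {E : Type*} [NormedAddCommGroup E] [NormedSpace ℝ E] [FiniteDimensional ℝ E]
  {E' : Type*} [NormedAddCommGroup E'] [NormedSpace ℝ E'] [FiniteDimensional ℝ E']
  {G : E → E →L[ℝ] E →L[ℝ] ℝ} {U : Set E} {U' : Set E'} {Φ : E' → E} {k : ℕ}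

theorem pullBilin_apply {V W : Type*} [AddCommGroup V] [Module ℝ V] [TopologicalSpace V]
    [AddCommGroup W] [Module ℝ W] [TopologicalSpace W]
    (B : V →L[ℝ] V →L[ℝ] ℝ) (A : W →L[ℝ] V) (u v : W) : pullBilin B A u v = B (A u) (A v) := rfl

theorem contDiffOn_pullBilin {V W X : Type*} [NormedAddCommGroup V] [NormedSpace ℝ V]
    [NormedAddCommGroup W] [NormedSpace ℝ W] [FiniteDimensional ℝ W]
    [NormedAddCommGroup X] [NormedSpace ℝ X]
    {B : X → V →L[ℝ] V →L[ℝ] ℝ} {A : X → W →L[ℝ] V} {s : Set X} (hB : ContDiffOn ℝ ∞ B s)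
    (hA : ContDiffOn ℝ ∞ A s) : ContDiffOn ℝ ∞ (fun x => pullBilin (B x) (A x)) s := by
  refine contDiffOn_clm_apply.2 fun u => contDiffOn_clm_apply.2 fun v => ?_
  simp only [pullBilin_apply]
  exact (hB.clm_apply (hA.clm_apply contDiffOn_const)).clm_apply (hA.clm_apply contDiffOn_const)

theorem isInvertible_pullBilin {B : E →L[ℝ] E →L[ℝ] ℝ} (hB : B.IsInvertible) {A : E' →L[ℝ] E}
    (hA : A.IsInvertible) : (pullBilin B A).IsInvertible := by
  obtain ⟨e, rfl⟩ := hA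
  have h : (ContinuousLinearMap.precomp ℝ (e : E' →L[ℝ] E)).IsInvertible :=
    ⟨e.symm.arrowCongr (.refl ℝ ℝ), by ext; rfl⟩
  exact h.comp (hB.comp ⟨e, rfl⟩)

/-- The product rule. In the Koszul combination of these terms, the symmetry of `G` and of `D²Φ`
leaves a single second-derivative term, in which `D²Φ(u, v)` is paired with `DΦ w`. -/
theorem fderiv_pullBilin {z : E'} (hG : DifferentiableAt ℝ G (Φ z)) (hΦ : DifferentiableAt ℝ Φ z)
    (hΦ' : DifferentiableAt ℝ (fderiv ℝ Φ) z) (u v w : E') :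
    fderiv ℝ (fun z => pullBilin (G (Φ z)) (fderiv ℝ Φ z)) z u v w =
      fderiv ℝ G (Φ z) (fderiv ℝ Φ z u) (fderiv ℝ Φ z v) (fderiv ℝ Φ z w) +
      G (Φ z) (fderiv ℝ (fderiv ℝ Φ) z u v) (fderiv ℝ Φ z w) +
      G (Φ z) (fderiv ℝ Φ z v) (fderiv ℝ (fderiv ℝ Φ) z u w) := by
  have hP : DifferentiableAt ℝ (fun z => pullBilin (G (Φ z)) (fderiv ℝ Φ z)) z := by
    have hpre : DifferentiableAt ℝ
        (fun z => (ContinuousLinearMap.precomp ℝ (fderiv ℝ Φ z) : (E →L[ℝ] ℝ) →L[ℝ] _)) z :=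
      ((ContinuousLinearMap.compL ℝ E' E ℝ).flip.differentiableAt).comp z hΦ'
    exact hpre.clm_comp ((hG.comp z hΦ).clm_comp hΦ')
  have h1 := (hP.hasFDerivAt.clm_apply (hasFDerivAt_const v z)).clm_apply (hasFDerivAt_const w z)
  have h2 := ((hG.hasFDerivAt.comp z hΦ.hasFDerivAt).clm_apply
    (hΦ'.hasFDerivAt.clm_apply (hasFDerivAt_const v z))).clm_apply
    (hΦ'.hasFDerivAt.clm_apply (hasFDerivAt_const w z))
  have h3 := DFunLike.congr_fun (h1.unique h2) u
  simp at h3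
  rw [h3]
  ring

/-- The transformation law of the Christoffel symbols. -/
theorem christoffel_pullBilin {z : E'} (hG : DifferentiableAt ℝ G (Φ z))
    (hinv : (G (Φ z)).IsInvertible) (hsymm : ∀ u v, G (Φ z) u v = G (Φ z) v u)
    (hΦ : ContDiffAt ℝ ∞ Φ z) (hΦinv : (fderiv ℝ Φ z).IsInvertible) (u v : E') :
    fderiv ℝ Φ z (christoffel (fun z => pullBilin (G (Φ z)) (fderiv ℝ Φ z)) z u v) =
      christoffel G (Φ z) (fderiv ℝ Φ z u) (fderiv ℝ Φ z v) + fderiv ℝ (fderiv ℝ Φ) z u v := by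
  have hΦ1 : DifferentiableAt ℝ Φ z := hΦ.differentiableAt (by simp)
  have h2 : (2 : WithTop ℕ∞) ≤ ∞ := by
    change ((2 : ℕ∞) : WithTop ℕ∞) ≤ ((⊤ : ℕ∞) : WithTop ℕ∞)
    exact_mod_cast le_top
  have hΦ2 : DifferentiableAt ℝ (fderiv ℝ Φ) z :=
    (hΦ.fderiv_right (m := 1) (by simpa [one_add_one_eq_two] using h2)).differentiableAt (by simp)
  have hsym2 := hΦ.isSymmSndFDerivAt (by simpa using h2)
  -- It suffices to compare both sides after lowering the index with `G` and pairing with vectors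
  -- `DΦ w`, which exhaust the space; both are then Koszul expressions.
  refine hinv.injective ?_
  ext w'
  obtain ⟨w, rfl⟩ := hΦinv.surjective w'
  have e1 : ∀ u v w, (pullBilin (G (Φ z)) (fderiv ℝ Φ z)
      (christoffel (fun z => pullBilin (G (Φ z)) (fderiv ℝ Φ z)) z u v)) w =
      koszul (fderiv ℝ (fun z => pullBilin (G (Φ z)) (fderiv ℝ Φ z)) z) u v w := by
    intro u v w
    exact DFunLike.congr_fun ((isInvertible_pullBilin hinv hΦinv).self_apply_inverse _) w
  have e2 : ∀ u v w, (G (Φ z) (christoffel G (Φ z) u v)) w =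
      koszul (fderiv ℝ G (Φ z)) u v w := by
    intro u v w
    exact DFunLike.congr_fun (hinv.self_apply_inverse _) w
  rw [← pullBilin_apply (G (Φ z)), e1, map_add, add_apply, e2, koszul_apply, koszul_apply,
    fderiv_pullBilin hG hΦ1 hΦ2, fderiv_pullBilin hG hΦ1 hΦ2, fderiv_pullBilin hG hΦ1 hΦ2,
    hsym2.eq v u, hsym2.eq w u, hsym2.eq w v, hsymm (fderiv ℝ Φ z v) (fderiv ℝ (fderiv ℝ Φ) z u w)]
  ring

/-- The covariant derivative is invariant under local diffeomorphisms. -/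
theorem covDerivMap_pullback {z : E'} {T : E → E [×k]→L[ℝ] ℝ} (hG : DifferentiableAt ℝ G (Φ z))
    (hinv : (G (Φ z)).IsInvertible) (hsymm : ∀ u v, G (Φ z) u v = G (Φ z) v u)
    (hT : DifferentiableAt ℝ T (Φ z))
    (hΦ : ContDiffAt ℝ ∞ Φ z) (hΦinv : (fderiv ℝ Φ z).IsInvertible) (u : Fin (k + 1) → E') :
    covDeriv (fun z => pullBilin (G (Φ z)) (fderiv ℝ Φ z))
      (fun z v => T (Φ z) fun i => fderiv ℝ Φ z (v i)) z u =
      covDerivMap G T (Φ z) fun i => fderiv ℝ Φ z (u i) := by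
  have hΦ1 : DifferentiableAt ℝ Φ z := hΦ.differentiableAt (by simp)
  have h2 : (2 : WithTop ℕ∞) ≤ ∞ := by
    change ((2 : ℕ∞) : WithTop ℕ∞) ≤ ((⊤ : ℕ∞) : WithTop ℕ∞)
    exact_mod_cast le_top
  have hΦ2 : DifferentiableAt ℝ (fderiv ℝ Φ) z :=
    (hΦ.fderiv_right (m := 1) (by simpa [one_add_one_eq_two] using h2)).differentiableAt (by simp)
  have h1 := (hT.hasFDerivAt.comp z hΦ1.hasFDerivAt).continuousMultilinearMap_apply
    (g := fun i z => fderiv ℝ Φ z (Fin.tail u i))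
    (fun i => hΦ2.hasFDerivAt.clm_apply (hasFDerivAt_const (Fin.tail u i) z))
  -- By the transformation law, the correction for the pulled back metric is that for `G` plus an
  -- insertion of `D²Φ`. The latter cancels the term arising when the arguments `DΦ (u i)` are
  -- differentiated.
  have h3 : ∀ i : Fin k, (T (Φ z) fun j => fderiv ℝ Φ z (Function.update (Fin.tail u) i
      (christoffel (fun z => pullBilin (G (Φ z)) (fderiv ℝ Φ z)) z (u 0) (Fin.tail u i)) j)) =
      T (Φ z) (Function.update (fun j => fderiv ℝ Φ z (Fin.tail u j)) i
        (christoffel G (Φ z) (fderiv ℝ Φ z (u 0)) (fderiv ℝ Φ z (Fin.tail u i)))) +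
      T (Φ z) (Function.update (fun j => fderiv ℝ Φ z (Fin.tail u j)) i
        (fderiv ℝ (fderiv ℝ Φ) z (u 0) (Fin.tail u i))) := by
    intro i
    rw [← ContinuousMultilinearMap.map_update_add, ← christoffel_pullBilin hG hinv hsymm hΦ hΦinv]
    refine congrArg _ (funext fun j => ?_)
    by_cases h : j = i
    · subst h; simp
    · simp [h]
  rw [covDerivMap, continuousMultilinearCurryLeftEquiv_symm_apply, sub_apply, sub_apply,
    christoffelAction_apply, derivation_apply]
  rw [covDeriv, Finset.sum_congr rfl fun i _ => h3 i]
  have h4 : fderiv ℝ (fun z => T (Φ z) fun i => fderiv ℝ Φ z (Fin.tail u i)) z (u 0) = _ :=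
    DFunLike.congr_fun h1.fderiv (u 0)
  rw [h4]
  simp [Finset.sum_add_distrib, ContinuousMultilinearMap.toContinuousLinearMap,
    christoffelMap_apply, Fin.tail]
  rfl

/-- The iterated covariant derivatives are invariant under local diffeomorphisms. -/
theorem iterCovDeriv_pullback {T : E → (Fin k → E) → ℝ} {T' : E → E [×k]→L[ℝ] ℝ} (hU : IsOpen U)
    (hG : ContDiffOn ℝ ∞ G U) (hinv : ∀ y ∈ U, (G y).IsInvertible)
    (hsymm : ∀ y ∈ U, ∀ u v, G y u v = G y v u)
    (hT : ∀ y ∈ U, ∀ v, T y v = T' y v) (hT' : ContDiffOn ℝ ∞ T' U) (hU' : IsOpen U')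
    (hΦ : ContDiffOn ℝ ∞ Φ U') (hΦinv : ∀ z ∈ U', (fderiv ℝ Φ z).IsInvertible)
    (hmaps : MapsTo Φ U' U) (j : ℕ) :
    ∀ z ∈ U', ∀ v, iterCovDeriv (fun z => pullBilin (G (Φ z)) (fderiv ℝ Φ z))
      (fun z v => T (Φ z) fun i => fderiv ℝ Φ z (v i)) j z v =
      iterCovDeriv G T j (Φ z) fun i => fderiv ℝ Φ z (v i) := by
  induction j with
  | zero => intro z _ v; rfl
  | succ j ih =>
    intro z hz v
    have hs := contDiffOn_iterCovDerivMap hU hG hinv hT' j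
    have he := iterCovDeriv_eq_iterCovDerivMap hU hG hinv hT hT' j
    have hUz := hU.mem_nhds (hmaps hz)
    rw [iterCovDeriv_eq_iterCovDerivMap hU hG hinv hT hT' (j + 1) _ (hmaps hz)]
    refine Eq.trans ?_ (covDerivMap_pullback (G := G) (Φ := Φ) (T := iterCovDerivMap G T' j)
      ((hG.contDiffAt hUz).differentiableAt (by simp)) (hinv _ (hmaps hz)) (hsymm _ (hmaps hz))
      ((hs.contDiffAt hUz).differentiableAt (by simp)) (hΦ.contDiffAt (hU'.mem_nhds hz))
      (hΦinv z hz) v)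
    refine congrFun (EventuallyEq.eq_of_nhds (iterCovDeriv_congr (j := 1) .rfl ?_)) v
    filter_upwards [hU'.mem_nhds hz] with w hw
    funext u
    rw [ih w hw, he _ (hmaps hw)]

end Invariance

-- From here on these operations matter only as bounded linear or bilinear maps, not through their
-- formulas.
attribute [irreducible] koszul raiseIndex derivation christoffelAction

/-! ### Weighted bounds for functions together with their partial derivatives -/

section Symbols
variable {E : Type} [NormedAddCommGroup E] [NormedSpace ℝ E]

/-- On `Ω`, the derivatives of `f` up to order `m` are bounded by multiples of `w`. -/
def BoundedToOrder (Ω : Set E) (w : E → ℝ) :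
    ℕ → ∀ {F : Type} [NormedAddCommGroup F] [NormedSpace ℝ F], (E → F) → Prop
  | 0, _, _, _, f => ∃ C : ℝ, ∀ z ∈ Ω, ‖f z‖ ≤ C * w z
  | m + 1, _, _, _, f => (∃ C : ℝ, ∀ z ∈ Ω, ‖f z‖ ≤ C * w z) ∧ BoundedToOrder Ω w m (fderiv ℝ f)

variable {F F₁ F₂ : Type} [NormedAddCommGroup F] [NormedSpace ℝ F]
  [NormedAddCommGroup F₁] [NormedSpace ℝ F₁] [NormedAddCommGroup F₂] [NormedSpace ℝ F₂]
  {Ω : Set E} {w w₁ w₂ : E → ℝ} {m : ℕ}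

theorem BoundedToOrder.bound {f : E → F} (h : BoundedToOrder Ω w m f) :
    ∃ C : ℝ, ∀ z ∈ Ω, ‖f z‖ ≤ C * w z := by
  cases m with
  | zero => exact h
  | succ m => exact h.1

theorem BoundedToOrder.of_succ {f : E → F} (h : BoundedToOrder Ω w (m + 1) f) :
    BoundedToOrder Ω w m f := by
  induction m generalizing F with
  | zero => exact h.1
  | succ m ih => exact ⟨h.1, ih h.2⟩

theorem BoundedToOrder.congr (hΩ : IsOpen Ω) {f g : E → F} (h : BoundedToOrder Ω w m f)
    (hfg : EqOn f g Ω) : BoundedToOrder Ω w m g := by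
  have h0 : (∃ C : ℝ, ∀ z ∈ Ω, ‖f z‖ ≤ C * w z) → ∃ C : ℝ, ∀ z ∈ Ω, ‖g z‖ ≤ C * w z :=
    fun ⟨C, hC⟩ => ⟨C, fun z hz => by rw [← hfg hz]; exact hC z hz⟩
  induction m generalizing F with
  | zero => exact h0 h
  | succ m ih =>
    have h1 : EqOn (fderiv ℝ f) (fderiv ℝ g) Ω := fun z hz =>
      (hfg.eventuallyEq_of_mem (hΩ.mem_nhds hz)).fderiv_eq
    exact ⟨h0 h.1, ih h.2 h1 fun ⟨C, hC⟩ => ⟨C, fun z hz => by rw [← h1 hz]; exact hC z hz⟩⟩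

theorem BoundedToOrder.mono_weight {f : E → F} (h : BoundedToOrder Ω w m f) {K : ℝ}
    (hw : ∀ z ∈ Ω, 0 ≤ w z) (hww : ∀ z ∈ Ω, w z ≤ K * w₁ z) : BoundedToOrder Ω w₁ m f := by
  have h0 : ∀ {X : Type} [NormedAddCommGroup X] [NormedSpace ℝ X] {f : E → X},
      (∃ C : ℝ, ∀ z ∈ Ω, ‖f z‖ ≤ C * w z) → ∃ C : ℝ, ∀ z ∈ Ω, ‖f z‖ ≤ C * w₁ z := by
    rintro X _ _ f ⟨C, hC⟩
    refine ⟨|C| * K, fun z hz => (hC z hz).trans ?_⟩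
    calc C * w z ≤ |C| * w z := mul_le_mul_of_nonneg_right (le_abs_self C) (hw z hz)
      _ ≤ |C| * (K * w₁ z) := mul_le_mul_of_nonneg_left (hww z hz) (abs_nonneg C)
      _ = _ := by ring
  induction m generalizing F with
  | zero => exact h0 h
  | succ m ih => exact ⟨h0 h.1, ih h.2⟩

theorem BoundedToOrder.add (hΩ : IsOpen Ω) {f g : E → F} (h : BoundedToOrder Ω w m f)
    (h' : BoundedToOrder Ω w m g) (hf : ContDiffOn ℝ ∞ f Ω) (hg : ContDiffOn ℝ ∞ g Ω) :
    BoundedToOrder Ω w m (fun z => f z + g z) := by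
  have h0 : ∀ {X : Type} [NormedAddCommGroup X] [NormedSpace ℝ X] {f g : E → X},
      (∃ C : ℝ, ∀ z ∈ Ω, ‖f z‖ ≤ C * w z) → (∃ C : ℝ, ∀ z ∈ Ω, ‖g z‖ ≤ C * w z) →
        ∃ C : ℝ, ∀ z ∈ Ω, ‖f z + g z‖ ≤ C * w z := by
    rintro X _ _ f g ⟨C, hC⟩ ⟨D, hD⟩
    refine ⟨C + D, fun z hz => (norm_add_le _ _).trans ?_⟩
    rw [add_mul]
    exact add_le_add (hC z hz) (hD z hz)
  induction m generalizing F with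
  | zero => exact h0 h h'
  | succ m ih =>
    have h1 := ih h.2 h'.2 (hf.fderiv_of_isOpen (m := ∞) hΩ (by simp))
      (hg.fderiv_of_isOpen (m := ∞) hΩ (by simp))
    refine ⟨h0 h.1 h'.1, h1.congr hΩ fun z hz => ?_⟩
    exact (fderiv_fun_add ((hf.contDiffAt (hΩ.mem_nhds hz)).differentiableAt (by simp))
      ((hg.contDiffAt (hΩ.mem_nhds hz)).differentiableAt (by simp))).symm

theorem BoundedToOrder.clm (hΩ : IsOpen Ω) {f : E → F} (h : BoundedToOrder Ω w m f)
    (hf : ContDiffOn ℝ ∞ f Ω) (A : F →L[ℝ] F₁) : BoundedToOrder Ω w m (fun z => A (f z)) := by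
  have h0 : ∀ {X Y : Type} [NormedAddCommGroup X] [NormedSpace ℝ X] [NormedAddCommGroup Y]
      [NormedSpace ℝ Y] {f : E → X} (A : X →L[ℝ] Y),
      (∃ C : ℝ, ∀ z ∈ Ω, ‖f z‖ ≤ C * w z) → ∃ C : ℝ, ∀ z ∈ Ω, ‖A (f z)‖ ≤ C * w z := by
    rintro X Y _ _ _ _ f A ⟨C, hC⟩
    refine ⟨‖A‖ * C, fun z hz => (A.le_opNorm _).trans ?_⟩
    rw [mul_assoc]
    exact mul_le_mul_of_nonneg_left (hC z hz) (norm_nonneg _)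
  induction m generalizing F F₁ with
  | zero => exact h0 A h
  | succ m ih =>
    have h1 := ih h.2 (hf.fderiv_of_isOpen (m := ∞) hΩ (by simp))
      (ContinuousLinearMap.compL ℝ E F F₁ A)
    refine ⟨h0 A h.1, h1.congr hΩ fun z hz => ?_⟩
    exact ((A.hasFDerivAt.comp z ((hf.contDiffAt (hΩ.mem_nhds hz)).differentiableAt
      (by simp)).hasFDerivAt).fderiv).symm

/-- The derivative of `B(f, g)` is `B(f, Dg) + B(Df, g)`, a sum of two bilinear expressions with the
same pair of weights. The induction on the order therefore runs over all spaces and all `B` at once.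
-/
theorem BoundedToOrder.bilinear (hΩ : IsOpen Ω) {f : E → F₁} {g : E → F₂}
    (h : BoundedToOrder Ω w₁ m f) (h' : BoundedToOrder Ω w₂ m g)
    (hf : ContDiffOn ℝ ∞ f Ω) (hg : ContDiffOn ℝ ∞ g Ω) (B : F₁ →L[ℝ] F₂ →L[ℝ] F) :
    BoundedToOrder Ω (fun z => w₁ z * w₂ z) m (fun z => B (f z) (g z)) := by
  have h0 : ∀ {X Y Z : Type} [NormedAddCommGroup X] [NormedSpace ℝ X] [NormedAddCommGroup Y]
      [NormedSpace ℝ Y] [NormedAddCommGroup Z] [NormedSpace ℝ Z] {f : E → X} {g : E → Y}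
      (B : X →L[ℝ] Y →L[ℝ] Z), (∃ C : ℝ, ∀ z ∈ Ω, ‖f z‖ ≤ C * w₁ z) →
      (∃ C : ℝ, ∀ z ∈ Ω, ‖g z‖ ≤ C * w₂ z) →
      ∃ C : ℝ, ∀ z ∈ Ω, ‖B (f z) (g z)‖ ≤ C * (w₁ z * w₂ z) := by
    rintro X Y Z _ _ _ _ _ _ f g B ⟨C, hC⟩ ⟨D, hD⟩
    refine ⟨‖B‖ * (C * D), fun z hz => (B.le_opNorm₂ _ _).trans ?_⟩
    calc ‖B‖ * ‖f z‖ * ‖g z‖ = ‖B‖ * (‖f z‖ * ‖g z‖) := by ring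
      _ ≤ ‖B‖ * ((C * w₁ z) * (D * w₂ z)) := mul_le_mul_of_nonneg_left
          (mul_le_mul (hC z hz) (hD z hz) (norm_nonneg _) ((norm_nonneg _).trans (hC z hz)))
          (norm_nonneg _)
      _ = _ := by ring
  induction m generalizing F F₁ F₂ with
  | zero => exact h0 B h h'
  | succ m ih =>
    have hf' : ContDiffOn ℝ ∞ (fderiv ℝ f) Ω := hf.fderiv_of_isOpen (m := ∞) hΩ (by simp)
    have hg' : ContDiffOn ℝ ∞ (fderiv ℝ g) Ω := hg.fderiv_of_isOpen (m := ∞) hΩ (by simp)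
    have h1 := ih h.of_succ h'.2 hf hg' (B.precompR E)
    have h2 := ih h.2 h'.of_succ hf' hg (B.precompL E)
    have hs1 : ContDiffOn ℝ ∞ (fun z => B.precompR E (f z) (fderiv ℝ g z)) Ω :=
      (B.precompR E).isBoundedBilinearMap.contDiff.comp_contDiffOn (hf.prodMk hg')
    have hs2 : ContDiffOn ℝ ∞ (fun z => B.precompL E (fderiv ℝ f z) (g z)) Ω :=
      (B.precompL E).isBoundedBilinearMap.contDiff.comp_contDiffOn (hf'.prodMk hg)
    refine ⟨h0 B h.1 h'.1, (h1.add hΩ h2 hs1 hs2).congr hΩ fun z hz => ?_⟩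
    exact (B.hasFDerivAt_of_bilinear
      ((hf.contDiffAt (hΩ.mem_nhds hz)).differentiableAt (by simp)).hasFDerivAt
      ((hg.contDiffAt (hΩ.mem_nhds hz)).differentiableAt (by simp)).hasFDerivAt).fderiv.symm

/-- Derivatives of the inverse of a field of linear maps. -/
theorem BoundedToOrder.inverse [CompleteSpace F₁] (hΩ : IsOpen Ω) {f : E → F₁ →L[ℝ] F₂}
    (h : BoundedToOrder Ω w m f) (hf : ContDiffOn ℝ ∞ f Ω) (hinv : ∀ z ∈ Ω, (f z).IsInvertible)
    (hw : ∀ z ∈ Ω, w z * w₁ z = 1) (h0 : BoundedToOrder Ω w₁ 0 fun z => (f z).inverse) :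
    BoundedToOrder Ω w₁ m fun z => (f z).inverse := by
  have hs : ContDiffOn ℝ ∞ (fun z => (f z).inverse) Ω := fun z hz =>
    (((hinv z hz).contDiffAt_map_inverse (n := ∞)).comp z
      (hf.contDiffAt (hΩ.mem_nhds hz))).contDiffWithinAt
  induction m with
  | zero => exact h0
  | succ m ih =>
    refine ⟨h0, ?_⟩
    have hI := ih h.of_succ
    have hf' : ContDiffOn ℝ ∞ (fderiv ℝ f) Ω := hf.fderiv_of_isOpen (m := ∞) hΩ (by simp)
    -- `D (f⁻¹) = - f⁻¹ ∘ (D f) ∘ f⁻¹`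
    let B₁ : (F₂ →L[ℝ] F₁) →L[ℝ] (E →L[ℝ] F₁ →L[ℝ] F₂) →L[ℝ] (E →L[ℝ] F₁ →L[ℝ] F₁) :=
      (ContinuousLinearMap.compL ℝ E _ _).comp (ContinuousLinearMap.compL ℝ F₁ F₂ F₁)
    let B₂ : (F₂ →L[ℝ] F₁) →L[ℝ] (E →L[ℝ] F₁ →L[ℝ] F₁) →L[ℝ] (E →L[ℝ] F₂ →L[ℝ] F₁) :=
      (ContinuousLinearMap.compL ℝ E _ _).comp (-(ContinuousLinearMap.compL ℝ F₂ F₁ F₁).flip)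
    have h1 := hI.bilinear hΩ h.2 hs hf' B₁
    have hs1 : ContDiffOn ℝ ∞ (fun z => B₁ (f z).inverse (fderiv ℝ f z)) Ω :=
      B₁.isBoundedBilinearMap.contDiff.comp_contDiffOn (hs.prodMk hf')
    have h2 := hI.bilinear hΩ h1 hs hs1 B₂
    -- The derivative of the inverse contains two factors of weight `w₁` and one of weight `w`; as
    -- `w w₁ = 1`, its weight is again `w₁` and the induction closes.
    have hw' : EqOn (fun z => w₁ z * (w₁ z * w z)) w₁ Ω := fun z hz => by
      have := hw z hz
      simp only
      rw [mul_comm (w₁ z) (w z), this, mul_one]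
    have h3 : BoundedToOrder Ω w₁ m
        fun z => B₂ (f z).inverse (B₁ (f z).inverse (fderiv ℝ f z)) := by
      have key : ∀ (m : ℕ) {X : Type} [NormedAddCommGroup X] [NormedSpace ℝ X] {φ : E → X},
          BoundedToOrder Ω (fun z => w₁ z * (w₁ z * w z)) m φ → BoundedToOrder Ω w₁ m φ := by
        intro m
        induction m with
        | zero =>
          rintro X _ _ φ ⟨C, hC⟩
          exact ⟨C, fun z hz => by rw [← hw' hz]; exact hC z hz⟩
        | succ m ih =>
          rintro X _ _ φ ⟨⟨C, hC⟩, h⟩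
          exact ⟨⟨C, fun z hz => by rw [← hw' hz]; exact hC z hz⟩, ih h⟩
      exact key m h2
    refine h3.congr hΩ fun z hz => ?_
    have hd : DifferentiableAt ℝ f z := (hf.contDiffAt (hΩ.mem_nhds hz)).differentiableAt (by simp)
    have hdi : DifferentiableAt ℝ (fun z => (f z).inverse) z :=
      (hs.contDiffAt (hΩ.mem_nhds hz)).differentiableAt (by simp)
    -- The formula for the derivative comes from differentiating `f⁻¹ ∘ f = id` and evaluating at
    -- `f⁻¹ v`.
    have hc := hdi.hasFDerivAt.clm_comp hd.hasFDerivAt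
    have hconst : (fun z => (f z).inverse.comp (f z)) =ᶠ[𝓝 z] fun _ => ContinuousLinearMap.id ℝ F₁ := by
      filter_upwards [hΩ.mem_nhds hz] with y hy using (hinv y hy).inverse_comp_self
    have hzero := hc.unique
      ((hasFDerivAt_const (ContinuousLinearMap.id ℝ F₁) z).congr_of_eventuallyEq hconst)
    ext u v
    have h4 := congrArg (fun T => T u ((f z).inverse v)) hzero
    simp [(hinv z hz).self_apply_inverse] at h4
    simp only [B₁, B₂, ContinuousLinearMap.comp_apply, ContinuousLinearMap.compL_apply,
      neg_apply, ContinuousLinearMap.flip_apply]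
    exact (eq_neg_of_add_eq_zero_right h4).symm

/-- Smooth functions are bounded with all derivatives on relatively compact sets. -/
theorem boundedToOrder_of_isCompact {U K : Set E} (hU : IsOpen U) (hK : IsCompact K) (hKU : K ⊆ U)
    (hΩ : Ω ⊆ K) {f : E → F} (hf : ContDiffOn ℝ ∞ f U) (m : ℕ) :
    BoundedToOrder Ω (fun _ => 1) m f := by
  have h0 : ∀ {X : Type} [NormedAddCommGroup X] [NormedSpace ℝ X] {f : E → X},
      ContDiffOn ℝ ∞ f U → ∃ C : ℝ, ∀ z ∈ Ω, ‖f z‖ ≤ C * 1 := by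
    intro X _ _ f hf
    obtain ⟨C, hC⟩ := hK.exists_bound_of_continuousOn (hf.continuousOn.mono hKU)
    exact ⟨C, fun z hz => by simpa using hC z (hΩ hz)⟩
  induction m generalizing F with
  | zero => exact h0 hf
  | succ m ih => exact ⟨h0 hf, ih (hf.fderiv_of_isOpen (m := ∞) hU (by simp))⟩

theorem BoundedToOrder.comp_clm {E₁ : Type} [NormedAddCommGroup E₁] [NormedSpace ℝ E₁]
    {U : Set E} (hU : IsOpen U)
    {Ω₁ : Set E₁} (hΩ₁ : IsOpen Ω₁) {f : E → F} (h : BoundedToOrder U w m f)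
    (hf : ContDiffOn ℝ ∞ f U) (A : E₁ →L[ℝ] E) (hA : MapsTo A Ω₁ U) :
    BoundedToOrder Ω₁ (fun z => w (A z)) m (fun z => f (A z)) := by
  have h0 : ∀ {X : Type} [NormedAddCommGroup X] [NormedSpace ℝ X] {f : E → X},
      (∃ C : ℝ, ∀ z ∈ U, ‖f z‖ ≤ C * w z) → ∃ C : ℝ, ∀ z ∈ Ω₁, ‖f (A z)‖ ≤ C * w (A z) :=
    fun ⟨C, hC⟩ => ⟨C, fun z hz => hC _ (hA hz)⟩
  induction m generalizing F with
  | zero => exact h0 h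
  | succ m ih =>
    have hf' : ContDiffOn ℝ ∞ (fderiv ℝ f) U := hf.fderiv_of_isOpen (m := ∞) hU (by simp)
    have h1 := (ih h.2 hf').clm hΩ₁ (hf'.comp A.contDiff.contDiffOn hA)
      ((ContinuousLinearMap.compL ℝ E₁ E F).flip A)
    refine ⟨h0 h.1, h1.congr hΩ₁ fun z hz => ?_⟩
    exact ((((hf.contDiffAt (hU.mem_nhds (hA hz))).differentiableAt (by simp)).hasFDerivAt.comp z
      A.hasFDerivAt).fderiv).symm

/-- The exponential of a linear form is bounded by itself with all derivatives. -/
theorem boundedToOrder_exp (Ω : Set E) (A : E →L[ℝ] ℝ) (m : ℕ) :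
    BoundedToOrder Ω (fun z => Real.exp (A z)) m (fun z => Real.exp (A z)) := by
  -- The derivative of `exp(A) c` is `exp(A)` times the fixed vector `A ⊗ c`, so the induction needs
  -- arbitrary vector coefficients.
  have h0 : ∀ {X : Type} [NormedAddCommGroup X] [NormedSpace ℝ X] (c : X),
      BoundedToOrder Ω (fun z => Real.exp (A z)) m (fun z => Real.exp (A z) • c) := by
    induction m with
    | zero =>
      intro X _ _ c
      exact ⟨‖c‖, fun z _ => by rw [norm_smul, Real.norm_eq_abs, Real.abs_exp, mul_comm]⟩
    | succ m ih =>
      intro X _ _ c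
      refine ⟨⟨‖c‖, fun z _ => by rw [norm_smul, Real.norm_eq_abs, Real.abs_exp, mul_comm]⟩, ?_⟩
      have : fderiv ℝ (fun z => Real.exp (A z) • c) =
          fun z => Real.exp (A z) • (A.smulRight c) := by
        funext z
        rw [(A.hasFDerivAt.exp.smul_const c).fderiv]
        ext v
        simp [mul_smul]
      rw [this]
      exact ih _
  simpa using h0 (1 : ℝ)

variable {G : E → E →L[ℝ] E →L[ℝ] ℝ} {k : ℕ}

-- The Christoffel symbols are linear in `G⁻¹`, of weight `w₁`, and in `DG`, of weight `w`. As the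
-- weights are reciprocal, the symbols are bounded, however fast the metric itself grows.
set_option maxHeartbeats 2000000 in
theorem BoundedToOrder.christoffelMap [FiniteDimensional ℝ E] (hΩ : IsOpen Ω)
    (hG : ContDiffOn ℝ ∞ G Ω) (hinv : ∀ y ∈ Ω, (G y).IsInvertible)
    (h : ∀ m, BoundedToOrder Ω w m G) (hw : ∀ z ∈ Ω, w z * w₁ z = 1)
    (h0 : BoundedToOrder Ω w₁ 0 fun z => (G z).inverse) (m : ℕ) :
    BoundedToOrder Ω (fun _ => 1) m (christoffelMap G) := by
  have : CompleteSpace E := FiniteDimensional.complete ℝ E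
  have h1 : BoundedToOrder Ω w₁ m fun z => (G z).inverse := (h m).inverse hΩ hG hinv hw h0
  have hG' : ContDiffOn ℝ ∞ (fderiv ℝ G) Ω := hG.fderiv_of_isOpen (m := ∞) hΩ (by simp)
  have h2 : BoundedToOrder Ω w m fun z => koszul (fderiv ℝ G z) := (h (m + 1)).2.clm hΩ hG' koszul
  have h3 : BoundedToOrder Ω (fun z => w₁ z * w z) m (Conifolds.christoffelMap G) :=
    h1.bilinear hΩ h2 (contDiffOn_inverse hΩ hG hinv) (koszul.contDiff.comp_contDiffOn hG') raiseIndex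
  have hww : ∀ z ∈ Ω, w₁ z * w z = 1 := fun z hz => by rw [mul_comm, hw z hz]
  refine h3.mono_weight (K := 1) (fun z hz => ?_) fun z hz => ?_
  · rw [hww z hz]; exact zero_le_one
  · rw [hww z hz, one_mul]

theorem BoundedToOrder.one_right {f : E → F} (h : BoundedToOrder Ω (fun z => w z * 1) m f) :
    BoundedToOrder Ω w m f := by
  simpa using h

/-- Covariant derivatives of a bounded tensor field are bounded. -/
theorem BoundedToOrder.iterCovDerivMap [FiniteDimensional ℝ E] (hΩ : IsOpen Ω)
    (hG : ContDiffOn ℝ ∞ G Ω) (hinv : ∀ y ∈ Ω, (G y).IsInvertible)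
    (hΓ : ∀ m, BoundedToOrder Ω (fun _ => 1) m (Conifolds.christoffelMap G))
    {T : E → E [×k]→L[ℝ] ℝ} (hT : ContDiffOn ℝ ∞ T Ω) (h : ∀ m, BoundedToOrder Ω w m T) (j : ℕ) :
    ∀ m, BoundedToOrder Ω w m (Conifolds.iterCovDerivMap G T j) := by
  induction j with
  | zero => exact h
  | succ j ih =>
    intro m
    have hs := contDiffOn_iterCovDerivMap hΩ hG hinv hT j
    have hs' : ContDiffOn ℝ ∞ (fderiv ℝ (Conifolds.iterCovDerivMap G T j)) Ω :=
      hs.fderiv_of_isOpen (m := ∞) hΩ (by simp)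
    have hΓs := contDiffOn_christoffelMap hΩ hG hinv
    have h1 := ((ih m).bilinear hΩ (hΓ m) hs hΓs (-christoffelAction E (k + j))).one_right
    have hs1 : ContDiffOn ℝ ∞ (fun z => (-christoffelAction E (k + j))
        (Conifolds.iterCovDerivMap G T j z) (Conifolds.christoffelMap G z)) Ω :=
      contDiffOn_bilinear hs hΓs _
    let A : (E →L[ℝ] E [×(k + j)]→L[ℝ] ℝ) →L[ℝ] (E [×(k + (j + 1))]→L[ℝ] ℝ) :=
      ((continuousMultilinearCurryLeftEquiv ℝ (fun _ : Fin (k + j + 1) => E)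
        ℝ).toContinuousLinearEquiv.symm : _ →L[ℝ] _)
    -- A covariant derivative costs one order of partial differentiation, hence the induction
    -- hypothesis for all orders.
    have h2 := ((ih (m + 1)).2.add hΩ h1 hs' hs1).clm hΩ (hs'.add hs1) A
    refine h2.congr hΩ fun z hz => ?_
    simp only [neg_apply, ← sub_eq_add_neg]
    rfl

/-- A tensor field all of whose covariant derivatives are bounded is bounded with all its partial
derivatives. -/
theorem boundedToOrder_of_iterCovDerivMap [FiniteDimensional ℝ E] (hΩ : IsOpen Ω)
    (hG : ContDiffOn ℝ ∞ G Ω) (hinv : ∀ y ∈ Ω, (G y).IsInvertible)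
    (hΓ : ∀ m, BoundedToOrder Ω (fun _ => 1) m (christoffelMap G))
    {T : E → E [×k]→L[ℝ] ℝ} (hT : ContDiffOn ℝ ∞ T Ω)
    (h : ∀ j, BoundedToOrder Ω w 0 (iterCovDerivMap G T j)) (m : ℕ) :
    ∀ j, BoundedToOrder Ω w m (iterCovDerivMap G T j) := by
  induction m with
  | zero => exact h
  | succ m ih =>
    intro j
    refine ⟨h j, ?_⟩
    have hs := contDiffOn_iterCovDerivMap hΩ hG hinv hT j
    have hs' := contDiffOn_iterCovDerivMap hΩ hG hinv hT (j + 1)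
    have hΓs := contDiffOn_christoffelMap hΩ hG hinv
    -- Solving the definition of `∇` for the partial derivative gives `D(∇^j T) = ∇^(j+1) T + Γ *
    -- ∇^j T`; order `m` of both terms on the right yields order `m + 1` of `∇^j T`.
    have h1 := ((ih j).bilinear hΩ (hΓ m) hs hΓs (christoffelAction E (k + j))).one_right
    have hs1 : ContDiffOn ℝ ∞ (fun z => christoffelAction E (k + j)
        (iterCovDerivMap G T j z) (christoffelMap G z)) Ω :=
      contDiffOn_bilinear hs hΓs _
    let A : (E [×(k + (j + 1))]→L[ℝ] ℝ) →L[ℝ] (E →L[ℝ] E [×(k + j)]→L[ℝ] ℝ) :=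
      ((continuousMultilinearCurryLeftEquiv ℝ (fun _ : Fin (k + j + 1) => E)
        ℝ).toContinuousLinearEquiv : _ →L[ℝ] _)
    have h2 := (ih (j + 1)).clm hΩ hs' A
    have hs2 : ContDiffOn ℝ ∞ (fun z => A (iterCovDerivMap G T (j + 1) z)) Ω :=
      A.contDiff.comp_contDiffOn hs'
    refine (h2.add hΩ h1 hs2 hs1).congr hΩ fun z hz => ?_
    have : A (iterCovDerivMap G T (j + 1) z) = fderiv ℝ (iterCovDerivMap G T j) z -
        christoffelAction E (k + j) (iterCovDerivMap G T j z) (christoffelMap G z) :=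
      (continuousMultilinearCurryLeftEquiv ℝ (fun _ : Fin (k + j + 1) => E) ℝ).apply_symm_apply _
    simp only [this, sub_add_cancel]

end Symbols

/-! ### Covariant derivatives and 1-forms on manifolds, in arbitrary local coordinates -/

section Pullback
variable {E : Type*} [NormedAddCommGroup E] [NormedSpace ℝ E]
  {H : Type*} [TopologicalSpace H] {I : ModelWithCorners ℝ E H}
  {M : Type*} [TopologicalSpace M] [ChartedSpace H M]
  {E' : Type*} [NormedAddCommGroup E'] [NormedSpace ℝ E']

theorem _root_.ContinuousLinearMap.IsInvertible.of_comp_left {A : E →L[ℝ] E} {B C : E' →L[ℝ] E}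
    (hA : A.IsInvertible) (hC : C.IsInvertible) (h : C = A.comp B) : B.IsInvertible := by
  have : B = A.inverse.comp C := by
    rw [h, ← ContinuousLinearMap.comp_assoc, hA.inverse_comp_self, ContinuousLinearMap.id_comp]
  rw [this]
  exact hA.inverse.comp hC

/-- Every tangent space is the model space `E`, so an equality of base points suffices to compare
values at equal vectors of `E`. -/
theorem tensorField_congr_point {k : ℕ} (T : TensorField I M k) {p q : M} (h : p = q)
    {v w : Fin k → E} (hvw : v = w) : T p v = T q w := by
  subst h; rw [hvw]

theorem pullBilin_congr_point (g : BilinField I M) {p q : M} (h : p = q) {A B : E' →L[ℝ] E}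
    (hAB : A = B) : pullBilin (W := E') (g p) A = pullBilin (W := E') (g q) B := by
  subst h; rw [hAB]

variable [I.Boundaryless] [IsManifold I ∞ M]

omit [I.Boundaryless] in
theorem mdifferentiableAt_extChartAt_symm [I.Boundaryless] (x₀ : M) {y : E}
    (hy : y ∈ (extChartAt I x₀).target) : MDifferentiableAt 𝓘(ℝ, E) I (extChartAt I x₀).symm y :=
  ((contMDiffOn_extChartAt_symm (n := ∞) x₀).contMDiffAt
    ((isOpen_extChartAt_target x₀).mem_nhds hy)).mdifferentiableAt (by simp)

theorem isInvertible_chartFrame (x₀ : M) {y : E} (hy : y ∈ (extChartAt I x₀).target) :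
    (chartFrame I x₀ y : E →L[ℝ] E).IsInvertible := by
  have : IsManifold I 1 M := .of_le (n := ∞) (by simp)
  have h := isInvertible_mfderivWithin_extChartAt_symm hy
  rw [I.range_eq_univ, mfderivWithin_univ] at h
  exact h

theorem chartFrame_self (x : M) (u : E) : chartFrame I x (extChartAt I x x) u = u := by
  have : IsManifold I 1 M := .of_le (n := ∞) (by simp)
  have h := mfderivWithin_range_extChartAt_symm (I := I) (x := x)
  rw [I.range_eq_univ, mfderivWithin_univ] at h
  exact DFunLike.congr_fun h u

variable {W : Set E'} {ψ : E' → M}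

/-- The expression in the preferred chart at `x` of a map to a manifold. -/
theorem chart_factorization (hW : IsOpen W) (hψ : ContMDiffOn 𝓘(ℝ, E') I ∞ ψ W) (x : M) :
    IsOpen (W ∩ ψ ⁻¹' (extChartAt I x).source) ∧
    ContDiffOn ℝ ∞ (extChartAt I x ∘ ψ) (W ∩ ψ ⁻¹' (extChartAt I x).source) ∧
    MapsTo (extChartAt I x ∘ ψ) (W ∩ ψ ⁻¹' (extChartAt I x).source) (extChartAt I x).target ∧
    ∀ z ∈ W ∩ ψ ⁻¹' (extChartAt I x).source, (extChartAt I x).symm (extChartAt I x (ψ z)) = ψ z ∧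
      (mfderiv 𝓘(ℝ, E') I ψ z : E' →L[ℝ] E) = (chartFrame I x (extChartAt I x (ψ z)) :
        E →L[ℝ] E).comp (fderiv ℝ (extChartAt I x ∘ ψ) z) := by
  have hopen : IsOpen (W ∩ ψ ⁻¹' (extChartAt I x).source) :=
    hψ.continuousOn.isOpen_inter_preimage hW (isOpen_extChartAt_source x)
  have hcd : ContDiffOn ℝ ∞ (extChartAt I x ∘ ψ) (W ∩ ψ ⁻¹' (extChartAt I x).source) := by
    rw [← contMDiffOn_iff_contDiffOn]
    exact (contMDiffOn_extChartAt (x := x)).comp (hψ.mono inter_subset_left) fun z hz => by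
      simpa using hz.2
  refine ⟨hopen, hcd, fun z hz => (extChartAt I x).map_source hz.2, fun z hz =>
    ⟨(extChartAt I x).left_inv hz.2, ?_⟩⟩
  have hev : ψ =ᶠ[𝓝 z] (extChartAt I x).symm ∘ (extChartAt I x ∘ ψ) := by
    filter_upwards [hopen.mem_nhds hz] with w hw using ((extChartAt I x).left_inv hw.2).symm
  have h1 := hev.mfderiv_eq (I := 𝓘(ℝ, E')) (I' := I)
  have h2 := mfderiv_comp z (I := 𝓘(ℝ, E')) (I' := 𝓘(ℝ, E)) (I'' := I)
    (mdifferentiableAt_extChartAt_symm x ((extChartAt I x).map_source hz.2))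
    ((hcd.contDiffAt (hopen.mem_nhds hz)).differentiableAt (by simp)).mdifferentiableAt
  rw [mfderiv_eq_fderiv] at h2
  exact h1.trans h2

theorem pullBilin_factorization (hW : IsOpen W) (hψ : ContMDiffOn 𝓘(ℝ, E') I ∞ ψ W)
    (g : BilinField I M) (x : M) :
    EqOn (fun z => pullBilin (W := E') (g (ψ z)) (mfderiv 𝓘(ℝ, E') I ψ z))
      (fun z => pullBilin (bilinInChart I g x ((extChartAt I x ∘ ψ) z))
        (fderiv ℝ (extChartAt I x ∘ ψ) z)) (W ∩ ψ ⁻¹' (extChartAt I x).source) := fun z hz =>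
  have h := (chart_factorization hW hψ x).2.2.2 z hz
  pullBilin_congr_point (E' := E') g h.1.symm h.2

/-- At the centre of its preferred chart, the coordinate frame and the differential of the chart are
both the identity of `E`. -/
theorem iterNabla_zero (g : BilinField I M) {k : ℕ} (T : TensorField I M k) (x : M)
    (v : Fin k → TangentSpace I x) : iterNabla g T 0 x v = T x v := by
  have : IsManifold I 1 M := .of_le (n := ∞) (by simp)
  refine tensorField_congr_point T ((extChartAt I x).left_inv (mem_extChartAt_source x)) ?_
  funext i
  refine (chartFrame_self (I := I) x _).trans ?_
  rw [mfderiv_extChartAt_self]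
  rfl

omit [I.Boundaryless] [IsManifold I ∞ M] in
theorem iterNabla_congr (g : BilinField I M) {k : ℕ} {T T' : TensorField I M k} {x : M}
    (h : ∀ᶠ y in 𝓝 x, T y = T' y) (j : ℕ) : iterNabla g T j x = iterNabla g T' j x := by
  funext v
  have h1 : tensorInChart T x =ᶠ[𝓝 (extChartAt I x x)] tensorInChart T' x := by
    have hc : ContinuousAt (extChartAt I x).symm (extChartAt I x x) := continuousAt_extChartAt_symm x
    have h' : ∀ᶠ y in 𝓝 ((extChartAt I x).symm (extChartAt I x x)), T y = T' y := by
      rwa [extChartAt_to_inv]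
    filter_upwards [hc.eventually h'] with y hy
    funext w
    exact congrFun hy _
  exact congrFun (iterCovDeriv_congr .rfl h1 j).eq_of_nhds _

/-- Iterated covariant derivatives can be computed in any local coordinates. -/
theorem iterNabla_pullback [FiniteDimensional ℝ E] [FiniteDimensional ℝ E']
    (g : BilinField I M) {k : ℕ} (T : TensorField I M k)
    (hW : IsOpen W) (hψ : ContMDiffOn 𝓘(ℝ, E') I ∞ ψ W)
    (hψinv : ∀ z ∈ W, (mfderiv 𝓘(ℝ, E') I ψ z : E' →L[ℝ] E).IsInvertible) {z : E'} (hz : z ∈ W)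
    {U : Set E} (hU : IsOpen U) (hUx : extChartAt I (ψ z) (ψ z) ∈ U)
    (hUt : U ⊆ (extChartAt I (ψ z)).target)
    (hG : ContDiffOn ℝ ∞ (bilinInChart I g (ψ z)) U)
    (hinv : ∀ y ∈ U, (bilinInChart I g (ψ z) y).IsInvertible)
    (hsymm : ∀ y ∈ U, ∀ u v, bilinInChart I g (ψ z) y u v = bilinInChart I g (ψ z) y v u)
    {T' : E → E [×k]→L[ℝ] ℝ} (hT : ∀ y ∈ U, ∀ v, tensorInChart T (ψ z) y v = T' y v)
    (hT' : ContDiffOn ℝ ∞ T' U) (j : ℕ) (v : Fin (k + j) → E') :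
    iterNabla g T j (ψ z) (fun i => mfderiv 𝓘(ℝ, E') I ψ z (v i)) =
      iterCovDeriv (fun z => pullBilin (W := E') (g (ψ z)) (mfderiv 𝓘(ℝ, E') I ψ z))
        (fun z v => T (ψ z) fun i => mfderiv 𝓘(ℝ, E') I ψ z (v i)) j z v := by
  have : IsManifold I 1 M := .of_le (n := ∞) (by simp)
  obtain ⟨ho, hcd, hmaps, hfac⟩ := chart_factorization hW hψ (ψ z)
  set Φ : E' → E := extChartAt I (ψ z) ∘ ψ with hΦ
  set O := W ∩ ψ ⁻¹' (extChartAt I (ψ z)).source with hO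
  have hzO : z ∈ O := ⟨hz, mem_extChartAt_source _⟩
  -- The comparison is confined to the preimage of `U`: smoothness and nondegeneracy are only
  -- available there, as for the conical metric, which degenerates at `r = 0`.
  have hO' : IsOpen (O ∩ Φ ⁻¹' U) := hcd.continuousOn.isOpen_inter_preimage ho hU
  have hΦinv : ∀ w ∈ O, (fderiv ℝ Φ w).IsInvertible := by
    intro w hw
    exact (isInvertible_chartFrame (I := I) (ψ z) (hmaps hw)).of_comp_left (hψinv w hw.1)
      (hfac w hw).2
  have key := iterCovDeriv_pullback hU hG hinv hsymm hT hT' hO' (hcd.mono inter_subset_left)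
    (fun w hw => hΦinv w hw.1) (fun w hw => hw.2) j z ⟨hzO, hUx⟩ v
  have e1 : (fun z => pullBilin (W := E') (g (ψ z)) (mfderiv 𝓘(ℝ, E') I ψ z)) =ᶠ[𝓝 z]
      fun w => pullBilin (bilinInChart I g (ψ z) (Φ w)) (fderiv ℝ Φ w) :=
    (pullBilin_factorization hW hψ g (ψ z)).eventuallyEq_of_mem (ho.mem_nhds hzO)
  have e2 : (fun z (v : Fin k → E') => T (ψ z) fun i => mfderiv 𝓘(ℝ, E') I ψ z (v i)) =ᶠ[𝓝 z]
      fun w v => tensorInChart T (ψ z) (Φ w) fun i => fderiv ℝ Φ w (v i) := by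
    filter_upwards [ho.mem_nhds hzO] with w hw
    funext v
    refine tensorField_congr_point T (hfac w hw).1.symm (funext fun i => ?_)
    exact DFunLike.congr_fun (hfac w hw).2 (v i)
  refine Eq.trans ?_ (key.symm.trans
    (congrFun (iterCovDeriv_congr e1.symm e2.symm j).eq_of_nhds v))
  have e3 : ∀ u : E', (mfderiv I 𝓘(ℝ, E) (extChartAt I (ψ z)) (ψ z) (mfderiv 𝓘(ℝ, E') I ψ z u) : E) =
      fderiv ℝ Φ z u := by
    intro u
    rw [mfderiv_extChartAt_self]
    have h1 := DFunLike.congr_fun (hfac z hzO).2 u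
    exact h1.trans (chartFrame_self (I := I) (ψ z) _)
  unfold iterNabla
  refine congrArg _ (funext fun i => ?_)
  exact e3 (v i)

end Pullback

section PullbackForms
variable {E : Type*} [NormedAddCommGroup E] [NormedSpace ℝ E]
  {M : Type*} [TopologicalSpace M] [ChartedSpace E M] [IsManifold 𝓘(ℝ, E) ∞ M]
  {E' : Type*} [NormedAddCommGroup E'] [NormedSpace ℝ E'] {W : Set E'} {ψ : E' → M}

theorem localPullback_factorization (hW : IsOpen W) (hψ : ContMDiffOn 𝓘(ℝ, E') 𝓘(ℝ, E) ∞ ψ W)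
    (α : ∀ x : M, TangentSpace 𝓘(ℝ, E) x →L[ℝ] ℝ) (x : M) :
    EqOn (localPullback α ψ)
      (fun z => (formInChart 𝓘(ℝ, E) α x ((extChartAt 𝓘(ℝ, E) x ∘ ψ) z)).comp
        (fderiv ℝ (extChartAt 𝓘(ℝ, E) x ∘ ψ) z)) (W ∩ ψ ⁻¹' (extChartAt 𝓘(ℝ, E) x).source) := by
  intro z hz
  have h := (chart_factorization hW hψ x).2.2.2 z hz
  have key : ∀ (p q : M) (_ : p = q) (A B : E' →L[ℝ] E), A = B →
      ContinuousLinearMap.comp (α p : E →L[ℝ] ℝ) A = ContinuousLinearMap.comp (α q : E →L[ℝ] ℝ) B := by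
    rintro p _ rfl A _ rfl; rfl
  exact key _ _ h.1.symm _ _ h.2

theorem contDiffOn_localPullback (hW : IsOpen W) (hψ : ContMDiffOn 𝓘(ℝ, E') 𝓘(ℝ, E) ∞ ψ W)
    (α : OneForm E M) : ContDiffOn ℝ ∞ (localPullback (fun x => α x) ψ) W := by
  intro z hz
  obtain ⟨ho, hcd, hmaps, -⟩ := chart_factorization hW hψ (ψ z)
  have hzO : z ∈ W ∩ ψ ⁻¹' (extChartAt 𝓘(ℝ, E) (ψ z)).source := ⟨hz, mem_extChartAt_source _⟩
  have h1 := ((contDiffOn_formInChart α (ψ z)).comp hcd hmaps).clm_comp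
    (hcd.fderiv_of_isOpen (m := ∞) ho (by simp))
  refine ((h1.contDiffAt (ho.mem_nhds hzO)).congr_of_eventuallyEq ?_).contDiffWithinAt
  exact (localPullback_factorization hW hψ _ (ψ z)).eventuallyEq_of_mem (ho.mem_nhds hzO)

/-- Pullback commutes with `d`: besides the pulled back derivative of `α` only the term `α(D²Φ(u,
v))` appears, and it is symmetric. -/
theorem fderiv_localPullback_symm (hW : IsOpen W) (hψ : ContMDiffOn 𝓘(ℝ, E') 𝓘(ℝ, E) ∞ ψ W)
    {α : OneForm E M} (hα : α ∈ closedForms E M) {z : E'} (hz : z ∈ W) (u v : E') :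
    fderiv ℝ (localPullback (fun x => α x) ψ) z u v =
      fderiv ℝ (localPullback (fun x => α x) ψ) z v u := by
  obtain ⟨ho, hcd, hmaps, -⟩ := chart_factorization hW hψ (ψ z)
  have hzO : z ∈ W ∩ ψ ⁻¹' (extChartAt 𝓘(ℝ, E) (ψ z)).source := ⟨hz, mem_extChartAt_source _⟩
  set Φ := extChartAt 𝓘(ℝ, E) (ψ z) ∘ ψ with hΦdef
  have hΦ : ContDiffAt ℝ ∞ Φ z := hcd.contDiffAt (ho.mem_nhds hzO)
  have hA : DifferentiableAt ℝ (formInChart 𝓘(ℝ, E) (fun x => α x) (ψ z)) (Φ z) :=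
    ((contDiffOn_formInChart α _).contDiffAt
      ((isOpen_extChartAt_target _).mem_nhds (hmaps hzO))).differentiableAt (by simp)
  have hΦ1 : DifferentiableAt ℝ Φ z := hΦ.differentiableAt (by simp)
  have h2 : (2 : WithTop ℕ∞) ≤ ∞ := by
    change ((2 : ℕ∞) : WithTop ℕ∞) ≤ ((⊤ : ℕ∞) : WithTop ℕ∞)
    exact_mod_cast le_top
  have hΦ2 : DifferentiableAt ℝ (fderiv ℝ Φ) z :=
    (hΦ.fderiv_right (m := 1) (by simpa [one_add_one_eq_two] using h2)).differentiableAt (by simp)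
  have hsymm := (hΦ.isSymmSndFDerivAt (by simpa using h2)).eq u v
  have hd := (hA.hasFDerivAt.comp z hΦ1.hasFDerivAt).clm_comp hΦ2.hasFDerivAt
  have hcl := hα (ψ z) (Φ z) (hmaps hzO) (fderiv ℝ Φ z u) (fderiv ℝ Φ z v)
  have e : fderiv ℝ (localPullback (fun x => α x) ψ) z = _ :=
    ((localPullback_factorization hW hψ _ (ψ z)).eventuallyEq_of_mem
      (ho.mem_nhds hzO)).fderiv_eq.trans hd.fderiv
  rw [e]
  simp [hsymm, hcl]

/-- The Poincaré lemma. -/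
theorem exists_primitive_localPullback (hW : IsOpen W) (hc : Convex ℝ W)
    (hψ : ContMDiffOn 𝓘(ℝ, E') 𝓘(ℝ, E) ∞ ψ W) {α : OneForm E M} (hα : α ∈ closedForms E M) :
    ∃ F : E' → ℝ, ∀ z ∈ W, HasFDerivAt F (localPullback (fun x => α x) ψ z) z :=
  hc.exists_forall_hasFDerivAt_of_fderiv_symmetric hW
    ((contDiffOn_localPullback hW hψ α).differentiableOn (by simp))
    fun _ hz u v => fderiv_localPullback_symm hW hψ hα hz u v

theorem contDiffOn_pullBilin_metric [FiniteDimensional ℝ E] [FiniteDimensional ℝ E'] (hW : IsOpen W)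
    (hψ : ContMDiffOn 𝓘(ℝ, E') 𝓘(ℝ, E) ∞ ψ W)
    (g : ContMDiffRiemannianMetric 𝓘(ℝ, E) ∞ E (fun x : M => TangentSpace 𝓘(ℝ, E) x)) :
    ContDiffOn ℝ ∞ (fun z => pullBilin (W := E') (g.inner (ψ z))
      (mfderiv 𝓘(ℝ, E') 𝓘(ℝ, E) ψ z)) W := by
  intro z hz
  obtain ⟨ho, hcd, hmaps, -⟩ := chart_factorization hW hψ (ψ z)
  have hzO : z ∈ W ∩ ψ ⁻¹' (extChartAt 𝓘(ℝ, E) (ψ z)).source := ⟨hz, mem_extChartAt_source _⟩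
  have h1 := contDiffOn_pullBilin ((contDiffOn_bilinInChart g.contMDiff (ψ z)).comp hcd hmaps)
    (hcd.fderiv_of_isOpen (m := ∞) ho (by simp))
  refine ((h1.contDiffAt (ho.mem_nhds hzO)).congr_of_eventuallyEq ?_).contDiffWithinAt
  exact (pullBilin_factorization hW hψ _ (ψ z)).eventuallyEq_of_mem (ho.mem_nhds hzO)

theorem d_apply (f : SmoothFunction E M) (x : M) :
    d f x = mfderiv 𝓘(ℝ, E) 𝓘(ℝ, ℝ) f x := rfl

/-- The iterated covariant derivatives of a function are those of its differential. -/
theorem iterNabla_d (g : BilinField 𝓘(ℝ, E) M) (f : SmoothFunction E M) (j : ℕ) (x : M)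
    (v : Fin (0 + (j + 1)) → TangentSpace 𝓘(ℝ, E) x) :
    iterNabla g (functionTensor f) (j + 1) x v =
      iterNabla g (formTensor fun x => d f x) j x
        fun i => v (Fin.cast (Nat.add_comm _ _ |>.trans (Nat.zero_add _).symm) i) := by
  have h : tensorInChart (formTensor (I := 𝓘(ℝ, E)) fun x => d f x) x
      =ᶠ[𝓝 (extChartAt 𝓘(ℝ, E) x x)]
      fun y v => fderiv ℝ (f ∘ (extChartAt 𝓘(ℝ, E) x).symm) y (v 0) := by
    filter_upwards [(isOpen_extChartAt_target x).mem_nhds (mem_extChartAt_target x)] with y hy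
    funext v
    rw [← mfderiv_eq_fderiv, mfderiv_comp y (f.contMDiff.mdifferentiable (by simp) _)
      (mdifferentiableAt_chart_symm x hy)]
    rfl
  unfold iterNabla
  rw [(iterCovDeriv_congr .rfl h j).eq_of_nhds]
  exact iterCovDeriv_fderiv (f ∘ (extChartAt 𝓘(ℝ, E) x).symm) j _ _

/-- A primitive of a smooth form is smooth. -/
theorem contMDiffOn_of_hasMFDerivAt {O : Set M} (hO : IsOpen O) {f : M → ℝ} {α : OneForm E M}
    (hf : ∀ x ∈ O, HasMFDerivAt 𝓘(ℝ, E) 𝓘(ℝ, ℝ) f x (α x)) :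
    ContMDiffOn 𝓘(ℝ, E) 𝓘(ℝ, ℝ) ∞ f O := by
  intro x hx
  have hcont : ContinuousOn (extChartAt 𝓘(ℝ, E) x).symm (extChartAt 𝓘(ℝ, E) x).target :=
    continuousOn_extChartAt_symm x
  have hV : IsOpen ((extChartAt 𝓘(ℝ, E) x).target ∩ (extChartAt 𝓘(ℝ, E) x).symm ⁻¹' O) :=
    hcont.isOpen_inter_preimage (isOpen_extChartAt_target x) hO
  have hd : ∀ y ∈ (extChartAt 𝓘(ℝ, E) x).target ∩ (extChartAt 𝓘(ℝ, E) x).symm ⁻¹' O,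
      HasFDerivAt (f ∘ (extChartAt 𝓘(ℝ, E) x).symm)
        (formInChart 𝓘(ℝ, E) (fun x => α x) x y) y := by
    intro y hy
    exact hasMFDerivAt_iff_hasFDerivAt.1
      ((hf _ hy.2).comp y (mdifferentiableAt_chart_symm x hy.1).hasMFDerivAt)
  have hs : ContDiffOn ℝ ∞ (f ∘ (extChartAt 𝓘(ℝ, E) x).symm)
      ((extChartAt 𝓘(ℝ, E) x).target ∩ (extChartAt 𝓘(ℝ, E) x).symm ⁻¹' O) := by
    -- Bootstrapping: the function is merely differentiable, but in coordinates its derivative is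
    -- the coefficient of a smooth form.
    rw [contDiffOn_infty_iff_fderiv_of_isOpen hV]
    refine ⟨fun y hy => (hd y hy).differentiableAt.differentiableWithinAt, ?_⟩
    exact ((contDiffOn_formInChart α x).mono inter_subset_left).congr fun y hy => (hd y hy).fderiv
  have hx' : extChartAt 𝓘(ℝ, E) x x ∈ (extChartAt 𝓘(ℝ, E) x).target ∩
      (extChartAt 𝓘(ℝ, E) x).symm ⁻¹' O :=
    ⟨mem_extChartAt_target x, by simpa using hx⟩
  have h2 : ContMDiffAt 𝓘(ℝ, E) 𝓘(ℝ, ℝ) ∞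
      ((f ∘ (extChartAt 𝓘(ℝ, E) x).symm) ∘ extChartAt 𝓘(ℝ, E) x) x :=
    ContMDiffAt.comp x (contMDiffAt_iff_contDiffAt.2 (hs.contDiffAt (hV.mem_nhds hx')))
      contMDiffAt_extChartAt
  refine (h2.congr_of_eventuallyEq ?_).contMDiffWithinAt
  filter_upwards [extChartAt_source_mem_nhds (I := 𝓘(ℝ, E)) x] with y hy
  exact congrArg f ((extChartAt 𝓘(ℝ, E) x).left_inv hy).symm

end PullbackForms

/-! ### The radial variable: intervals, filters and cutoffs -/

namespace EndKind

theorem openInterval_subset {a : ℝ} : ∀ k : EndKind, k.openInterval a ⊆ k.interval a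
  | cs => Ioo_subset_Ioc_self
  | ac => Ioi_subset_Ici_self

theorem isOpen_openInterval {a : ℝ} : ∀ k : EndKind, IsOpen (k.openInterval a)
  | cs => isOpen_Ioo
  | ac => isOpen_Ioi

theorem convex_openInterval {a : ℝ} : ∀ k : EndKind, Convex ℝ (k.openInterval a)
  | cs => convex_Ioo 0 a
  | ac => convex_Ioi a

theorem pos_of_mem_openInterval {a r : ℝ} (ha : 0 < a) : ∀ k : EndKind, r ∈ k.openInterval a → 0 < r
  | cs => fun h => h.1
  | ac => fun h => ha.trans h

theorem openInterval_mono {a c : ℝ} : ∀ k : EndKind, c ∈ k.openInterval a →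
    k.openInterval c ⊆ k.openInterval a
  | cs => fun h _ hr => ⟨hr.1, hr.2.trans h.2⟩
  | ac => fun h => Ioi_subset_Ioi (le_of_lt h)

theorem hasBasis_radial {a : ℝ} (ha : 0 < a) : ∀ k : EndKind,
    k.radial.HasBasis (fun c => c ∈ k.openInterval a) k.openInterval
  | cs => by
    refine (nhdsGT_basis (0 : ℝ)).to_hasBasis (fun c hc => ⟨min c (a / 2), ?_, ?_⟩)
      fun c hc => ⟨c, hc.1, subset_rfl⟩
    · exact ⟨lt_min hc (half_pos ha), (min_le_right _ _).trans_lt (half_lt_self ha)⟩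
    · exact fun r hr => ⟨hr.1, hr.2.trans_le (min_le_left _ _)⟩
  | ac => by
    refine (atTop_basis_Ioi (α := ℝ)).to_hasBasis (fun c _ => ⟨max c (a + 1), ?_, ?_⟩)
      fun c _ => ⟨c, trivial, subset_rfl⟩
    · exact lt_of_lt_of_le (lt_add_one a) (le_max_right _ _)
    · exact Ioi_subset_Ioi (le_max_left _ _)

instance (k : EndKind) : k.radial.NeBot := by
  cases k
  · exact (inferInstance : (𝓝[>] (0 : ℝ)).NeBot)
  · exact (inferInstance : (atTop : Filter ℝ).NeBot)

theorem openInterval_mem_radial {a : ℝ} (ha : 0 < a) (k : EndKind) :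
    k.openInterval a ∈ k.radial := by
  obtain ⟨c, hc⟩ : (k.openInterval a).Nonempty := by
    cases k
    · exact nonempty_Ioo.2 ha
    · exact nonempty_Ioi
  exact (hasBasis_radial ha k).mem_iff.2 ⟨c, hc, k.openInterval_mono hc⟩

theorem nonempty_openInterval {a : ℝ} (ha : 0 < a) (k : EndKind) : (k.openInterval a).Nonempty :=
  nonempty_of_mem (openInterval_mem_radial ha k)

/-- The weights which force decay along an end of the given kind. -/
def Decays (b : ℝ) : EndKind → Prop
  | cs => 0 < b
  | ac => b < 0

theorem Decays.ne_zero {b : ℝ} : ∀ {k : EndKind}, k.Decays b → b ≠ 0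
  | cs, h => ne_of_gt h
  | ac, h => ne_of_lt h

theorem Decays.tendsto_rpow {b : ℝ} : ∀ {k : EndKind}, k.Decays b →
    Tendsto (fun r : ℝ => r ^ b) k.radial (𝓝 0)
  | cs, h => by
    have h1 : Tendsto (fun r : ℝ => r ^ b) (𝓝 0) (𝓝 (0 ^ b)) :=
      (Real.continuousAt_rpow_const 0 b (Or.inr (le_of_lt h))).tendsto
    rw [Real.zero_rpow (ne_of_gt h)] at h1
    exact h1.mono_left nhdsWithin_le_nhds
  | ac, h => by
    have := tendsto_rpow_neg_atTop (y := -b) (neg_pos.2 h)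
    rw [neg_neg] at this
    exact this

theorem RateSign.decays {ν : ℝ} : ∀ {k : EndKind}, k.RateSign ν → k.Decays ν
  | cs, h => h
  | ac, h => h

/-- A smooth cutoff function of the radial variable. -/
theorem exists_cutoff {a : ℝ} (ha : 0 < a) (k : EndKind) : ∃ (η : ℝ → ℝ) (A : Set ℝ),
    ContDiff ℝ ∞ η ∧ IsClosed A ∧ k.interval a ∩ A ⊆ k.openInterval a ∧ (∀ r ∉ A, η r = 0) ∧
      ∀ᶠ r in k.radial, η r = 1 := by
  cases k
  -- The affine argument is `0` at `a / 2` and `1` at `a / 4`. The cutoff vanishes off the closed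
  -- set `A`, which does not reach the end point `a`; this is what makes extension by zero smooth
  -- later.
  · refine ⟨fun r => Real.smoothTransition (2 - r * (4 / a)), Iic (a / 2), ?_, isClosed_Iic, ?_, ?_, ?_⟩
    · exact Real.smoothTransition.contDiff.comp (by fun_prop)
    · rintro r ⟨h1, h2⟩
      exact ⟨h1.1, lt_of_le_of_lt h2 (half_lt_self ha)⟩
    · intro r hr
      have hr' : a / 2 < r := not_le.1 hr
      refine Real.smoothTransition.zero_of_nonpos ?_
      have : r * (4 / a) = 2 + (r - a / 2) * (4 / a) := by field_simp; ring
      rw [this]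
      have : 0 < (r - a / 2) * (4 / a) := mul_pos (sub_pos.2 hr') (by positivity)
      linarith
    · refine mem_of_superset ((hasBasis_radial ha cs).mem_of_mem (i := a / 4) ?_) fun r hr => ?_
      · exact ⟨by positivity, by linarith⟩
      · refine Real.smoothTransition.one_of_one_le ?_
        have : r * (4 / a) ≤ a / 4 * (4 / a) :=
          mul_le_mul_of_nonneg_right (le_of_lt hr.2) (by positivity)
        have h2 : a / 4 * (4 / a) = 1 := by field_simp
        linarith
  -- Here the transition takes place between `a + 1` and `a + 2`.
  · refine ⟨fun r => Real.smoothTransition (r - (a + 1)), Ici (a + 1), ?_, isClosed_Ici, ?_, ?_, ?_⟩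
    · exact Real.smoothTransition.contDiff.comp (by fun_prop)
    · rintro r ⟨_, h2⟩
      exact lt_of_lt_of_le (lt_add_one a) h2
    · intro r hr
      exact Real.smoothTransition.zero_of_nonpos (sub_nonpos.2 (le_of_lt (not_le.1 hr)))
    · filter_upwards [eventually_ge_atTop (a + 2)] with r hr
      exact Real.smoothTransition.one_of_one_le (by linarith)

end EndKind

/-! ### Topology of the ends -/

namespace Conifold

variable {n : ℕ} {L : Type*} [TopologicalSpace L] [ChartedSpace (Euc (n + 1)) L]
  [IsManifold 𝓘(ℝ, Euc (n + 1)) ∞ L] {ι : Type*} {S : ι → Type*}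
  [∀ i, TopologicalSpace (S i)] [∀ i, ChartedSpace (Euc n) (S i)]
  [∀ i, IsManifold 𝓘(ℝ, Euc n) ∞ (S i)] (C : Conifold n L S) {i : ι}

/-- The `i`-th end. -/
def openEnd (i : ι) : Set L := C.param i '' (univ ×ˢ (C.kind i).openInterval (C.bound i))

theorem mem_source {θ : S i} {r : ℝ} (hr : r ∈ (C.kind i).interval (C.bound i)) :
    (θ, r) ∈ (C.param i).source := by
  rw [C.source_param i]; exact ⟨mem_univ _, hr⟩

theorem mem_source' {θ : S i} {r : ℝ} (hr : r ∈ (C.kind i).openInterval (C.bound i)) :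
    (θ, r) ∈ (C.param i).source := C.mem_source ((C.kind i).openInterval_subset hr)

theorem param_symm_param {θ : S i} {r : ℝ} (hr : r ∈ (C.kind i).interval (C.bound i)) :
    (C.param i).symm (C.param i (θ, r)) = (θ, r) := (C.param i).left_inv (C.mem_source hr)

theorem radius_param {θ : S i} {r : ℝ} (hr : r ∈ (C.kind i).interval (C.bound i)) :
    C.radius i (C.param i (θ, r)) = r := by
  rw [radius, C.param_symm_param hr]

theorem param_mem_openEnd (θ : S i) {r : ℝ} (hr : r ∈ (C.kind i).openInterval (C.bound i)) :
    C.param i (θ, r) ∈ C.openEnd i := ⟨(θ, r), ⟨mem_univ _, hr⟩, rfl⟩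

theorem openEnd_subset_target : C.openEnd i ⊆ (C.param i).target := by
  rw [C.target_param i]; exact subset_closure

theorem isClosed_target : IsClosed (C.param i).target := by
  rw [C.target_param i]; exact isClosed_closure

theorem mem_openEnd_iff {x : L} (hx : x ∈ (C.param i).target) :
    x ∈ C.openEnd i ↔ C.radius i x ∈ (C.kind i).openInterval (C.bound i) := by
  constructor
  · rintro ⟨⟨θ, r⟩, ⟨-, hr⟩, rfl⟩
    rwa [C.radius_param ((C.kind i).openInterval_subset hr)]
  · intro h
    exact ⟨(C.param i).symm x, ⟨mem_univ _, h⟩, (C.param i).right_inv hx⟩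

theorem eventually_endFilter {P : L → Prop} :
    (∀ᶠ x in C.endFilter i, P x) ↔ ∀ᶠ r in (C.kind i).radial, ∀ θ, P (C.param i (θ, r)) := by
  rw [endFilter, eventually_map, eventually_comap]
  refine eventually_congr (.of_forall fun r => ⟨fun h θ => h _ rfl, ?_⟩)
  rintro h ⟨θ, s⟩ rfl
  exact h θ

theorem eventually_endFilter_iff_exists {P : L → Prop} :
    (∀ᶠ x in C.endFilter i, P x) ↔ ∃ c ∈ (C.kind i).openInterval (C.bound i),
      ∀ r ∈ (C.kind i).openInterval c, ∀ θ, P (C.param i (θ, r)) := by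
  rw [C.eventually_endFilter]
  exact ((C.kind i).hasBasis_radial (C.bound_pos i)).eventually_iff

theorem openEnd_mem_endFilter : C.openEnd i ∈ C.endFilter i :=
  C.eventually_endFilter.2 (mem_of_superset
    (EndKind.openInterval_mem_radial (C.bound_pos i) _) fun _ hr θ => C.param_mem_openEnd θ hr)

theorem continuousOn_param_symm : ContinuousOn (C.param i).symm (C.param i).target :=
  (C.contMDiffOn_param_symm i).continuousOn

theorem isOpen_tail {c : ℝ} (hc : c ∈ (C.kind i).openInterval (C.bound i)) :
    IsOpen (C.param i '' (univ ×ˢ (C.kind i).openInterval c)) := by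
  have h1 : C.param i '' (univ ×ˢ (C.kind i).openInterval c) =
      C.openEnd i ∩ (C.param i).symm ⁻¹' (univ ×ˢ (C.kind i).openInterval c) := by
    ext x
    constructor
    · rintro ⟨⟨θ, r⟩, ⟨-, hr⟩, rfl⟩
      have hr' := (C.kind i).openInterval_mono hc hr
      refine ⟨C.param_mem_openEnd θ hr', ?_⟩
      rw [mem_preimage, C.param_symm_param ((C.kind i).openInterval_subset hr')]
      exact ⟨mem_univ _, hr⟩
    · rintro ⟨hx, hx'⟩
      exact ⟨_, hx', (C.param i).right_inv (C.openEnd_subset_target hx)⟩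
  rw [h1]
  exact (C.continuousOn_param_symm.mono C.openEnd_subset_target).isOpen_inter_preimage
    (C.isOpen_end i) (isOpen_univ.prod (C.kind i).isOpen_openInterval)

theorem eventually_endFilter_nhds {P : L → Prop} (h : ∀ᶠ x in C.endFilter i, P x) :
    ∀ᶠ x in C.endFilter i, ∀ᶠ y in 𝓝 x, P y := by
  obtain ⟨c, hc, h⟩ := C.eventually_endFilter_iff_exists.1 h
  refine C.eventually_endFilter_iff_exists.2 ⟨c, hc, fun r hr θ => ?_⟩
  filter_upwards [(C.isOpen_tail hc).mem_nhds ⟨(θ, r), ⟨mem_univ _, hr⟩, rfl⟩]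
  rintro _ ⟨⟨θ', r'⟩, ⟨-, hr'⟩, rfl⟩
  exact h r' hr' θ'

theorem endFilter_neBot [Nonempty (S i)] : (C.endFilter i).NeBot := by
  rw [endFilter]
  have : (comap (Prod.snd : S i × ℝ → ℝ) (C.kind i).radial).NeBot :=
    (inferInstance : (C.kind i).radial.NeBot).comap_of_surj Prod.snd_surjective
  infer_instance

theorem disjoint_openEnd {j : ι} (h : j ≠ i) : Disjoint (C.openEnd j) (C.openEnd i) :=
  C.disjoint_end j i h

/-- A smooth function on an end can be cut off to a smooth function on the conifold. -/
theorem exists_cutoff {f : L → ℝ}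
    (hf : ContMDiffOn 𝓘(ℝ, Euc (n + 1)) 𝓘(ℝ, ℝ) ∞ f (C.openEnd i)) :
    ∃ h : SmoothFunction (Euc (n + 1)) L, (∀ᶠ x in C.endFilter i, h x = f x) ∧
      ∀ x ∉ C.openEnd i, h x = 0 := by
  classical
  obtain ⟨η, A, hη, hA, hAI, hη0, hη1⟩ := (C.kind i).exists_cutoff (C.bound_pos i)
  set h : L → ℝ := fun x => if x ∈ C.openEnd i then η (C.radius i x) * f x else 0 with hdef
  have hopen : IsOpen (C.openEnd i) := C.isOpen_end i
  have hsmooth : ContMDiff 𝓘(ℝ, Euc (n + 1)) 𝓘(ℝ, ℝ) ∞ h := by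
    intro x
    by_cases hx : x ∈ C.openEnd i
    · have h1 : ContMDiffOn 𝓘(ℝ, Euc (n + 1)) 𝓘(ℝ, ℝ) ∞ (C.radius i) (C.openEnd i) :=
        contMDiff_snd.comp_contMDiffOn ((C.contMDiffOn_param_symm i).mono C.openEnd_subset_target)
      have h2 : ContMDiffOn 𝓘(ℝ, Euc (n + 1)) 𝓘(ℝ, ℝ) ∞ (fun x => η (C.radius i x))
          (C.openEnd i) := hη.contMDiff.comp_contMDiffOn h1
      refine ((h2.mul hf).contMDiffAt (hopen.mem_nhds hx)).congr_of_eventuallyEq ?_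
      filter_upwards [hopen.mem_nhds hx] with y hy
      simp [hdef, hy]
    -- The closure of the end is closed in `L`, so the part of it where the cutoff may be nonzero is
    -- closed in `L`, and it lies inside the open end. The extension by zero therefore vanishes near
    -- every point outside the end.
    · have hZ : IsClosed ((C.param i).target ∩ (C.param i).symm ⁻¹' (univ ×ˢ A)) :=
        C.continuousOn_param_symm.preimage_isClosed_of_isClosed C.isClosed_target
          (isClosed_univ.prod hA)
      have hZ' : (C.param i).target ∩ (C.param i).symm ⁻¹' (univ ×ˢ A) ⊆ C.openEnd i := by
        rintro y ⟨hy, hy'⟩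
        refine (C.mem_openEnd_iff hy).2 (hAI ⟨?_, hy'.2⟩)
        have := (C.param i).map_target hy
        rw [C.source_param i] at this
        exact this.2
      refine (contMDiffAt_const (c := (0 : ℝ))).congr_of_eventuallyEq ?_
      filter_upwards [hZ.isOpen_compl.mem_nhds fun h => hx (hZ' h)] with y hy
      by_cases hyE : y ∈ C.openEnd i
      · have : C.radius i y ∉ A := fun hA' =>
          hy ⟨C.openEnd_subset_target hyE, mem_univ _, hA'⟩
        simp [hdef, hyE, hη0 _ this]
      · simp [hdef, hyE]
  refine ⟨⟨h, hsmooth⟩, C.eventually_endFilter.2 ?_, fun x hx => ?_⟩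
  · filter_upwards [hη1, EndKind.openInterval_mem_radial (C.bound_pos i) (C.kind i)] with r hr hr' θ
    change h _ = _
    simp [hdef, C.param_mem_openEnd θ hr', C.radius_param ((C.kind i).openInterval_subset hr'), hr]
  · change h x = 0
    simp [hdef, hx]

theorem eventually_not_mem_openEnd {j : ι} (h : j ≠ i) : ∀ᶠ x in C.endFilter j, x ∉ C.openEnd i :=
  mem_of_superset C.openEnd_mem_endFilter fun _ hx hx' => (C.disjoint_openEnd h).le_bot ⟨hx, hx'⟩

/-- Removing a tail from an end leaves a set inside a compact one, because the link is compact.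
Conversely a compact set meets the closed end in a compact set of radii, which stays away from `0`,
respectively from `∞`. This identifies compact support with vanishing near all ends. -/
theorem cocompact_eq_iSup_endFilter [T2Space L] [Finite ι] [∀ i, CompactSpace (S i)] :
    cocompact L = ⨆ i, C.endFilter i := by
  refine le_antisymm (fun s hs => ?_) (iSup_le fun i s hs => ?_)
  · rw [mem_iSup] at hs
    have h1 : ∀ i, ∃ K : Set L, IsCompact K ∧ ∀ x ∈ C.openEnd i, x ∉ s → x ∈ K := by
      intro i
      obtain ⟨c, hc, h⟩ := C.eventually_endFilter_iff_exists.1 (hs i)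
      obtain ⟨B, hB, hBI, hBc⟩ : ∃ B : Set ℝ, IsCompact B ∧ B ⊆ (C.kind i).interval (C.bound i) ∧
          (C.kind i).openInterval (C.bound i) \ (C.kind i).openInterval c ⊆ B := by
        generalize C.kind i = k at hc
        cases k
        · exact ⟨Icc c (C.bound i), isCompact_Icc, fun r hr => ⟨lt_of_lt_of_le hc.1 hr.1, hr.2⟩,
            fun r hr => ⟨not_lt.1 fun h => hr.2 ⟨hr.1.1, h⟩, le_of_lt hr.1.2⟩⟩
        · exact ⟨Icc (C.bound i) c, isCompact_Icc, fun r hr => hr.1,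
            fun r hr => ⟨le_of_lt hr.1, not_lt.1 hr.2⟩⟩
      refine ⟨C.param i '' (univ ×ˢ B), (isCompact_univ.prod hB).image_of_continuousOn
        ((C.contMDiffOn_param i).continuousOn.mono ?_), ?_⟩
      · rintro ⟨θ, r⟩ hr
        exact C.mem_source (hBI hr.2)
      · rintro _ ⟨⟨θ, r⟩, ⟨-, hr⟩, rfl⟩ hx
        exact ⟨(θ, r), ⟨mem_univ _, hBc ⟨hr, fun h' => hx (h r h' θ)⟩⟩, rfl⟩
    choose K hK hK' using h1
    refine mem_cocompact'.2 ⟨_, C.isCompact_compl_ends.union (isCompact_iUnion hK), fun x hx => ?_⟩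
    by_cases hxe : x ∈ ⋃ i, C.openEnd i
    · obtain ⟨i, hi⟩ := mem_iUnion.1 hxe
      exact Or.inr (mem_iUnion.2 ⟨i, hK' i x hi hx⟩)
    · exact Or.inl hxe
  · obtain ⟨K, hK, hKs⟩ := mem_cocompact.1 hs
    have h1 : IsCompact ((fun x => ((C.param i).symm x).2) '' (K ∩ (C.param i).target)) :=
      (hK.inter_right C.isClosed_target).image_of_continuousOn
        (continuous_snd.comp_continuousOn (C.continuousOn_param_symm.mono inter_subset_right))
    set B := (fun x => ((C.param i).symm x).2) '' (K ∩ (C.param i).target) with hB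
    have hBI : B ⊆ (C.kind i).interval (C.bound i) := by
      rintro _ ⟨x, hx, rfl⟩
      have := (C.param i).map_target hx.2
      rw [C.source_param i] at this
      exact this.2
    have h2 : Bᶜ ∈ (C.kind i).radial := by
      generalize C.kind i = k at hBI
      cases k
      · exact mem_nhdsWithin_of_mem_nhds (h1.isClosed.isOpen_compl.mem_nhds
          fun h0 => lt_irrefl _ (hBI h0).1)
      · obtain ⟨M, hM⟩ := h1.bddAbove
        filter_upwards [eventually_gt_atTop M] with r hr hrB using not_lt.2 (hM hrB) hr
    refine mem_of_superset (C.eventually_endFilter.2 ?_ : ∀ᶠ x in C.endFilter i, x ∉ K) hKs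
    filter_upwards [h2, EndKind.openInterval_mem_radial (C.bound_pos i) (C.kind i)] with r hr hr' θ hK
    refine hr ⟨C.param i (θ, r), ⟨hK, C.openEnd_subset_target (C.param_mem_openEnd θ hr')⟩, ?_⟩
    change ((C.param i).symm _).2 = r
    rw [C.param_symm_param ((C.kind i).openInterval_subset hr')]

theorem isPreconnected_tail [ConnectedSpace (S i)] {c : ℝ}
    (hc : c ∈ (C.kind i).openInterval (C.bound i)) :
    IsPreconnected (C.param i '' (univ ×ˢ (C.kind i).openInterval c)) := by
  refine (isPreconnected_univ.prod (C.kind i).convex_openInterval.isPreconnected).image _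
    ((C.contMDiffOn_param i).continuousOn.mono ?_)
  rintro ⟨θ, r⟩ hr
  exact C.mem_source' ((C.kind i).openInterval_mono hc hr.2)

end Conifold

section Constancy
variable {E : Type*} [NormedAddCommGroup E] [NormedSpace ℝ E]
  {M : Type*} [TopologicalSpace M] [ChartedSpace E M] [IsManifold 𝓘(ℝ, E) ∞ M]

/-- A function whose differential vanishes on a connected open set is constant there. -/
theorem eq_of_hasMFDerivAt_zero {O : Set M} (hO : IsOpen O) (hc : IsPreconnected O) {f : M → ℝ}
    (hf : ∀ x ∈ O, HasMFDerivAt 𝓘(ℝ, E) 𝓘(ℝ, ℝ) f x 0) {x y : M} (hx : x ∈ O) (hy : y ∈ O) :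
    f x = f y := by
  refine hc.induction₂ (fun x y => f x = f y) (fun x hx => ?_) (fun _ _ _ _ _ _ => Eq.trans)
    (fun _ _ _ _ => Eq.symm) hx hy
  refine mem_nhdsWithin_of_mem_nhds ?_
  have hcont : ContinuousOn (extChartAt 𝓘(ℝ, E) x).symm (extChartAt 𝓘(ℝ, E) x).target :=
    continuousOn_extChartAt_symm x
  have hV : IsOpen ((extChartAt 𝓘(ℝ, E) x).target ∩ (extChartAt 𝓘(ℝ, E) x).symm ⁻¹' O) :=
    hcont.isOpen_inter_preimage (isOpen_extChartAt_target x) hO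
  have hx' : extChartAt 𝓘(ℝ, E) x x ∈ (extChartAt 𝓘(ℝ, E) x).target ∩
      (extChartAt 𝓘(ℝ, E) x).symm ⁻¹' O :=
    ⟨mem_extChartAt_target x, by simpa using hx⟩
  obtain ⟨δ, hδ, hball⟩ := Metric.isOpen_iff.1 hV _ hx'
  have hd : ∀ y ∈ Metric.ball (extChartAt 𝓘(ℝ, E) x x) δ,
      HasFDerivAt (f ∘ (extChartAt 𝓘(ℝ, E) x).symm) (0 : E →L[ℝ] ℝ) y := by
    intro y hy
    have := hasMFDerivAt_iff_hasFDerivAt.1 ((hf _ (hball hy).2).comp y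
      (mdifferentiableAt_chart_symm x (hball hy).1).hasMFDerivAt)
    exact this.congr_fderiv (ContinuousLinearMap.zero_comp _)
  have hconst : ∀ y ∈ Metric.ball (extChartAt 𝓘(ℝ, E) x x) δ,
      f ((extChartAt 𝓘(ℝ, E) x).symm y) = f x := by
    intro y hy
    have := (convex_ball _ δ).is_const_of_fderivWithin_eq_zero (𝕜 := ℝ)
      (f := f ∘ (extChartAt 𝓘(ℝ, E) x).symm)
      (fun y hy => (hd y hy).differentiableAt.differentiableWithinAt) (fun y hy => by
        rw [fderivWithin_of_isOpen Metric.isOpen_ball hy, (hd y hy).fderiv]) hy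
        (Metric.mem_ball_self hδ)
    simpa using this
  have hn : ∀ᶠ y in 𝓝 x, extChartAt 𝓘(ℝ, E) x y ∈ Metric.ball (extChartAt 𝓘(ℝ, E) x x) δ :=
    (continuousAt_extChartAt x).eventually (Metric.ball_mem_nhds _ hδ)
  filter_upwards [hn, extChartAt_source_mem_nhds (I := 𝓘(ℝ, E)) x] with y hy hys
  rw [← hconst _ hy, (extChartAt 𝓘(ℝ, E) x).left_inv hys]

end Constancy

/-! ### Coordinates on the cone and on the ends -/

section ConeCoordinates
variable {n : ℕ} {S : Type*} [TopologicalSpace S] [ChartedSpace (Euc n) S]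

/-- Coordinates on the cone `S × ℝ`: a chart of `S` and a function `ρ` of the radial variable. -/
def coneCoord (θ₀ : S) (ρ : ℝ → ℝ) (z : Euc n × ℝ) : S × ℝ :=
  ((extChartAt 𝓘(ℝ, Euc n) θ₀).symm z.1, ρ z.2)

/-- The conical metric in the coordinates `coneCoord θ₀ ρ`. -/
def coneMetricCoord (g' : BilinField 𝓘(ℝ, Euc n) S) (θ₀ : S) (ρ : ℝ → ℝ) (z w w' : Euc n × ℝ) : ℝ :=
  (deriv ρ z.2 * w.2) * (deriv ρ z.2 * w'.2) +
    ρ z.2 ^ 2 * bilinInChart 𝓘(ℝ, Euc n) g' θ₀ z.1 w.1 w'.1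

variable [IsManifold 𝓘(ℝ, Euc n) ∞ S] {θ₀ : S} {ρ : ℝ → ℝ}

/-- Two functions `ρ` are used: the identity, for primitives and pointwise bounds, and the
exponential, which turns the conical metric into `exp(2t)` times a product metric. -/
theorem contMDiffOn_coneCoord (hρ : ContDiff ℝ ∞ ρ) :
    ContMDiffOn 𝓘(ℝ, Euc n × ℝ) (𝓘(ℝ, Euc n).prod 𝓘(ℝ, ℝ)) ∞ (coneCoord θ₀ ρ)
      ((extChartAt 𝓘(ℝ, Euc n) θ₀).target ×ˢ univ) := by
  have h1 : ContMDiff 𝓘(ℝ, Euc n × ℝ) 𝓘(ℝ, Euc n) ∞ (Prod.fst : Euc n × ℝ → Euc n) :=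
    contDiff_fst.contMDiff
  have h2 : ContMDiff 𝓘(ℝ, Euc n × ℝ) 𝓘(ℝ, ℝ) ∞ (fun z : Euc n × ℝ => ρ z.2) :=
    (hρ.comp contDiff_snd).contMDiff
  exact ((contMDiffOn_extChartAt_symm θ₀).comp h1.contMDiffOn fun z hz => hz.1).prodMk
    h2.contMDiffOn

theorem mdifferentiableAt_coneCoord (hρ : ContDiff ℝ ∞ ρ) {z : Euc n × ℝ}
    (hz : z.1 ∈ (extChartAt 𝓘(ℝ, Euc n) θ₀).target) :
    MDifferentiableAt 𝓘(ℝ, Euc n × ℝ) (𝓘(ℝ, Euc n).prod 𝓘(ℝ, ℝ)) (coneCoord θ₀ ρ) z :=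
  ((contMDiffOn_coneCoord hρ).contMDiffAt (((isOpen_extChartAt_target θ₀).prod isOpen_univ).mem_nhds
    ⟨hz, mem_univ _⟩)).mdifferentiableAt (by simp)

theorem mfderiv_fst_coneCoord (hρ : ContDiff ℝ ∞ ρ) {z : Euc n × ℝ}
    (hz : z.1 ∈ (extChartAt 𝓘(ℝ, Euc n) θ₀).target) (w : Euc n × ℝ) :
    mfderiv (𝓘(ℝ, Euc n).prod 𝓘(ℝ, ℝ)) 𝓘(ℝ, Euc n) (Prod.fst : S × ℝ → S) (coneCoord θ₀ ρ z)
      (mfderiv 𝓘(ℝ, Euc n × ℝ) (𝓘(ℝ, Euc n).prod 𝓘(ℝ, ℝ)) (coneCoord θ₀ ρ) z w) =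
      chartFrame 𝓘(ℝ, Euc n) θ₀ z.1 w.1 := by
  have h1 := mfderiv_comp z (I' := 𝓘(ℝ, Euc n).prod 𝓘(ℝ, ℝ)) (I'' := 𝓘(ℝ, Euc n))
    (g := (Prod.fst : S × ℝ → S)) mdifferentiableAt_fst (mdifferentiableAt_coneCoord hρ hz)
  have h2 := mfderiv_comp z (I := 𝓘(ℝ, Euc n × ℝ)) (I' := 𝓘(ℝ, Euc n)) (I'' := 𝓘(ℝ, Euc n))
    (g := (extChartAt 𝓘(ℝ, Euc n) θ₀).symm) (f := (Prod.fst : Euc n × ℝ → Euc n))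
    (mdifferentiableAt_chart_symm θ₀ hz) differentiableAt_fst.mdifferentiableAt
  have h3 := DFunLike.congr_fun (h1.symm.trans h2) w
  refine h3.trans ?_
  rw [mfderiv_eq_fderiv, fderiv_fst]
  rfl

theorem mfderiv_snd_coneCoord (hρ : ContDiff ℝ ∞ ρ) {z : Euc n × ℝ}
    (hz : z.1 ∈ (extChartAt 𝓘(ℝ, Euc n) θ₀).target) (w : Euc n × ℝ) :
    mfderiv (𝓘(ℝ, Euc n).prod 𝓘(ℝ, ℝ)) 𝓘(ℝ, ℝ) (Prod.snd : S × ℝ → ℝ) (coneCoord θ₀ ρ z)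
      (mfderiv 𝓘(ℝ, Euc n × ℝ) (𝓘(ℝ, Euc n).prod 𝓘(ℝ, ℝ)) (coneCoord θ₀ ρ) z w) =
      deriv ρ z.2 * w.2 := by
  have h1 := mfderiv_comp z (I' := 𝓘(ℝ, Euc n).prod 𝓘(ℝ, ℝ)) (I'' := 𝓘(ℝ, ℝ))
    (g := (Prod.snd : S × ℝ → ℝ)) mdifferentiableAt_snd (mdifferentiableAt_coneCoord hρ hz)
  have h2 : HasFDerivAt (fun z : Euc n × ℝ => ρ z.2) _ z :=
    ((hρ.differentiable (by simp) z.2).hasDerivAt.hasFDerivAt).comp z hasFDerivAt_snd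
  have h3 : mfderiv 𝓘(ℝ, Euc n × ℝ) 𝓘(ℝ, ℝ) ((Prod.snd : S × ℝ → ℝ) ∘ coneCoord θ₀ ρ) z = _ :=
    (mfderiv_eq_fderiv).trans h2.fderiv
  refine (DFunLike.congr_fun (h1.symm.trans h3) w).trans ?_
  change w.2 * deriv ρ z.2 = _
  exact mul_comm _ _

theorem coneMetric_coneCoord (hρ : ContDiff ℝ ∞ ρ) (g' : BilinField 𝓘(ℝ, Euc n) S) {z : Euc n × ℝ}
    (hz : z.1 ∈ (extChartAt 𝓘(ℝ, Euc n) θ₀).target) (w w' : Euc n × ℝ) :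
    coneMetric g' (coneCoord θ₀ ρ z)
      (mfderiv 𝓘(ℝ, Euc n × ℝ) (𝓘(ℝ, Euc n).prod 𝓘(ℝ, ℝ)) (coneCoord θ₀ ρ) z w)
      (mfderiv 𝓘(ℝ, Euc n × ℝ) (𝓘(ℝ, Euc n).prod 𝓘(ℝ, ℝ)) (coneCoord θ₀ ρ) z w') =
      coneMetricCoord g' θ₀ ρ z w w' := by
  have h := mfderiv_snd_coneCoord hρ hz w
  have h' := mfderiv_snd_coneCoord hρ hz w'
  have e := mfderiv_fst_coneCoord hρ hz w
  have e' := mfderiv_fst_coneCoord hρ hz w'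
  unfold coneMetricCoord
  rw [← h, ← h']
  refine congrArg₂ (fun a b : ℝ => a + b) rfl (congrArg₂ (fun a b : ℝ => a * b) rfl ?_)
  let B : Euc n →L[ℝ] Euc n →L[ℝ] ℝ := g' ((extChartAt 𝓘(ℝ, Euc n) θ₀).symm z.1)
  exact congrArg₂ (fun a b : Euc n => B a b) e e'

theorem coneMetric_self_nonneg
    (g' : ContMDiffRiemannianMetric 𝓘(ℝ, Euc n) ∞ (Euc n) (fun θ : S => TangentSpace 𝓘(ℝ, Euc n) θ))
    (p : S × ℝ) (v : TangentSpace (𝓘(ℝ, Euc n).prod 𝓘(ℝ, ℝ)) p) :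
    0 ≤ coneMetric g'.inner p v v := by
  have h : ∀ (θ : S) (u : TangentSpace 𝓘(ℝ, Euc n) θ), 0 ≤ g'.inner θ u u := by
    intro θ u
    by_cases hu : u = 0
    · rw [hu, map_zero]
    · exact (g'.pos θ u hu).le
  exact add_nonneg (mul_self_nonneg _) (mul_nonneg (sq_nonneg _) (h _ _))

end ConeCoordinates

/-- `ρ` is a smooth change of the radial variable with inverse `σ`. -/
structure RadialChange (ρ σ : ℝ → ℝ) : Prop where
  contDiff : ContDiff ℝ ∞ ρ
  contDiffOn : ContDiffOn ℝ ∞ σ (Ioi 0)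
  left_inv : ∀ t, 0 < ρ t → σ (ρ t) = t
  right_inv : ∀ r, 0 < r → ρ (σ r) = r

theorem RadialChange.id : RadialChange (fun r => r) (fun r => r) :=
  ⟨contDiff_id, contDiff_id.contDiffOn, fun _ _ => rfl, fun _ _ => rfl⟩

theorem RadialChange.exp : RadialChange Real.exp Real.log :=
  ⟨Real.contDiff_exp, Real.contDiffOn_log.mono fun _ hr => (ne_of_gt hr : _ ≠ (0 : ℝ)),
    fun t _ => Real.log_exp t, fun _ hr => Real.exp_log hr⟩

namespace Conifold

variable {n : ℕ} {L : Type*} [TopologicalSpace L] [ChartedSpace (Euc (n + 1)) L]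
  [IsManifold 𝓘(ℝ, Euc (n + 1)) ∞ L] {ι : Type*} {S : ι → Type*}
  [∀ i, TopologicalSpace (S i)] [∀ i, ChartedSpace (Euc n) (S i)]
  [∀ i, IsManifold 𝓘(ℝ, Euc n) ∞ (S i)] (C : Conifold n L S) {i : ι}

/-- Coordinates on the `i`-th end: a chart of the link and a function `ρ` of the radial
variable. -/
def endCoord (i : ι) (θ₀ : S i) (ρ : ℝ → ℝ) (z : Euc n × ℝ) : L := C.param i (coneCoord θ₀ ρ z)

/-- The domain of the coordinates `endCoord`. -/
def coordDomain (i : ι) (θ₀ : S i) (ρ : ℝ → ℝ) : Set (Euc n × ℝ) :=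
  (extChartAt 𝓘(ℝ, Euc n) θ₀).target ×ˢ (ρ ⁻¹' (C.kind i).openInterval (C.bound i))

variable {θ₀ : S i} {ρ σ : ℝ → ℝ}

theorem isOpen_coordDomain (hρ : Continuous ρ) : IsOpen (C.coordDomain i θ₀ ρ) :=
  (isOpen_extChartAt_target θ₀).prod ((C.kind i).isOpen_openInterval.preimage hρ)

theorem contMDiffAt_param {p : S i × ℝ} (hp : p.2 ∈ (C.kind i).openInterval (C.bound i)) :
    ContMDiffAt (𝓘(ℝ, Euc n).prod 𝓘(ℝ, ℝ)) 𝓘(ℝ, Euc (n + 1)) ∞ (C.param i) p := by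
  refine (C.contMDiffOn_param i).contMDiffAt (mem_of_superset
    ((isOpen_univ.prod (C.kind i).isOpen_openInterval).mem_nhds ⟨mem_univ _, hp⟩) ?_)
  rintro ⟨θ, r⟩ ⟨-, hr⟩
  exact C.mem_source' hr

theorem contMDiffOn_endCoord (hρ : ContDiff ℝ ∞ ρ) :
    ContMDiffOn 𝓘(ℝ, Euc n × ℝ) 𝓘(ℝ, Euc (n + 1)) ∞ (C.endCoord i θ₀ ρ) (C.coordDomain i θ₀ ρ) := by
  refine (C.contMDiffOn_param i).comp ((contMDiffOn_coneCoord hρ).mono ?_) fun z hz => ?_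
  · exact prod_mono subset_rfl (subset_univ _)
  · exact C.mem_source' hz.2

theorem mfderiv_endCoord (hρ : ContDiff ℝ ∞ ρ) {z : Euc n × ℝ} (hz : z ∈ C.coordDomain i θ₀ ρ)
    (w : Euc n × ℝ) :
    mfderiv 𝓘(ℝ, Euc n × ℝ) 𝓘(ℝ, Euc (n + 1)) (C.endCoord i θ₀ ρ) z w =
      mfderiv (𝓘(ℝ, Euc n).prod 𝓘(ℝ, ℝ)) 𝓘(ℝ, Euc (n + 1)) (C.param i) (coneCoord θ₀ ρ z)
        (mfderiv 𝓘(ℝ, Euc n × ℝ) (𝓘(ℝ, Euc n).prod 𝓘(ℝ, ℝ)) (coneCoord θ₀ ρ) z w) :=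
  DFunLike.congr_fun (mfderiv_comp z ((C.contMDiffAt_param (p := coneCoord θ₀ ρ z) hz.2).mdifferentiableAt (by simp))
    (mdifferentiableAt_coneCoord hρ hz.1)) w

/-- The inverse of the coordinates `endCoord`. -/
def endChart (i : ι) (θ₀ : S i) (σ : ℝ → ℝ) (x : L) : Euc n × ℝ :=
  (extChartAt 𝓘(ℝ, Euc n) θ₀ ((C.param i).symm x).1, σ (C.radius i x))

theorem endChart_endCoord (h : RadialChange ρ σ) {z : Euc n × ℝ} (hz : z ∈ C.coordDomain i θ₀ ρ) :
    C.endChart i θ₀ σ (C.endCoord i θ₀ ρ z) = z := by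
  have hp : (C.param i).symm (C.endCoord i θ₀ ρ z) = coneCoord θ₀ ρ z :=
    C.param_symm_param ((C.kind i).openInterval_subset hz.2)
  rw [endChart, radius, hp]
  refine Prod.ext ((extChartAt 𝓘(ℝ, Euc n) θ₀).right_inv hz.1) ?_
  exact h.left_inv _ ((C.kind i).pos_of_mem_openInterval (C.bound_pos i) hz.2)

/-- The domain of the chart `endChart`. -/
def chartDomain (i : ι) (θ₀ : S i) : Set L :=
  C.openEnd i ∩ (C.param i).symm ⁻¹' ((extChartAt 𝓘(ℝ, Euc n) θ₀).source ×ˢ univ)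

theorem isOpen_chartDomain : IsOpen (C.chartDomain i θ₀) :=
  (C.continuousOn_param_symm.mono C.openEnd_subset_target).isOpen_inter_preimage
    (C.isOpen_end i) ((isOpen_extChartAt_source θ₀).prod isOpen_univ)

theorem endCoord_mem_chartDomain {z : Euc n × ℝ} (hz : z ∈ C.coordDomain i θ₀ ρ) :
    C.endCoord i θ₀ ρ z ∈ C.chartDomain i θ₀ := by
  refine ⟨C.param_mem_openEnd _ hz.2, ?_⟩
  have hp : (C.param i).symm (C.endCoord i θ₀ ρ z) = coneCoord θ₀ ρ z :=
    C.param_symm_param ((C.kind i).openInterval_subset hz.2)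
  rw [mem_preimage, hp]
  exact ⟨(extChartAt 𝓘(ℝ, Euc n) θ₀).map_target hz.1, mem_univ _⟩

theorem endCoord_endChart (h : RadialChange ρ σ) {x : L} (hx : x ∈ C.chartDomain i θ₀) :
    C.endCoord i θ₀ ρ (C.endChart i θ₀ σ x) = x := by
  have hr := (C.mem_openEnd_iff (C.openEnd_subset_target hx.1)).1 hx.1
  have : coneCoord θ₀ ρ (C.endChart i θ₀ σ x) = (C.param i).symm x :=
    Prod.ext ((extChartAt 𝓘(ℝ, Euc n) θ₀).left_inv hx.2.1)
      (h.right_inv _ ((C.kind i).pos_of_mem_openInterval (C.bound_pos i) hr))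
  rw [endCoord, this, (C.param i).right_inv (C.openEnd_subset_target hx.1)]

theorem contMDiffOn_endChart (h : RadialChange ρ σ) :
    ContMDiffOn 𝓘(ℝ, Euc (n + 1)) 𝓘(ℝ, Euc n × ℝ) ∞ (C.endChart i θ₀ σ) (C.chartDomain i θ₀) := by
  have h0 : ContMDiffOn 𝓘(ℝ, Euc (n + 1)) (𝓘(ℝ, Euc n).prod 𝓘(ℝ, ℝ)) ∞ (C.param i).symm
      (C.chartDomain i θ₀) :=
    (C.contMDiffOn_param_symm i).mono fun x hx => C.openEnd_subset_target hx.1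
  have h1 : ContMDiffOn 𝓘(ℝ, Euc (n + 1)) 𝓘(ℝ, Euc n) ∞
      (fun x => extChartAt 𝓘(ℝ, Euc n) θ₀ ((C.param i).symm x).1) (C.chartDomain i θ₀) :=
    (contMDiffOn_extChartAt (x := θ₀)).comp (contMDiff_fst.comp_contMDiffOn h0) fun x hx => by
      simpa using hx.2.1
  have h2 : ContMDiffOn 𝓘(ℝ, Euc (n + 1)) 𝓘(ℝ, ℝ) ∞ (fun x => σ (C.radius i x))
      (C.chartDomain i θ₀) :=
    h.contDiffOn.contMDiffOn.comp (contMDiff_snd.comp_contMDiffOn h0) fun x hx =>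
      (C.kind i).pos_of_mem_openInterval (C.bound_pos i)
        ((C.mem_openEnd_iff (C.openEnd_subset_target hx.1)).1 hx.1)
  exact h1.prodMk_space h2

/-- This differentiates `endCoord ∘ endChart = id`. The resulting right inverse makes the
differential of `endCoord` surjective, hence invertible, since the dimensions agree. -/
theorem mfderiv_endCoord_comp_mfderiv_endChart (h : RadialChange ρ σ) {z : Euc n × ℝ}
    (hz : z ∈ C.coordDomain i θ₀ ρ) (v : Euc (n + 1)) :
    mfderiv 𝓘(ℝ, Euc n × ℝ) 𝓘(ℝ, Euc (n + 1)) (C.endCoord i θ₀ ρ) z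
      (mfderiv 𝓘(ℝ, Euc (n + 1)) 𝓘(ℝ, Euc n × ℝ) (C.endChart i θ₀ σ) (C.endCoord i θ₀ ρ z) v) = v := by
  have hx := C.endCoord_mem_chartDomain hz
  have hκ : MDifferentiableAt 𝓘(ℝ, Euc (n + 1)) 𝓘(ℝ, Euc n × ℝ) (C.endChart i θ₀ σ)
      (C.endCoord i θ₀ ρ z) :=
    ((C.contMDiffOn_endChart h).contMDiffAt (C.isOpen_chartDomain.mem_nhds hx)).mdifferentiableAt
      (by simp)
  have hψ : MDifferentiableAt 𝓘(ℝ, Euc n × ℝ) 𝓘(ℝ, Euc (n + 1)) (C.endCoord i θ₀ ρ)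
      (C.endChart i θ₀ σ (C.endCoord i θ₀ ρ z)) := by
    rw [C.endChart_endCoord h hz]
    exact ((C.contMDiffOn_endCoord h.contDiff).contMDiffAt
      ((C.isOpen_coordDomain h.contDiff.continuous).mem_nhds hz)).mdifferentiableAt (by simp)
  have h1 := mfderiv_comp (C.endCoord i θ₀ ρ z) hψ hκ
  have h2 : C.endCoord i θ₀ ρ ∘ C.endChart i θ₀ σ =ᶠ[𝓝 (C.endCoord i θ₀ ρ z)] id := by
    filter_upwards [C.isOpen_chartDomain.mem_nhds hx] with y hy using C.endCoord_endChart h hy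
  have h3 := (h1.symm.trans h2.mfderiv_eq).trans mfderiv_id
  have key : ∀ z', z' = z → ∀ u : Euc n × ℝ,
      (mfderiv 𝓘(ℝ, Euc n × ℝ) 𝓘(ℝ, Euc (n + 1)) (C.endCoord i θ₀ ρ) z' u : Euc (n + 1)) =
      mfderiv 𝓘(ℝ, Euc n × ℝ) 𝓘(ℝ, Euc (n + 1)) (C.endCoord i θ₀ ρ) z u := by
    rintro _ rfl u; rfl
  exact (key _ (C.endChart_endCoord h hz) _).symm.trans (DFunLike.congr_fun h3 v)

theorem isInvertible_mfderiv_endCoord (h : RadialChange ρ σ) {z : Euc n × ℝ}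
    (hz : z ∈ C.coordDomain i θ₀ ρ) :
    (mfderiv 𝓘(ℝ, Euc n × ℝ) 𝓘(ℝ, Euc (n + 1)) (C.endCoord i θ₀ ρ) z :
      Euc n × ℝ →L[ℝ] Euc (n + 1)).IsInvertible := by
  set A : Euc n × ℝ →L[ℝ] Euc (n + 1) :=
    mfderiv 𝓘(ℝ, Euc n × ℝ) 𝓘(ℝ, Euc (n + 1)) (C.endCoord i θ₀ ρ) z with hA
  have hsurj : Function.Surjective (A : Euc n × ℝ →ₗ[ℝ] Euc (n + 1)) := fun v =>
    ⟨_, C.mfderiv_endCoord_comp_mfderiv_endChart h hz v⟩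
  have hfin : Module.finrank ℝ (Euc n × ℝ) = Module.finrank ℝ (Euc (n + 1)) := by
    simp
  have hinj := (LinearMap.injective_iff_surjective_of_finrank_eq_finrank hfin).2 hsurj
  refine ⟨(LinearEquiv.ofBijective _ ⟨hinj, hsurj⟩).toContinuousLinearEquiv, ?_⟩
  ext v
  rfl

/-- The function on the `i`-th end with a given expression in terms of `S i × ℝ`. -/
def onEnd (i : ι) (f : S i → ℝ → ℝ) (x : L) : ℝ :=
  f ((C.param i).symm x).1 ((C.param i).symm x).2

theorem onEnd_param (f : S i → ℝ → ℝ) (θ : S i) {r : ℝ}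
    (hr : r ∈ (C.kind i).openInterval (C.bound i)) : C.onEnd i f (C.param i (θ, r)) = f θ r := by
  rw [onEnd, C.param_symm_param ((C.kind i).openInterval_subset hr)]

theorem onEnd_eventuallyEq {f : S i → ℝ → ℝ} {F : Euc n × ℝ → ℝ} {z : Euc n × ℝ}
    (hz : z ∈ C.coordDomain i θ₀ fun r => r)
    (hf : ∀ᶠ w in 𝓝 z, f ((extChartAt 𝓘(ℝ, Euc n) θ₀).symm w.1) w.2 = F w) :
    C.onEnd i f =ᶠ[𝓝 (C.endCoord i θ₀ (fun r => r) z)] F ∘ C.endChart i θ₀ fun r => r := by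
  have hx := C.endCoord_mem_chartDomain hz
  have hc : ContinuousAt (C.endChart i θ₀ fun r => r) (C.endCoord i θ₀ (fun r => r) z) :=
    ((C.contMDiffOn_endChart RadialChange.id).contMDiffAt
      (C.isOpen_chartDomain.mem_nhds hx)).continuousAt
  have hc' : Tendsto (C.endChart i θ₀ fun r => r) (𝓝 (C.endCoord i θ₀ (fun r => r) z)) (𝓝 z) := by
    have := hc.tendsto
    rwa [C.endChart_endCoord RadialChange.id hz] at this
  filter_upwards [hc'.eventually hf, C.isOpen_chartDomain.mem_nhds hx] with x h1 h2
  change _ = F _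
  rw [← h1, onEnd]
  congr 1
  exact ((extChartAt 𝓘(ℝ, Euc n) θ₀).left_inv h2.2.1).symm

theorem contMDiffAt_onEnd {f : S i → ℝ → ℝ} {F : Euc n × ℝ → ℝ} {z : Euc n × ℝ}
    (hz : z ∈ C.coordDomain i θ₀ fun r => r)
    (hf : ∀ᶠ w in 𝓝 z, f ((extChartAt 𝓘(ℝ, Euc n) θ₀).symm w.1) w.2 = F w)
    (hF : ContDiffAt ℝ ∞ F z) :
    ContMDiffAt 𝓘(ℝ, Euc (n + 1)) 𝓘(ℝ, ℝ) ∞ (C.onEnd i f) (C.endCoord i θ₀ (fun r => r) z) := by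
  have hx := C.endCoord_mem_chartDomain hz
  refine ContMDiffAt.congr_of_eventuallyEq ?_ (C.onEnd_eventuallyEq hz hf)
  refine ContMDiffAt.comp _ (I' := 𝓘(ℝ, Euc n × ℝ)) ?_
    ((C.contMDiffOn_endChart RadialChange.id).contMDiffAt (C.isOpen_chartDomain.mem_nhds hx))
  rw [C.endChart_endCoord RadialChange.id hz]
  exact hF.contMDiffAt

/-- Pulling `α` back by `endCoord` and then by its inverse `endChart` gives `α` again; thus a
primitive found in coordinates is a primitive on the manifold. -/
theorem hasMFDerivAt_onEnd {f : S i → ℝ → ℝ} {F : Euc n × ℝ → ℝ} {z : Euc n × ℝ}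
    (hz : z ∈ C.coordDomain i θ₀ fun r => r)
    (hf : ∀ᶠ w in 𝓝 z, f ((extChartAt 𝓘(ℝ, Euc n) θ₀).symm w.1) w.2 = F w)
    {α : ∀ x : L, TangentSpace 𝓘(ℝ, Euc (n + 1)) x →L[ℝ] ℝ}
    (hF : HasFDerivAt F (localPullback α (C.endCoord i θ₀ fun r => r) z) z) :
    HasMFDerivAt 𝓘(ℝ, Euc (n + 1)) 𝓘(ℝ, ℝ) (C.onEnd i f) (C.endCoord i θ₀ (fun r => r) z)
      (α (C.endCoord i θ₀ (fun r => r) z)) := by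
  have hx := C.endCoord_mem_chartDomain hz
  have hκ := (((C.contMDiffOn_endChart RadialChange.id).contMDiffAt
    (C.isOpen_chartDomain.mem_nhds hx)).mdifferentiableAt (by simp)).hasMFDerivAt
  have hF' : HasMFDerivAt 𝓘(ℝ, Euc n × ℝ) 𝓘(ℝ, ℝ) F
      (C.endChart i θ₀ (fun r => r) (C.endCoord i θ₀ (fun r => r) z))
      (localPullback α (C.endCoord i θ₀ fun r => r) z) := by
    rw [C.endChart_endCoord RadialChange.id hz]
    exact hasMFDerivAt_iff_hasFDerivAt.2 hF
  have h1 := (hF'.comp _ hκ).congr_of_eventuallyEq (C.onEnd_eventuallyEq hz hf)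
  refine h1.congr_mfderiv ?_
  ext v
  exact congrArg (α _) (C.mfderiv_endCoord_comp_mfderiv_endChart RadialChange.id hz v)

/-- Near the end, the metric is comparable to the conical one. -/
theorem eventually_metric_sub_cone_le (C : Conifold n L S) (i : ι) :
    ∀ᶠ r in (C.kind i).radial, ∀ (θ : S i)
      (v : TangentSpace (𝓘(ℝ, Euc n).prod 𝓘(ℝ, ℝ)) ((θ, r) : S i × ℝ)),
    |C.metric.inner (C.param i (θ, r))
        (mfderiv (𝓘(ℝ, Euc n).prod 𝓘(ℝ, ℝ)) 𝓘(ℝ, Euc (n + 1)) (C.param i) (θ, r) v)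
        (mfderiv (𝓘(ℝ, Euc n).prod 𝓘(ℝ, ℝ)) 𝓘(ℝ, Euc (n + 1)) (C.param i) (θ, r) v) -
      coneMetric (C.linkMetric i).inner (θ, r) v v| ≤
      1 / 2 * coneMetric (C.linkMetric i).inner (θ, r) v v := by
  obtain ⟨K, hK⟩ := C.asymptotic i 0
  rw [eventually_comap] at hK
  -- The sign of the rate means that `r ^ ν → 0` along the end, so the relative error of the
  -- order-zero estimate is eventually below `1 / 2`.
  have h0 : Tendsto (fun r : ℝ => K * r ^ C.rate i) (C.kind i).radial (𝓝 0) := by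
    simpa using (EndKind.Decays.tendsto_rpow (C.rateSign i).decays).const_mul K
  filter_upwards [hK, h0.eventually (gt_mem_nhds (show (0 : ℝ) < 1 / 2 by norm_num))]
    with r hr hr2 θ v
  have h1 := hr (θ, r) rfl fun _ => v
  rw [iterNabla_zero] at h1
  have hnn := coneMetric_self_nonneg (C.linkMetric i) (θ, r) v
  have h2 : (∏ _k : Fin (2 + 0), √(coneMetric (C.linkMetric i).inner (θ, r) v v)) =
      coneMetric (C.linkMetric i).inner (θ, r) v v := by
    rw [Finset.prod_const, Finset.card_univ, Fintype.card_fin, Nat.add_zero, Real.sq_sqrt hnn]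
  rw [h2] at h1
  refine le_trans h1 (mul_le_mul_of_nonneg_right ?_ hnn)
  simpa using hr2.le

theorem eventually_metric_sub_coneCoord_le (C : Conifold n L S) (i : ι) :
    ∀ᶠ r in (C.kind i).radial, ∀ (θ₀ : S i) (ρ : ℝ → ℝ), ContDiff ℝ ∞ ρ →
      ∀ z ∈ C.coordDomain i θ₀ ρ, ρ z.2 = r → ∀ w : Euc n × ℝ,
    |C.metric.inner (C.endCoord i θ₀ ρ z)
        (mfderiv 𝓘(ℝ, Euc n × ℝ) 𝓘(ℝ, Euc (n + 1)) (C.endCoord i θ₀ ρ) z w)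
        (mfderiv 𝓘(ℝ, Euc n × ℝ) 𝓘(ℝ, Euc (n + 1)) (C.endCoord i θ₀ ρ) z w) -
      coneMetricCoord (C.linkMetric i).inner θ₀ ρ z w w| ≤
      1 / 2 * coneMetricCoord (C.linkMetric i).inner θ₀ ρ z w w := by
  filter_upwards [C.eventually_metric_sub_cone_le i] with r hr θ₀ ρ hρ z hz hzr w
  subst hzr
  have h := hr (coneCoord θ₀ ρ z).1
    (mfderiv 𝓘(ℝ, Euc n × ℝ) (𝓘(ℝ, Euc n).prod 𝓘(ℝ, ℝ)) (coneCoord θ₀ ρ) z w)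
  rw [← coneMetric_coneCoord hρ _ hz.1, C.mfderiv_endCoord hρ hz]
  exact h

end Conifold

/-! ### Integration of radial bounds in one variable -/

namespace EndKind

/-- A function whose derivative is `O(r ^ (b - 1))` varies like `r ^ b`. -/
theorem abs_sub_le_rpow {k : EndKind} {c b K : ℝ} (hc : 0 < c) (hb : b ≠ 0) {p p' : ℝ → ℝ}
    (hp : ∀ r ∈ k.openInterval c, HasDerivAt p (p' r) r)
    (hp' : ∀ r ∈ k.openInterval c, |p' r| ≤ K * r ^ (b - 1)) {r s : ℝ}
    (hr : r ∈ k.openInterval c) (hs : s ∈ k.openInterval c) :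
    |p r - p s| ≤ K / |b| * |r ^ b - s ^ b| := by
  have hd : ∀ r ∈ k.openInterval c, HasDerivAt (fun r : ℝ => K / b * r ^ b) (K * r ^ (b - 1)) r := by
    intro r hr
    have h := (Real.hasDerivAt_rpow_const (p := b)
      (Or.inl (k.pos_of_mem_openInterval hc hr).ne')).const_mul (K / b)
    rwa [← mul_assoc, div_mul_cancel₀ _ hb] at h
  -- Since `K / b * r ^ b` has derivative `K r ^ (b - 1)`, it dominates `p` on both sides: adding
  -- `p` or `-p` gives a nondecreasing function. This works for either sign of `b`.
  have hm : ∀ σ : ℝ, |σ| = 1 →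
      MonotoneOn (fun r => K / b * r ^ b + σ * p r) (k.openInterval c) := by
    intro σ hσ
    have h1 : ∀ r ∈ k.openInterval c, HasDerivAt (fun r => K / b * r ^ b + σ * p r)
        (K * r ^ (b - 1) + σ * p' r) r := fun r hr => (hd r hr).add ((hp r hr).const_mul σ)
    refine monotoneOn_of_deriv_nonneg k.convex_openInterval
      (fun r hr => (h1 r hr).continuousAt.continuousWithinAt)
      (fun r hr => (h1 r (interior_subset hr)).differentiableAt.differentiableWithinAt)
      fun r hr => ?_
    rw [(h1 r (interior_subset hr)).deriv]
    have h2 := hp' r (interior_subset hr)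
    have h3 : |σ * p' r| ≤ K * r ^ (b - 1) := by rwa [abs_mul, hσ, one_mul]
    linarith [neg_abs_le (σ * p' r)]
  have key : ∀ r ∈ k.openInterval c, ∀ s ∈ k.openInterval c, s ≤ r →
      |p r - p s| ≤ K / |b| * |r ^ b - s ^ b| := by
    intro r hr s hs hsr
    have h1 := hm 1 (by simp) hs hr hsr
    have h2 := hm (-1) (by simp) hs hr hsr
    dsimp only at h1 h2
    have hK : 0 ≤ K := by
      have := (abs_nonneg _).trans (hp' r hr)
      exact nonneg_of_mul_nonneg_left this (Real.rpow_pos_of_pos (k.pos_of_mem_openInterval hc hr) _)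
    have h3 : K / |b| * |r ^ b - s ^ b| = |K / b * (r ^ b - s ^ b)| := by
      rw [abs_mul, abs_div, abs_of_nonneg hK]
    rw [h3]
    refine le_trans ?_ (le_abs_self _)
    rw [abs_le]
    constructor <;> linarith
  rcases le_total s r with h | h
  · exact key r hr s hs h
  · rw [abs_sub_comm, abs_sub_comm (r ^ b)]
    exact key s hs r hr h

/-- A function whose derivative is `O(r ^ (b - 1))` with a decaying weight `b` has a limit. -/
theorem exists_tendsto_of_deriv_le {k : EndKind} {c b K : ℝ} (hc : 0 < c) (hb : k.Decays b)
    {p p' : ℝ → ℝ} (hp : ∀ r ∈ k.openInterval c, HasDerivAt p (p' r) r)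
    (hp' : ∀ r ∈ k.openInterval c, |p' r| ≤ K * r ^ (b - 1)) :
    ∃ P, Tendsto p k.radial (𝓝 P) ∧ ∀ r ∈ k.openInterval c, |p r - P| ≤ K / |b| * r ^ b := by
  have hmem := openInterval_mem_radial hc k
  have ht := hb.tendsto_rpow
  -- Oscillations of `p` are dominated by those of `K / |b| * r ^ b`, which converges.
  have hcauchy : Cauchy (map p k.radial) := by
    rw [Metric.cauchy_iff]
    refine ⟨inferInstance, fun ε hε => ?_⟩
    have h1 := ((ht.const_mul (K / |b|)).cauchy_map)
    rw [Metric.cauchy_iff] at h1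
    obtain ⟨t, ht1, ht2⟩ := h1.2 ε hε
    refine ⟨p '' ((fun r => K / |b| * r ^ b) ⁻¹' t ∩ k.openInterval c),
      image_mem_map (inter_mem ht1 hmem), ?_⟩
    rintro _ ⟨r, ⟨hr, hr'⟩, rfl⟩ _ ⟨s, ⟨hs, hs'⟩, rfl⟩
    have h2 := ht2 _ hr _ hs
    rw [Real.dist_eq] at h2 ⊢
    have h3 := abs_sub_le_rpow hc hb.ne_zero hp hp' hr' hs'
    have hK : 0 ≤ K / |b| := by
      have := (abs_nonneg _).trans (hp' r hr')
      exact div_nonneg (nonneg_of_mul_nonneg_left this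
        (Real.rpow_pos_of_pos (k.pos_of_mem_openInterval hc hr') _)) (abs_nonneg b)
    rw [← mul_sub, abs_mul, abs_of_nonneg hK] at h2
    exact h3.trans_lt h2
  obtain ⟨P, hP⟩ := CompleteSpace.complete hcauchy
  refine ⟨P, hP, fun r hr => ?_⟩
  have h1 : Tendsto (fun s => |p r - p s|) k.radial (𝓝 |p r - P|) :=
    (tendsto_const_nhds.sub hP).abs
  have h2 : Tendsto (fun s => K / |b| * |r ^ b - s ^ b|) k.radial (𝓝 (K / |b| * |r ^ b - 0|)) :=
    ((tendsto_const_nhds.sub ht).abs).const_mul _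
  rw [sub_zero, abs_of_nonneg (Real.rpow_nonneg (k.pos_of_mem_openInterval hc hr).le b)] at h2
  refine le_of_tendsto_of_tendsto h1 h2 ?_
  filter_upwards [hmem] with s hs using abs_sub_le_rpow hc hb.ne_zero hp hp' hr hs

/-- The difference of two antiderivatives is constant, and a common limit makes it zero. The filter
is arbitrary because three normalisations occur: at the singularity or infinity, at the boundary of
the end, and at a fixed radius. -/
theorem eq_of_hasDerivAt_of_tendsto {k : EndKind} {c u : ℝ} {l : Filter ℝ} [l.NeBot]
    (hl : k.openInterval c ∈ l) {p q p' : ℝ → ℝ}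
    (hp : ∀ r ∈ k.openInterval c, HasDerivAt p (p' r) r)
    (hq : ∀ r ∈ k.openInterval c, HasDerivAt q (p' r) r)
    (hpu : Tendsto p l (𝓝 u)) (hqu : Tendsto q l (𝓝 u)) :
    ∀ r ∈ k.openInterval c, p r = q r := by
  intro r hr
  have h1 : ∀ s ∈ k.openInterval c, p s - q s = p r - q r := by
    intro s hs
    refine k.convex_openInterval.is_const_of_fderivWithin_eq_zero (𝕜 := ℝ)
      (f := fun s => p s - q s)
      (fun s hs => ((hp s hs).sub (hq s hs)).differentiableAt.differentiableWithinAt)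
      (fun s hs => ?_) hs hr
    have h2 : HasFDerivAt (fun s => p s - q s) _ s := ((hp s hs).sub (hq s hs)).hasFDerivAt
    rw [fderivWithin_of_isOpen k.isOpen_openInterval hs, h2.fderiv]
    simp
  have h2 : Tendsto (fun s => p s - q s) l (𝓝 (p r - q r)) :=
    tendsto_const_nhds.congr' (mem_of_superset hl fun s hs => (h1 s hs).symm)
  have h3 := tendsto_nhds_unique h2 (hpu.sub hqu)
  linarith

end EndKind

section Metric
variable {n : ℕ} {S : Type*} [TopologicalSpace S] [ChartedSpace (Euc n) S]
  [IsManifold 𝓘(ℝ, Euc n) ∞ S]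

theorem exists_bilinInChart_le
    (g' : ContMDiffRiemannianMetric 𝓘(ℝ, Euc n) ∞ (Euc n) (fun θ : S => TangentSpace 𝓘(ℝ, Euc n) θ))
    (θ₀ : S) {K : Set (Euc n)} (hK : IsCompact K)
    (hKt : K ⊆ (extChartAt 𝓘(ℝ, Euc n) θ₀).target) :
    ∃ M : ℝ, 0 ≤ M ∧ ∀ y ∈ K, ∀ w, bilinInChart 𝓘(ℝ, Euc n) g'.inner θ₀ y w w ≤ M * ‖w‖ ^ 2 := by
  obtain ⟨M, hM⟩ := hK.exists_bound_of_continuousOn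
    ((contDiffOn_bilinInChart g'.contMDiff θ₀).continuousOn.mono hKt)
  refine ⟨max M 0, le_max_right _ _, fun y hy w => ?_⟩
  calc bilinInChart 𝓘(ℝ, Euc n) g'.inner θ₀ y w w
      ≤ ‖bilinInChart 𝓘(ℝ, Euc n) g'.inner θ₀ y w w‖ := le_abs_self _
    _ ≤ ‖bilinInChart 𝓘(ℝ, Euc n) g'.inner θ₀ y‖ * ‖w‖ * ‖w‖ :=
        ContinuousLinearMap.le_opNorm₂ _ w w
    _ = ‖bilinInChart 𝓘(ℝ, Euc n) g'.inner θ₀ y‖ * ‖w‖ ^ 2 := by ring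
    _ ≤ max M 0 * ‖w‖ ^ 2 :=
        mul_le_mul_of_nonneg_right ((hM y hy).trans (le_max_left _ _)) (sq_nonneg _)

end Metric

/-! ### Primitives of closed 1-forms on an end -/

namespace Conifold

variable {n : ℕ} {L : Type*} [TopologicalSpace L] [ChartedSpace (Euc (n + 1)) L]
  [IsManifold 𝓘(ℝ, Euc (n + 1)) ∞ L] {ι : Type*} {S : ι → Type*}
  [∀ i, TopologicalSpace (S i)] [∀ i, ChartedSpace (Euc n) (S i)]
  [∀ i, IsManifold 𝓘(ℝ, Euc n) ∞ (S i)] (C : Conifold n L S) {i : ι}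
  {θ₀ : S i} {α : OneForm (Euc (n + 1)) L}

/-- The radial component of a 1-form. -/
def radialPart (α : OneForm (Euc (n + 1)) L) (θ : S i) (r : ℝ) : ℝ :=
  localPullback (fun x => α x) (fun s : ℝ => C.param i (θ, s)) r 1

theorem radialPart_eq {z : Euc n × ℝ} (hz : z ∈ C.coordDomain i θ₀ fun r => r) :
    C.radialPart α ((extChartAt 𝓘(ℝ, Euc n) θ₀).symm z.1) z.2 =
      localPullback (fun x => α x) (C.endCoord i θ₀ fun r => r) z (0, 1) := by
  have hψ : MDifferentiableAt 𝓘(ℝ, Euc n × ℝ) 𝓘(ℝ, Euc (n + 1)) (C.endCoord i θ₀ fun r => r)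
      (z.1, z.2) :=
    ((C.contMDiffOn_endCoord contDiff_id).contMDiffAt
      ((C.isOpen_coordDomain continuous_id).mem_nhds hz)).mdifferentiableAt (by simp)
  have hc : HasFDerivAt (fun s : ℝ => (z.1, s)) (ContinuousLinearMap.inr ℝ (Euc n) ℝ) z.2 :=
    hasFDerivAt_prodMk_right z.1 z.2
  have h := mfderiv_comp (I := 𝓘(ℝ, ℝ)) z.2 (g := C.endCoord i θ₀ fun r => r)
    (f := fun s : ℝ => (z.1, s)) hψ hc.differentiableAt.mdifferentiableAt
  have h1 := DFunLike.congr_fun h (1 : ℝ)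
  refine congrArg (α _) (h1.trans ?_)
  change mfderiv 𝓘(ℝ, Euc n × ℝ) 𝓘(ℝ, Euc (n + 1)) (C.endCoord i θ₀ fun r => r) z
    (mfderiv 𝓘(ℝ, ℝ) 𝓘(ℝ, Euc n × ℝ) (fun s : ℝ => (z.1, s)) z.2 1) = _
  rw [mfderiv_eq_fderiv, hc.fderiv]
  rfl

/-- The estimate `|α| = O(r ^ (b - 1))` along the `i`-th end. -/
def FormBound (i : ι) (b : ℝ) (α : OneForm (Euc (n + 1)) L) : Prop :=
  ∃ K : ℝ, ∀ᶠ x in C.endFilter i, ∀ v : TangentSpace 𝓘(ℝ, Euc (n + 1)) x,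
    |α x v| ≤ K * C.radius i x ^ (b - 1) * √(C.metric.inner x v v)

variable {C}

/-- Close to the end `g ≤ 3/2` times the conical metric, whence the factor `√(3/2)`. The constant
and the radius `c` do not depend on the chart of the link. -/
theorem FormBound.localPullback_le {b : ℝ} (h : C.FormBound i b α) :
    ∃ K : ℝ, 0 ≤ K ∧ ∃ c ∈ (C.kind i).openInterval (C.bound i), ∀ (θ₀ : S i) (z : Euc n × ℝ),
      z.1 ∈ (extChartAt 𝓘(ℝ, Euc n) θ₀).target → z.2 ∈ (C.kind i).openInterval c → ∀ w,
      |localPullback (fun x => α x) (C.endCoord i θ₀ fun r => r) z w| ≤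
        K * z.2 ^ (b - 1) * √(coneMetricCoord (C.linkMetric i).inner θ₀ (fun r => r) z w w) := by
  obtain ⟨K, hK⟩ := h
  obtain ⟨c₁, hc₁, h1⟩ := C.eventually_endFilter_iff_exists.1 hK
  obtain ⟨c₂, hc₂, h2⟩ := ((C.kind i).hasBasis_radial (C.bound_pos i)).eventually_iff.1
    (C.eventually_metric_sub_coneCoord_le i)
  obtain ⟨c, hc, hcs⟩ := ((C.kind i).hasBasis_radial (C.bound_pos i)).mem_iff.1
    (inter_mem (((C.kind i).hasBasis_radial (C.bound_pos i)).mem_of_mem hc₁)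
      (((C.kind i).hasBasis_radial (C.bound_pos i)).mem_of_mem hc₂))
  refine ⟨|K| * √(3 / 2), by positivity, c, hc, fun θ₀ z hz1 hz2 w => ?_⟩
  have hzI := (C.kind i).openInterval_mono hc hz2
  have hz : z ∈ C.coordDomain i θ₀ fun r => r := ⟨hz1, hzI⟩
  have hpos := (C.kind i).pos_of_mem_openInterval (C.bound_pos i) hzI
  have e1 := h1 z.2 (hcs hz2).1 ((extChartAt 𝓘(ℝ, Euc n) θ₀).symm z.1)
    (mfderiv 𝓘(ℝ, Euc n × ℝ) 𝓘(ℝ, Euc (n + 1)) (C.endCoord i θ₀ fun r => r) z w)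
  rw [C.radius_param ((C.kind i).openInterval_subset hzI)] at e1
  have e2 := h2 (hcs hz2).2 θ₀ (fun r => r) contDiff_id z hz rfl w
  refine le_trans e1 ?_
  have hr : 0 ≤ z.2 ^ (b - 1) := Real.rpow_nonneg hpos.le _
  calc K * z.2 ^ (b - 1) * _ ≤ |K| * z.2 ^ (b - 1) *
        √(3 / 2 * coneMetricCoord (C.linkMetric i).inner θ₀ (fun r => r) z w w) := by
        refine mul_le_mul (mul_le_mul_of_nonneg_right (le_abs_self K) hr) (Real.sqrt_le_sqrt ?_)
          (Real.sqrt_nonneg _) (by positivity)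
        have := (abs_le.1 e2).2
        refine le_trans (sub_le_iff_le_add.1 this) ?_
        linarith
    _ = _ := by rw [Real.sqrt_mul (by norm_num)]; ring

/-- The radial coordinate vector has length one for the conical metric. -/
theorem FormBound.radialPart_le {b : ℝ} (h : C.FormBound i b α) :
    ∃ K : ℝ, ∃ c ∈ (C.kind i).openInterval (C.bound i), ∀ (θ : S i),
      ∀ r ∈ (C.kind i).openInterval c, |C.radialPart α θ r| ≤ K * r ^ (b - 1) := by
  obtain ⟨K, -, c, hc, h⟩ := h.localPullback_le
  refine ⟨K, c, hc, fun θ r hr => ?_⟩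
  have ht := mem_extChartAt_target (I := 𝓘(ℝ, Euc n)) θ
  have e := C.radialPart_eq (α := α) (θ₀ := θ) (z := (extChartAt 𝓘(ℝ, Euc n) θ θ, r))
    ⟨ht, (C.kind i).openInterval_mono hc hr⟩
  rw [extChartAt_to_inv] at e
  rw [e]
  refine (h θ (extChartAt 𝓘(ℝ, Euc n) θ θ, r) ht hr (0, 1)).trans (le_of_eq ?_)
  simp [coneMetricCoord]

variable (C)

/-- A function `F` on `S i × ℝ` is a primitive of the 1-form `α` over `O`. -/
def IsPrimitiveOver (i : ι) (α : OneForm (Euc (n + 1)) L) (F : S i → ℝ → ℝ) (O : Set (S i)) : Prop :=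
  ∀ θ ∈ O, ∀ r ∈ (C.kind i).openInterval (C.bound i),
    HasMFDerivAt 𝓘(ℝ, Euc (n + 1)) 𝓘(ℝ, ℝ) (C.onEnd i F) (C.param i (θ, r)) (α (C.param i (θ, r)))

variable {C}

theorem IsPrimitiveOver.hasFDerivAt_coord {ρ : ℝ → ℝ} (hρ : ContDiff ℝ ∞ ρ) {F : S i → ℝ → ℝ}
    {O : Set (S i)} (h : C.IsPrimitiveOver i α F O) {z : Euc n × ℝ} (hz : z ∈ C.coordDomain i θ₀ ρ)
    (hO : (extChartAt 𝓘(ℝ, Euc n) θ₀).symm z.1 ∈ O) :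
    HasFDerivAt (fun w : Euc n × ℝ => F ((extChartAt 𝓘(ℝ, Euc n) θ₀).symm w.1) (ρ w.2))
      (localPullback (fun x => α x) (C.endCoord i θ₀ ρ) z) z := by
  have hψ : MDifferentiableAt 𝓘(ℝ, Euc n × ℝ) 𝓘(ℝ, Euc (n + 1)) (C.endCoord i θ₀ ρ) z :=
    ((C.contMDiffOn_endCoord hρ).contMDiffAt
      ((C.isOpen_coordDomain hρ.continuous).mem_nhds hz)).mdifferentiableAt (by simp)
  have h1 := hasMFDerivAt_iff_hasFDerivAt.1 ((h _ hO (ρ z.2) hz.2).comp z hψ.hasMFDerivAt)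
  refine HasFDerivAt.congr_of_eventuallyEq h1 ?_
  filter_upwards [(C.isOpen_coordDomain hρ.continuous).mem_nhds hz] with w hw
  exact (C.onEnd_param F _ hw.2).symm

theorem IsPrimitiveOver.hasFDerivAt {F : S i → ℝ → ℝ} {O : Set (S i)}
    (h : C.IsPrimitiveOver i α F O) {z : Euc n × ℝ} (hz : z ∈ C.coordDomain i θ₀ fun r => r)
    (hO : (extChartAt 𝓘(ℝ, Euc n) θ₀).symm z.1 ∈ O) :
    HasFDerivAt (fun w : Euc n × ℝ => F ((extChartAt 𝓘(ℝ, Euc n) θ₀).symm w.1) w.2)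
      (localPullback (fun x => α x) (C.endCoord i θ₀ fun r => r) z) z :=
  h.hasFDerivAt_coord contDiff_fun_id hz hO

theorem IsPrimitiveOver.hasDerivAt {F : S i → ℝ → ℝ} {O : Set (S i)}
    (h : C.IsPrimitiveOver i α F O) {θ : S i} (hθ : θ ∈ O) {r : ℝ}
    (hr : r ∈ (C.kind i).openInterval (C.bound i)) :
    HasDerivAt (F θ) (C.radialPart α θ r) r := by
  have hz : ((extChartAt 𝓘(ℝ, Euc n) θ θ, r) : Euc n × ℝ) ∈ C.coordDomain i θ fun r => r :=
    ⟨mem_extChartAt_target θ, hr⟩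
  have hs : (extChartAt 𝓘(ℝ, Euc n) θ).symm (extChartAt 𝓘(ℝ, Euc n) θ θ) = θ := extChartAt_to_inv θ
  have h1 := h.hasFDerivAt hz (by rwa [hs])
  have hc : HasDerivAt (fun s : ℝ => (extChartAt 𝓘(ℝ, Euc n) θ θ, s)) ((0 : Euc n), (1 : ℝ)) r :=
    (hasDerivAt_const r _).prodMk (hasDerivAt_id r)
  have h2 := h1.comp_hasDerivAt r hc
  rw [← C.radialPart_eq hz] at h2
  simp only [Function.comp_def, hs] at h2
  exact h2

theorem IsPrimitiveOver.congr {F F' : S i → ℝ → ℝ} {O : Set (S i)} (hO : IsOpen O)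
    (h : C.IsPrimitiveOver i α F O)
    (hF : ∀ θ ∈ O, ∀ r ∈ (C.kind i).openInterval (C.bound i), F' θ r = F θ r) :
    C.IsPrimitiveOver i α F' O := by
  intro θ hθ r hr
  refine (h θ hθ r hr).congr_of_eventuallyEq ?_
  have hopen : IsOpen (C.openEnd i ∩ (C.param i).symm ⁻¹' (O ×ˢ univ)) :=
    (C.continuousOn_param_symm.mono C.openEnd_subset_target).isOpen_inter_preimage
      (C.isOpen_end i) (hO.prod isOpen_univ)
  have hp := C.param_symm_param (θ := θ) ((C.kind i).openInterval_subset hr)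
  filter_upwards [hopen.mem_nhds ⟨C.param_mem_openEnd θ hr, by
    rw [mem_preimage, hp]; exact ⟨hθ, mem_univ _⟩⟩]
  rintro _ ⟨⟨⟨θ', r'⟩, ⟨-, hr'⟩, rfl⟩, h2⟩
  rw [mem_preimage, C.param_symm_param ((C.kind i).openInterval_subset hr')] at h2
  rw [C.onEnd_param _ _ hr', C.onEnd_param _ _ hr']
  exact hF θ' h2.1 r' hr'

theorem IsPrimitiveOver.mono {F : S i → ℝ → ℝ} {O O' : Set (S i)} (h : C.IsPrimitiveOver i α F O)
    (hO : O' ⊆ O) : C.IsPrimitiveOver i α F O' := fun θ hθ => h θ (hO hθ)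

theorem IsPrimitiveOver.sub_const {F : S i → ℝ → ℝ} {O : Set (S i)} (h : C.IsPrimitiveOver i α F O)
    (c : ℝ) : C.IsPrimitiveOver i α (fun θ r => F θ r - c) O := fun θ hθ r hr => by
  have := (h θ hθ r hr).sub (hasMFDerivAt_const c (C.param i (θ, r)))
  refine this.congr_mfderiv ?_
  exact sub_zero _

theorem IsPrimitiveOver.hasMFDerivAt {F : S i → ℝ → ℝ} (h : C.IsPrimitiveOver i α F univ) :
    ∀ x ∈ C.openEnd i, HasMFDerivAt 𝓘(ℝ, Euc (n + 1)) 𝓘(ℝ, ℝ) (C.onEnd i F) x (α x) := by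
  rintro _ ⟨⟨θ, r⟩, ⟨-, hr⟩, rfl⟩
  exact h θ (mem_univ _) r hr

variable (C)

/-- The Poincaré lemma on the convex set ball × interval. The closed ball is kept inside the chart
so that the link metric is uniformly bounded over it. -/
theorem exists_local_primitive (hα : α ∈ closedForms (Euc (n + 1)) L) (θ₀ : S i) :
    ∃ δ > 0, Metric.closedBall (extChartAt 𝓘(ℝ, Euc n) θ₀ θ₀) δ ⊆
        (extChartAt 𝓘(ℝ, Euc n) θ₀).target ∧
      ∃ F : S i → ℝ → ℝ, C.IsPrimitiveOver i α F ((extChartAt 𝓘(ℝ, Euc n) θ₀).source ∩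
        extChartAt 𝓘(ℝ, Euc n) θ₀ ⁻¹' Metric.ball (extChartAt 𝓘(ℝ, Euc n) θ₀ θ₀) δ) := by
  obtain ⟨δ, hδ, hball⟩ := Metric.nhds_basis_closedBall.mem_iff.1
    ((isOpen_extChartAt_target (I := 𝓘(ℝ, Euc n)) θ₀).mem_nhds (mem_extChartAt_target θ₀))
  set W := Metric.ball (extChartAt 𝓘(ℝ, Euc n) θ₀ θ₀) δ ×ˢ (C.kind i).openInterval (C.bound i)
  have hW : IsOpen W := Metric.isOpen_ball.prod (C.kind i).isOpen_openInterval
  have hWc : W ⊆ C.coordDomain i θ₀ fun r => r :=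
    prod_mono (Metric.ball_subset_closedBall.trans hball) subset_rfl
  obtain ⟨F, hF⟩ := exists_primitive_localPullback hW
    ((convex_ball _ _).prod (C.kind i).convex_openInterval)
    ((C.contMDiffOn_endCoord contDiff_id).mono hWc) hα
  refine ⟨δ, hδ, hball, fun θ r => F (extChartAt 𝓘(ℝ, Euc n) θ₀ θ, r), fun θ hθ r hr => ?_⟩
  have hz : ((extChartAt 𝓘(ℝ, Euc n) θ₀ θ, r) : Euc n × ℝ) ∈ W := ⟨hθ.2, hr⟩
  have := C.hasMFDerivAt_onEnd (hWc hz) (f := fun θ r => F (extChartAt 𝓘(ℝ, Euc n) θ₀ θ, r))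
    (F := F) (by
      filter_upwards [hW.mem_nhds hz] with w hw
      rw [(extChartAt 𝓘(ℝ, Euc n) θ₀).right_inv (hWc hw).1]) (hF _ hz)
  have he : C.endCoord i θ₀ (fun r => r) (extChartAt 𝓘(ℝ, Euc n) θ₀ θ, r) = C.param i (θ, r) := by
    rw [endCoord, coneCoord, (extChartAt 𝓘(ℝ, Euc n) θ₀).left_inv hθ.1]
  rwa [he] at this

/-- Local primitives with a prescribed limit glue. -/
theorem exists_primitive_of_tendsto {l : Filter ℝ} [l.NeBot]
    (hl : (C.kind i).openInterval (C.bound i) ∈ l) {u : S i → ℝ}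
    (h : ∀ θ₀ : S i, ∃ O ∈ 𝓝 θ₀, ∃ F : S i → ℝ → ℝ, C.IsPrimitiveOver i α F O ∧
      ∀ θ ∈ O, Tendsto (F θ) l (𝓝 (u θ))) :
    ∃ F : S i → ℝ → ℝ, C.IsPrimitiveOver i α F univ ∧ ∀ θ, Tendsto (F θ) l (𝓝 (u θ)) := by
  choose O hO F hF hFu using h
  -- Over each point the primitive chosen at that point is used. Two local primitives have the same
  -- radial derivative and the same limit along each ray, so near `θ₀` this is the primitive chosen
  -- at `θ₀`.
  refine ⟨fun θ => F θ θ, fun θ₀ _ r hr => ?_, fun θ => hFu θ θ (mem_of_mem_nhds (hO θ))⟩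
  obtain ⟨O', hO'O, hO', hθ₀⟩ := mem_nhds_iff.1 (hO θ₀)
  refine ((hF θ₀).mono hO'O).congr hO' (fun θ hθ s hs => ?_) θ₀ hθ₀ r hr
  refine EndKind.eq_of_hasDerivAt_of_tendsto hl
    (fun r hr => (hF θ).hasDerivAt (mem_of_mem_nhds (hO θ)) hr)
    (fun r hr => (hF θ₀).hasDerivAt (hO'O hθ) hr) (hFu θ θ (mem_of_mem_nhds (hO θ)))
    (hFu θ₀ θ (hO'O hθ)) s hs

end Conifold

theorem EndKind.neBot_nhdsWithin {a : ℝ} (ha : 0 < a) (k : EndKind) :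
    (𝓝[k.openInterval a] a).NeBot := by
  rw [← mem_closure_iff_nhdsWithin_neBot]
  cases k
  · change a ∈ closure (Ioo 0 a)
    rw [closure_Ioo ha.ne]
    exact right_mem_Icc.2 ha.le
  · change a ∈ closure (Ioi a)
    rw [closure_Ioi]
    exact self_mem_Ici

section LocalPrimitive
variable {E : Type*} [NormedAddCommGroup E] [NormedSpace ℝ E] [CompleteSpace E]
  {M : Type*} [TopologicalSpace M] [ChartedSpace E M] [IsManifold 𝓘(ℝ, E) ∞ M]

/-- Closed 1-forms are locally exact. -/
theorem exists_primitive_nhds {α : OneForm E M} (hα : α ∈ closedForms E M) (p : M) :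
    ∃ G : M → ℝ, ∀ᶠ x in 𝓝 p, HasMFDerivAt 𝓘(ℝ, E) 𝓘(ℝ, ℝ) G x (α x) := by
  have : IsManifold 𝓘(ℝ, E) 1 M := .of_le (n := ∞) (by simp)
  obtain ⟨δ, hδ, hball⟩ := Metric.isOpen_iff.1 (isOpen_extChartAt_target (I := 𝓘(ℝ, E)) p) _
    (mem_extChartAt_target p)
  obtain ⟨F, hF⟩ := exists_primitive_localPullback Metric.isOpen_ball (convex_ball _ δ)
    ((contMDiffOn_extChartAt_symm p).mono hball) hα
  refine ⟨F ∘ extChartAt 𝓘(ℝ, E) p, ?_⟩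
  filter_upwards [(continuousAt_extChartAt (I := 𝓘(ℝ, E)) p).eventually (Metric.ball_mem_nhds _ hδ),
    extChartAt_source_mem_nhds (I := 𝓘(ℝ, E)) p] with x hx hxs
  have h1 : MDifferentiableAt 𝓘(ℝ, E) 𝓘(ℝ, E) (extChartAt 𝓘(ℝ, E) p) x :=
    mdifferentiableAt_extChartAt (by simpa using hxs)
  have h2 := (hasMFDerivAt_iff_hasFDerivAt.2 (hF _ hx)).comp x h1.hasMFDerivAt
  refine h2.congr_mfderiv ?_
  have hs : MDifferentiableAt 𝓘(ℝ, E) 𝓘(ℝ, E) (extChartAt 𝓘(ℝ, E) p).symm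
      (extChartAt 𝓘(ℝ, E) p x) := mdifferentiableAt_chart_symm p (hball hx)
  have h3 := mfderiv_comp x hs h1
  have h4 : (extChartAt 𝓘(ℝ, E) p).symm ∘ extChartAt 𝓘(ℝ, E) p =ᶠ[𝓝 x] id := by
    filter_upwards [(isOpen_extChartAt_source (I := 𝓘(ℝ, E)) p).mem_nhds hxs] with y hy
    exact (extChartAt 𝓘(ℝ, E) p).left_inv hy
  have h5 := (h3.symm.trans h4.mfderiv_eq).trans mfderiv_id
  have key : ∀ q, q = x → ∀ A : E →L[ℝ] E, A = ContinuousLinearMap.id ℝ E →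
      ContinuousLinearMap.comp (α q : E →L[ℝ] ℝ) A = α x := by
    rintro _ rfl _ rfl
    exact ContinuousLinearMap.comp_id _
  exact key _ ((extChartAt 𝓘(ℝ, E) p).left_inv hxs) _ h5

end LocalPrimitive

namespace Conifold

variable {n : ℕ} {L : Type*} [TopologicalSpace L] [ChartedSpace (Euc (n + 1)) L]
  [IsManifold 𝓘(ℝ, Euc (n + 1)) ∞ L] {ι : Type*} {S : ι → Type*}
  [∀ i, TopologicalSpace (S i)] [∀ i, ChartedSpace (Euc n) (S i)]
  [∀ i, IsManifold 𝓘(ℝ, Euc n) ∞ (S i)] {C : Conifold n L S} {i : ι}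
  {θ₀ : S i} {α : OneForm (Euc (n + 1)) L}

/-- The radial bound is integrable, so there is a limit along each ray. Limits along different rays
coincide because the derivative of the primitive in the directions of the link is `O(r ^ b)`, which
tends to zero. -/
theorem IsPrimitiveOver.exists_tendsto_radial {b : ℝ} (hb : (C.kind i).Decays b)
    (hbound : C.FormBound i b α) {δ : ℝ}
    (hball : Metric.closedBall (extChartAt 𝓘(ℝ, Euc n) θ₀ θ₀) δ ⊆
      (extChartAt 𝓘(ℝ, Euc n) θ₀).target) {F : S i → ℝ → ℝ}
    (hF : C.IsPrimitiveOver i α F ((extChartAt 𝓘(ℝ, Euc n) θ₀).source ∩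
      extChartAt 𝓘(ℝ, Euc n) θ₀ ⁻¹' Metric.ball (extChartAt 𝓘(ℝ, Euc n) θ₀ θ₀) δ)) :
    ∃ P, ∀ θ ∈ (extChartAt 𝓘(ℝ, Euc n) θ₀).source ∩
      extChartAt 𝓘(ℝ, Euc n) θ₀ ⁻¹' Metric.ball (extChartAt 𝓘(ℝ, Euc n) θ₀ θ₀) δ,
      Tendsto (F θ) (C.kind i).radial (𝓝 P) := by
  set φ := extChartAt 𝓘(ℝ, Euc n) θ₀ with hφ
  set O := φ.source ∩ φ ⁻¹' Metric.ball (φ θ₀) δ with hO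
  obtain ⟨K, c, hc, h1⟩ := hbound.radialPart_le
  obtain ⟨K', hK', c', hc', h2⟩ := hbound.localPullback_le
  obtain ⟨M, hM0, hM⟩ := exists_bilinInChart_le (C.linkMetric i) θ₀
    (isCompact_closedBall (φ θ₀) δ) hball
  have hlim : ∀ θ ∈ O, ∃ P, Tendsto (F θ) (C.kind i).radial (𝓝 P) := fun θ hθ => by
    obtain ⟨P, hP, -⟩ := EndKind.exists_tendsto_of_deriv_le
      ((C.kind i).pos_of_mem_openInterval (C.bound_pos i) hc) hb
      (fun r hr => hF.hasDerivAt hθ ((C.kind i).openInterval_mono hc hr)) (h1 θ)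
    exact ⟨P, hP⟩
  have hdiff : ∀ θ ∈ O, ∀ θ' ∈ O, Tendsto (fun r => F θ r - F θ' r) (C.kind i).radial (𝓝 0) := by
    intro θ hθ θ' hθ'
    have h3 : ∀ r ∈ (C.kind i).openInterval c',
        ‖F θ r - F θ' r‖ ≤ r ^ b * (K' * √M * ‖φ θ - φ θ'‖) := by
      intro r hr
      have hrI := (C.kind i).openInterval_mono hc' hr
      have hpos := (C.kind i).pos_of_mem_openInterval (C.bound_pos i) hrI
      have hd : ∀ y ∈ Metric.ball (φ θ₀) δ, HasFDerivWithinAt (fun y => F (φ.symm y) r)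
          ((localPullback (fun x => α x) (C.endCoord i θ₀ fun r => r) (y, r)).comp
            (ContinuousLinearMap.inl ℝ (Euc n) ℝ)) (Metric.ball (φ θ₀) δ) y := by
        intro y hy
        have hyt := hball (Metric.ball_subset_closedBall hy)
        have h4 := hF.hasFDerivAt (θ₀ := θ₀) (z := (y, r)) ⟨hyt, hrI⟩
          ⟨φ.map_target hyt, by rw [mem_preimage, φ.right_inv hyt]; exact hy⟩
        exact (HasFDerivAt.comp y (f := fun y : Euc n => (y, r)) h4
          (hasFDerivAt_prodMk_left (𝕜 := ℝ) y r)).hasFDerivWithinAt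
      have hn : ∀ y ∈ Metric.ball (φ θ₀) δ,
          ‖(localPullback (fun x => α x) (C.endCoord i θ₀ fun r => r) (y, r)).comp
            (ContinuousLinearMap.inl ℝ (Euc n) ℝ)‖ ≤ r ^ b * (K' * √M) := by
        intro y hy
        have hyt := hball (Metric.ball_subset_closedBall hy)
        refine ContinuousLinearMap.opNorm_le_bound _ (by positivity) fun w => ?_
        refine (h2 θ₀ (y, r) hyt hr (w, 0)).trans ?_
        -- A vector tangent to the link has conical length at most `r √M ‖w‖`; the factor `r` turns
        -- `r ^ (b - 1)` into `r ^ b`.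
        have h5 : coneMetricCoord (C.linkMetric i).inner θ₀ (fun r => r) (y, r) (w, 0) (w, 0) ≤
            (r * (√M * ‖w‖)) ^ 2 := by
          simp only [coneMetricCoord, mul_zero, zero_add]
          rw [mul_pow, mul_pow, Real.sq_sqrt hM0]
          exact mul_le_mul_of_nonneg_left (hM y (Metric.ball_subset_closedBall hy) w) (sq_nonneg r)
        have h6 : r ^ b = r ^ (b - 1) * r := by
          rw [Real.rpow_sub_one hpos.ne', div_mul_cancel₀ _ hpos.ne']
        calc K' * r ^ (b - 1) * √(coneMetricCoord (C.linkMetric i).inner θ₀ (fun r => r) (y, r)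
              (w, 0) (w, 0)) ≤ K' * r ^ (b - 1) * (r * (√M * ‖w‖)) := by
              refine mul_le_mul_of_nonneg_left ?_ (by positivity)
              exact (Real.sqrt_le_sqrt h5).trans (by rw [Real.sqrt_sq (by positivity)])
          _ = _ := by rw [h6]; ring
      have h7 := (convex_ball (φ θ₀) δ).norm_image_sub_le_of_norm_hasFDerivWithin_le hd hn hθ'.2 hθ.2
      rw [φ.left_inv hθ.1, φ.left_inv hθ'.1] at h7
      rwa [← mul_assoc]
    refine squeeze_zero_norm' (mem_of_superset
      (EndKind.openInterval_mem_radial ((C.kind i).pos_of_mem_openInterval (C.bound_pos i) hc') _)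
      h3) ?_
    simpa using hb.tendsto_rpow.mul_const (K' * √M * ‖φ θ - φ θ'‖)
  by_cases hne : O.Nonempty
  · obtain ⟨θ', hθ'⟩ := hne
    obtain ⟨P, hP⟩ := hlim θ' hθ'
    refine ⟨P, fun θ hθ => ?_⟩
    simpa using (hdiff θ hθ θ' hθ').add hP
  · exact ⟨0, fun θ hθ => (hne ⟨θ, hθ⟩).elim⟩

theorem chartBall_mem_nhds (θ₀ : S i) {δ : ℝ} (hδ : 0 < δ) :
    (extChartAt 𝓘(ℝ, Euc n) θ₀).source ∩
      extChartAt 𝓘(ℝ, Euc n) θ₀ ⁻¹' Metric.ball (extChartAt 𝓘(ℝ, Euc n) θ₀ θ₀) δ ∈ 𝓝 θ₀ :=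
  inter_mem (extChartAt_source_mem_nhds θ₀)
    ((continuousAt_extChartAt θ₀).preimage_mem_nhds (Metric.ball_mem_nhds _ hδ))

/-- On an end along which it decays, a closed 1-form has a primitive which decays. -/
theorem exists_primitive_of_decays (hα : α ∈ closedForms (Euc (n + 1)) L) {b : ℝ}
    (hb : (C.kind i).Decays b) (hbound : C.FormBound i b α) :
    ∃ F : S i → ℝ → ℝ, C.IsPrimitiveOver i α F univ ∧
      ∃ K : ℝ, ∃ c ∈ (C.kind i).openInterval (C.bound i), ∀ θ,
        ∀ r ∈ (C.kind i).openInterval c, |F θ r| ≤ K * r ^ b := by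
  obtain ⟨F, hF, hlim⟩ := C.exists_primitive_of_tendsto (α := α) (u := fun _ => 0)
    (EndKind.openInterval_mem_radial (C.bound_pos i) (C.kind i)) fun θ₀ => by
      obtain ⟨δ, hδ, hball, F, hF⟩ := C.exists_local_primitive hα θ₀
      obtain ⟨P, hP⟩ := hF.exists_tendsto_radial hb hbound hball
      -- Subtracting the common limit `P` normalises every local primitive to limit zero, the
      -- condition under which they glue.
      refine ⟨_, chartBall_mem_nhds θ₀ hδ, _, hF.sub_const P, fun θ hθ => ?_⟩
      simpa using (hP θ hθ).sub_const P
  obtain ⟨K, c, hc, h1⟩ := hbound.radialPart_le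
  refine ⟨F, hF, K / |b|, c, hc, fun θ r hr => ?_⟩
  obtain ⟨P, hP, h2⟩ := EndKind.exists_tendsto_of_deriv_le
    ((C.kind i).pos_of_mem_openInterval (C.bound_pos i) hc) hb
    (fun r hr => hF.hasDerivAt (mem_univ θ) ((C.kind i).openInterval_mono hc hr)) (h1 θ)
  have := h2 r hr
  rwa [tendsto_nhds_unique hP (hlim θ), sub_zero] at this

/-- Primitives on an end extend to the boundary. -/
theorem IsPrimitiveOver.exists_tendsto_bound (hα : α ∈ closedForms (Euc (n + 1)) L)
    {F : S i → ℝ → ℝ} {O : Set (S i)} (hO : O ∈ 𝓝 θ₀) (hF : C.IsPrimitiveOver i α F O) :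
    ∃ O' ⊆ O, IsOpen O' ∧ IsConnected O' ∧ θ₀ ∈ O' ∧ ∃ H : S i → ℝ, ∀ θ ∈ O',
      Tendsto (F θ) (𝓝[(C.kind i).openInterval (C.bound i)] C.bound i) (𝓝 (H θ)) ∧
      HasMFDerivAt 𝓘(ℝ, Euc n) 𝓘(ℝ, ℝ) H θ
        (pullback (C.linkInclusion i) (C.contMDiff_linkInclusion i) α θ) := by
  -- `α` is closed on a full neighbourhood of the boundary point, hence has a primitive `G` there.
  -- On a connected piece of the open end touching the boundary, `F - G` is constant, so `F` extends
  -- to the boundary as `G` does.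
  obtain ⟨G, hG⟩ := exists_primitive_nhds hα (C.linkInclusion i θ₀)
  have hcw : ∀ θ, ContinuousWithinAt (C.param i) (univ ×ˢ (C.kind i).interval (C.bound i))
      (θ, C.bound i) := fun θ => by
    rw [← C.source_param i]
    exact (C.contMDiffOn_param i).continuousOn _ (C.mem_source ((C.kind i).mem_interval (C.bound_pos i)))
  obtain ⟨B, hB, hBo, hBθ⟩ := eventually_nhds_iff.1 hG
  have h1 : C.param i ⁻¹' B ∈ 𝓝[univ ×ˢ (C.kind i).interval (C.bound i)] (θ₀, C.bound i) :=
    (hcw θ₀).preimage_mem_nhdsWithin (hBo.mem_nhds hBθ)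
  rw [nhdsWithin_prod_eq, nhdsWithin_univ] at h1
  obtain ⟨O₁, hO₁, J₁, hJ₁, hOJ⟩ := mem_prod_iff.1 h1
  obtain ⟨ε, hε, hJε⟩ := Metric.mem_nhdsWithin_iff.1 hJ₁
  have : LocallyConnectedSpace (S i) := ChartedSpace.locallyConnectedSpace (Euc n) (S i)
  obtain ⟨O', hO'O, hO'o, hθ₀, hO'c⟩ := locallyConnectedSpace_iff_subsets_isOpen_isConnected.1 this
    θ₀ (O ∩ O₁) (inter_mem hO hO₁)
  set J := Metric.ball (C.bound i) ε ∩ (C.kind i).openInterval (C.bound i) with hJ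
  have hJI : J ⊆ (C.kind i).openInterval (C.bound i) := inter_subset_right
  have hJo : IsOpen J := Metric.isOpen_ball.inter (C.kind i).isOpen_openInterval
  have hJc : Convex ℝ J := (convex_ball _ _).inter (C.kind i).convex_openInterval
  have hJn : J ∈ 𝓝[(C.kind i).openInterval (C.bound i)] C.bound i :=
    inter_mem (mem_nhdsWithin_of_mem_nhds (Metric.ball_mem_nhds _ hε)) self_mem_nhdsWithin
  have hNeBot := (C.kind i).neBot_nhdsWithin (C.bound_pos i)
  obtain ⟨r₀, hr₀⟩ := Filter.nonempty_of_mem hJn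
  have hJB : ∀ θ ∈ O', ∀ r ∈ J, C.param i (θ, r) ∈ B := fun θ hθ r hr =>
    hOJ ⟨(hO'O hθ).2, hJε ⟨hr.1, (C.kind i).openInterval_subset hr.2⟩⟩
  set N := C.param i '' (O' ×ˢ J) with hN
  have hNo : IsOpen N := by
    have h2 : N = C.openEnd i ∩ (C.param i).symm ⁻¹' (O' ×ˢ J) := by
      ext x
      constructor
      · rintro ⟨⟨θ, r⟩, ⟨hθ, hr⟩, rfl⟩
        refine ⟨C.param_mem_openEnd θ (hJI hr), ?_⟩
        rw [mem_preimage, C.param_symm_param ((C.kind i).openInterval_subset (hJI hr))]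
        exact ⟨hθ, hr⟩
      · rintro ⟨hx, hx'⟩
        exact ⟨_, hx', (C.param i).right_inv (C.openEnd_subset_target hx)⟩
    rw [h2]
    exact (C.continuousOn_param_symm.mono C.openEnd_subset_target).isOpen_inter_preimage
      (C.isOpen_end i) (hO'o.prod hJo)
  have hNc : IsPreconnected N := by
    refine (hO'c.isPreconnected.prod hJc.isPreconnected).image _
      ((C.contMDiffOn_param i).continuousOn.mono ?_)
    rintro ⟨θ, r⟩ hr
    exact C.mem_source' (hJI hr.2)
  have hconst : ∀ θ ∈ O', ∀ r ∈ J, F θ r - G (C.param i (θ, r)) =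
      F θ₀ r₀ - G (C.param i (θ₀, r₀)) := by
    intro θ hθ r hr
    have h2 := eq_of_hasMFDerivAt_zero (E := Euc (n + 1)) hNo hNc
      (f := fun x => C.onEnd i F x - G x) (x := C.param i (θ, r)) (y := C.param i (θ₀, r₀)) (by
        rintro _ ⟨⟨θ', r'⟩, ⟨hθ', hr'⟩, rfl⟩
        refine ((hF θ' (hO'O hθ').1 r' (hJI hr')).sub (hB _ (hJB θ' hθ' r' hr'))).congr_mfderiv ?_
        exact sub_self _) ⟨(θ, r), ⟨hθ, hr⟩, rfl⟩ ⟨(θ₀, r₀), ⟨hθ₀, hr₀⟩, rfl⟩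
    simpa only [C.onEnd_param F _ (hJI hr), C.onEnd_param F _ (hJI hr₀)] using h2
  have hBθ' : ∀ θ ∈ O', C.linkInclusion i θ ∈ B := fun θ hθ =>
    hOJ ⟨(hO'O hθ).2, hJε ⟨Metric.mem_ball_self hε, (C.kind i).mem_interval (C.bound_pos i)⟩⟩
  -- `H` is the restriction of `G` to the link plus the constant value of `F - G`.
  refine ⟨O', fun θ hθ => (hO'O hθ).1, hO'o, hO'c, hθ₀,
    fun θ => G (C.linkInclusion i θ) - -(F θ₀ r₀ - G (C.param i (θ₀, r₀))), fun θ hθ => ⟨?_, ?_⟩⟩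
  · have h3 : Tendsto (fun r => C.param i (θ, r))
        (𝓝[(C.kind i).openInterval (C.bound i)] C.bound i) (𝓝 (C.linkInclusion i θ)) := by
      refine (hcw θ).tendsto.comp (tendsto_nhdsWithin_iff.2 ⟨?_, ?_⟩)
      · exact tendsto_const_nhds.prodMk_nhds (tendsto_id.mono_left nhdsWithin_le_nhds)
      · filter_upwards [self_mem_nhdsWithin] with r hr
        exact ⟨mem_univ _, (C.kind i).openInterval_subset hr⟩
    have h4 : Tendsto (fun r => G (C.param i (θ, r)))
        (𝓝[(C.kind i).openInterval (C.bound i)] C.bound i) (𝓝 (G (C.linkInclusion i θ))) :=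
      ((hB _ (hBθ' θ hθ)).continuousAt.tendsto).comp h3
    dsimp only
    rw [sub_neg_eq_add]
    refine (h4.add_const (F θ₀ r₀ - G (C.param i (θ₀, r₀)))).congr' ?_
    filter_upwards [hJn] with r hr
    rw [← hconst θ hθ r hr]
    ring
  · have h3 := (hB _ (hBθ' θ hθ)).comp θ
      ((C.contMDiff_linkInclusion i).mdifferentiable (by simp) θ).hasMFDerivAt
    refine (h3.sub (hasMFDerivAt_const _ θ)).congr_mfderiv ?_
    exact sub_zero _

/-- A closed 1-form has a primitive on an end if and only if its restriction to the link
is exact. -/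
theorem exists_primitive_iff (hα : α ∈ closedForms (Euc (n + 1)) L) :
    (∃ F : S i → ℝ → ℝ, C.IsPrimitiveOver i α F univ) ↔ ∃ u : SmoothFunction (Euc n) (S i),
      pullback (C.linkInclusion i) (C.contMDiff_linkInclusion i) α = d u := by
  have hNeBot := (C.kind i).neBot_nhdsWithin (C.bound_pos i)
  constructor
  · rintro ⟨F, hF⟩
    -- The boundary values of a primitive on the end form a primitive on the link; they are
    -- independent of the local choices by uniqueness of limits.
    have h := fun θ₀ => hF.exists_tendsto_bound (θ₀ := θ₀) hα univ_mem
    choose O hOu hO hOc hθO H hH using h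
    have hd : ∀ θ ∈ univ, HasMFDerivAt 𝓘(ℝ, Euc n) 𝓘(ℝ, ℝ) (fun θ => H θ θ) θ
        (pullback (C.linkInclusion i) (C.contMDiff_linkInclusion i) α θ) := by
      intro θ _
      refine (hH θ θ (hθO θ)).2.congr_of_eventuallyEq ?_
      filter_upwards [(hO θ).mem_nhds (hθO θ)] with θ' hθ'
      exact tendsto_nhds_unique (hH θ' θ' (hθO θ')).1 (hH θ θ' hθ').1
    refine ⟨⟨fun θ => H θ θ, contMDiffOn_univ.1 (contMDiffOn_of_hasMFDerivAt isOpen_univ hd)⟩, ?_⟩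
    ext θ v
    exact DFunLike.congr_fun (hd θ (mem_univ _)).mfderiv.symm v
  · rintro ⟨u, hu⟩
    -- Conversely, local primitives are normalised to have boundary values `u`. This is possible
    -- because the boundary values `H` and `u` have the same differential, hence differ by a
    -- constant on a connected neighbourhood.
    obtain ⟨F, hF, -⟩ := C.exists_primitive_of_tendsto (α := α) (u := u)
      (l := 𝓝[(C.kind i).openInterval (C.bound i)] C.bound i) self_mem_nhdsWithin fun θ₀ => by
        obtain ⟨δ, hδ, hball, F, hF⟩ := C.exists_local_primitive hα θ₀
        obtain ⟨O, hO, hOo, hOc, hθ₀, H, hH⟩ :=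
          hF.exists_tendsto_bound (θ₀ := θ₀) hα (chartBall_mem_nhds θ₀ hδ)
        refine ⟨O, hOo.mem_nhds hθ₀, _, (hF.mono hO).sub_const (H θ₀ - u θ₀), fun θ hθ => ?_⟩
        have h1 := eq_of_hasMFDerivAt_zero (E := Euc n) hOo hOc.isPreconnected
          (f := fun θ => H θ - u θ) (fun θ hθ => by
            refine ((hH θ hθ).2.sub
              (u.contMDiff.mdifferentiable (by simp) θ).hasMFDerivAt).congr_mfderiv ?_
            rw [hu]
            exact sub_self _) hθ₀ hθ
        have h2 := (hH θ hθ).1.sub_const (H θ₀ - u θ₀)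
        have h3 : H θ - (H θ₀ - u θ₀) = u θ := by rw [h1]; ring
        rwa [h3] at h2
    exact ⟨F, hF⟩

end Conifold

section Exact
variable {E : Type*} [NormedAddCommGroup E] [NormedSpace ℝ E]
  {M : Type*} [TopologicalSpace M] [ChartedSpace E M] [IsManifold 𝓘(ℝ, E) ∞ M]

theorem d_mem_closedForms (f : SmoothFunction E M) : d f ∈ closedForms E M := by
  intro x₀ y hy u v
  have h1 : ContDiffOn ℝ ∞ (f ∘ (extChartAt 𝓘(ℝ, E) x₀).symm) (extChartAt 𝓘(ℝ, E) x₀).target :=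
    (contMDiffOn_chart_iff _ x₀).1 f.contMDiff.contMDiffOn
  have hn := (isOpen_extChartAt_target (I := 𝓘(ℝ, E)) x₀).mem_nhds hy
  have h2 : formInChart 𝓘(ℝ, E) (fun x => d f x) x₀ =ᶠ[𝓝 y]
      fderiv ℝ (f ∘ (extChartAt 𝓘(ℝ, E) x₀).symm) := by
    filter_upwards [hn] with y hy
    rw [← mfderiv_eq_fderiv, mfderiv_comp y (f.contMDiff.mdifferentiable (by simp) _)
      (mdifferentiableAt_chart_symm x₀ hy)]
    rfl
  have h3 : (2 : WithTop ℕ∞) ≤ ∞ := by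
    change ((2 : ℕ∞) : WithTop ℕ∞) ≤ ((⊤ : ℕ∞) : WithTop ℕ∞)
    exact_mod_cast le_top
  have hsymm := ((h1.contDiffAt hn).isSymmSndFDerivAt (by simpa using h3)).eq u v
  rw [h2.fderiv_eq]
  exact hsymm

end Exact

/-! ### Growth of functions and weights along an end -/

namespace Conifold

variable {n : ℕ} {L : Type*} [TopologicalSpace L] [ChartedSpace (Euc (n + 1)) L]
  [IsManifold 𝓘(ℝ, Euc (n + 1)) ∞ L] {ι : Type*} {S : ι → Type*}
  [∀ i, TopologicalSpace (S i)] [∀ i, ChartedSpace (Euc n) (S i)]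
  [∀ i, IsManifold 𝓘(ℝ, Euc n) ∞ (S i)] {C : Conifold n L S} {i : ι}
  {α : OneForm (Euc (n + 1)) L}

theorem isPrimitiveOver_d (h : SmoothFunction (Euc (n + 1)) L) (O : Set (S i)) :
    C.IsPrimitiveOver i (d h) (fun θ r => h (C.param i (θ, r))) O := by
  intro θ _ r hr
  refine (h.contMDiff.mdifferentiable (by simp) _).hasMFDerivAt.congr_of_eventuallyEq ?_
  filter_upwards [(C.isOpen_end i).mem_nhds (C.param_mem_openEnd θ hr)]
  rintro _ ⟨⟨θ', r'⟩, ⟨-, hr'⟩, rfl⟩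
  exact C.onEnd_param _ θ' hr'

theorem tendsto_radius : Tendsto (C.radius i) (C.endFilter i) (C.kind i).radial := by
  intro s hs
  refine C.eventually_endFilter.2 ?_
  filter_upwards [hs, EndKind.openInterval_mem_radial (C.bound_pos i) (C.kind i)] with r hr hr' θ
  rwa [C.radius_param ((C.kind i).openInterval_subset hr')]

/-- A function whose differential decays is asymptotic to a constant. -/
theorem FormBound.exists_const [ConnectedSpace (S i)] {b : ℝ} (hb : (C.kind i).Decays b)
    {h : SmoothFunction (Euc (n + 1)) L} (hh : C.FormBound i b (d h)) :
    ∃ c K : ℝ, ∀ᶠ x in C.endFilter i, |h x - c| ≤ K * C.radius i x ^ b := by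
  obtain ⟨F, hF, K, c, hc, hK⟩ := exists_primitive_of_decays (d_mem_closedForms h) hb hh
  obtain ⟨r₀, hr₀⟩ := EndKind.nonempty_openInterval
    ((C.kind i).pos_of_mem_openInterval (C.bound_pos i) hc) (C.kind i)
  obtain ⟨θ₀⟩ := (inferInstance : Nonempty (S i))
  have hcI := (C.kind i).openInterval_mono hc
  refine ⟨h (C.param i (θ₀, r₀)) - F θ₀ r₀, K, C.eventually_endFilter_iff_exists.2
    ⟨c, hc, fun r hr θ => ?_⟩⟩
  -- On a connected tail, `h` and the decaying primitive of its differential differ by a constant,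
  -- read off at a reference point.
  have h2 := eq_of_hasMFDerivAt_zero (E := Euc (n + 1)) (C.isOpen_tail hc) (C.isPreconnected_tail hc)
    (f := fun x => h x - C.onEnd i F x) (x := C.param i (θ₀, r₀)) (y := C.param i (θ, r)) (by
      rintro _ ⟨⟨θ', r'⟩, ⟨hθ', hr'⟩, rfl⟩
      refine ((h.contMDiff.mdifferentiable (by simp) _).hasMFDerivAt.sub
        (hF θ' (mem_univ _) r' (hcI hr'))).congr_mfderiv ?_
      exact sub_self _) ⟨(θ₀, r₀), ⟨mem_univ _, hr₀⟩, rfl⟩ ⟨(θ, r), ⟨mem_univ _, hr⟩, rfl⟩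
  rw [C.onEnd_param F _ (hcI hr), C.onEnd_param F _ (hcI hr₀)] at h2
  rw [C.radius_param ((C.kind i).openInterval_subset (hcI hr)), h2, sub_sub_cancel]
  exact hK θ r hr

/-- The growth of a function is controlled by the growth of its differential. -/
theorem FormBound.abs_le [CompactSpace (S i)] {b : ℝ} (hi : C.kind i = .ac) (hb : 0 < b)
    {h : SmoothFunction (Euc (n + 1)) L} (hh : C.FormBound i b (d h)) :
    ∃ K : ℝ, ∀ᶠ x in C.endFilter i, |h x| ≤ K * C.radius i x ^ b := by
  obtain ⟨K, c, hc, hK⟩ := hh.radialPart_le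
  have hc0 := (C.kind i).pos_of_mem_openInterval (C.bound_pos i) hc
  obtain ⟨s, hs⟩ := EndKind.nonempty_openInterval hc0 (C.kind i)
  have hcI := (C.kind i).openInterval_mono hc
  have hcont : Continuous fun θ => h (C.param i (θ, s)) := by
    refine h.contMDiff.continuous.comp (continuous_iff_continuousAt.2 fun θ => ?_)
    exact ContinuousAt.comp (f := fun θ : S i => (θ, s))
      (C.contMDiffAt_param (p := (θ, s)) (hcI hs)).continuousAt
      (continuousAt_id.prodMk continuousAt_const)
  obtain ⟨A, hA⟩ := isCompact_univ.exists_bound_of_continuousOn hcont.continuousOn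
  -- Integration starts from the fixed radius `s`, where `h` is bounded by `A` since the link is
  -- compact. As `b > 0` and `r > s`, this bounded term is absorbed by `1 ≤ (s ^ b)⁻¹ r ^ b`.
  refine ⟨max A 0 * (s ^ b)⁻¹ + |K| / |b|, C.eventually_endFilter_iff_exists.2
    ⟨max c s, ?_, fun r hr θ => ?_⟩⟩
  · rw [hi] at hc hs ⊢
    exact lt_of_lt_of_le (show C.bound i < c from hc) (le_max_left _ _)
  have hr' : c < r ∧ s < r := by
    rw [hi] at hr
    exact max_lt_iff.1 hr
  have hrc : r ∈ (C.kind i).openInterval c := by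
    rw [hi]
    exact hr'.1
  have h1 := EndKind.abs_sub_le_rpow hc0 hb.ne'
    (fun r hr => (isPrimitiveOver_d h univ).hasDerivAt (mem_univ θ) (hcI hr)) (hK θ) hrc hs
  have h2 := hA θ (mem_univ _)
  rw [Real.norm_eq_abs] at h2
  have hs0 := (C.kind i).pos_of_mem_openInterval hc0 hs
  have hsb : 0 < s ^ b := Real.rpow_pos_of_pos hs0 _
  have hrs : s ^ b ≤ r ^ b := Real.rpow_le_rpow hs0.le hr'.2.le hb.le
  rw [C.radius_param ((C.kind i).openInterval_subset (hcI hrc))]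
  have h3 : |r ^ b - s ^ b| ≤ r ^ b := by
    rw [abs_of_nonneg (sub_nonneg.2 hrs)]
    linarith
  calc |h (C.param i (θ, r))| ≤ |h (C.param i (θ, s))| +
        |h (C.param i (θ, r)) - h (C.param i (θ, s))| := by
        have := abs_add_le (h (C.param i (θ, s))) (h (C.param i (θ, r)) - h (C.param i (θ, s)))
        rwa [add_sub_cancel] at this
    _ ≤ max A 0 * 1 + |K| / |b| * r ^ b := by
        refine add_le_add (by rw [mul_one]; exact h2.trans (le_max_left _ _)) (h1.trans ?_)
        exact mul_le_mul (div_le_div_of_nonneg_right (le_abs_self K) (abs_nonneg b)) h3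
          (abs_nonneg _) (by positivity)
    _ ≤ max A 0 * ((s ^ b)⁻¹ * r ^ b) + |K| / |b| * r ^ b := by
        gcongr
        rw [← div_eq_inv_mul, le_div_iff₀ hsb, one_mul]
        exact hrs
    _ = _ := by ring

/-- A function whose differential vanishes near an end is constant near that end. -/
theorem exists_eventually_eq_const [ConnectedSpace (S i)] {h : SmoothFunction (Euc (n + 1)) L}
    (hh : ∀ᶠ x in C.endFilter i, d h x = 0) : ∃ c : ℝ, ∀ᶠ x in C.endFilter i, h x = c := by
  obtain ⟨c, hc, h1⟩ := C.eventually_endFilter_iff_exists.1 hh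
  obtain ⟨r₀, hr₀⟩ := EndKind.nonempty_openInterval
    ((C.kind i).pos_of_mem_openInterval (C.bound_pos i) hc) (C.kind i)
  obtain ⟨θ₀⟩ := (inferInstance : Nonempty (S i))
  refine ⟨h (C.param i (θ₀, r₀)), C.eventually_endFilter_iff_exists.2 ⟨c, hc, fun r hr θ => ?_⟩⟩
  refine eq_of_hasMFDerivAt_zero (E := Euc (n + 1)) (C.isOpen_tail hc) (C.isPreconnected_tail hc) ?_
    ⟨(θ, r), ⟨mem_univ _, hr⟩, rfl⟩ ⟨(θ₀, r₀), ⟨mem_univ _, hr₀⟩, rfl⟩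
  rintro _ ⟨⟨θ', r'⟩, ⟨hθ', hr'⟩, rfl⟩
  have := (h.contMDiff.mdifferentiable (by simp) (C.param i (θ', r'))).hasMFDerivAt
  rwa [← d_apply, h1 r' hr' θ'] at this

/-- The estimates `|∇^j T| = O(r ^ (b - j))` along the `i`-th end. -/
def WeightAt (C : Conifold n L S) (i : ι) (b : ℝ) {k : ℕ}
    (T : TensorField 𝓘(ℝ, Euc (n + 1)) L k) : Prop :=
  ∀ j : ℕ, TensorIsBigO (C.endFilter i) C.metric.inner (iterNabla C.metric.inner T j)
    (fun x => C.radius i x ^ (b - j))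

theorem WeightAt.congr {b : ℝ} {k : ℕ} {T T' : TensorField 𝓘(ℝ, Euc (n + 1)) L k}
    (h : C.WeightAt i b T) (hT : ∀ᶠ x in C.endFilter i, T x = T' x) : C.WeightAt i b T' := by
  intro j
  obtain ⟨K, hK⟩ := h j
  refine ⟨K, ?_⟩
  filter_upwards [hK, C.eventually_endFilter_nhds hT] with x hx hT v
  rw [← iterNabla_congr _ hT]
  exact hx v

theorem weightAt_form_zero {b : ℝ} :
    C.WeightAt i b (formTensor (I := 𝓘(ℝ, Euc (n + 1))) fun x => (0 : OneForm (Euc (n + 1)) L) x) := by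
  have h := HasWeight.zero C (β := fun _ => b)
    (chartSmooth_form (0 : OneForm (Euc (n + 1)) L))
  refine (congrArg (C.WeightAt i b) ?_).mp (h i)
  funext x v
  simp [formTensor]

theorem WeightAt.sub {b : ℝ} {α α' : OneForm (Euc (n + 1)) L}
    (h : C.WeightAt i b (formTensor (I := 𝓘(ℝ, Euc (n + 1))) fun x => α x))
    (h' : C.WeightAt i b (formTensor (I := 𝓘(ℝ, Euc (n + 1))) fun x => α' x)) :
    C.WeightAt i b (formTensor (I := 𝓘(ℝ, Euc (n + 1))) fun x => (α - α') x) := by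
  intro j
  have h1 := (h j).add (h' j) 1 (-1)
  rw [← iterNabla_linear C.metric (chartSmooth_form α) (chartSmooth_form α') 1 (-1) j] at h1
  have h2 : (fun x v => 1 * formTensor (I := 𝓘(ℝ, Euc (n + 1))) (fun x => α x) x v +
      -1 * formTensor (I := 𝓘(ℝ, Euc (n + 1))) (fun x => α' x) x v) =
      formTensor (I := 𝓘(ℝ, Euc (n + 1))) fun x => (α - α') x := by
    funext x v
    simp [formTensor, sub_eq_add_neg]
  rwa [h2] at h1

/-- The order-zero estimate is all that the construction of primitives and the growth of functions
require. -/
theorem WeightAt.formBound {b : ℝ}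
    (h : C.WeightAt i (b - 1) (formTensor (I := 𝓘(ℝ, Euc (n + 1))) fun x => α x)) :
    C.FormBound i b α := by
  obtain ⟨K, hK⟩ := h 0
  refine ⟨K, ?_⟩
  filter_upwards [hK] with x hx v
  have := hx fun _ => v
  rw [iterNabla_zero] at this
  simpa [formTensor] using this

/-- The weights on an AC end are increasing. -/
theorem WeightAt.mono {b b' : ℝ} (hi : C.kind i = .ac) (hb : b ≤ b') {k : ℕ}
    {T : TensorField 𝓘(ℝ, Euc (n + 1)) L k} (h : C.WeightAt i b T) : C.WeightAt i b' T := by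
  intro j
  obtain ⟨K, hK⟩ := h j
  have ht := C.tendsto_radius (i := i)
  rw [hi] at ht
  refine ⟨|K|, ?_⟩
  filter_upwards [hK, ht.eventually (eventually_ge_atTop 1)] with x hx hr v
  refine (hx v).trans (mul_le_mul_of_nonneg_right ?_ (Finset.prod_nonneg fun _ _ => Real.sqrt_nonneg _))
  exact mul_le_mul (le_abs_self K) (Real.rpow_le_rpow_of_exponent_le hr (by linarith))
    (Real.rpow_nonneg (zero_le_one.trans hr) _) (abs_nonneg K)

/-- Because `∇^(j+1) f = ∇^j (df)`, the estimates of positive order on `f` are exactly those on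
`df`. A primitive of a weighted form thus lies in the weighted space as soon as its values have the
right size. -/
theorem weightAt_function_iff {b : ℝ} {f : SmoothFunction (Euc (n + 1)) L} :
    C.WeightAt i b (functionTensor (I := 𝓘(ℝ, Euc (n + 1))) f) ↔
      (∃ K : ℝ, ∀ᶠ x in C.endFilter i, |f x| ≤ K * C.radius i x ^ b) ∧
      C.WeightAt i (b - 1) (formTensor (I := 𝓘(ℝ, Euc (n + 1))) fun x => d f x) := by
  have hcast : ∀ j : ℕ, 0 + (j + 1) = 1 + j := fun j => by omega
  constructor
  · intro h
    constructor
    · obtain ⟨K, hK⟩ := h 0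
      refine ⟨K, ?_⟩
      filter_upwards [hK] with x hx
      have := hx fun k => k.elim0
      rw [iterNabla_zero] at this
      simpa [functionTensor] using this
    · intro j
      obtain ⟨K, hK⟩ := h (j + 1)
      refine ⟨K, ?_⟩
      filter_upwards [hK] with x hx v
      have h1 := hx fun k => v (Fin.cast (hcast j) k)
      rw [iterNabla_d] at h1
      have h2 : b - ((j + 1 : ℕ) : ℝ) = b - 1 - j := by push_cast; ring
      rw [h2] at h1
      refine h1.trans (le_of_eq ?_)
      congr 1
      exact Fintype.prod_equiv (finCongr (hcast j)) _ _ fun _ => rfl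
  · rintro ⟨⟨K, hK⟩, h⟩ j
    cases j with
    | zero =>
      refine ⟨K, ?_⟩
      filter_upwards [hK] with x hx v
      rw [iterNabla_zero]
      simpa [functionTensor] using hx
    | succ j =>
      obtain ⟨K, hK⟩ := h j
      refine ⟨K, ?_⟩
      filter_upwards [hK] with x hx v
      rw [iterNabla_d]
      refine (hx _).trans (le_of_eq ?_)
      have h2 : b - ((j + 1 : ℕ) : ℝ) = b - 1 - j := by push_cast; ring
      rw [h2]
      congr 1
      exact (Fintype.prod_equiv (finCongr (hcast j)) _ _ fun _ => rfl).symm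

end Conifold

/-! ### The metric of an AC end in logarithmic coordinates -/

section Bilinear
variable (E : Type*) [NormedAddCommGroup E] [NormedSpace ℝ E]

/-- Bilinear forms as multilinear forms in two variables. -/
def bilinToMultilinear : (E →L[ℝ] E →L[ℝ] ℝ) →L[ℝ] E [×2]→L[ℝ] ℝ :=
  ((continuousMultilinearCurryLeftEquiv ℝ (fun _ : Fin 2 => E) ℝ).symm.toContinuousLinearEquiv :
      (E →L[ℝ] E [×1]→L[ℝ] ℝ) →L[ℝ] E [×2]→L[ℝ] ℝ).comp
    (ContinuousLinearMap.compL ℝ E (E →L[ℝ] ℝ) (E [×1]→L[ℝ] ℝ)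
      ((continuousMultilinearCurryFin1 ℝ E ℝ).symm.toContinuousLinearEquiv :
        (E →L[ℝ] ℝ) →L[ℝ] E [×1]→L[ℝ] ℝ))

/-- Multilinear forms in two variables as bilinear forms. -/
def multilinearToBilin : (E [×2]→L[ℝ] ℝ) →L[ℝ] E →L[ℝ] E →L[ℝ] ℝ :=
  (ContinuousLinearMap.compL ℝ E (E [×1]→L[ℝ] ℝ) (E →L[ℝ] ℝ)
      ((continuousMultilinearCurryFin1 ℝ E ℝ).toContinuousLinearEquiv :
        (E [×1]→L[ℝ] ℝ) →L[ℝ] E →L[ℝ] ℝ)).comp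
    ((continuousMultilinearCurryLeftEquiv ℝ (fun _ : Fin 2 => E) ℝ).toContinuousLinearEquiv :
      (E [×2]→L[ℝ] ℝ) →L[ℝ] E →L[ℝ] E [×1]→L[ℝ] ℝ)

/-- Linear forms as multilinear forms in one variable. -/
def linToMultilinear : (E →L[ℝ] ℝ) →L[ℝ] E [×1]→L[ℝ] ℝ :=
  ((continuousMultilinearCurryFin1 ℝ E ℝ).symm.toContinuousLinearEquiv :
    (E →L[ℝ] ℝ) →L[ℝ] E [×1]→L[ℝ] ℝ)

variable {E}

theorem bilinToMultilinear_apply (B : E →L[ℝ] E →L[ℝ] ℝ) (v : Fin 2 → E) :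
    bilinToMultilinear E B v = B (v 0) (v 1) := rfl

theorem isInvertible_of_pos [FiniteDimensional ℝ E] {B : E →L[ℝ] E →L[ℝ] ℝ}
    (h : ∀ w, w ≠ 0 → 0 < B w w) : B.IsInvertible := by
  have hker : Function.Injective (B : E →ₗ[ℝ] (E →L[ℝ] ℝ)) := by
    rw [← LinearMap.ker_eq_bot, LinearMap.ker_eq_bot']
    intro u hu
    by_contra hne
    have h1 : B u u = 0 := by
      have := congrArg (fun f : E →L[ℝ] ℝ => f u) hu
      simpa using this
    exact (h u hne).ne' h1
  have hfin : Module.finrank ℝ E = Module.finrank ℝ (E →L[ℝ] ℝ) := by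
    rw [← (LinearMap.toContinuousLinearMap (𝕜 := ℝ) (E := E) (F' := ℝ)).finrank_eq]
    exact (Subspace.dual_finrank_eq (K := ℝ) (V := E)).symm
  refine ⟨(LinearEquiv.ofInjectiveOfFinrankEq _ hker hfin).toContinuousLinearEquiv, ?_⟩
  ext u v
  rfl

/-- For `w = B⁻¹ ℓ` one has `c ‖w‖² ≤ B(w, w) = ℓ(w) ≤ ‖ℓ‖ ‖w‖`. -/
theorem norm_inverse_le_of_coercive {B : E →L[ℝ] E →L[ℝ] ℝ} (hB : B.IsInvertible) {c : ℝ}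
    (hc : 0 < c) (h : ∀ w, c * ‖w‖ ^ 2 ≤ B w w) : ‖B.inverse‖ ≤ c⁻¹ := by
  refine ContinuousLinearMap.opNorm_le_bound _ (inv_nonneg.2 hc.le) fun ℓ => ?_
  set w := B.inverse ℓ with hw
  have h1 : B w w = ℓ w := by rw [hw, hB.self_apply_inverse]
  have h2 : c * ‖w‖ ^ 2 ≤ ‖ℓ‖ * ‖w‖ := by
    refine (h w).trans ?_
    rw [h1]
    exact (le_abs_self _).trans (ℓ.le_opNorm w)
  rcases (norm_nonneg w).eq_or_lt with h0 | h0
  · rw [← h0]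
    positivity
  · rw [← div_eq_inv_mul, le_div_iff₀ hc]
    have : c * ‖w‖ * ‖w‖ ≤ ‖ℓ‖ * ‖w‖ := by linarith
    linarith [le_of_mul_le_mul_right this h0]

end Bilinear

section ConeMetric
variable {n : ℕ} {S : Type*} [TopologicalSpace S] [ChartedSpace (Euc n) S]
  [IsManifold 𝓘(ℝ, Euc n) ∞ S]
  (g' : ContMDiffRiemannianMetric 𝓘(ℝ, Euc n) ∞ (Euc n) (fun θ : S => TangentSpace 𝓘(ℝ, Euc n) θ))
  {θ₀ : S} {ρ : ℝ → ℝ}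

theorem bilinInChart_pos {y : Euc n} (hy : y ∈ (extChartAt 𝓘(ℝ, Euc n) θ₀).target) {w : Euc n}
    (hw : w ≠ 0) : 0 < bilinInChart 𝓘(ℝ, Euc n) g'.inner θ₀ y w w := by
  refine g'.pos _ _ fun h => hw ?_
  exact (isInvertible_chartFrame (I := 𝓘(ℝ, Euc n)) θ₀ hy).injective (h.trans (map_zero _).symm)

/-- A positive continuous function on the compact set `K` × unit sphere is bounded below by a
positive constant; homogeneity of degree two gives the rest. -/
theorem exists_le_bilinInChart {K : Set (Euc n)} (hK : IsCompact K)
    (hKt : K ⊆ (extChartAt 𝓘(ℝ, Euc n) θ₀).target) :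
    ∃ c : ℝ, 0 < c ∧ ∀ y ∈ K, ∀ w, c * ‖w‖ ^ 2 ≤ bilinInChart 𝓘(ℝ, Euc n) g'.inner θ₀ y w w := by
  have hcont : ContinuousOn (fun p : Euc n × Euc n =>
      bilinInChart 𝓘(ℝ, Euc n) g'.inner θ₀ p.1 p.2 p.2) (K ×ˢ Metric.sphere 0 1) := by
    have h1 : ContinuousOn (fun p : Euc n × Euc n => bilinInChart 𝓘(ℝ, Euc n) g'.inner θ₀ p.1)
        (K ×ˢ Metric.sphere 0 1) :=
      ((contDiffOn_bilinInChart g'.contMDiff θ₀).continuousOn.mono hKt).comp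
        continuousOn_fst fun p hp => hp.1
    exact (h1.clm_apply continuousOn_snd).clm_apply continuousOn_snd
  obtain ⟨c, hc, h⟩ := (hK.prod (isCompact_sphere (0 : Euc n) 1)).exists_forall_le' hcont (a := 0)
    fun p hp => bilinInChart_pos g' (hKt hp.1) (ne_zero_of_mem_unit_sphere ⟨p.2, hp.2⟩)
  refine ⟨c, hc, fun y hy w => ?_⟩
  by_cases hw : w = 0
  · simp [hw]
  · have hw' : 0 < ‖w‖ := norm_pos_iff.2 hw
    have h1 := h (y, ‖w‖⁻¹ • w) ⟨hy, by simp [norm_smul, hw'.ne']⟩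
    simp only [map_smul, smul_apply, smul_eq_mul] at h1
    have h2 : bilinInChart 𝓘(ℝ, Euc n) g'.inner θ₀ y w w =
        ‖w‖ ^ 2 * (‖w‖⁻¹ * (‖w‖⁻¹ * bilinInChart 𝓘(ℝ, Euc n) g'.inner θ₀ y w w)) := by
      field_simp
    rw [h2, mul_comm c]
    exact mul_le_mul_of_nonneg_left h1 (sq_nonneg _)

/-- The conical metric in coordinates, as a field of bilinear forms. -/
def coneBilin (θ₀ : S) (ρ : ℝ → ℝ) (z : Euc n × ℝ) : (Euc n × ℝ) →L[ℝ] (Euc n × ℝ) →L[ℝ] ℝ :=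
  (deriv ρ z.2) ^ 2 • (ContinuousLinearMap.snd ℝ (Euc n) ℝ).smulRight
      (ContinuousLinearMap.snd ℝ (Euc n) ℝ) +
    (ρ z.2) ^ 2 • pullBilin (bilinInChart 𝓘(ℝ, Euc n) g'.inner θ₀ z.1)
      (ContinuousLinearMap.fst ℝ (Euc n) ℝ)

theorem coneBilin_apply (z w w' : Euc n × ℝ) :
    coneBilin g' θ₀ ρ z w w' = coneMetricCoord g'.inner θ₀ ρ z w w' := by
  change (deriv ρ z.2) ^ 2 * (w.2 * w'.2) + (ρ z.2) ^ 2 * _ = _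
  rw [coneMetricCoord]
  congr 1
  ring

theorem contDiffOn_coneBilin (hρ : ContDiff ℝ ∞ ρ) :
    ContDiffOn ℝ ∞ (coneBilin g' θ₀ ρ) ((extChartAt 𝓘(ℝ, Euc n) θ₀).target ×ˢ univ) := by
  have h1 : ContDiff ℝ ∞ (deriv ρ) := (contDiff_infty_iff_deriv.1 hρ).2
  have h2 : ContDiffOn ℝ ∞ (fun z : Euc n × ℝ => bilinInChart 𝓘(ℝ, Euc n) g'.inner θ₀ z.1)
      ((extChartAt 𝓘(ℝ, Euc n) θ₀).target ×ˢ univ) :=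
    (contDiffOn_bilinInChart g'.contMDiff θ₀).comp contDiffOn_fst fun z hz => hz.1
  have h3 : ContDiff ℝ ∞ (fun z : Euc n × ℝ => deriv ρ z.2 ^ 2) := (h1.comp contDiff_snd).pow 2
  have h4 : ContDiff ℝ ∞ (fun z : Euc n × ℝ => ρ z.2 ^ 2) := (hρ.comp contDiff_snd).pow 2
  exact (h3.contDiffOn.smul contDiffOn_const).add
    (h4.contDiffOn.smul (contDiffOn_pullBilin h2 contDiffOn_const))

theorem isInvertible_coneBilin {z : Euc n × ℝ} (hz : z.1 ∈ (extChartAt 𝓘(ℝ, Euc n) θ₀).target)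
    (h : deriv ρ z.2 ≠ 0) (h' : ρ z.2 ≠ 0) : (coneBilin g' θ₀ ρ z).IsInvertible := by
  refine isInvertible_of_pos fun w hw => ?_
  rw [coneBilin_apply, coneMetricCoord]
  by_cases h1 : w.1 = 0
  · have h2 : w.2 ≠ 0 := fun h2 => hw (Prod.ext h1 h2)
    rw [h1, map_zero, mul_zero, add_zero]
    exact mul_self_pos.2 (mul_ne_zero h h2)
  · exact add_pos_of_nonneg_of_pos (mul_self_nonneg _)
      (mul_pos (by positivity) (bilinInChart_pos g' hz h1))

theorem coneBilin_symm (z u v : Euc n × ℝ) :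
    coneBilin g' θ₀ ρ z u v = coneBilin g' θ₀ ρ z v u := by
  rw [coneBilin_apply, coneBilin_apply, coneMetricCoord, coneMetricCoord, mul_comm (deriv ρ z.2 * u.2)]
  congr 2
  exact g'.symm _ _ _

theorem isInvertible_mfderiv_coneCoord (hρ : ContDiff ℝ ∞ ρ) {z : Euc n × ℝ}
    (hz : z.1 ∈ (extChartAt 𝓘(ℝ, Euc n) θ₀).target) (h : deriv ρ z.2 ≠ 0) :
    (mfderiv 𝓘(ℝ, Euc n × ℝ) (𝓘(ℝ, Euc n).prod 𝓘(ℝ, ℝ)) (coneCoord θ₀ ρ) z :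
      Euc n × ℝ →L[ℝ] Euc n × ℝ).IsInvertible := by
  set A : Euc n × ℝ →L[ℝ] Euc n × ℝ :=
    mfderiv 𝓘(ℝ, Euc n × ℝ) (𝓘(ℝ, Euc n).prod 𝓘(ℝ, ℝ)) (coneCoord θ₀ ρ) z with hA
  have hinj : Function.Injective (A : Euc n × ℝ →ₗ[ℝ] Euc n × ℝ) := by
    rw [← LinearMap.ker_eq_bot, LinearMap.ker_eq_bot']
    intro w hw
    have h1 := mfderiv_fst_coneCoord hρ hz w
    have h2 := mfderiv_snd_coneCoord hρ hz w
    have h3 : mfderiv 𝓘(ℝ, Euc n × ℝ) (𝓘(ℝ, Euc n).prod 𝓘(ℝ, ℝ)) (coneCoord θ₀ ρ) z w = 0 := hw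
    rw [h3, map_zero] at h1 h2
    refine Prod.ext ?_ ((mul_eq_zero.1 h2.symm).resolve_left h)
    exact (isInvertible_chartFrame (I := 𝓘(ℝ, Euc n)) θ₀ hz).injective
      (h1.symm.trans (map_zero _).symm)
  refine ⟨(LinearEquiv.ofInjectiveEndo _ hinj).toContinuousLinearEquiv, ?_⟩
  ext v <;> rfl

/-- The preferred chart of `ℝ` is the identity, so the preferred charts of the cone are the
coordinates with `ρ` the identity. -/
theorem extChartAt_prod_symm (p : S × ℝ) :
    ((extChartAt (𝓘(ℝ, Euc n).prod 𝓘(ℝ, ℝ)) p).symm : Euc n × ℝ → S × ℝ) =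
      coneCoord p.1 fun r => r := by
  funext z
  rw [extChartAt_prod]
  rfl

theorem bilinInChart_coneMetric (p : S × ℝ) {y : Euc n × ℝ}
    (hy : y.1 ∈ (extChartAt 𝓘(ℝ, Euc n) p.1).target) :
    bilinInChart (𝓘(ℝ, Euc n).prod 𝓘(ℝ, ℝ)) (coneMetric g'.inner) p y =
      coneBilin g' p.1 (fun r => r) y := by
  have key : ∀ ψ : Euc n × ℝ → S × ℝ, ψ = coneCoord p.1 (fun r => r) → ∀ u v : Euc n × ℝ,
      coneMetric g'.inner (ψ y) (mfderiv 𝓘(ℝ, Euc n × ℝ) (𝓘(ℝ, Euc n).prod 𝓘(ℝ, ℝ)) ψ y u)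
        (mfderiv 𝓘(ℝ, Euc n × ℝ) (𝓘(ℝ, Euc n).prod 𝓘(ℝ, ℝ)) ψ y v) =
      coneBilin g' p.1 (fun r => r) y u v := by
    rintro _ rfl u v
    rw [coneMetric_coneCoord contDiff_fun_id _ hy, coneBilin_apply]
  refine ContinuousLinearMap.ext fun u => ContinuousLinearMap.ext fun v => ?_
  exact key _ (extChartAt_prod_symm p) u v

end ConeMetric

namespace Conifold

variable {n : ℕ} {L : Type*} [TopologicalSpace L] [ChartedSpace (Euc (n + 1)) L]
  [IsManifold 𝓘(ℝ, Euc (n + 1)) ∞ L] {ι : Type*} {S : ι → Type*}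
  [∀ i, TopologicalSpace (S i)] [∀ i, ChartedSpace (Euc n) (S i)]
  [∀ i, IsManifold 𝓘(ℝ, Euc n) ∞ (S i)] (C : Conifold n L S) {i : ι}
  {θ₀ : S i} {ρ : ℝ → ℝ} {α : OneForm (Euc (n + 1)) L}

/-- The metric of the conifold in the coordinates `endCoord`. -/
def metricCoord (i : ι) (θ₀ : S i) (ρ : ℝ → ℝ) (z : Euc n × ℝ) :
    (Euc n × ℝ) →L[ℝ] (Euc n × ℝ) →L[ℝ] ℝ :=
  pullBilin (W := Euc n × ℝ) (C.metric.inner (C.endCoord i θ₀ ρ z))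
    (mfderiv 𝓘(ℝ, Euc n × ℝ) 𝓘(ℝ, Euc (n + 1)) (C.endCoord i θ₀ ρ) z)

theorem contDiffOn_metricCoord (hρ : ContDiff ℝ ∞ ρ) :
    ContDiffOn ℝ ∞ (C.metricCoord i θ₀ ρ) (C.coordDomain i θ₀ ρ) :=
  contDiffOn_pullBilin_metric (C.isOpen_coordDomain hρ.continuous) (C.contMDiffOn_endCoord hρ) C.metric

/-- The difference of the metric of the conifold and of the conical metric. -/
def metricDiff (i : ι) : BilinField (𝓘(ℝ, Euc n).prod 𝓘(ℝ, ℝ)) (S i × ℝ) := fun p =>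
  pullBilin (C.metric.inner (C.param i p))
    (mfderiv (𝓘(ℝ, Euc n).prod 𝓘(ℝ, ℝ)) 𝓘(ℝ, Euc (n + 1)) (C.param i) p) -
  coneMetric (C.linkMetric i).inner p

theorem metricDiff_coneCoord (hρ : ContDiff ℝ ∞ ρ) {z : Euc n × ℝ} (hz : z ∈ C.coordDomain i θ₀ ρ)
    (u v : Euc n × ℝ) :
    C.metricDiff i (coneCoord θ₀ ρ z)
      (mfderiv 𝓘(ℝ, Euc n × ℝ) (𝓘(ℝ, Euc n).prod 𝓘(ℝ, ℝ)) (coneCoord θ₀ ρ) z u)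
      (mfderiv 𝓘(ℝ, Euc n × ℝ) (𝓘(ℝ, Euc n).prod 𝓘(ℝ, ℝ)) (coneCoord θ₀ ρ) z v) =
    (C.metricCoord i θ₀ ρ z - coneBilin (C.linkMetric i) θ₀ ρ z) u v := by
  have h1 := coneMetric_coneCoord hρ (C.linkMetric i).inner hz.1 u v
  rw [← coneBilin_apply] at h1
  have h2 : C.metricCoord i θ₀ ρ z u v = C.metric.inner (C.param i (coneCoord θ₀ ρ z))
      (mfderiv (𝓘(ℝ, Euc n).prod 𝓘(ℝ, ℝ)) 𝓘(ℝ, Euc (n + 1)) (C.param i) (coneCoord θ₀ ρ z)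
        (mfderiv 𝓘(ℝ, Euc n × ℝ) (𝓘(ℝ, Euc n).prod 𝓘(ℝ, ℝ)) (coneCoord θ₀ ρ) z u))
      (mfderiv (𝓘(ℝ, Euc n).prod 𝓘(ℝ, ℝ)) 𝓘(ℝ, Euc (n + 1)) (C.param i) (coneCoord θ₀ ρ z)
        (mfderiv 𝓘(ℝ, Euc n × ℝ) (𝓘(ℝ, Euc n).prod 𝓘(ℝ, ℝ)) (coneCoord θ₀ ρ) z v)) := by
    rw [← C.mfderiv_endCoord hρ hz, ← C.mfderiv_endCoord hρ hz]
    rfl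
  change _ - _ = C.metricCoord i θ₀ ρ z u v - coneBilin (C.linkMetric i) θ₀ ρ z u v
  rw [h2, ← h1]
  rfl

/-- The asymptotic condition is formulated in the preferred charts of `S i × ℝ`; here it is
transported to the coordinates with radial function `ρ`. The comparison stays over the end itself,
where `r > 0` and both metrics are smooth and nondegenerate. -/
theorem iterNabla_metricDiff (hρ : ContDiff ℝ ∞ ρ) (hρ' : ∀ t, deriv ρ t ≠ 0) {z : Euc n × ℝ}
    (hz : z ∈ C.coordDomain i θ₀ ρ) (j : ℕ) (v : Fin (2 + j) → Euc n × ℝ) :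
    iterNabla (coneMetric (C.linkMetric i).inner) (bilinTensor (C.metricDiff i)) j
      (coneCoord θ₀ ρ z) (fun k =>
        mfderiv 𝓘(ℝ, Euc n × ℝ) (𝓘(ℝ, Euc n).prod 𝓘(ℝ, ℝ)) (coneCoord θ₀ ρ) z (v k)) =
    iterCovDerivMap (coneBilin (C.linkMetric i) θ₀ ρ) (fun z => bilinToMultilinear _
      (C.metricCoord i θ₀ ρ z - coneBilin (C.linkMetric i) θ₀ ρ z)) j z v := by
  set p := coneCoord θ₀ ρ z with hp
  have hW := C.isOpen_coordDomain (i := i) (θ₀ := θ₀) hρ.continuous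
  have hne : ∀ r ∈ (C.kind i).openInterval (C.bound i), r ≠ 0 := fun r hr =>
    ((C.kind i).pos_of_mem_openInterval (C.bound_pos i) hr).ne'
  have hsub : ∀ {θ : S i} {ρ : ℝ → ℝ}, C.coordDomain i θ ρ ⊆
      (extChartAt 𝓘(ℝ, Euc n) θ).target ×ˢ univ := by
    intro θ ρ
    exact Set.prod_mono subset_rfl (subset_univ _)
  have hDs : ∀ {θ : S i} {ρ : ℝ → ℝ}, ContDiff ℝ ∞ ρ → ContDiffOn ℝ ∞ (fun z =>
      bilinToMultilinear _ (C.metricCoord i θ ρ z - coneBilin (C.linkMetric i) θ ρ z))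
      (C.coordDomain i θ ρ) := fun hρ =>
    ((C.contDiffOn_metricCoord hρ).sub
      ((contDiffOn_coneBilin _ hρ).mono hsub)).continuousLinearMap_comp (bilinToMultilinear (Euc n × ℝ))
  have hG : EqOn (bilinInChart (𝓘(ℝ, Euc n).prod 𝓘(ℝ, ℝ)) (coneMetric (C.linkMetric i).inner) p)
      (coneBilin (C.linkMetric i) p.1 fun r => r) (C.coordDomain i p.1 fun r => r) := fun y hy =>
    bilinInChart_coneMetric _ p hy.1
  have hT : ∀ y ∈ C.coordDomain i p.1 (fun r => r), ∀ v : Fin 2 → Euc n × ℝ,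
      tensorInChart (bilinTensor (C.metricDiff i)) p y v = bilinToMultilinear _
        (C.metricCoord i p.1 (fun r => r) y - coneBilin (C.linkMetric i) p.1 (fun r => r) y) v := by
    intro y hy v
    rw [bilinToMultilinear_apply]
    have key : ∀ ψ : Euc n × ℝ → S i × ℝ, ψ = coneCoord p.1 (fun r => r) → ∀ u v : Euc n × ℝ,
        C.metricDiff i (ψ y) (mfderiv 𝓘(ℝ, Euc n × ℝ) (𝓘(ℝ, Euc n).prod 𝓘(ℝ, ℝ)) ψ y u)
          (mfderiv 𝓘(ℝ, Euc n × ℝ) (𝓘(ℝ, Euc n).prod 𝓘(ℝ, ℝ)) ψ y v) =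
        (C.metricCoord i p.1 (fun r => r) y - coneBilin (C.linkMetric i) p.1 (fun r => r) y) u v := by
      rintro _ rfl u v
      exact C.metricDiff_coneCoord contDiff_fun_id hy u v
    exact key _ (extChartAt_prod_symm p) _ _
  have h1 := iterNabla_pullback (coneMetric (C.linkMetric i).inner) (bilinTensor (C.metricDiff i))
    hW ((contMDiffOn_coneCoord hρ).mono hsub)
    (fun w hw => isInvertible_mfderiv_coneCoord hρ hw.1 (hρ' _)) hz
    (C.isOpen_coordDomain (i := i) (θ₀ := p.1) continuous_id') (by
      rw [extChartAt_prod]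
      exact ⟨mem_extChartAt_target _, hz.2⟩) (by
      rw [extChartAt_prod]
      intro y hy
      exact ⟨hy.1, by rw [extChartAt_model_space_eq_id]; exact mem_univ _⟩)
    (((contDiffOn_coneBilin _ contDiff_fun_id).mono hsub).congr hG)
    (fun y hy => by
      rw [hG hy]
      exact isInvertible_coneBilin _ hy.1 (by simp) (hne _ hy.2))
    (fun y hy u v => by
      rw [hG hy]
      exact coneBilin_symm _ y u v)
    hT (hDs contDiff_fun_id) j v
  refine h1.trans ?_
  have h2 : (fun z => pullBilin (W := Euc n × ℝ)
      (coneMetric (C.linkMetric i).inner (coneCoord θ₀ ρ z))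
      (mfderiv 𝓘(ℝ, Euc n × ℝ) (𝓘(ℝ, Euc n).prod 𝓘(ℝ, ℝ)) (coneCoord θ₀ ρ) z)) =ᶠ[𝓝 z]
      coneBilin (C.linkMetric i) θ₀ ρ := by
    filter_upwards [hW.mem_nhds hz] with w hw
    refine ContinuousLinearMap.ext fun u => ContinuousLinearMap.ext fun v => ?_
    rw [coneBilin_apply]
    exact coneMetric_coneCoord hρ _ hw.1 u v
  refine (congrFun (iterCovDeriv_congr h2 .rfl j).eq_of_nhds v).trans ?_
  refine iterCovDeriv_eq_iterCovDerivMap hW ((contDiffOn_coneBilin _ hρ).mono hsub)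
    (fun y hy => isInvertible_coneBilin _ hy.1 (hρ' _) (hne _ hy.2)) (fun y hy v => ?_)
    (hDs hρ) j z hz v
  exact C.metricDiff_coneCoord hρ hy (v 0) (v 1)

theorem metricCoord_pos {σ : ℝ → ℝ} (h : RadialChange ρ σ) {z : Euc n × ℝ}
    (hz : z ∈ C.coordDomain i θ₀ ρ) {w : Euc n × ℝ} (hw : w ≠ 0) :
    0 < C.metricCoord i θ₀ ρ z w w := by
  refine C.metric.pos _ _ fun h0 => hw ?_
  exact (C.isInvertible_mfderiv_endCoord h hz).injective (h0.trans (map_zero _).symm)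

/-- The same transport for 1-forms on `L`, so that their weights can be computed in logarithmic
coordinates. -/
theorem iterNabla_formTensor {σ : ℝ → ℝ} (h : RadialChange ρ σ) {z : Euc n × ℝ}
    (hz : z ∈ C.coordDomain i θ₀ ρ) (j : ℕ) (v : Fin (1 + j) → Euc n × ℝ) :
    iterNabla C.metric.inner (formTensor fun x => α x) j (C.endCoord i θ₀ ρ z) (fun k =>
      mfderiv 𝓘(ℝ, Euc n × ℝ) 𝓘(ℝ, Euc (n + 1)) (C.endCoord i θ₀ ρ) z (v k)) =
    iterCovDerivMap (C.metricCoord i θ₀ ρ) (fun z => linToMultilinear _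
      (localPullback (fun x => α x) (C.endCoord i θ₀ ρ) z)) j z v := by
  set x := C.endCoord i θ₀ ρ z with hx
  have hW := C.isOpen_coordDomain (i := i) (θ₀ := θ₀) h.contDiff.continuous
  have hψ := C.contMDiffOn_endCoord (i := i) (θ₀ := θ₀) h.contDiff
  have h1 := iterNabla_pullback C.metric.inner (formTensor fun x => α x) hW hψ
    (fun w hw => C.isInvertible_mfderiv_endCoord h hw) hz
    (isOpen_extChartAt_target (I := 𝓘(ℝ, Euc (n + 1))) x) (mem_extChartAt_target _) subset_rfl
    (contDiffOn_bilinInChart C.metric.contMDiff _)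
    (fun y hy => isInvertible_bilinInChart C.metric.pos _ hy)
    (fun y hy u v => C.metric.symm _ _ _)
    (T' := fun y => linToMultilinear _ (formInChart 𝓘(ℝ, Euc (n + 1)) (fun x => α x) x y))
    (fun y hy v => rfl)
    ((contDiffOn_formInChart α x).continuousLinearMap_comp (linToMultilinear (Euc (n + 1)))) j v
  refine h1.trans ?_
  exact iterCovDeriv_eq_iterCovDerivMap hW (C.contDiffOn_metricCoord h.contDiff)
    (fun y hy => isInvertible_of_pos fun w hw => C.metricCoord_pos h hy hw) (fun y hy v => rfl)
    ((contDiffOn_localPullback hW hψ α).continuousLinearMap_comp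
      (linToMultilinear (Euc n × ℝ))) j z hz v

end Conifold

theorem BoundedToOrder.mono_set {E : Type} [NormedAddCommGroup E] [NormedSpace ℝ E] {F : Type}
    [NormedAddCommGroup F] [NormedSpace ℝ F] {Ω Ω' : Set E} {w : E → ℝ} {m : ℕ} {f : E → F}
    (h : BoundedToOrder Ω w m f) (hΩ : Ω' ⊆ Ω) : BoundedToOrder Ω' w m f := by
  induction m generalizing F with
  | zero =>
    obtain ⟨C, hC⟩ := h
    exact ⟨C, fun z hz => hC z (hΩ hz)⟩
  | succ m ih =>
    obtain ⟨⟨C, hC⟩, h⟩ := h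
    exact ⟨⟨C, fun z hz => hC z (hΩ hz)⟩, ih h⟩

section ConeBounds
variable {n : ℕ} {S : Type*} [TopologicalSpace S] [ChartedSpace (Euc n) S]
  [IsManifold 𝓘(ℝ, Euc n) ∞ S]
  (g' : ContMDiffRiemannianMetric 𝓘(ℝ, Euc n) ∞ (Euc n) (fun θ : S => TangentSpace 𝓘(ℝ, Euc n) θ))
  {θ₀ : S} {y₀ : Euc n} {δ : ℝ}

/-- With `r = exp t` the conical metric is `exp(2t)(dt² + g')`: an exponential, which bounds its own
derivatives, times a field depending only on the point of a relatively compact ball. -/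
theorem boundedToOrder_coneBilin
    (hball : Metric.closedBall y₀ δ ⊆ (extChartAt 𝓘(ℝ, Euc n) θ₀).target) (T : ℝ) (m : ℕ) :
    BoundedToOrder (Metric.ball y₀ δ ×ˢ Ioi T) (fun z : Euc n × ℝ => Real.exp (2 * z.2)) m
      (coneBilin g' θ₀ Real.exp) := by
  set Ω : Set (Euc n × ℝ) := Metric.ball y₀ δ ×ˢ Ioi T
  have hΩ : IsOpen Ω := Metric.isOpen_ball.prod isOpen_Ioi
  let f : Euc n → (Euc n × ℝ) →L[ℝ] (Euc n × ℝ) →L[ℝ] ℝ := fun y =>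
    (ContinuousLinearMap.snd ℝ (Euc n) ℝ).smulRight (ContinuousLinearMap.snd ℝ (Euc n) ℝ) +
      pullBilin (bilinInChart 𝓘(ℝ, Euc n) g'.inner θ₀ y) (ContinuousLinearMap.fst ℝ (Euc n) ℝ)
  have hf : ContDiffOn ℝ ∞ f (extChartAt 𝓘(ℝ, Euc n) θ₀).target :=
    contDiffOn_const.add (contDiffOn_pullBilin (contDiffOn_bilinInChart g'.contMDiff θ₀)
      contDiffOn_const)
  have h2 : BoundedToOrder (Metric.ball y₀ δ) (fun _ => 1) m f :=
    boundedToOrder_of_isCompact (isOpen_extChartAt_target θ₀) (isCompact_closedBall y₀ δ) hball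
      Metric.ball_subset_closedBall hf m
  have hf' := hf.mono (Metric.ball_subset_closedBall.trans hball)
  have h3 := h2.comp_clm Metric.isOpen_ball hΩ hf' (ContinuousLinearMap.fst ℝ (Euc n) ℝ)
    fun z hz => hz.1
  have hs : ContDiffOn ℝ ∞ (fun z : Euc n × ℝ => f (ContinuousLinearMap.fst ℝ (Euc n) ℝ z)) Ω :=
    hf'.comp (ContinuousLinearMap.contDiff _).contDiffOn fun z hz => hz.1
  let A : (Euc n × ℝ) →L[ℝ] ℝ := (2 : ℝ) • ContinuousLinearMap.snd ℝ (Euc n) ℝ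
  have h4 := (boundedToOrder_exp Ω A m).bilinear hΩ h3
    (Real.contDiff_exp.comp A.contDiff).contDiffOn hs
    (ContinuousLinearMap.lsmul ℝ ℝ)
  refine h4.one_right.congr hΩ fun z _ => ?_
  change Real.exp (2 * z.2) • f z.1 = _
  simp only [f, coneBilin, Real.deriv_exp, smul_add]
  rw [← Real.exp_nat_mul]
  rfl

/-- In the same factorisation `dt²` has coefficient one and `g' ≥ c` over the compact ball, so the
product metric dominates `min 1 c` times the square of the norm of the product. -/
theorem exists_le_coneBilin
    (hball : Metric.closedBall y₀ δ ⊆ (extChartAt 𝓘(ℝ, Euc n) θ₀).target) :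
    ∃ c : ℝ, 0 < c ∧ ∀ z : Euc n × ℝ, z.1 ∈ Metric.ball y₀ δ → ∀ w : Euc n × ℝ,
      c * Real.exp (2 * z.2) * ‖w‖ ^ 2 ≤ coneBilin g' θ₀ Real.exp z w w := by
  obtain ⟨c, hc, h⟩ := exists_le_bilinInChart g' (isCompact_closedBall y₀ δ) hball
  refine ⟨min 1 c, lt_min one_pos hc, fun z hz w => ?_⟩
  have h1 := h z.1 (Metric.ball_subset_closedBall hz) w.1
  have h2 : coneBilin g' θ₀ Real.exp z w w =
      Real.exp (2 * z.2) * (w.2 ^ 2 + bilinInChart 𝓘(ℝ, Euc n) g'.inner θ₀ z.1 w.1 w.1) := by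
    have : Real.exp (2 * z.2) = Real.exp z.2 ^ 2 := by
      rw [← Real.exp_nat_mul]
      norm_num
    rw [coneBilin_apply, coneMetricCoord, Real.deriv_exp, this]
    ring
  rw [h2, mul_comm _ (Real.exp _), mul_assoc]
  refine mul_le_mul_of_nonneg_left ?_ (Real.exp_pos _).le
  have h3 : ‖w‖ ^ 2 ≤ w.2 ^ 2 + ‖w.1‖ ^ 2 := by
    rcases max_choice ‖w.1‖ ‖w.2‖ with h | h <;> rw [Prod.norm_def, h]
    · linarith [sq_nonneg w.2]
    · rw [Real.norm_eq_abs, sq_abs]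
      linarith [sq_nonneg ‖w.1‖]
  calc min 1 c * ‖w‖ ^ 2 ≤ min 1 c * (w.2 ^ 2 + ‖w.1‖ ^ 2) :=
        mul_le_mul_of_nonneg_left h3 (lt_min one_pos hc).le
    _ = min 1 c * w.2 ^ 2 + min 1 c * ‖w.1‖ ^ 2 := by ring
    _ ≤ 1 * w.2 ^ 2 + c * ‖w.1‖ ^ 2 := by
        gcongr
        · exact min_le_left _ _
        · exact min_le_right _ _
    _ ≤ _ := by linarith

end ConeBounds

/-- Coercivity bounds the inverse metric by `c⁻¹ exp(-2t)`, the weight reciprocal to that of the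
metric. -/
theorem boundedToOrder_christoffelMap_of_coercive {n : ℕ} {Ω : Set (Euc n × ℝ)} (hΩ : IsOpen Ω)
    {G : Euc n × ℝ → (Euc n × ℝ) →L[ℝ] (Euc n × ℝ) →L[ℝ] ℝ} (hG : ContDiffOn ℝ ∞ G Ω)
    (hinv : ∀ z ∈ Ω, (G z).IsInvertible) {c : ℝ} (hc : 0 < c)
    (hcoer : ∀ z ∈ Ω, ∀ w, c * Real.exp (2 * z.2) * ‖w‖ ^ 2 ≤ G z w w)
    (h : ∀ m, BoundedToOrder Ω (fun z : Euc n × ℝ => Real.exp (2 * z.2)) m G) (m : ℕ) :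
    BoundedToOrder Ω (fun _ => 1) m (christoffelMap G) := by
  refine BoundedToOrder.christoffelMap (w₁ := fun z : Euc n × ℝ => Real.exp (-(2 * z.2)))
    hΩ hG hinv h (fun z _ => ?_) ⟨c⁻¹, fun z hz => ?_⟩ m
  · rw [← Real.exp_add, add_neg_cancel, Real.exp_zero]
  · refine (norm_inverse_le_of_coercive (hinv z hz) (by positivity) (hcoer z hz)).trans (le_of_eq ?_)
    rw [mul_inv, ← Real.exp_neg]

namespace Conifold

variable {n : ℕ} {L : Type*} [TopologicalSpace L] [ChartedSpace (Euc (n + 1)) L]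
  [IsManifold 𝓘(ℝ, Euc (n + 1)) ∞ L] {ι : Type*} {S : ι → Type*}
  [∀ i, TopologicalSpace (S i)] [∀ i, ChartedSpace (Euc n) (S i)]
  [∀ i, IsManifold 𝓘(ℝ, Euc n) ∞ (S i)] (C : Conifold n L S) {i : ι}
  {θ₀ : S i} {α : OneForm (Euc (n + 1)) L}

/-- In the coordinates `(y, t)` with `r = exp t`, the metric of an AC end is comparable to
`exp (2 t)`, with all its derivatives. -/
theorem exists_boundedToOrder_metricCoord (hi : C.kind i = .ac) {y₀ : Euc n} {δ : ℝ}
    (hball : Metric.closedBall y₀ δ ⊆ (extChartAt 𝓘(ℝ, Euc n) θ₀).target) :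
    ∃ T : ℝ, Metric.ball y₀ δ ×ˢ Ioi T ⊆ C.coordDomain i θ₀ Real.exp ∧
      (∃ c : ℝ, 0 < c ∧ ∀ z ∈ Metric.ball y₀ δ ×ˢ Ioi T, ∀ w : Euc n × ℝ,
        c * Real.exp (2 * z.2) * ‖w‖ ^ 2 ≤ C.metricCoord i θ₀ Real.exp z w w) ∧
      ∀ m, BoundedToOrder (Metric.ball y₀ δ ×ˢ Ioi T)
        (fun z : Euc n × ℝ => Real.exp (2 * z.2)) m (C.metricCoord i θ₀ Real.exp) := by
  have h0 := C.eventually_metric_sub_coneCoord_le i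
  rw [hi] at h0
  obtain ⟨R, hR⟩ := eventually_atTop.1 h0
  -- `R'` lies in the range where the metrics are comparable and inside the end, and it exceeds `1`,
  -- so that `T = log R'` is positive.
  set R' := max R (max (C.bound i) 1) + 1 with hR'
  have hR1 : R ≤ R' := by linarith [le_max_left R (max (C.bound i) 1)]
  have hR2 : C.bound i < R' := by
    linarith [le_max_right R (max (C.bound i) 1), le_max_left (C.bound i) 1]
  have hR3 : 1 < R' := by
    linarith [le_max_right R (max (C.bound i) 1), le_max_right (C.bound i) 1]
  set T := Real.log R' with hT
  have hexpT : Real.exp T = R' := Real.exp_log (by linarith)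
  have hT0 : 0 < T := Real.log_pos hR3
  set Ω : Set (Euc n × ℝ) := Metric.ball y₀ δ ×ˢ Ioi T with hΩdef
  have hΩ : IsOpen Ω := Metric.isOpen_ball.prod isOpen_Ioi
  have hexp : ∀ t, T ≤ t → R' ≤ Real.exp t := fun t ht => hexpT ▸ Real.exp_le_exp.2 ht
  have hdom : Metric.closedBall y₀ δ ×ˢ Ici T ⊆ C.coordDomain i θ₀ Real.exp := fun z hz => by
    refine ⟨hball hz.1, ?_⟩
    rw [mem_preimage, hi]
    exact hR2.trans_le (hexp _ hz.2)
  have hΩd : Ω ⊆ C.coordDomain i θ₀ Real.exp :=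
    (Set.prod_mono Metric.ball_subset_closedBall Ioi_subset_Ici_self).trans hdom
  have hGs := C.contDiffOn_metricCoord (i := i) (θ₀ := θ₀) Real.contDiff_exp
  have hG's : ContDiffOn ℝ ∞ (coneBilin (C.linkMetric i) θ₀ Real.exp)
      (C.coordDomain i θ₀ Real.exp) := (contDiffOn_coneBilin _ Real.contDiff_exp).mono
        (Set.prod_mono subset_rfl (subset_univ _))
  have hderiv : ∀ t, deriv Real.exp t ≠ 0 := fun t => by
    rw [Real.deriv_exp]
    exact (Real.exp_pos t).ne'
  have hinv' : ∀ z ∈ C.coordDomain i θ₀ Real.exp,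
      (coneBilin (C.linkMetric i) θ₀ Real.exp z).IsInvertible := fun z hz =>
    isInvertible_coneBilin _ hz.1 (hderiv _) (Real.exp_pos _).ne'
  obtain ⟨c, hc, hcoer⟩ := exists_le_coneBilin (C.linkMetric i) hball
  have hcone := boundedToOrder_coneBilin (C.linkMetric i) hball T
  have hΓ := boundedToOrder_christoffelMap_of_coercive hΩ (hG's.mono hΩd)
    (fun z hz => hinv' z (hΩd hz)) hc (fun z hz => hcoer z hz.1) hcone
  obtain ⟨M, hM⟩ := (hcone 0).bound
  set D : Euc n × ℝ → (Euc n × ℝ) [×2]→L[ℝ] ℝ := fun z => bilinToMultilinear _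
    (C.metricCoord i θ₀ Real.exp z - coneBilin (C.linkMetric i) θ₀ Real.exp z) with hD
  have hDs : ContDiffOn ℝ ∞ D (C.coordDomain i θ₀ Real.exp) :=
    (hGs.sub hG's).continuousLinearMap_comp (bilinToMultilinear (Euc n × ℝ))
  -- The `j`-th asymptotic estimate holds only for `r ≥ Rj`. The region `T ≤ t ≤ Rj` is handled by
  -- compactness, and for `t > Rj` the estimate applies since `exp t ≥ t + 1 > Rj`.
  have hcov : ∀ j, BoundedToOrder Ω (fun z : Euc n × ℝ => Real.exp (2 * z.2)) 0
      (iterCovDerivMap (coneBilin (C.linkMetric i) θ₀ Real.exp) D j) := by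
    intro j
    obtain ⟨K, hK⟩ := C.asymptotic i j
    rw [eventually_comap, hi] at hK
    obtain ⟨Rj, hRj⟩ := eventually_atTop.1 hK
    have hν : C.rate i < 0 := by
      have := C.rateSign i
      rwa [hi] at this
    have hDc := (contDiffOn_iterCovDerivMap (C.isOpen_coordDomain (i := i) (θ₀ := θ₀)
      Real.continuous_exp) hG's hinv' hDs j).continuousOn
    obtain ⟨A, hA⟩ := ((isCompact_closedBall y₀ δ).prod
      (isCompact_Icc (a := T) (b := Rj))).exists_bound_of_continuousOn
        (hDc.mono ((Set.prod_mono subset_rfl Icc_subset_Ici_self).trans hdom))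
    refine ⟨max A 0 + |K| * √|M| ^ (2 + j), fun z hz => ?_⟩
    have ht0 : 0 < z.2 := hT0.trans hz.2
    have he1 : 1 ≤ Real.exp (2 * z.2) := Real.one_le_exp (by linarith)
    have hP : 0 ≤ |K| * √|M| ^ (2 + j) := by positivity
    by_cases hzR : z.2 ≤ Rj
    · have h1 := hA z ⟨Metric.ball_subset_closedBall hz.1, hz.2.le, hzR⟩
      calc _ ≤ max A 0 * 1 := by rw [mul_one]; exact h1.trans (le_max_left _ _)
        _ ≤ (max A 0 + |K| * √|M| ^ (2 + j)) * Real.exp (2 * z.2) :=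
          mul_le_mul (le_add_of_nonneg_right hP) he1 zero_le_one
            (add_nonneg (le_max_right _ _) hP)
    · have hzR' : Rj ≤ Real.exp z.2 :=
        (not_le.1 hzR).le.trans ((le_add_of_nonneg_right zero_le_one).trans (Real.add_one_le_exp _))
      have h2 : ‖iterCovDerivMap (coneBilin (C.linkMetric i) θ₀ Real.exp) D j z‖ ≤
          |K| * √|M| ^ (2 + j) * Real.exp (2 * z.2) := by
        refine ContinuousMultilinearMap.opNorm_le_bound (by positivity) fun v => ?_
        have h3 := C.iterNabla_metricDiff Real.contDiff_exp hderiv (hΩd hz) j v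
        have h4 := hRj _ hzR' (coneCoord θ₀ Real.exp z) rfl fun k =>
          mfderiv 𝓘(ℝ, Euc n × ℝ) (𝓘(ℝ, Euc n).prod 𝓘(ℝ, ℝ)) (coneCoord θ₀ Real.exp) z (v k)
        rw [Real.norm_eq_abs, ← h3]
        refine h4.trans ?_
        have h5 : ∀ w : Euc n × ℝ, √(coneMetric (C.linkMetric i).inner (coneCoord θ₀ Real.exp z)
            (mfderiv 𝓘(ℝ, Euc n × ℝ) (𝓘(ℝ, Euc n).prod 𝓘(ℝ, ℝ)) (coneCoord θ₀ Real.exp) z w)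
            (mfderiv 𝓘(ℝ, Euc n × ℝ) (𝓘(ℝ, Euc n).prod 𝓘(ℝ, ℝ)) (coneCoord θ₀ Real.exp) z w)) ≤
            √|M| * Real.exp z.2 * ‖w‖ := by
          intro w
          rw [coneMetric_coneCoord Real.contDiff_exp _ (hΩd hz).1, ← coneBilin_apply]
          have h6 : coneBilin (C.linkMetric i) θ₀ Real.exp z w w ≤
              (√|M| * Real.exp z.2 * ‖w‖) ^ 2 := by
            have h7 : Real.exp (2 * z.2) = Real.exp z.2 ^ 2 := by
              rw [← Real.exp_nat_mul]
              norm_num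
            rw [mul_pow, mul_pow, Real.sq_sqrt (abs_nonneg M), ← h7]
            calc coneBilin (C.linkMetric i) θ₀ Real.exp z w w
                ≤ ‖coneBilin (C.linkMetric i) θ₀ Real.exp z w w‖ := le_abs_self _
              _ ≤ ‖coneBilin (C.linkMetric i) θ₀ Real.exp z‖ * ‖w‖ * ‖w‖ :=
                ContinuousLinearMap.le_opNorm₂ _ w w
              _ ≤ |M| * Real.exp (2 * z.2) * ‖w‖ * ‖w‖ := by
                gcongr
                exact (hM z hz).trans (mul_le_mul_of_nonneg_right (le_abs_self M)
                  (Real.exp_pos _).le)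
              _ = _ := by ring
          exact (Real.sqrt_le_sqrt h6).trans (by rw [Real.sqrt_sq (by positivity)])
        have h8 : (∏ k : Fin (2 + j), √(coneMetric (C.linkMetric i).inner (coneCoord θ₀ Real.exp z)
            (mfderiv 𝓘(ℝ, Euc n × ℝ) (𝓘(ℝ, Euc n).prod 𝓘(ℝ, ℝ)) (coneCoord θ₀ Real.exp) z (v k))
            (mfderiv 𝓘(ℝ, Euc n × ℝ) (𝓘(ℝ, Euc n).prod 𝓘(ℝ, ℝ)) (coneCoord θ₀ Real.exp) z (v k)))) ≤
            ∏ k, (√|M| * Real.exp z.2 * ‖v k‖) :=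
          Finset.prod_le_prod (fun _ _ => Real.sqrt_nonneg _) fun k _ => h5 (v k)
        rw [Finset.prod_mul_distrib, Finset.prod_const, Finset.card_univ, Fintype.card_fin] at h8
        -- Each of the `2 + j` arguments has conical length at most `√|M| exp(t) ‖v‖`. The total
        -- exponent is `(ν - j) + (2 + j) = ν + 2`, less than `2` because `ν < 0`, and `t > 0`.
        have h9 : Real.exp z.2 ^ (C.rate i - (j : ℝ)) * Real.exp z.2 ^ (2 + j) ≤
            Real.exp (2 * z.2) := by
          rw [← Real.rpow_natCast, ← Real.rpow_add (Real.exp_pos _), ← Real.exp_mul]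
          refine Real.exp_le_exp.2 ?_
          push_cast
          nlinarith
        have h10 : (0 : ℝ) ≤ Real.exp z.2 ^ (C.rate i - (j : ℝ)) :=
          Real.rpow_nonneg (Real.exp_pos _).le _
        change K * Real.exp z.2 ^ (C.rate i - (j : ℝ)) * _ ≤ _
        calc _ ≤ |K| * Real.exp z.2 ^ (C.rate i - (j : ℝ)) *
              ((√|M| * Real.exp z.2) ^ (2 + j) * ∏ k, ‖v k‖) :=
              mul_le_mul (mul_le_mul_of_nonneg_right (le_abs_self K) h10) h8
                (Finset.prod_nonneg fun _ _ => Real.sqrt_nonneg _) (by positivity)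
          _ = |K| * √|M| ^ (2 + j) *
              (Real.exp z.2 ^ (C.rate i - (j : ℝ)) * Real.exp z.2 ^ (2 + j)) * ∏ k, ‖v k‖ := by
              rw [mul_pow]; ring
          _ ≤ _ := by gcongr
      refine h2.trans (mul_le_mul_of_nonneg_right ?_ (Real.exp_pos _).le)
      exact le_add_of_nonneg_left (le_max_right _ _)
  -- The factor `1 / 2` is the comparison of `g` with the conical metric.
  refine ⟨T, hΩd, ⟨1 / 2 * c, by positivity, fun z hz w => ?_⟩, fun m => ?_⟩
  · have h1 := hR (Real.exp z.2) (hR1.trans (hexp _ (le_of_lt hz.2))) θ₀ Real.exp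
      Real.contDiff_exp z (hΩd hz) rfl w
    have h2 := hcoer z hz.1 w
    rw [coneBilin_apply] at h2
    have h3 := (abs_le.1 h1).1
    change _ ≤ C.metric.inner (C.endCoord i θ₀ Real.exp z)
      (mfderiv 𝓘(ℝ, Euc n × ℝ) 𝓘(ℝ, Euc (n + 1)) (C.endCoord i θ₀ Real.exp) z w)
      (mfderiv 𝓘(ℝ, Euc n × ℝ) 𝓘(ℝ, Euc (n + 1)) (C.endCoord i θ₀ Real.exp) z w)
    linarith
  -- The bounds on the conical covariant derivatives of the difference become bounds on its partial
  -- derivatives; adding the conical metric gives those of `g`.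
  · have h1 := boundedToOrder_of_iterCovDerivMap hΩ (hG's.mono hΩd)
      (fun z hz => hinv' z (hΩd hz)) hΓ (hDs.mono hΩd) hcov m 0
    have h2 := h1.clm hΩ (hDs.mono hΩd) (multilinearToBilin (Euc n × ℝ))
    have h3 := (hcone m).add hΩ h2 (hG's.mono hΩd)
      ((hDs.mono hΩd).continuousLinearMap_comp (multilinearToBilin (Euc n × ℝ)))
    refine h3.congr hΩ fun z _ => ?_
    change _ + (C.metricCoord i θ₀ Real.exp z - coneBilin (C.linkMetric i) θ₀ Real.exp z) = _
    exact add_sub_cancel _ _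

end Conifold

/-! ### Representatives on AC ends which do not depend on the radial variable -/

namespace Conifold

variable {n : ℕ} {L : Type*} [TopologicalSpace L] [ChartedSpace (Euc (n + 1)) L]
  [IsManifold 𝓘(ℝ, Euc (n + 1)) ∞ L] {ι : Type*} {S : ι → Type*}
  [∀ i, TopologicalSpace (S i)] [∀ i, ChartedSpace (Euc n) (S i)]
  [∀ i, IsManifold 𝓘(ℝ, Euc n) ∞ (S i)] {C : Conifold n L S} {i : ι}
  {θ₀ : S i} {α : OneForm (Euc (n + 1)) L}

/-- A 1-form which does not depend on the radial variable has weight `-1` on an AC end. -/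
theorem exists_iterNabla_le_of_radially_constant (hi : C.kind i = .ac) {y₀ : Euc n} {δ : ℝ}
    (hball : Metric.closedBall y₀ δ ⊆ (extChartAt 𝓘(ℝ, Euc n) θ₀).target)
    {a : Euc n → Euc n →L[ℝ] ℝ} (ha : ContDiffOn ℝ ∞ a (extChartAt 𝓘(ℝ, Euc n) θ₀).target) {T₀ : ℝ}
    (hα : ∀ z ∈ Metric.ball y₀ δ ×ˢ Ioi T₀, localPullback (fun x => α x)
      (C.endCoord i θ₀ Real.exp) z = (a z.1).comp (ContinuousLinearMap.fst ℝ (Euc n) ℝ)) (j : ℕ) :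
    ∃ K T : ℝ, ∀ z ∈ Metric.ball y₀ δ ×ˢ Ioi T,
      ∀ v : Fin (1 + j) → TangentSpace 𝓘(ℝ, Euc (n + 1)) (C.endCoord i θ₀ Real.exp z),
      |iterNabla C.metric.inner (formTensor fun x => α x) j (C.endCoord i θ₀ Real.exp z) v| ≤
        K * Real.exp z.2 ^ (-1 - j : ℝ) *
          ∏ k, √(C.metric.inner (C.endCoord i θ₀ Real.exp z) (v k) (v k)) := by
  obtain ⟨T₁, hdom, ⟨c, hc, hcoer⟩, hG⟩ := C.exists_boundedToOrder_metricCoord hi hball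
  set Ω : Set (Euc n × ℝ) := Metric.ball y₀ δ ×ˢ Ioi (max T₀ T₁) with hΩdef
  have hΩ : IsOpen Ω := Metric.isOpen_ball.prod isOpen_Ioi
  have hΩ₁ : Ω ⊆ Metric.ball y₀ δ ×ˢ Ioi T₁ :=
    Set.prod_mono subset_rfl (Ioi_subset_Ioi (le_max_right _ _))
  have hΩ₀ : Ω ⊆ Metric.ball y₀ δ ×ˢ Ioi T₀ :=
    Set.prod_mono subset_rfl (Ioi_subset_Ioi (le_max_left _ _))
  have hΩd := hΩ₁.trans hdom
  have hGs := (C.contDiffOn_metricCoord (i := i) (θ₀ := θ₀) Real.contDiff_exp).mono hΩd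
  have hinv : ∀ z ∈ Ω, (C.metricCoord i θ₀ Real.exp z).IsInvertible := fun z hz =>
    isInvertible_of_pos fun w hw => C.metricCoord_pos RadialChange.exp (hΩd hz) hw
  have hΓ := boundedToOrder_christoffelMap_of_coercive hΩ hGs hinv hc
    (fun z hz => hcoer z (hΩ₁ hz)) fun m => (hG m).mono_set hΩ₁
  let Λ : (Euc n →L[ℝ] ℝ) →L[ℝ] (Euc n × ℝ) [×1]→L[ℝ] ℝ :=
    (linToMultilinear (Euc n × ℝ)).comp
      ((ContinuousLinearMap.compL ℝ (Euc n × ℝ) (Euc n) ℝ).flip (ContinuousLinearMap.fst ℝ (Euc n) ℝ))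
  set η : Euc n × ℝ → (Euc n × ℝ) [×1]→L[ℝ] ℝ := fun z => linToMultilinear _
    (localPullback (fun x => α x) (C.endCoord i θ₀ Real.exp) z) with hη
  have hηs : ContDiffOn ℝ ∞ η Ω :=
    ((contDiffOn_localPullback (C.isOpen_coordDomain Real.continuous_exp)
      (C.contMDiffOn_endCoord (i := i) (θ₀ := θ₀) Real.contDiff_exp) α).mono hΩd).continuousLinearMap_comp
      (linToMultilinear (Euc n × ℝ))
  have ha' := ha.mono (Metric.ball_subset_closedBall.trans hball)
  -- In coordinates the form depends only on the point of a relatively compact ball, so its partial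
  -- derivatives are bounded; as the Christoffel symbols are bounded, so are its covariant
  -- derivatives.
  have hηb : ∀ m, BoundedToOrder Ω (fun _ => 1) m η := fun m => by
    have h1 : BoundedToOrder (Metric.ball y₀ δ) (fun _ => 1) m a :=
      boundedToOrder_of_isCompact (isOpen_extChartAt_target θ₀) (isCompact_closedBall y₀ δ) hball
        Metric.ball_subset_closedBall ha m
    have h2 := h1.comp_clm Metric.isOpen_ball hΩ ha' (ContinuousLinearMap.fst ℝ (Euc n) ℝ)
      fun z hz => hz.1
    have h3 := h2.clm hΩ (ha'.comp (ContinuousLinearMap.contDiff _).contDiffOn fun z hz => hz.1) Λ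
    refine h3.congr hΩ fun z hz => ?_
    rw [hη]
    dsimp only
    rw [hα z (hΩ₀ hz)]
    rfl
  obtain ⟨K, hK⟩ := (BoundedToOrder.iterCovDerivMap hΩ hGs hinv hΓ hηs hηb j 0).bound
  refine ⟨|K| * (√c)⁻¹ ^ (1 + j), max T₀ T₁, fun z hz v => ?_⟩
  have hsurj : ∀ k, ∃ w : Euc n × ℝ,
      mfderiv 𝓘(ℝ, Euc n × ℝ) 𝓘(ℝ, Euc (n + 1)) (C.endCoord i θ₀ Real.exp) z w = v k := fun k =>
    (C.isInvertible_mfderiv_endCoord RadialChange.exp (hΩd hz)).surjective (v k)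
  choose w hw using hsurj
  obtain rfl : (fun k => mfderiv 𝓘(ℝ, Euc n × ℝ) 𝓘(ℝ, Euc (n + 1)) (C.endCoord i θ₀ Real.exp) z
    (w k)) = v := funext hw
  rw [C.iterNabla_formTensor RadialChange.exp (hΩd hz) j w]
  -- Coercivity compares the coordinate norm with the length for `g`, with a factor `exp(-t) = r⁻¹`.
  -- The `1 + j` arguments of `∇^j α` produce the decay `r ^ (-1 - j)`.
  have h1 : ∀ u : Euc n × ℝ, ‖u‖ ≤ (√c)⁻¹ * (Real.exp z.2)⁻¹ *
      √(C.metricCoord i θ₀ Real.exp z u u) := by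
    intro u
    have h2 := Real.sqrt_le_sqrt (hcoer z (hΩ₁ hz) u)
    have h3 : c * Real.exp (2 * z.2) * ‖u‖ ^ 2 = c * (Real.exp z.2 * ‖u‖) ^ 2 := by
      have : Real.exp (2 * z.2) = Real.exp z.2 ^ 2 := by
        rw [← Real.exp_nat_mul]
        norm_num
      rw [this]
      ring
    rw [h3, Real.sqrt_mul hc.le, Real.sqrt_sq (by positivity)] at h2
    have hsc : 0 < √c := Real.sqrt_pos.2 hc
    calc ‖u‖ = (√c)⁻¹ * (Real.exp z.2)⁻¹ * (√c * (Real.exp z.2 * ‖u‖)) := by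
          field_simp
      _ ≤ _ := mul_le_mul_of_nonneg_left h2 (by positivity)
  have h4 : (∏ k, ‖w k‖) ≤ ∏ k, ((√c)⁻¹ * (Real.exp z.2)⁻¹ *
      √(C.metricCoord i θ₀ Real.exp z (w k) (w k))) :=
    Finset.prod_le_prod (fun _ _ => norm_nonneg _) fun k _ => h1 (w k)
  rw [Finset.prod_mul_distrib, Finset.prod_const, Finset.card_univ, Fintype.card_fin, mul_pow] at h4
  have h5 : (Real.exp z.2)⁻¹ ^ (1 + j) = Real.exp z.2 ^ (-1 - j : ℝ) := by
    rw [inv_pow, ← Real.rpow_natCast, ← Real.rpow_neg (Real.exp_pos _).le]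
    congr 1
    push_cast
    ring
  rw [h5] at h4
  have h6 := (iterCovDerivMap (C.metricCoord i θ₀ Real.exp) η j z).le_opNorm w
  rw [Real.norm_eq_abs] at h6
  refine h6.trans ?_
  have h7 : ‖iterCovDerivMap (C.metricCoord i θ₀ Real.exp) η j z‖ ≤ |K| := by
    have := hK z hz
    rw [mul_one] at this
    exact this.trans (le_abs_self K)
  refine (mul_le_mul h7 h4 (Finset.prod_nonneg fun _ _ => norm_nonneg _) (abs_nonneg K)).trans ?_
  rw [← mul_assoc, ← mul_assoc]
  exact le_refl _

/-- The estimates hold near each point of the link with constants depending on the point;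
compactness of the link makes them uniform. -/
theorem weightAt_neg_one_of_radially_constant [CompactSpace (S i)] (hi : C.kind i = .ac)
    (h : ∀ θ₀ : S i, ∃ δ > 0, Metric.closedBall (extChartAt 𝓘(ℝ, Euc n) θ₀ θ₀) δ ⊆
        (extChartAt 𝓘(ℝ, Euc n) θ₀).target ∧ ∃ a : Euc n → Euc n →L[ℝ] ℝ,
      ContDiffOn ℝ ∞ a (extChartAt 𝓘(ℝ, Euc n) θ₀).target ∧ ∃ T₀ : ℝ,
      ∀ z ∈ Metric.ball (extChartAt 𝓘(ℝ, Euc n) θ₀ θ₀) δ ×ˢ Ioi T₀, localPullback (fun x => α x)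
        (C.endCoord i θ₀ Real.exp) z = (a z.1).comp (ContinuousLinearMap.fst ℝ (Euc n) ℝ)) :
    C.WeightAt i (-1) (formTensor (I := 𝓘(ℝ, Euc (n + 1))) fun x => α x) := by
  intro j
  suffices H : ∃ K R : ℝ, ∀ θ ∈ (univ : Set (S i)), ∀ r > R,
      ∀ v : Fin (1 + j) → TangentSpace 𝓘(ℝ, Euc (n + 1)) (C.param i (θ, r)),
      |iterNabla C.metric.inner (formTensor fun x => α x) j (C.param i (θ, r)) v| ≤
        K * r ^ (-1 - j : ℝ) * ∏ k, √(C.metric.inner (C.param i (θ, r)) (v k) (v k)) by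
    obtain ⟨K, R, H⟩ := H
    refine ⟨K, C.eventually_endFilter.2 ?_⟩
    have h1 := EndKind.openInterval_mem_radial (C.bound_pos i) (C.kind i)
    have h2 : Ioi R ∈ (C.kind i).radial := by
      rw [hi]
      exact Ioi_mem_atTop R
    filter_upwards [h1, h2] with r hr hr' θ v
    rw [C.radius_param ((C.kind i).openInterval_subset hr)]
    exact H θ (mem_univ _) r hr' v
  refine isCompact_univ.induction_on (p := fun s => ∃ K R : ℝ, ∀ θ ∈ s, ∀ r > R,
      ∀ v : Fin (1 + j) → TangentSpace 𝓘(ℝ, Euc (n + 1)) (C.param i (θ, r)),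
      |iterNabla C.metric.inner (formTensor fun x => α x) j (C.param i (θ, r)) v| ≤
        K * r ^ (-1 - j : ℝ) * ∏ k, √(C.metric.inner (C.param i (θ, r)) (v k) (v k)))
    ⟨0, 0, fun θ hθ => hθ.elim⟩ ?_ ?_ fun θ₀ _ => ?_
  · rintro s t hst ⟨K, R, H⟩
    exact ⟨K, R, fun θ hθ => H θ (hst hθ)⟩
  · rintro s t ⟨K, R, H⟩ ⟨K', R', H'⟩
    -- The bound `0` on the radius keeps `r ^ (-1 - j)` nonnegative, so that enlarging the constant
    -- weakens the estimate.
    refine ⟨max K K', max (max R R') 0, fun θ hθ r hr v => ?_⟩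
    obtain ⟨hr1, hr0⟩ := max_lt_iff.1 hr
    obtain ⟨hr1, hr2⟩ := max_lt_iff.1 hr1
    have hn : 0 ≤ r ^ (-1 - j : ℝ) := Real.rpow_nonneg hr0.le _
    have hp : 0 ≤ ∏ k, √(C.metric.inner (C.param i (θ, r)) (v k) (v k)) :=
      Finset.prod_nonneg fun _ _ => Real.sqrt_nonneg _
    rcases hθ with hθ | hθ
    · exact (H θ hθ r hr1 v).trans (mul_le_mul_of_nonneg_right
        (mul_le_mul_of_nonneg_right (le_max_left _ _) hn) hp)
    · exact (H' θ hθ r hr2 v).trans (mul_le_mul_of_nonneg_right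
        (mul_le_mul_of_nonneg_right (le_max_right _ _) hn) hp)
  · obtain ⟨δ, hδ, hball, a, ha, T₀, hT₀⟩ := h θ₀
    obtain ⟨K, T, hK⟩ := exists_iterNabla_le_of_radially_constant hi hball ha hT₀ j
    refine ⟨_, mem_nhdsWithin_of_mem_nhds (chartBall_mem_nhds (n := n) θ₀ hδ), K, Real.exp T,
      fun θ hθ r hr => ?_⟩
    have hr0 : 0 < r := (Real.exp_pos T).trans hr
    have h1 := hK (extChartAt 𝓘(ℝ, Euc n) θ₀ θ, Real.log r)
      ⟨hθ.2, (Real.lt_log_iff_exp_lt hr0).2 hr⟩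
    have h2 : C.endCoord i θ₀ Real.exp (extChartAt 𝓘(ℝ, Euc n) θ₀ θ, Real.log r) =
        C.param i (θ, r) := by
      rw [endCoord, coneCoord, (extChartAt 𝓘(ℝ, Euc n) θ₀).left_inv hθ.1, Real.exp_log hr0]
    rw [h2, Real.exp_log hr0] at h1
    exact h1

/-- The set of points whose coordinates are in a ball. -/
def chartBall (θ₀ : S i) (δ : ℝ) : Set (S i) :=
  (extChartAt 𝓘(ℝ, Euc n) θ₀).source ∩
    extChartAt 𝓘(ℝ, Euc n) θ₀ ⁻¹' Metric.ball (extChartAt 𝓘(ℝ, Euc n) θ₀ θ₀) δ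

theorem symm_mem_chartBall {θ₀ : S i} {δ : ℝ}
    (hball : Metric.closedBall (extChartAt 𝓘(ℝ, Euc n) θ₀ θ₀) δ ⊆
      (extChartAt 𝓘(ℝ, Euc n) θ₀).target) {y : Euc n}
    (hy : y ∈ Metric.ball (extChartAt 𝓘(ℝ, Euc n) θ₀ θ₀) δ) :
    (extChartAt 𝓘(ℝ, Euc n) θ₀).symm y ∈ chartBall (n := n) θ₀ δ := by
  have hyt := hball (Metric.ball_subset_closedBall hy)
  refine ⟨(extChartAt 𝓘(ℝ, Euc n) θ₀).map_target hyt, ?_⟩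
  rw [mem_preimage, (extChartAt 𝓘(ℝ, Euc n) θ₀).right_inv hyt]
  exact hy

/-- A function `f` on `S i × ℝ` which is locally a primitive of `α`, up to functions of the point
of the link, and which vanishes for `r = r₀`. -/
theorem exists_relative_primitive (hα : α ∈ closedForms (Euc (n + 1)) L) {r₀ : ℝ}
    (hr₀ : r₀ ∈ (C.kind i).openInterval (C.bound i)) :
    ∃ f : S i → ℝ → ℝ, ∀ θ₀ : S i, ∃ δ > 0,
      Metric.closedBall (extChartAt 𝓘(ℝ, Euc n) θ₀ θ₀) δ ⊆ (extChartAt 𝓘(ℝ, Euc n) θ₀).target ∧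
      ∃ F : S i → ℝ → ℝ, C.IsPrimitiveOver i α F (chartBall (n := n) θ₀ δ) ∧
        ∀ θ ∈ chartBall (n := n) θ₀ δ, ∀ r ∈ (C.kind i).openInterval (C.bound i),
          f θ r = F θ r - F θ r₀ := by
  choose δ hδ hball F hF using fun θ₀ => C.exists_local_primitive (i := i) hα θ₀
  -- Subtracting the value at `r₀` removes the dependence on the local primitive: the result is the
  -- integral of the radial component from `r₀` to `r`.
  refine ⟨fun θ r => F θ θ r - F θ θ r₀, fun θ₀ =>
    ⟨δ θ₀, hδ θ₀, hball θ₀, F θ₀, hF θ₀, fun θ hθ r hr => ?_⟩⟩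
  have h1 : ∀ θ₁, θ ∈ chartBall (n := n) θ₁ (δ θ₁) →
      (∀ r ∈ (C.kind i).openInterval (C.bound i),
        HasDerivAt (fun r => F θ₁ θ r - F θ₁ θ r₀) (C.radialPart α θ r) r) ∧
      Tendsto (fun r => F θ₁ θ r - F θ₁ θ r₀) (pure r₀) (𝓝 0) := fun θ₁ hθ₁ => by
    refine ⟨fun r hr => ((hF θ₁).hasDerivAt hθ₁ hr).sub_const _, ?_⟩
    have := tendsto_pure_nhds (fun r => F θ₁ θ r - F θ₁ θ r₀) r₀
    rwa [sub_self] at this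
  have h2 := h1 θ (mem_of_mem_nhds (chartBall_mem_nhds θ (hδ θ)))
  have h3 := h1 θ₀ hθ
  -- Along `pure r₀`, convergence to `0` means vanishing at `r₀`.
  exact EndKind.eq_of_hasDerivAt_of_tendsto (l := pure r₀) (mem_pure.2 hr₀) h2.1 h3.1 h2.2 h3.2 r hr

theorem IsPrimitiveOver.contDiffOn {F : S i → ℝ → ℝ} {δ : ℝ}
    (hF : C.IsPrimitiveOver i α F (chartBall (n := n) θ₀ δ))
    (hball : Metric.closedBall (extChartAt 𝓘(ℝ, Euc n) θ₀ θ₀) δ ⊆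
      (extChartAt 𝓘(ℝ, Euc n) θ₀).target) :
    ContDiffOn ℝ ∞ (fun w : Euc n × ℝ => F ((extChartAt 𝓘(ℝ, Euc n) θ₀).symm w.1) w.2)
      (Metric.ball (extChartAt 𝓘(ℝ, Euc n) θ₀ θ₀) δ ×ˢ (C.kind i).openInterval (C.bound i)) := by
  have hW : IsOpen (Metric.ball (extChartAt 𝓘(ℝ, Euc n) θ₀ θ₀) δ ×ˢ
      (C.kind i).openInterval (C.bound i)) := Metric.isOpen_ball.prod (C.kind i).isOpen_openInterval
  have hsub : Metric.ball (extChartAt 𝓘(ℝ, Euc n) θ₀ θ₀) δ ×ˢ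
      (C.kind i).openInterval (C.bound i) ⊆ C.coordDomain i θ₀ fun r => r :=
    Set.prod_mono (Metric.ball_subset_closedBall.trans hball) subset_rfl
  have hd : ∀ w ∈ Metric.ball (extChartAt 𝓘(ℝ, Euc n) θ₀ θ₀) δ ×ˢ
      (C.kind i).openInterval (C.bound i), HasFDerivAt
      (fun w : Euc n × ℝ => F ((extChartAt 𝓘(ℝ, Euc n) θ₀).symm w.1) w.2)
      (localPullback (fun x => α x) (C.endCoord i θ₀ fun r => r) w) w := fun w hw =>
    hF.hasFDerivAt (hsub hw) (symm_mem_chartBall hball hw.1)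
  refine (contDiffOn_infty_iff_fderiv_of_isOpen hW).2
    ⟨fun w hw => (hd w hw).differentiableAt.differentiableWithinAt, ?_⟩
  have hA : ContDiffOn ℝ ∞ (localPullback (fun x => α x) (C.endCoord i θ₀ fun r => r))
      (C.coordDomain i θ₀ fun r => r) :=
    contDiffOn_localPullback (C.isOpen_coordDomain continuous_id')
      (C.contMDiffOn_endCoord contDiff_fun_id) α
  exact (hA.mono hsub).congr fun w hw => (hd w hw).fderiv

theorem contMDiffOn_onEnd_relative_primitive {f : S i → ℝ → ℝ} {r₀ : ℝ}
    (hr₀ : r₀ ∈ (C.kind i).openInterval (C.bound i))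
    (hf : ∀ θ₀ : S i, ∃ δ > 0,
      Metric.closedBall (extChartAt 𝓘(ℝ, Euc n) θ₀ θ₀) δ ⊆ (extChartAt 𝓘(ℝ, Euc n) θ₀).target ∧
      ∃ F : S i → ℝ → ℝ, C.IsPrimitiveOver i α F (chartBall (n := n) θ₀ δ) ∧
        ∀ θ ∈ chartBall (n := n) θ₀ δ, ∀ r ∈ (C.kind i).openInterval (C.bound i),
          f θ r = F θ r - F θ r₀) :
    ContMDiffOn 𝓘(ℝ, Euc (n + 1)) 𝓘(ℝ, ℝ) ∞ (C.onEnd i f) (C.openEnd i) := by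
  rintro _ ⟨⟨θ₀, r⟩, ⟨-, hr⟩, rfl⟩
  obtain ⟨δ, hδ, hball, F, hF, hfF⟩ := hf θ₀
  have hW : IsOpen (Metric.ball (extChartAt 𝓘(ℝ, Euc n) θ₀ θ₀) δ ×ˢ
      (C.kind i).openInterval (C.bound i)) := Metric.isOpen_ball.prod (C.kind i).isOpen_openInterval
  have hz : ((extChartAt 𝓘(ℝ, Euc n) θ₀ θ₀, r) : Euc n × ℝ) ∈
      Metric.ball (extChartAt 𝓘(ℝ, Euc n) θ₀ θ₀) δ ×ˢ
      (C.kind i).openInterval (C.bound i) := ⟨Metric.mem_ball_self hδ, hr⟩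
  have hz₀ : ((extChartAt 𝓘(ℝ, Euc n) θ₀ θ₀, r₀) : Euc n × ℝ) ∈
      Metric.ball (extChartAt 𝓘(ℝ, Euc n) θ₀ θ₀) δ ×ˢ
      (C.kind i).openInterval (C.bound i) := ⟨Metric.mem_ball_self hδ, hr₀⟩
  have hP := hF.contDiffOn hball
  have h1 : ContDiffAt ℝ ∞ (fun w : Euc n × ℝ => F ((extChartAt 𝓘(ℝ, Euc n) θ₀).symm w.1) w.2 -
      F ((extChartAt 𝓘(ℝ, Euc n) θ₀).symm w.1) r₀) (extChartAt 𝓘(ℝ, Euc n) θ₀ θ₀, r) := by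
    have hP₀ := hP.contDiffAt (hW.mem_nhds hz₀)
    exact (hP.contDiffAt (hW.mem_nhds hz)).sub
      (hP₀.comp (f := fun w : Euc n × ℝ => (w.1, r₀)) (extChartAt 𝓘(ℝ, Euc n) θ₀ θ₀, r)
        (contDiffAt_fst.prodMk contDiffAt_const))
  have hz' : ((extChartAt 𝓘(ℝ, Euc n) θ₀ θ₀, r) : Euc n × ℝ) ∈ C.coordDomain i θ₀ fun r => r :=
    ⟨mem_extChartAt_target θ₀, hr⟩
  have h2 := C.contMDiffAt_onEnd (f := f) hz' (by
    filter_upwards [hW.mem_nhds hz] with w hw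
    exact hfF _ (symm_mem_chartBall hball hw.1) w.2 hw.2) h1
  have h3 : C.endCoord i θ₀ (fun r => r) (extChartAt 𝓘(ℝ, Euc n) θ₀ θ₀, r) = C.param i (θ₀, r) := by
    rw [endCoord, coneCoord, extChartAt_to_inv]
  rw [h3] at h2
  exact h2.contMDiffWithinAt

/-- Near infinity `α = dF` and `h = F - F(·, r₀)`, so `α - dh` is the differential of `F(·, r₀)`, a
function of the point of the link alone. Its coefficients are the components of `α` along the link
at radius `r₀`. -/
theorem localPullback_sub_d_relative_primitive (hi : C.kind i = .ac) {δ : ℝ}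
    (hball : Metric.closedBall (extChartAt 𝓘(ℝ, Euc n) θ₀ θ₀) δ ⊆
      (extChartAt 𝓘(ℝ, Euc n) θ₀).target) {F : S i → ℝ → ℝ}
    (hF : C.IsPrimitiveOver i α F (chartBall (n := n) θ₀ δ)) {r₀ c : ℝ}
    (hr₀ : r₀ ∈ (C.kind i).openInterval (C.bound i)) (hc : c ∈ (C.kind i).openInterval (C.bound i))
    {h : SmoothFunction (Euc (n + 1)) L} (hh : ∀ θ ∈ chartBall (n := n) θ₀ δ,
      ∀ r ∈ (C.kind i).openInterval c, h (C.param i (θ, r)) = F θ r - F θ r₀) {z : Euc n × ℝ}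
    (hz : z ∈ Metric.ball (extChartAt 𝓘(ℝ, Euc n) θ₀ θ₀) δ ×ˢ Ioi (Real.log c)) :
    localPullback (fun x => (α - d h) x) (C.endCoord i θ₀ Real.exp) z =
      ((localPullback (fun x => α x) (C.endCoord i θ₀ fun r => r) (z.1, r₀)).comp
        (ContinuousLinearMap.inl ℝ (Euc n) ℝ)).comp (ContinuousLinearMap.fst ℝ (Euc n) ℝ) := by
  have hc0 := (C.kind i).pos_of_mem_openInterval (C.bound_pos i) hc
  have hexp : Real.exp z.2 ∈ (C.kind i).openInterval c := by
    rw [hi]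
    exact (Real.log_lt_iff_lt_exp hc0).1 hz.2
  have hzt := hball (Metric.ball_subset_closedBall hz.1)
  have hzd : z ∈ C.coordDomain i θ₀ Real.exp := ⟨hzt, (C.kind i).openInterval_mono hc hexp⟩
  have hzO := symm_mem_chartBall hball hz.1
  have h1 := hF.hasFDerivAt_coord Real.contDiff_exp hzd hzO
  have h2 : HasFDerivAt
      (fun w : Euc n × ℝ => F ((extChartAt 𝓘(ℝ, Euc n) θ₀).symm w.1) r₀) _ z :=
    HasFDerivAt.comp (f := fun w : Euc n × ℝ => (w.1, r₀)) z
      (hF.hasFDerivAt (z := (z.1, r₀)) ⟨hzt, hr₀⟩ hzO)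
      (hasFDerivAt_fst.prodMk (hasFDerivAt_const r₀ z))
  have hψ : MDifferentiableAt 𝓘(ℝ, Euc n × ℝ) 𝓘(ℝ, Euc (n + 1)) (C.endCoord i θ₀ Real.exp) z :=
    ((C.contMDiffOn_endCoord Real.contDiff_exp).contMDiffAt
      ((C.isOpen_coordDomain Real.continuous_exp).mem_nhds hzd)).mdifferentiableAt (by simp)
  have h3 : HasFDerivAt (h ∘ C.endCoord i θ₀ Real.exp)
      (localPullback (fun x => d h x) (C.endCoord i θ₀ Real.exp) z) z :=
    hasMFDerivAt_iff_hasFDerivAt.1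
      ((h.contMDiff.mdifferentiable (by simp) _).hasMFDerivAt.comp z hψ.hasMFDerivAt)
  have h4 : h ∘ C.endCoord i θ₀ Real.exp =ᶠ[𝓝 z] fun w =>
      F ((extChartAt 𝓘(ℝ, Euc n) θ₀).symm w.1) (Real.exp w.2) -
        F ((extChartAt 𝓘(ℝ, Euc n) θ₀).symm w.1) r₀ := by
    have ho : IsOpen (Metric.ball (extChartAt 𝓘(ℝ, Euc n) θ₀ θ₀) δ ×ˢ
        (Real.exp ⁻¹' (C.kind i).openInterval c)) :=
      Metric.isOpen_ball.prod ((C.kind i).isOpen_openInterval.preimage Real.continuous_exp)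
    filter_upwards [ho.mem_nhds ⟨hz.1, hexp⟩] with w hw
    exact hh _ (symm_mem_chartBall hball hw.1) _ hw.2
  have h5 := (h3.congr_of_eventuallyEq h4.symm).unique (h1.sub h2)
  have h6 : localPullback (fun x => (α - d h) x) (C.endCoord i θ₀ Real.exp) z =
      localPullback (fun x => α x) (C.endCoord i θ₀ Real.exp) z -
        localPullback (fun x => d h x) (C.endCoord i θ₀ Real.exp) z := rfl
  rw [h6, h5, sub_sub_cancel]
  ext w
  all_goals simp

/-- On an AC end, a closed 1-form is the sum of an exact form and of a form which does not depend
on the radial variable near infinity. -/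
theorem exists_weightAt_neg_one_sub_d [CompactSpace (S i)] (hi : C.kind i = .ac)
    (hα : α ∈ closedForms (Euc (n + 1)) L) :
    ∃ h : SmoothFunction (Euc (n + 1)) L, (∀ x ∉ C.openEnd i, h x = 0) ∧
      C.WeightAt i (-1) (formTensor (I := 𝓘(ℝ, Euc (n + 1))) fun x => (α - d h) x) := by
  obtain ⟨r₀, hr₀⟩ := EndKind.nonempty_openInterval (C.bound_pos i) (C.kind i)
  obtain ⟨f, hf⟩ := exists_relative_primitive hα hr₀
  obtain ⟨h, hh, hh0⟩ := C.exists_cutoff (contMDiffOn_onEnd_relative_primitive hr₀ hf)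
  obtain ⟨c, hc, hhc⟩ := C.eventually_endFilter_iff_exists.1 hh
  refine ⟨h, hh0, weightAt_neg_one_of_radially_constant hi fun θ₀ => ?_⟩
  obtain ⟨δ, hδ, hball, F, hF, hfF⟩ := hf θ₀
  have hA : ContDiffOn ℝ ∞ (localPullback (fun x => α x) (C.endCoord i θ₀ fun r => r))
      (C.coordDomain i θ₀ fun r => r) :=
    contDiffOn_localPullback (C.isOpen_coordDomain continuous_id')
      (C.contMDiffOn_endCoord contDiff_fun_id) α
  refine ⟨δ, hδ, hball,
    fun y => (localPullback (fun x => α x) (C.endCoord i θ₀ fun r => r) (y, r₀)).comp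
      (ContinuousLinearMap.inl ℝ (Euc n) ℝ), ContDiffOn.clm_comp
      (hA.comp (contDiffOn_id.prodMk contDiffOn_const) fun y hy => ⟨hy, hr₀⟩) contDiffOn_const,
    Real.log c, fun z hz => localPullback_sub_d_relative_primitive hi hball hF hr₀ hc
      (fun θ hθ r hr => ?_) hz⟩
  have hrI := (C.kind i).openInterval_mono hc hr
  rw [hhc r hr θ, C.onEnd_param _ _ hrI, hfF θ hθ r hrI]

end Conifold

/-! ### The algebraic splitting -/

section Splitting
variable {E : Type*} [NormedAddCommGroup E] [NormedSpace ℝ E]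
  {M : Type*} [TopologicalSpace M] [ChartedSpace E M] [IsManifold 𝓘(ℝ, E) ∞ M] {l : Filter M}

theorem H1Rel.mk_eq_zero {α : OneForm E M} {hα : α ∈ closedFormsVanishing E l} :
    H1Rel.mk α hα = 0 ↔ α ∈ (functionsVanishing E l).map d :=
  (Submodule.Quotient.mk_eq_zero _).trans Iff.rfl

theorem H1Rel.mk_eq_mk {α α' : OneForm E M} {hα : α ∈ closedFormsVanishing E l}
    {hα' : α' ∈ closedFormsVanishing E l} :
    H1Rel.mk α hα = H1Rel.mk α' hα' ↔ α - α' ∈ (functionsVanishing E l).map d :=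
  (Submodule.Quotient.eq _).trans Iff.rfl

/-- A space `W` of closed 1-forms splits as the sum of a space `K` of cohomology classes and of a
space `D` of exact forms, provided that every element of `W` is cohomologous modulo `D` to an
element of a class in `K`, every class in `K` is represented in `W`, and the exact forms are
compatible. -/
theorem exists_splitting {W D : Submodule ℝ (OneForm E M)} {K : Submodule ℝ (H1Rel E l)}
    (hDW : D ≤ W) (hW : ∀ f ∈ functionsVanishing E l, d f ∈ W → d f ∈ D)
    (hD : ∀ δ ∈ D, δ ∈ closedFormsVanishing E l → δ ∈ (functionsVanishing E l).map d)
    (hα : ∀ α ∈ W, ∃ δ ∈ D, ∃ h : α - δ ∈ closedFormsVanishing E l, H1Rel.mk (α - δ) h ∈ K)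
    (hK : ∀ α (h : α ∈ closedFormsVanishing E l), H1Rel.mk α h ∈ K →
      ∃ f ∈ functionsVanishing E l, α - d f ∈ W) (hd : ∀ f : SmoothFunction E M,
        f ∈ functionsVanishing E l → d f ∈ closedFormsVanishing E l) :
    ∃ Φ : (K × D) ≃ₗ[ℝ] W, (∀ b, (Φ (0, b)).1 = b.1) ∧
      ∀ c, ∃ h, H1Rel.mk (Φ (c, 0)).1 h = c.1 := by
  let q : closedFormsVanishing E l →ₗ[ℝ] H1Rel E l := Submodule.mkQ _
  -- `U` consists of the forms lying both in `W` and in the complex whose class is in `K`; the class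
  -- map `P` sends it onto `K`.
  let U : Submodule ℝ (closedFormsVanishing E l) :=
    W.comap (closedFormsVanishing E l).subtype ⊓ K.comap q
  let P : U →ₗ[ℝ] K := (q.comp U.subtype).codRestrict K fun u => u.2.2
  have hP : LinearMap.range P = ⊤ := by
    refine LinearMap.range_eq_top.2 ?_
    rintro ⟨c, hc⟩
    obtain ⟨⟨α, h⟩, rfl⟩ := Submodule.mkQ_surjective _ c
    obtain ⟨f, hf, hfW⟩ := hK α h hc
    have h1 := hd f hf
    have h2 : H1Rel.mk (α - d f) (sub_mem h h1) = H1Rel.mk α h := H1Rel.mk_eq_mk.2 (by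
      rw [sub_sub_cancel_left]
      exact neg_mem ⟨f, hf, rfl⟩)
    refine ⟨⟨⟨α - d f, sub_mem h h1⟩, hfW, ?_⟩, Subtype.ext h2⟩
    change H1Rel.mk _ _ ∈ K
    rw [h2]
    exact hc
  -- A linear section of `P` is the choice of representatives.
  obtain ⟨s, hs⟩ := P.exists_rightInverse_of_surjective hP
  have hs' : ∀ c : K, H1Rel.mk (s c).1.1 (s c).1.2 = c.1 := fun c =>
    congrArg Subtype.val (LinearMap.congr_fun hs c)
  let t : K →ₗ[ℝ] W := ((closedFormsVanishing E l).subtype.comp (U.subtype.comp s)).codRestrict W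
    fun c => (s c).2.1
  let Ψ : (K × D) →ₗ[ℝ] W := t.coprod (Submodule.inclusion hDW)
  have hΨ : ∀ c b, (Ψ (c, b)).1 = (s c).1.1 + b.1 := fun c b => rfl
  have hbij : Function.Bijective Ψ := by
    constructor
    · refine (injective_iff_map_eq_zero Ψ).2 ?_
      rintro ⟨c, b⟩ h0
      have h1 : (s c).1.1 + b.1 = 0 := (hΨ c b).symm.trans (congrArg Subtype.val h0)
      have h2 : (s c).1.1 = -b.1 := eq_neg_of_add_eq_zero_left h1
      -- A representative lying in `D` is exact in the complex, so its class is zero.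
      have h3 : (s c).1.1 ∈ (functionsVanishing E l).map d :=
        hD _ (h2 ▸ neg_mem b.2) (s c).1.2
      have h4 : c = 0 := Subtype.ext ((hs' c).symm.trans (H1Rel.mk_eq_zero.2 h3))
      subst h4
      have h5 : b.1 = 0 := by simpa using h1
      exact Prod.ext rfl (Subtype.ext h5)
    · rintro ⟨α, hαW⟩
      obtain ⟨δ, hδ, h, hc⟩ := hα α hαW
      -- `α - δ` differs from the chosen representative of its class by some `df`; as a difference
      -- of elements of `W`, `df` is in `W`, hence in `D`.
      obtain ⟨f, hf, hfe⟩ := H1Rel.mk_eq_mk.1 (hs' ⟨_, hc⟩).symm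
      have h1 : d f ∈ D := hW f hf (by
        rw [hfe]
        exact sub_mem (sub_mem hαW (hDW hδ)) (s ⟨_, hc⟩).2.1)
      refine ⟨(⟨_, hc⟩, ⟨δ + d f, add_mem hδ h1⟩), Subtype.ext ?_⟩
      rw [hΨ]
      change _ + (δ + d f) = α
      rw [hfe]
      abel
  refine ⟨LinearEquiv.ofBijective Ψ hbij, fun b => ?_, fun c => ?_⟩
  · refine (hΨ 0 b).trans ?_
    rw [map_zero]
    exact zero_add _
  · have h1 : (Ψ (c, 0)).1 = (s c).1.1 := (hΨ c 0).trans (add_zero _)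
    have h2 : (Ψ (c, 0)).1 ∈ closedFormsVanishing E l := h1 ▸ (s c).1.2
    refine ⟨h2, Eq.trans ?_ (hs' c)⟩
    congr 1

theorem sum_apply {ι : Type*} (s : Finset ι) (f : ι → SmoothFunction E M) (x : M) :
    (∑ i ∈ s, f i) x = ∑ i ∈ s, f i x :=
  (congrFun (map_sum (ContMDiffMap.coeFnAddMonoidHom (I := 𝓘(ℝ, E)) (N := M) (I' := 𝓘(ℝ, ℝ))
    (n := ∞) (G := ℝ)) f s) x).trans (Finset.sum_apply x s _)

theorem d_mem_closedFormsVanishing_bot (f : SmoothFunction E M) :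
    d f ∈ closedFormsVanishing E (⊥ : Filter M) :=
  ⟨d_mem_closedForms f, by simp [formsVanishing]⟩

theorem mem_functionsVanishing_bot (f : SmoothFunction E M) :
    f ∈ functionsVanishing E (⊥ : Filter M) := by
  simp [functionsVanishing]

variable (E M) in
theorem closedFormsVanishing_bot :
    closedFormsVanishing E (⊥ : Filter M) = closedForms E M := by
  refine inf_eq_left.2 fun α _ => ?_
  simp [formsVanishing]

variable (E M) in
/-- Closed forms are the sum of cohomology classes and of exact forms. -/
theorem exists_splitting_closedForms :
    ∃ Φ : (H1 E M × (⊤ : Submodule ℝ (SmoothFunction E M)).map d) ≃ₗ[ℝ] closedForms E M,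
      (∀ b, (Φ (0, b)).1 = b.1) ∧ ∀ c, ∃ h, H1Rel.mk (Φ (c, 0)).1 h = c := by
  obtain ⟨Φ, h1, h2⟩ := exists_splitting (l := (⊥ : Filter M)) (W := closedForms E M)
    (D := (⊤ : Submodule ℝ (SmoothFunction E M)).map d) (K := ⊤)
    (Submodule.map_le_iff_le_comap.2 fun f _ => d_mem_closedForms f)
    (fun f _ _ => ⟨f, trivial, rfl⟩)
    (by rintro _ ⟨f, -, rfl⟩ _; exact ⟨f, mem_functionsVanishing_bot f, rfl⟩)
    (fun α hα => ⟨0, zero_mem _, by rwa [sub_zero, closedFormsVanishing_bot], trivial⟩)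
    (fun α h _ => ⟨0, zero_mem _, by rw [map_zero, sub_zero]; exact h.1⟩)
    (fun f _ => d_mem_closedFormsVanishing_bot f)
  refine ⟨((LinearEquiv.ofTop ⊤ rfl).symm.prodCongr (.refl ℝ _)).trans Φ, fun b => ?_, fun c => ?_⟩
  · exact h1 b
  · exact h2 ⟨c, trivial⟩

end Splitting

/-! ### Gluing along the ends and restriction to the links -/

namespace Conifold

variable {n : ℕ} {L : Type*} [TopologicalSpace L] [ChartedSpace (Euc (n + 1)) L]
  [IsManifold 𝓘(ℝ, Euc (n + 1)) ∞ L] {ι : Type*} {S : ι → Type*}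
  [∀ i, TopologicalSpace (S i)] [∀ i, ChartedSpace (Euc n) (S i)]
  [∀ i, IsManifold 𝓘(ℝ, Euc n) ∞ (S i)] {C : Conifold n L S} {i : ι}
  {α : OneForm (Euc (n + 1)) L}

theorem eventually_d_eq {f h : SmoothFunction (Euc (n + 1)) L}
    (hfh : ∀ᶠ x in C.endFilter i, f x = h x) : ∀ᶠ x in C.endFilter i, d f x = d h x := by
  filter_upwards [C.eventually_endFilter_nhds hfh] with x hx
  exact Filter.EventuallyEq.mfderiv_eq hx

theorem eventually_d_eq_zero {f : SmoothFunction (Euc (n + 1)) L} {c : ℝ}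
    (hf : ∀ᶠ x in C.endFilter i, f x = c) : ∀ᶠ x in C.endFilter i, d f x = 0 := by
  filter_upwards [C.eventually_endFilter_nhds hf] with x hx
  exact (Filter.EventuallyEq.mfderiv_eq (f := fun _ => c) hx).trans mfderiv_const

theorem weightAt_form_of_eventually_eq_zero {b : ℝ} (hα : ∀ᶠ x in C.endFilter i, α x = 0) :
    C.WeightAt i b (formTensor (I := 𝓘(ℝ, Euc (n + 1))) fun x => α x) := by
  refine weightAt_form_zero.congr ?_
  filter_upwards [hα] with x hx
  funext v
  simp [formTensor, hx]

theorem mem_closedWeightedForms_iff {β : ι → ℝ} :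
    α ∈ C.closedWeightedForms β ↔ α ∈ closedForms (Euc (n + 1)) L ∧
      ∀ i, C.WeightAt i (β i - 1) (formTensor (I := 𝓘(ℝ, Euc (n + 1))) fun x => α x) := Iff.rfl

theorem mem_weightedFunctions_iff {β : ι → ℝ} {f : SmoothFunction (Euc (n + 1)) L} :
    f ∈ C.weightedFunctions β ↔ ∀ i, (∃ K : ℝ, ∀ᶠ x in C.endFilter i, |f x| ≤ K * C.radius i x ^ β i) ∧
      C.WeightAt i (β i - 1) (formTensor (I := 𝓘(ℝ, Euc (n + 1))) fun x => d f x) :=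
  forall_congr' fun _ => weightAt_function_iff

theorem d_mem_closedWeightedForms {β : ι → ℝ} {f : SmoothFunction (Euc (n + 1)) L}
    (hf : f ∈ C.weightedFunctions β) : d f ∈ C.closedWeightedForms β :=
  ⟨d_mem_closedForms f, fun i => ((mem_weightedFunctions_iff.1 hf) i).2⟩

theorem tendsto_zero_of_le {b K : ℝ} (hb : (C.kind i).Decays b) {f : L → ℝ}
    (hf : ∀ᶠ x in C.endFilter i, |f x| ≤ K * C.radius i x ^ b) :
    Tendsto f (C.endFilter i) (𝓝 0) := by
  refine squeeze_zero_norm' hf ?_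
  simpa using (hb.tendsto_rpow.comp C.tendsto_radius).const_mul K

/-- A primitive on an end is, near the singularity or infinity, a smooth function on the
conifold. -/
theorem IsPrimitiveOver.exists_smooth {F : S i → ℝ → ℝ} (hF : C.IsPrimitiveOver i α F univ) :
    ∃ h : SmoothFunction (Euc (n + 1)) L, (∀ x ∉ C.openEnd i, h x = 0) ∧
      (∀ᶠ x in C.endFilter i, h x = C.onEnd i F x) ∧ ∀ᶠ x in C.endFilter i, α x = d h x := by
  obtain ⟨h, h1, h2⟩ := C.exists_cutoff (contMDiffOn_of_hasMFDerivAt (C.isOpen_end i) hF.hasMFDerivAt)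
  refine ⟨h, h2, h1, ?_⟩
  filter_upwards [C.eventually_endFilter_nhds h1, C.openEnd_mem_endFilter] with x hx hxe
  exact (hF.hasMFDerivAt x hxe).mfderiv.symm.trans (Filter.EventuallyEq.mfderiv_eq hx).symm

/-- The sum has the required germs, because each summand vanishes off its own end and the ends are
disjoint. -/
theorem exists_glue [Fintype ι] (h : ι → SmoothFunction (Euc (n + 1)) L)
    (hh : ∀ i, ∀ x ∉ C.openEnd i, h i x = 0) :
    ∃ H : SmoothFunction (Euc (n + 1)) L, ∀ j, ∀ᶠ x in C.endFilter j, H x = h j x := by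
  refine ⟨∑ i, h i, fun j => ?_⟩
  have h1 : ∀ᶠ x in C.endFilter j, ∀ i, i ≠ j → h i x = 0 := eventually_all.2 fun i => by
    by_cases hij : i = j
    · exact .of_forall fun x hx => (hx hij).elim
    · filter_upwards [C.eventually_not_mem_openEnd (Ne.symm hij)] with x hx _ using hh i x hx
  filter_upwards [h1] with x hx
  rw [sum_apply]
  exact Finset.sum_eq_single j (fun i _ hi => hx i hi) fun h => (h (Finset.mem_univ _)).elim

/-- Together with `exists_primitive_iff` this turns the kernel of `ρ` into the existence of
primitives on the CS ends. -/
theorem mk_mem_ker_restrictCS {l : Filter L} {hα : α ∈ closedFormsVanishing (Euc (n + 1)) l} :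
    H1Rel.mk α hα ∈ (C.restrictCS l).ker ↔ ∀ i, C.kind i = .cs →
      ∃ u : SmoothFunction (Euc n) (S i),
        pullback (C.linkInclusion i) (C.contMDiff_linkInclusion i) α = d u := by
  have h0 : ∀ i : {i // C.kind i = .cs},
      pullback (C.linkInclusion i) (C.contMDiff_linkInclusion i) α ∈
        closedFormsVanishing (Euc n) (⊥ : Filter (S i)) := fun i => by
    rw [closedFormsVanishing_bot]
    exact pullback_mem_closedForms _ (Submodule.mem_inf.1 hα).1
  have h1 : ∀ i : {i // C.kind i = .cs}, C.restrictCS l (H1Rel.mk α hα) i =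
      H1Rel.mk (pullback (C.linkInclusion i) (C.contMDiff_linkInclusion i) α)
        (h0 i) := fun i => rfl
  rw [LinearMap.mem_ker, funext_iff, Subtype.forall]
  refine forall₂_congr fun i hi => ?_
  rw [h1 ⟨i, hi⟩, Pi.zero_apply]
  refine H1Rel.mk_eq_zero.trans ?_
  exact ⟨fun ⟨u, _, hu⟩ => ⟨u, hu.symm⟩, fun ⟨u, hu⟩ => ⟨u, mem_functionsVanishing_bot u, hu.symm⟩⟩

end Conifold

theorem exists_equiv_of_disjoint {V : Type*} [AddCommGroup V] [Module ℝ V]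
    {A B P : Submodule ℝ V} (hd : Disjoint A B) (hP : A ⊔ B = P) :
    ∃ T : (A × B) ≃ₗ[ℝ] P, ∀ a b, (T (a, b)).1 = a.1 + b.1 := by
  subst hP
  let T : (A × B) →ₗ[ℝ] (A ⊔ B : Submodule ℝ V) :=
    (Submodule.inclusion le_sup_left).coprod (Submodule.inclusion le_sup_right)
  have hT : ∀ a b, (T (a, b)).1 = a.1 + b.1 := fun a b => rfl
  have hbij : Function.Bijective T := by
    constructor
    · refine (injective_iff_map_eq_zero T).2 ?_
      rintro ⟨a, b⟩ h
      have h3 : a.1 + b.1 = 0 := (hT a b).symm.trans (congrArg Subtype.val h)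
      have h4 : a.1 = -b.1 := eq_neg_of_add_eq_zero_left h3
      have h5 : a.1 = 0 := Submodule.disjoint_def.1 hd _ a.2 (h4 ▸ neg_mem b.2)
      have h6 : b.1 = 0 := by rwa [h5, zero_add] at h3
      exact Prod.ext (Subtype.ext h5) (Subtype.ext h6)
    · rintro ⟨x, hx⟩
      obtain ⟨a, ha, b, hb, rfl⟩ := Submodule.mem_sup.1 hx
      exact ⟨(⟨a, ha⟩, ⟨b, hb⟩), Subtype.ext rfl⟩
  exact ⟨LinearEquiv.ofBijective T hbij, hT⟩

/-- Only the exact summand is decomposed; the condition on the representatives is carried along as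
the predicate `Q`. -/
theorem exists_equiv_prod {K V : Type*} [AddCommGroup K] [Module ℝ K] [AddCommGroup V] [Module ℝ V]
    {A B P W : Submodule ℝ V} (hd : Disjoint A B) (hP : A ⊔ B = P) {Q : K → V → Prop}
    (h : ∃ Φ : (K × P) ≃ₗ[ℝ] W, (∀ b, (Φ (0, b)).1 = b.1) ∧ ∀ c, Q c (Φ (c, 0)).1) :
    ∃ Φ : (K × A × B) ≃ₗ[ℝ] W, (∀ a b, (Φ (0, a, b)).1 = a.1 + b.1) ∧ ∀ c, Q c (Φ (c, 0, 0)).1 := by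
  obtain ⟨Φ, h1, h2⟩ := h
  obtain ⟨T, hT⟩ := exists_equiv_of_disjoint hd hP
  have h3 : T 0 = 0 := map_zero T
  refine ⟨((LinearEquiv.refl ℝ K).prodCongr T).trans Φ, fun a b => (h1 _).trans (hT a b), fun c => ?_⟩
  have h4 : (((LinearEquiv.refl ℝ K).prodCongr T).trans Φ) (c, 0, 0) = Φ (c, 0) :=
    congrArg (fun t => Φ (c, t)) h3
  rw [h4]
  exact h2 c

/-! ### Cutoff functions and the splitting of the weighted spaces -/

namespace Conifold

variable {n : ℕ} {L : Type*} [TopologicalSpace L] [ChartedSpace (Euc (n + 1)) L]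
  [IsManifold 𝓘(ℝ, Euc (n + 1)) ∞ L] {ι : Type*} {S : ι → Type*}
  [∀ i, TopologicalSpace (S i)] [∀ i, ChartedSpace (Euc n) (S i)]
  [∀ i, IsManifold 𝓘(ℝ, Euc n) ∞ (S i)] {C : Conifold n L S} {i : ι}
  {α : OneForm (Euc (n + 1)) L} {β : ι → ℝ} {f : ι → SmoothFunction (Euc (n + 1)) L}
  {l : Filter L}

theorem eventually_acFilter {P : L → Prop} :
    (∀ᶠ x in C.acFilter, P x) ↔ ∀ i, C.kind i = .ac → ∀ᶠ x in C.endFilter i, P x := by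
  simp only [acFilter, eventually_iSup]

/-- The weights `β` are positive on the CS ends and, on the AC ends, negative for the complex of
forms which vanish near infinity, positive for the complex of all forms. -/
def Adapted (C : Conifold n L S) (β : ι → ℝ) (l : Filter L) : Prop :=
  (∀ i, C.kind i = .cs → 0 < β i) ∧ ((l = ⊥ ∧ ∀ i, C.kind i = .ac → 0 < β i) ∨
    (l = C.acFilter ∧ ∀ i, C.kind i = .ac → β i < 0))

theorem Adapted.decays_cs (h : C.Adapted β l) (hi : C.kind i = .cs) :
    (C.kind i).Decays (β i) := by
  rw [hi]
  exact h.1 i hi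

section Cutoff
variable [Fintype ι]

open Classical in
/-- The combination of the cutoff functions with the given values at the singularities. -/
def cutoffSum (C : Conifold n L S) (f : ι → SmoothFunction (Euc (n + 1)) L) (c : ι → ℝ) :
    SmoothFunction (Euc (n + 1)) L := ∑ i with C.kind i = .cs, c i • f i

open Classical in
theorem mem_cutoffSpan_iff {e : SmoothFunction (Euc (n + 1)) L} :
    e ∈ C.cutoffSpan f ↔ ∃ c : ι → ℝ, C.cutoffSum f c = e := by
  have h : {i | C.kind i = .cs} = ((Finset.univ.filter fun i => C.kind i = .cs : Finset ι) : Set ι) := by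
    ext i
    simp
  rw [cutoffSpan, h, Submodule.mem_span_image_finset_iff_exists_fun']
  rfl

open Classical in
theorem IsEndCutoff.eventually_cutoffSum (hf : C.IsEndCutoff f) (c : ι → ℝ) (j : ι) :
    ∀ᶠ x in C.endFilter j, C.cutoffSum f c x = if C.kind j = .cs then c j else 0 := by
  have h1 : ∀ᶠ x in C.endFilter j, ∀ i, C.kind i = .cs → c i * f i x = if i = j then c i else 0 :=
    eventually_all.2 fun i => by
      by_cases hi : C.kind i = .cs
      · by_cases hij : i = j
        · subst hij
          filter_upwards [(hf i hi).1] with x hx _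
          simp [hx]
        · filter_upwards [(hf i hi).2 j (Ne.symm hij)] with x hx _
          simp [hx, hij]
      · exact .of_forall fun x hx => (hi hx).elim
  filter_upwards [h1] with x hx
  rw [cutoffSum, sum_apply]
  calc ∑ i with C.kind i = .cs, (c i • f i) x
      = ∑ i with C.kind i = .cs, if i = j then c i else 0 :=
        Finset.sum_congr rfl fun i hi => hx i (Finset.mem_filter.1 hi).2
    _ = _ := by simp [Finset.sum_ite_eq', Finset.mem_filter]

theorem IsEndCutoff.eventually_cutoffSum_cs (hf : C.IsEndCutoff f) (c : ι → ℝ) {j : ι}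
    (hj : C.kind j = .cs) : ∀ᶠ x in C.endFilter j, C.cutoffSum f c x = c j := by
  simpa [hj] using hf.eventually_cutoffSum c j

theorem IsEndCutoff.eventually_cutoffSum_ac (hf : C.IsEndCutoff f) (c : ι → ℝ) {j : ι}
    (hj : C.kind j = .ac) : ∀ᶠ x in C.endFilter j, C.cutoffSum f c x = 0 := by
  simpa [hj] using hf.eventually_cutoffSum c j

theorem IsEndCutoff.eventually_d_eq_zero (hf : C.IsEndCutoff f)
    {e : SmoothFunction (Euc (n + 1)) L} (he : e ∈ C.cutoffSpan f) (j : ι) :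
    ∀ᶠ x in C.endFilter j, d e x = 0 := by
  obtain ⟨c, rfl⟩ := mem_cutoffSpan_iff.1 he
  exact Conifold.eventually_d_eq_zero (hf.eventually_cutoffSum c j)

open Classical in
/-- A combination of the cutoff functions is determined by its values at the singularities. -/
theorem IsEndCutoff.eq_smul_of_tendsto [∀ i, Nonempty (S i)] (hf : C.IsEndCutoff f)
    {e : SmoothFunction (Euc (n + 1)) L} (he : e ∈ C.cutoffSpan f) {a : ℝ}
    (ha : ∀ i, C.kind i = .cs → Tendsto e (C.endFilter i) (𝓝 a)) :
    e = C.cutoffSum f fun _ => a := by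
  obtain ⟨c, rfl⟩ := mem_cutoffSpan_iff.1 he
  refine Finset.sum_congr rfl fun i hi => ?_
  have hi := (Finset.mem_filter.1 hi).2
  have := C.endFilter_neBot (i := i)
  have h1 : Tendsto (C.cutoffSum f c) (C.endFilter i) (𝓝 (c i)) :=
    tendsto_const_nhds.congr' (by
      filter_upwards [hf.eventually_cutoffSum_cs c hi] with x hx using hx.symm)
  rw [tendsto_nhds_unique h1 (ha i hi)]

theorem IsEndCutoff.eq_zero_of_tendsto [∀ i, Nonempty (S i)] (hf : C.IsEndCutoff f)
    {e : SmoothFunction (Euc (n + 1)) L} (he : e ∈ C.cutoffSpan f)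
    (ha : ∀ i, C.kind i = .cs → Tendsto e (C.endFilter i) (𝓝 0)) : e = 0 :=
  (hf.eq_smul_of_tendsto he ha).trans (by simp [cutoffSum])

end Cutoff

theorem tendsto_zero_of_mem_weightedFunctions {h : SmoothFunction (Euc (n + 1)) L}
    (hh : h ∈ C.weightedFunctions β) (hi : (C.kind i).Decays (β i)) :
    Tendsto h (C.endFilter i) (𝓝 0) := by
  obtain ⟨K, hK⟩ := ((mem_weightedFunctions_iff.1 hh) i).1
  exact tendsto_zero_of_le hi hK

/-- A combination of cutoffs is constant near each singularity, equal to its coefficient there,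
whereas a function of positive weight tends to zero. -/
theorem IsEndCutoff.disjoint [Fintype ι] [∀ i, Nonempty (S i)] (hf : C.IsEndCutoff f)
    (hβ : ∀ i, C.kind i = .cs → 0 < β i) :
    Disjoint (C.cutoffSpan f) (C.weightedFunctions β) := by
  refine Submodule.disjoint_def.2 fun e he he' => hf.eq_zero_of_tendsto he fun i hi => ?_
  refine tendsto_zero_of_mem_weightedFunctions he' ?_
  rw [hi]
  exact hβ i hi

theorem eq_const_of_d_eq_zero [ConnectedSpace L] {h : SmoothFunction (Euc (n + 1)) L}
    (hh : d h = 0) : ∃ a : ℝ, ∀ x, h x = a := by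
  obtain ⟨x₀⟩ := (inferInstance : Nonempty L)
  refine ⟨h x₀, fun x => eq_of_hasMFDerivAt_zero (E := Euc (n + 1)) isOpen_univ isPreconnected_univ
    (fun x _ => ?_) (mem_univ x) (mem_univ x₀)⟩
  have h1 := (h.contMDiff.mdifferentiable (by simp) x).hasMFDerivAt
  have h2 : mfderiv 𝓘(ℝ, Euc (n + 1)) 𝓘(ℝ, ℝ) h x = 0 := by rw [← d_apply, hh]; rfl
  rwa [h2] at h1

/-- On a connected conifold, the differentials of the cutoff functions are independent of those
of the decaying functions, if constants are excluded at an AC end or if the sum of the cutoff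
functions is closed. -/
theorem IsEndCutoff.disjoint_map_d [Fintype ι] [∀ i, Nonempty (S i)] [ConnectedSpace L]
    (hf : C.IsEndCutoff f) (hβ : ∀ i, C.kind i = .cs → 0 < β i)
    (h : d (C.cutoffSum f fun _ => 1) = 0 ∨ ∃ i, C.kind i = .ac ∧ β i < 0) :
    Disjoint ((C.cutoffSpan f).map d) ((C.weightedFunctions β).map d) := by
  refine Submodule.disjoint_def.2 ?_
  rintro _ ⟨e, he, rfl⟩ ⟨w, hw, hwe⟩
  -- If `de = dw` on a connected manifold, then `e - w` is a constant `a`. Since `w → 0` at the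
  -- singularities, every coefficient of `e` equals `a`.
  obtain ⟨a, ha⟩ := eq_const_of_d_eq_zero (h := e - w) (by rw [map_sub, hwe, sub_self])
  have hea : ∀ i, (C.kind i).Decays (β i) → Tendsto e (C.endFilter i) (𝓝 a) := fun i hi => by
    have h1 := (tendsto_zero_of_mem_weightedFunctions hw hi).const_add a
    rw [add_zero] at h1
    refine h1.congr fun x => ?_
    rw [← ha x]
    exact sub_add_cancel _ _
  have h1 := hf.eq_smul_of_tendsto he (a := a) fun i hi => hea i (by rw [hi]; exact hβ i hi)
  have h2 : (C.cutoffSum f fun _ => a) = a • C.cutoffSum f fun _ => 1 := by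
    simp [cutoffSum, Finset.smul_sum]
  -- In the first case `e` is `a` times a function with zero differential. In the second, both `e`
  -- and `w` tend to zero along the AC end, so `a = 0`.
  rcases h with h | ⟨i, hi, hib⟩
  · rw [h1, h2, map_smul, h, smul_zero]
  · have := C.endFilter_neBot (i := i)
    have h3 : Tendsto e (C.endFilter i) (𝓝 0) := tendsto_const_nhds.congr' (by
      filter_upwards [hf.eventually_cutoffSum_ac (fun _ => a) hi] with x hx
      rw [h1, hx])
    have h4 : a = 0 := tendsto_nhds_unique (hea i (by rw [hi]; exact hib)) h3
    rw [h1, h2, h4, zero_smul, map_zero]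

theorem IsEndCutoff.map_d_le [Fintype ι] (hf : C.IsEndCutoff f) :
    (C.cutoffSpan f ⊔ C.weightedFunctions β).map d ≤ C.closedWeightedForms β := by
  refine Submodule.map_le_iff_le_comap.2 (sup_le (fun e he => ?_) fun w hw =>
    d_mem_closedWeightedForms hw)
  exact mem_closedWeightedForms_iff.2 ⟨d_mem_closedForms e, fun i =>
    weightAt_form_of_eventually_eq_zero (hf.eventually_d_eq_zero he i)⟩

/-- A function whose differential is in the weighted space is, up to a combination of the cutoff
functions, in the weighted space. -/
theorem Adapted.mem_sup [Fintype ι] [∀ i, CompactSpace (S i)] [∀ i, ConnectedSpace (S i)]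
    (hA : C.Adapted β l) (hf : C.IsEndCutoff f) {h : SmoothFunction (Euc (n + 1)) L}
    (hl : h ∈ functionsVanishing (Euc (n + 1)) l) (hh : d h ∈ C.closedWeightedForms β) :
    h ∈ C.cutoffSpan f ⊔ C.weightedFunctions β := by
  have hw := (mem_closedWeightedForms_iff.1 hh).2
  -- The limits of `h` at the singularities are the coefficients of its part in `E₀`; the value `0`
  -- on the AC ends plays no role.
  have h1 : ∀ i, ∃ c : ℝ, C.kind i = .cs →
      ∃ K : ℝ, ∀ᶠ x in C.endFilter i, |h x - c| ≤ K * C.radius i x ^ β i := fun i => by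
    by_cases hi : C.kind i = .cs
    · obtain ⟨c, hc⟩ := (hw i).formBound.exists_const (hA.decays_cs hi)
      exact ⟨c, fun _ => hc⟩
    · exact ⟨0, fun h => (hi h).elim⟩
  choose c hc using h1
  have he : C.cutoffSum f c ∈ C.cutoffSpan f := mem_cutoffSpan_iff.2 ⟨c, rfl⟩
  refine Submodule.mem_sup.2 ⟨_, he, h - C.cutoffSum f c, mem_weightedFunctions_iff.2 fun i => ⟨?_, ?_⟩,
    add_sub_cancel _ _⟩
  · cases hi : C.kind i with
    | cs =>
      obtain ⟨K, hK⟩ := hc i hi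
      refine ⟨K, ?_⟩
      filter_upwards [hK, hf.eventually_cutoffSum_cs c hi] with x hx hxe
      rw [ContMDiffMap.coe_sub, Pi.sub_apply, hxe]
      exact hx
    | ac =>
      -- On AC ends no constant has to be removed: for positive weights the growth estimate
      -- suffices, and for negative ones `h` vanishes near infinity.
      have h2 : ∃ K : ℝ, ∀ᶠ x in C.endFilter i, |h x| ≤ K * C.radius i x ^ β i := by
        rcases hA.2 with ⟨-, hβ⟩ | ⟨rfl, -⟩
        · exact (hw i).formBound.abs_le hi (hβ i hi)
        · refine ⟨0, ?_⟩
          filter_upwards [eventually_acFilter.1 hl i hi] with x hx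
          simp [hx]
      obtain ⟨K, hK⟩ := h2
      refine ⟨K, ?_⟩
      filter_upwards [hK, hf.eventually_cutoffSum_ac c hi] with x hx hxe
      rw [ContMDiffMap.coe_sub, Pi.sub_apply, hxe, sub_zero]
      exact hx
  · rw [map_sub]
    exact (hw i).sub (weightAt_form_of_eventually_eq_zero (hf.eventually_d_eq_zero he i))

/-- The exact forms of the weighted complex which vanish along `l` are exact in the complex of
forms vanishing along `l`. -/
theorem Adapted.d_mem_map [Fintype ι] [∀ i, ConnectedSpace (S i)]
    (hA : C.Adapted β l) (hf : C.IsEndCutoff f) {δ : OneForm (Euc (n + 1)) L}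
    (hδ : δ ∈ (C.cutoffSpan f ⊔ C.weightedFunctions β).map d)
    (hl : δ ∈ closedFormsVanishing (Euc (n + 1)) l) :
    δ ∈ (functionsVanishing (Euc (n + 1)) l).map d := by
  obtain ⟨h, hh, rfl⟩ := hδ
  refine ⟨h, ?_, rfl⟩
  rcases hA.2 with ⟨rfl, -⟩ | ⟨rfl, hβ⟩
  · exact mem_functionsVanishing_bot h
  obtain ⟨e, he, w, hw, rfl⟩ := Submodule.mem_sup.1 hh
  obtain ⟨c, rfl⟩ := mem_cutoffSpan_iff.1 he
  refine eventually_acFilter.2 fun i hi => ?_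
  -- Where its differential vanishes, the function is constant near infinity. It coincides there
  -- with `w`, which tends to zero, so the constant is zero.
  obtain ⟨a, ha⟩ := exists_eventually_eq_const (eventually_acFilter.1 (Submodule.mem_inf.1 hl).2 i hi)
  have := C.endFilter_neBot (i := i)
  have h1 : Tendsto w (C.endFilter i) (𝓝 a) := tendsto_const_nhds.congr' (by
    filter_upwards [ha, hf.eventually_cutoffSum_ac c hi] with x hx hxe
    rw [← hx, ContMDiffMap.coe_add, Pi.add_apply, hxe, zero_add])
  have h2 : a = 0 := tendsto_nhds_unique h1
    (tendsto_zero_of_mem_weightedFunctions hw (by rw [hi]; exact hβ i hi))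
  rwa [h2] at ha

/-- The decaying primitive on the end, cut off so as to extend by zero to the whole conifold. -/
theorem exists_primitive_of_mem_closedWeightedForms [ConnectedSpace (S i)]
    (hi : (C.kind i).Decays (β i)) (hα : α ∈ C.closedWeightedForms β) :
    ∃ h : SmoothFunction (Euc (n + 1)) L, (∀ x ∉ C.openEnd i, h x = 0) ∧
      (∃ K : ℝ, ∀ᶠ x in C.endFilter i, |h x| ≤ K * C.radius i x ^ β i) ∧
      ∀ᶠ x in C.endFilter i, α x = d h x := by
  have hα' := mem_closedWeightedForms_iff.1 hα
  obtain ⟨F, hF, K, c, hc, hK⟩ := exists_primitive_of_decays hα'.1 hi (hα'.2 i).formBound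
  obtain ⟨h, h1, h2, h3⟩ := hF.exists_smooth
  refine ⟨h, h1, ⟨K, ?_⟩, h3⟩
  have h4 : ∀ᶠ x in C.endFilter i, |C.onEnd i F x| ≤ K * C.radius i x ^ β i := by
    refine C.eventually_endFilter_iff_exists.2 ⟨c, hc, fun r hr θ => ?_⟩
    have hr' := (C.kind i).openInterval_mono hc hr
    rw [C.onEnd_param F θ hr', C.radius_param ((C.kind i).openInterval_subset hr')]
    exact hK θ r hr
  filter_upwards [h2, h4] with x hx hxK
  rwa [hx]

/-- A closed form in the weighted space is cohomologous, within the weighted complex, to a form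
which vanishes along `l` and whose restriction to the links of the CS ends is exact. -/
theorem Adapted.exists_sub_d_mem_closedFormsVanishing [Fintype ι] [∀ i, ConnectedSpace (S i)]
    (hA : C.Adapted β l) (hα : α ∈ C.closedWeightedForms β) :
    ∃ w ∈ C.weightedFunctions β, ∃ h : α - d w ∈ closedFormsVanishing (Euc (n + 1)) l,
      H1Rel.mk (α - d w) h ∈ (C.restrictCS l).ker := by
  have hα' := mem_closedWeightedForms_iff.1 hα
  suffices H : ∃ w ∈ C.weightedFunctions β, α - d w ∈ closedFormsVanishing (Euc (n + 1)) l by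
    obtain ⟨w, hw, h⟩ := H
    refine ⟨w, hw, h, mk_mem_ker_restrictCS.2 fun i hi => ?_⟩
    have h1 := sub_mem hα (d_mem_closedWeightedForms hw)
    obtain ⟨F, hF, -⟩ := exists_primitive_of_decays (mem_closedWeightedForms_iff.1 h1).1
      (hA.decays_cs hi) ((mem_closedWeightedForms_iff.1 h1).2 i).formBound
    exact (exists_primitive_iff (mem_closedWeightedForms_iff.1 h1).1).1 ⟨F, hF⟩
  rcases hA.2 with ⟨rfl, -⟩ | ⟨rfl, hβ⟩
  · refine ⟨0, zero_mem _, ?_⟩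
    rw [map_zero, sub_zero, closedFormsVanishing_bot]
    exact hα'.1
  -- With negative weights at infinity all ends are decaying. The glued primitive `H` is in the
  -- weighted space because `dH = α` near every end, and `α - dH` vanishes there.
  have h1 : ∀ i, ∃ h : SmoothFunction (Euc (n + 1)) L, (∀ x ∉ C.openEnd i, h x = 0) ∧
      (∃ K : ℝ, ∀ᶠ x in C.endFilter i, |h x| ≤ K * C.radius i x ^ β i) ∧
      ∀ᶠ x in C.endFilter i, α x = d h x := fun i => by
    refine exists_primitive_of_mem_closedWeightedForms ?_ hα
    cases hi : C.kind i with
    | cs => exact hA.1 i hi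
    | ac => exact hβ i hi
  choose h hh hK hd using h1
  obtain ⟨H, hH⟩ := C.exists_glue h hh
  have hdH : ∀ i, ∀ᶠ x in C.endFilter i, α x = d H x := fun i => by
    filter_upwards [hd i, eventually_d_eq (hH i)] with x hx hxH
    rw [hx, hxH]
  refine ⟨H, mem_weightedFunctions_iff.2 fun i => ⟨?_, ?_⟩,
    Submodule.mem_inf.2 ⟨sub_mem hα'.1 (d_mem_closedForms H), ?_⟩⟩
  · obtain ⟨K, hK⟩ := hK i
    refine ⟨K, ?_⟩
    filter_upwards [hK, hH i] with x hx hxH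
    rwa [hxH]
  · refine (hα'.2 i).congr ?_
    filter_upwards [hdH i] with x hx
    funext v
    simp only [formTensor, hx]
  · refine eventually_acFilter.2 fun i _ => ?_
    filter_upwards [hdH i] with x hx
    exact sub_eq_zero.2 hx

/-- A closed form which vanishes along `l` and whose restriction to the links of the CS ends is
exact is cohomologous to a form in the weighted space. -/
theorem Adapted.exists_sub_d_mem_closedWeightedForms [Fintype ι] [∀ i, CompactSpace (S i)]
    (hA : C.Adapted β l) (hα : α ∈ closedFormsVanishing (Euc (n + 1)) l)
    (hρ : H1Rel.mk α hα ∈ (C.restrictCS l).ker) :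
    ∃ w ∈ functionsVanishing (Euc (n + 1)) l, α - d w ∈ C.closedWeightedForms β := by
  have hαc := (Submodule.mem_inf.1 hα).1
  -- The correction on one end: a primitive of `α` at a singularity; on AC ends, nothing if `α`
  -- already vanishes near infinity, and otherwise the radial integral of `α`. The middle condition
  -- keeps the glued function in the complex.
  have h1 : ∀ i, ∃ h : SmoothFunction (Euc (n + 1)) L, (∀ x ∉ C.openEnd i, h x = 0) ∧
      (C.kind i = .ac → l = C.acFilter → h = 0) ∧
      C.WeightAt i (β i - 1) (formTensor (I := 𝓘(ℝ, Euc (n + 1))) fun x => (α - d h) x) := fun i => by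
    cases hi : C.kind i with
    | cs =>
      obtain ⟨F, hF⟩ := (exists_primitive_iff hαc).2 (mk_mem_ker_restrictCS.1 hρ i hi)
      obtain ⟨h, hh, -, hd⟩ := hF.exists_smooth
      refine ⟨h, hh, (fun h => by cases h), weightAt_form_of_eventually_eq_zero ?_⟩
      filter_upwards [hd] with x hx
      exact sub_eq_zero.2 hx
    | ac =>
      by_cases hl : l = C.acFilter
      · refine ⟨0, fun _ _ => rfl, fun _ _ => rfl, ?_⟩
        rw [map_zero, sub_zero]
        subst hl
        exact weightAt_form_of_eventually_eq_zero
          (eventually_acFilter.1 (Submodule.mem_inf.1 hα).2 i hi)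
      · rcases hA.2 with ⟨-, hβ⟩ | ⟨h, -⟩
        · obtain ⟨h, hh, hw⟩ := exists_weightAt_neg_one_sub_d hi hαc
          -- Since `β i > 0`, weight `-1` implies weight `β i - 1` at infinity.
          exact ⟨h, hh, fun _ h => (hl h).elim, hw.mono hi (by linarith [hβ i hi])⟩
        · exact (hl h).elim
  choose h hh h0 hw using h1
  obtain ⟨H, hH⟩ := C.exists_glue h hh
  refine ⟨H, ?_, mem_closedWeightedForms_iff.2 ⟨sub_mem hαc (d_mem_closedForms H), fun i => ?_⟩⟩
  · rcases hA.2 with ⟨rfl, -⟩ | ⟨rfl, -⟩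
    · exact mem_functionsVanishing_bot H
    · refine eventually_acFilter.2 fun i hi => ?_
      filter_upwards [hH i] with x hx
      rw [hx, h0 i hi rfl]
      rfl
  · refine (hw i).congr ?_
    filter_upwards [eventually_d_eq (hH i)] with x hx
    funext v
    change (α x - d (h i) x) _ = (α x - d H x) _
    rw [hx]

/-- Closed forms in a weighted space are the sum of cohomology classes and of exact forms. -/
theorem Adapted.exists_splitting [Fintype ι] [∀ i, CompactSpace (S i)] [∀ i, ConnectedSpace (S i)]
    (hA : C.Adapted β l) (hf : C.IsEndCutoff f) :
    ∃ Φ : ((C.restrictCS l).ker × (C.cutoffSpan f ⊔ C.weightedFunctions β).map d) ≃ₗ[ℝ]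
        C.closedWeightedForms β,
      (∀ b, (Φ (0, b)).1 = b.1) ∧ ∀ c, ∃ h, H1Rel.mk (Φ (c, 0)).1 h = c.1 := by
  refine Conifolds.exists_splitting hf.map_d_le (fun h hl hh => ⟨h, hA.mem_sup hf hl hh, rfl⟩)
    (fun δ hδ hl => hA.d_mem_map hf hδ hl) (fun α hα => ?_)
    (fun α h hρ => hA.exists_sub_d_mem_closedWeightedForms h hρ) (fun h hl => ?_)
  · obtain ⟨w, hw, h⟩ := hA.exists_sub_d_mem_closedFormsVanishing hα
    exact ⟨d w, ⟨w, Submodule.mem_sup_right hw, rfl⟩, h⟩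
  · refine Submodule.mem_inf.2 ⟨d_mem_closedForms h, ?_⟩
    rcases hA.2 with ⟨rfl, -⟩ | ⟨rfl, -⟩
    · simp [formsVanishing]
    · exact eventually_acFilter.2 fun i hi =>
        eventually_d_eq_zero (eventually_acFilter.1 hl i hi)

/-- The splitting when the two spaces of exact forms are independent. -/
theorem Adapted.exists_splitting_of_disjoint [Fintype ι] [∀ i, CompactSpace (S i)]
    [∀ i, ConnectedSpace (S i)] (hA : C.Adapted β l) (hf : C.IsEndCutoff f)
    (hd : Disjoint ((C.cutoffSpan f).map d) ((C.weightedFunctions β).map d)) :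
    ∃ Φ : ((C.restrictCS l).ker × (C.cutoffSpan f).map d × (C.weightedFunctions β).map d) ≃ₗ[ℝ]
        C.closedWeightedForms β,
      (∀ a b, (Φ (0, a, b)).1 = a.1 + b.1) ∧ ∀ c, ∃ h, H1Rel.mk (Φ (c, 0, 0)).1 h = c.1 := by
  exact exists_equiv_prod hd (Submodule.map_sup _ _ d).symm
    (Q := fun (c : (C.restrictCS l).ker) α => ∃ h, H1Rel.mk α h = c.1) (hA.exists_splitting hf)

/-- On an AC manifold there is no condition at the singularities. -/
theorem Adapted.exists_splitting_of_ac [Fintype ι] [∀ i, CompactSpace (S i)]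
    [∀ i, ConnectedSpace (S i)] (hA : C.Adapted β l) (hac : ∀ i, C.kind i = .ac) :
    ∃ Φ : (H1Rel (Euc (n + 1)) l × (C.weightedFunctions β).map d) ≃ₗ[ℝ] C.closedWeightedForms β,
      (∀ b, (Φ (0, b)).1 = b.1) ∧ ∀ c, ∃ h, H1Rel.mk (Φ (c, 0)).1 h = c := by
  have hne : ∀ i, C.kind i ≠ .cs := fun i hi => by
    rw [hac i] at hi
    cases hi
  -- Without CS ends the cutoff condition is empty, so the zero family serves; its span is zero and
  -- the condition on the links disappears.
  obtain ⟨Φ, h1, h2⟩ := hA.exists_splitting (f := 0) fun i hi => (hne i hi).elim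
  have hK : (C.restrictCS l).ker = ⊤ := eq_top_iff.2 fun c _ =>
    LinearMap.mem_ker.2 (funext fun i => (hne i.1 i.2).elim)
  have hD : (C.weightedFunctions β).map d = (C.cutoffSpan 0 ⊔ C.weightedFunctions β).map d := by
    have : C.cutoffSpan 0 = ⊥ := Submodule.span_eq_bot.2 fun x hx => by
      obtain ⟨i, -, rfl⟩ := hx
      rfl
    rw [this, bot_sup_eq]
  refine ⟨((LinearEquiv.ofTop _ hK).symm.prodCongr (LinearEquiv.ofEq _ _ hD)).trans Φ,
    fun b => ?_, fun c => ?_⟩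
  · exact h1 ⟨b.1, hD ▸ b.2⟩
  · exact h2 ⟨c, hK ▸ trivial⟩

end Conifold

end Conifolds

end

theorem corollary2p21 :
    -- compact manifolds
    (∀ (n : ℕ) (M : Type*) [TopologicalSpace M] [T2Space M] [CompactSpace M]
      [ChartedSpace (Euc n) M] [IsManifold 𝓘(ℝ, Euc n) ∞ M],
      ∃ Φ : (H1 (Euc n) M × (⊤ : Submodule ℝ (SmoothFunction (Euc n) M)).map d) ≃ₗ[ℝ]
          closedForms (Euc n) M,
        (∀ b, (Φ (0, b)).1 = b.1) ∧
        ∀ c, ∃ h, H1Rel.mk (Φ (c, 0)).1 h = c) ∧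
    -- conifolds
    (∀ (n : ℕ) (L : Type*) [TopologicalSpace L] [T2Space L] [SecondCountableTopology L]
      [ChartedSpace (Euc (n + 1)) L] [IsManifold 𝓘(ℝ, Euc (n + 1)) ∞ L]
      (ι : Type*) [Fintype ι] (S : ι → Type*) [∀ i, TopologicalSpace (S i)]
      [∀ i, T2Space (S i)] [∀ i, CompactSpace (S i)] [∀ i, ConnectedSpace (S i)]
      [∀ i, ChartedSpace (Euc n) (S i)] [∀ i, IsManifold 𝓘(ℝ, Euc n) ∞ (S i)]
      (C : Conifold n L S) (β : ι → ℝ),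
      -- AC manifolds, negative weights
      ((∀ i, C.kind i = .ac) → (∀ i, β i < 0) →
        ∃ Φ : (H1Rel (Euc (n + 1)) (cocompact L) × (C.weightedFunctions β).map d) ≃ₗ[ℝ]
            C.closedWeightedForms β,
          (∀ b, (Φ (0, b)).1 = b.1) ∧
          ∀ c, ∃ h, H1Rel.mk (Φ (c, 0)).1 h = c) ∧
      -- AC manifolds, positive weights
      ((∀ i, C.kind i = .ac) → (∀ i, 0 < β i) →
        ∃ Φ : (H1 (Euc (n + 1)) L × (C.weightedFunctions β).map d) ≃ₗ[ℝ]
            C.closedWeightedForms β,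
          (∀ b, (Φ (0, b)).1 = b.1) ∧
          ∀ c, ∃ h, H1Rel.mk (Φ (c, 0)).1 h = c) ∧
      -- CS manifolds, positive weights
      (ConnectedSpace L → (∀ i, C.kind i = .cs) → (∀ i, 0 < β i) →
        ∀ f : ι → SmoothFunction (Euc (n + 1)) L, C.IsEndCutoff f → ∑ i, f i = 1 →
        ∃ Φ : ((C.restrictCS ⊥).ker × (C.cutoffSpan f).map d × (C.weightedFunctions β).map d)
            ≃ₗ[ℝ] C.closedWeightedForms β,
          (∀ a b, (Φ (0, a, b)).1 = a.1 + b.1) ∧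
          ∀ c, ∃ h, H1Rel.mk (Φ (c, 0, 0)).1 h = c.1) ∧
      -- CS/AC manifolds, positive weights on the CS ends and negative weights on the AC ends
      (ConnectedSpace L → (∃ i, C.kind i = .ac) → (∀ i, C.kind i = .cs → 0 < β i) →
        (∀ i, C.kind i = .ac → β i < 0) →
        ∀ f : ι → SmoothFunction (Euc (n + 1)) L, C.IsEndCutoff f →
        ∃ Φ : ((C.restrictCS C.acFilter).ker × (C.cutoffSpan f).map d ×
            (C.weightedFunctions β).map d) ≃ₗ[ℝ] C.closedWeightedForms β,
          (∀ a b, (Φ (0, a, b)).1 = a.1 + b.1) ∧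
          ∀ c, ∃ h, H1Rel.mk (Φ (c, 0, 0)).1 h = c.1) ∧
      -- CS/AC manifolds, positive weights on all ends
      ((∀ i, 0 < β i) →
        ∀ f : ι → SmoothFunction (Euc (n + 1)) L, C.IsEndCutoff f →
        Disjoint (C.cutoffSpan f) (C.weightedFunctions β) ∧
        ∃ Φ : ((C.restrictCS ⊥).ker × (C.cutoffSpan f ⊔ C.weightedFunctions β).map d) ≃ₗ[ℝ]
            C.closedWeightedForms β,
          (∀ b, (Φ (0, b)).1 = b.1) ∧
          ∀ c, ∃ h, H1Rel.mk (Φ (c, 0)).1 h = c.1)) := by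
  refine ⟨fun n M _ _ _ _ _ => exists_splitting_closedForms (Euc n) M, ?_⟩
  intro n L _ _ _ _ _ ι _ S _ _ _ _ _ _ C β
  refine ⟨fun hac hβ => ?_, fun hac hβ => ?_, fun _ hcs hβ f hf hsum => ?_,
    fun _ ⟨i, hi⟩ hμ hlam f hf => ?_, fun hβ f hf => ⟨hf.disjoint fun i _ => hβ i, ?_⟩⟩
  -- All ends are AC, so compact support means vanishing near infinity on the AC ends.
  · have hl : cocompact L = C.acFilter := by
      rw [C.cocompact_eq_iSup_endFilter, Conifold.acFilter]
      simp [hac]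
    have hA : C.Adapted β (cocompact L) :=
      ⟨fun i hi => by simp [hac i] at hi, .inr ⟨hl, fun i _ => hβ i⟩⟩
    exact hA.exists_splitting_of_ac hac
  · have hA : C.Adapted β ⊥ :=
      ⟨fun i hi => by simp [hac i] at hi, .inl ⟨rfl, fun i _ => hβ i⟩⟩
    exact hA.exists_splitting_of_ac hac
  · have hA : C.Adapted β ⊥ := ⟨fun i _ => hβ i, .inl ⟨rfl, fun i _ => hβ i⟩⟩
    refine hA.exists_splitting_of_disjoint hf
      (hf.disjoint_map_d (fun i _ => hβ i) (.inl ?_))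
    -- All ends are CS, so the combination of cutoffs with coefficients one is the full sum, the
    -- constant function `1`, whose differential is zero.
    have h1 : (C.cutoffSum f fun _ => 1) = 1 := by
      simp [Conifold.cutoffSum, hcs, hsum]
    rw [h1]
    ext x v
    exact DFunLike.congr_fun (mfderiv_const (c := (1 : ℝ))) v
  · have hA : C.Adapted β C.acFilter := ⟨hμ, .inr ⟨rfl, hlam⟩⟩
    exact hA.exists_splitting_of_disjoint hf (hf.disjoint_map_d hμ (.inr ⟨i, hi, hlam i hi⟩))
  · have hA : C.Adapted β ⊥ := ⟨fun i _ => hβ i, .inl ⟨rfl, fun i _ => hβ i⟩⟩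
    exact hA.exists_splitting hf
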